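/- **Setting.** Let $\Omega=\{x\in\mathbb R^2 : G(x_1)<x_2<0\}$ with $G\in C^\infty(\mathbb R;\mathbb R)$, $G<0$, and $G=-\pi$ outside $[-R_0,R_0]$ for some $R_0>0$. For $\lambda\in(0,1)$ put $c=\sqrt{1-\lambda^2}/\lambda$ and $$P(\lambda)=-\lambda^2\partial_{x_1}^2+(1-\lambda^2)\partial_{x_2}^2,\qquad \ell^\pm(x)=\pm\frac{x_1}{\lambda}+\frac{x_2}{\sqrt{1-\lambda^2}} .$$ Suppose that $\Omega$ is subcritical for $\lambda$, i.e. $\max|G'|<c$. Let $\gamma^\pm$ be the involution of $\partial\Omega$ which exchanges the upper boundary $\{x_2=0\}$ and the lower boundary $\{x_2=G(x_1)\}$ and preserves $\ell^\pm$, and let $b=\gamma^-\circ\gamma^+$ on the upper boundary, identified with $\mathbb R$ by $(x_1,0)\mapsto x_1$. Fix $M>R_0+3\pi/c$, open intervals $\mathcal J_L\subset(-\infty,-M)$ and $\mathcal J_R\subset(M,\infty)$ of length $2\pi/c$, and $N\in\mathbb N$ with $\mathcal J_R=b^N(\mathcal J_L)$, and let $\mathbf b=b^N$. Both intervals are identified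 with $\mathbb T=\mathbb R/(\tfrac{2\pi}{c}\mathbb Z)$ by reduction modulo $2\pi/c$, so that $\mathbf b:\mathcal J_L\to\mathcal J_R$ acts on $\mathbb T$. Functions $g$ on $\mathbb T$ are identified with one-forms $g\,dx_1$, and $\mathbf b^*$, $(\mathbf b^{-1})^*$ are the pullbacks of one-forms: $\mathbf b^*(g\,dx_1)=\mathbf b'\,(g\circ\mathbf b)\,dx_1$. Let $\mathring L^2(\mathbb T)$ be the space of complex-valued $L^2$ functions of mean zero, $\widehat g(k)=\frac{c}{2\pi}\int_{\mathbb T}e^{-ick\theta}g$, and let $\Pi^\pm$ be the projections onto the modes $e^{ick\theta}$ with $\pm k>0$. Let $\mathring H^s(\mathbb T;T^*\mathbb T)$ be the space of distributional one-forms $g$ with $\widehat g(0)=0$ and $\|g\|_{s}^2:=\sum_{k\neq0}|k|^{2s}|\widehat g(k)|^2<\infty$. Finally, $\dot H^1_{\rm loc}(\Omega)$ is the space of functions in $H^1_{\rm loc}(\mathbb R^2)$ with support in $\overline\Omega$ (so that they vanish on $\partial\Omega$); the equation $P(\lambda)u=0$ is understood in the sense of distributions in $\Omega$. **Theorem 1.1.**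 1. For every $g^i\in\mathring L^2(\mathbb T)$ there are unique $g^o\in\mathring L^2(\mathbb T)$ and $u\in\dot H^1_{\rm loc}(\Omega)$ with $$P(\lambda)u=0 \text{ in }\Omega,\qquad \partial_{x_2}u|_{\mathcal J_L}=\Pi^+g^i+\Pi^-g^o,\qquad \partial_{x_2}u|_{\mathcal J_R}=\Pi^-g^i+\Pi^+g^o ,$$ where the Neumann data are boundary values in the $L^2$ sense. 2. The resulting scattering matrix $S(\lambda):g^i\mapsto g^o$ is a bounded linear operator on $\mathring L^2(\mathbb T)$, $\mathbf b^*$ and $(\mathbf b^{-1})^*$ map $L^2$ one-forms to $L^2$ one-forms, and $$S(\lambda)=\Pi^+(\mathbf b^{-1})^*\Pi^++\Pi^-\mathbf b^*\Pi^-+R ,$$ where $R:\mathcal D'(\mathbb T;T^*\mathbb T)\to C^\infty(\mathbb T;T^*\mathbb T)$ is a smoothing operator, i.e. an operator with a $C^\infty$ kernel. 3. $S(\lambda)$ extends to a linear operator on the mean-zero distributional one-forms which is bounded from $\mathring H^s(\mathbb T;T^*\mathbb T)$ to itself for every $s\in\mathbb R$. 4. This operator is unitary on the space of one-forms $g=dw$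 with $w\in\mathring H^{1/2}(\mathbb T)$ a function of mean zero, with the norm of the primitive, $\|w\|_{1/2}^2=\sum_{k\ne0}|k||\widehat w(k)|^2$. (As $\widehat g(k)=ick\,\widehat w(k)$, this space of one-forms is $\mathring H^{-1/2}(\mathbb T;T^*\mathbb T)$, with the norm $c^{-1}\|g\|_{-1/2}$.) -/

import Mathlib

open MeasureTheory Set Filter Topology
open scoped ENNReal ContDiff

noncomputable section

namespace ChannelScattering

/-! ### The channel and its chess billiard -/

/-- The data of a channel `{G(x₁) < x₂ < 0}` with smooth bottom `G < 0` which is flat, at depth `π`,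
outside `[-R₀, R₀]`. -/
structure Channel where
  G : ℝ → ℝ
  R₀ : ℝ
  R₀_pos : 0 < R₀
  smooth : ContDiff ℝ ∞ G
  neg : ∀ x, G x < 0
  flat : ∀ x, x ∉ Icc (-R₀) R₀ → G x = -Real.pi

/-- The open channel `Ω ⊂ ℝ²`. -/
def Channel.dom (Ω : Channel) : Set (ℝ × ℝ) := {x | Ω.G x.1 < x.2 ∧ x.2 < 0}

/-- The upper boundary. -/
def bdryUp : Set (ℝ × ℝ) := {x | x.2 = 0}

/-- The lower boundary. -/
def Channel.bdryDown (Ω : Channel) : Set (ℝ × ℝ) := {x | x.2 = Ω.G x.1}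

/-- The slope `c(λ) = √(1-λ²)/λ` of the characteristic lines. -/
def slope (lam : Ioo (0 : ℝ) 1) : ℝ := √(1 - (lam : ℝ) ^ 2) / lam

/-- `ℓ^±_λ(x) = ± x₁/λ + x₂/√(1-λ²)`; the sign is `σ = 1` or `σ = -1`. -/
def charFn (σ : ℝ) (lam : Ioo (0 : ℝ) 1) (x : ℝ × ℝ) : ℝ :=
  σ * (x.1 / lam) + x.2 / √(1 - (lam : ℝ) ^ 2)

/-- `max |G'| < c(λ)`. As `G'` is continuous with compact support the maximum is attained, so the
condition can be stated pointwise. -/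
def Channel.Subcritical (Ω : Channel) (lam : Ioo (0 : ℝ) 1) : Prop :=
  ∀ x, |deriv Ω.G x| < slope lam

/-- The involution `γ^±_λ` of `∂Ω`: it sends a point of the upper (lower) boundary to the point of
the lower (upper) boundary on the same level line of `ℓ^±_λ`. -/
def Channel.gam (Ω : Channel) (σ : ℝ) (lam : Ioo (0 : ℝ) 1) (x : ℝ × ℝ) : ℝ × ℝ :=
  Classical.epsilon fun y => charFn σ lam y = charFn σ lam x ∧
    ((x ∈ bdryUp ∧ y ∈ Ω.bdryDown) ∨ (x ∈ Ω.bdryDown ∧ y ∈ bdryUp))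

/-- The single bounce map `b_λ = γ^- ∘ γ^+` of the upper boundary, identified with `ℝ`. -/
def Channel.bounce (Ω : Channel) (lam : Ioo (0 : ℝ) 1) (θ : ℝ) : ℝ :=
  (Ω.gam (-1) lam (Ω.gam 1 lam (θ, 0))).1

/-- The length `2π/c(λ)` of the fundamental intervals. -/
def period (lam : Ioo (0 : ℝ) 1) : ℝ := 2 * Real.pi / slope lam

theorem slope_pos (lam : Ioo (0 : ℝ) 1) : 0 < slope lam := by
  obtain ⟨l, h0, h1⟩ := lam
  have : 0 < 1 - l ^ 2 := by nlinarith
  exact div_pos (Real.sqrt_pos.2 this) h0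

instance (lam : Ioo (0 : ℝ) 1) : Fact (0 < period lam) :=
  ⟨div_pos (by positivity) (slope_pos lam)⟩

/-- A choice of fundamental intervals `𝓙_L = (aL, aL + 2π/c)`, `𝓙_R = (aR, aR + 2π/c)`, with
`M > R₀ + 3π/c`, `𝓙_L ⊂ (-∞, -M)`, `𝓙_R ⊂ (M, ∞)` and `𝓙_R = b^N(𝓙_L)`. -/
structure FundamentalIntervals (Ω : Channel) (lam : Ioo (0 : ℝ) 1) where
  M : ℝ
  aL : ℝ
  aR : ℝ
  N : ℕ
  M_gt : Ω.R₀ + 3 * Real.pi / slope lam < M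
  left : Ioo aL (aL + period lam) ⊆ Iio (-M)
  right : Ioo aR (aR + period lam) ⊆ Ioi M
  image : (Ω.bounce lam)^[N] '' Ioo aL (aL + period lam) = Ioo aR (aR + period lam)

/-- The multi-bounce map `𝐛 = b^N`. -/
def FundamentalIntervals.mb {Ω : Channel} {lam : Ioo (0 : ℝ) 1}
    (J : FundamentalIntervals Ω lam) : ℝ → ℝ := (Ω.bounce lam)^[J.N]

/-! ### Functions and distributional one-forms on the torus -/

/-- The torus `𝕋_λ = ℝ/(2π/c(λ))ℤ`. -/
abbrev Torus (lam : Ioo (0 : ℝ) 1) : Type := AddCircle (period lam)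

/-- `L²(𝕋_λ)`; the measure is normalized, which does not change the space. A function `g` stands
also for the one-form `g dx₁`. -/
abbrev L2 (lam : Ioo (0 : ℝ) 1) : Type :=
  Lp ℂ 2 (AddCircle.haarAddCircle : Measure (Torus lam))

/-- The mean-zero subspace of `L²(𝕋_λ)`. -/
def L2zero (lam : Ioo (0 : ℝ) 1) : Submodule ℂ (L2 lam) where
  carrier := {g | ∫ t, g t ∂(AddCircle.haarAddCircle : Measure (Torus lam)) = 0}
  zero_mem' := by
    rw [mem_ofPred_eq, integral_congr_ae (Lp.coeFn_zero ℂ 2 _)]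
    simp
  add_mem' := by
    intro f g hf hg
    rw [mem_ofPred_eq] at hf hg ⊢
    rw [integral_congr_ae (Lp.coeFn_add f g)]
    have h1 := (Lp.memLp f).integrable (by norm_num)
    have h2 := (Lp.memLp g).integrable (by norm_num)
    simp only [Pi.add_apply]
    rw [integral_add h1 h2, hf, hg, add_zero]
  smul_mem' := by
    intro a f hf
    rw [mem_ofPred_eq] at hf ⊢
    rw [integral_congr_ae (Lp.coeFn_smul a f)]
    simp only [Pi.smul_apply]
    rw [integral_smul, hf, smul_zero]

/-- The closed span of the Fourier modes `e^{i c(λ) k θ}` with `k ∈ A`. -/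
def modes (lam : Ioo (0 : ℝ) 1) (A : Set ℤ) : Submodule ℂ (L2 lam) :=
  (Submodule.span ℂ ((fun k : ℤ => (fourierLp 2 k : L2 lam)) '' A)).topologicalClosure

instance (lam : Ioo (0 : ℝ) 1) (A : Set ℤ) : CompleteSpace (modes lam A) :=
  (Submodule.isClosed_topologicalClosure _).completeSpace_coe

/-- `Π^+`, the projection onto the positive Fourier modes. -/
def projPos (lam : Ioo (0 : ℝ) 1) : L2 lam →L[ℂ] L2 lam := (modes lam (Ioi 0)).starProjection

/-- `Π^-`, the projection onto the negative Fourier modes. -/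
def projNeg (lam : Ioo (0 : ℝ) 1) : L2 lam →L[ℂ] L2 lam := (modes lam (Iio 0)).starProjection

/-- The class in `L²(𝕋_λ)` of a square-integrable function. -/
def toL2 (lam : Ioo (0 : ℝ) 1) (f : Torus lam → ℂ) : L2 lam :=
  open Classical in
  if h : MemLp f 2 (AddCircle.haarAddCircle : Measure (Torus lam)) then h.toLp f else 0

section Pullback

variable {Ω : Channel} {lam : Ioo (0 : ℝ) 1}

/-- The pullback `𝐛^*(v dx₁)` of a one-form by `𝐛 : 𝓙_L → 𝓙_R` (written as a function times `dx₁`),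
both intervals being identified with the torus by reduction modulo `2π/c(λ)`. -/
def FundamentalIntervals.pull (J : FundamentalIntervals Ω lam) (v : Torus lam → ℂ) :
    Torus lam → ℂ :=
  AddCircle.liftIoc (period lam) J.aL fun x =>
    ((deriv J.mb x : ℝ) : ℂ) * v ((J.mb x : ℝ) : Torus lam)

/-- The pullback `(𝐛⁻¹)^*(v dx₁)` of a one-form by `𝐛⁻¹ : 𝓙_R → 𝓙_L`. -/
def FundamentalIntervals.pullInv (J : FundamentalIntervals Ω lam) (v : Torus lam → ℂ) :
    Torus lam → ℂ :=
  AddCircle.liftIoc (period lam) J.aR fun x =>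
    ((deriv (Function.invFun J.mb) x : ℝ) : ℂ) * v ((Function.invFun J.mb x : ℝ) : Torus lam)

end Pullback

/-- `C^∞(𝕋_λ)`. -/
def TestFn (lam : Ioo (0 : ℝ) 1) : Submodule ℂ (Torus lam → ℂ) where
  carrier := {f | ContDiff ℝ ∞ fun x : ℝ => f (x : Torus lam)}
  zero_mem' := by
    rw [mem_ofPred_eq]
    exact contDiff_const
  add_mem' := by
    intro f g hf hg
    rw [mem_ofPred_eq] at hf hg ⊢
    exact hf.add hg
  smul_mem' := by
    intro a f hf
    rw [mem_ofPred_eq] at hf ⊢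
    exact hf.const_smul a

/-- `𝓓'(𝕋_λ; T^*𝕋_λ)`: distributional one-forms are the linear forms on `C^∞(𝕋_λ)` that are
continuous, that is, bounded by finitely many derivatives. -/
def Distr (lam : Ioo (0 : ℝ) 1) : Submodule ℂ (Module.Dual ℂ (TestFn lam)) where
  carrier := {u | ∃ (m : ℕ) (C : ℝ), ∀ (φ : TestFn lam) (B : ℝ),
    (∀ j ≤ m, ∀ x : ℝ, ‖iteratedDeriv j (fun y : ℝ => (φ : Torus lam → ℂ) y) x‖ ≤ B) →
      ‖u φ‖ ≤ C * B}
  zero_mem' := ⟨0, 0, fun φ B _ => by simp⟩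
  add_mem' := by
    rintro u v ⟨m, C, hu⟩ ⟨n, D, hv⟩
    refine ⟨max m n, C + D, fun φ B h => ?_⟩
    have h1 := hu φ B fun j hj => h j (hj.trans (le_max_left _ _))
    have h2 := hv φ B fun j hj => h j (hj.trans (le_max_right _ _))
    calc ‖(u + v) φ‖ ≤ ‖u φ‖ + ‖v φ‖ := norm_add_le _ _
      _ ≤ (C + D) * B := by linarith
  smul_mem' := by
    rintro a u ⟨m, C, hu⟩
    refine ⟨m, ‖a‖ * C, fun φ B h => ?_⟩
    rw [LinearMap.smul_apply, norm_smul, mul_assoc]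
    exact mul_le_mul_of_nonneg_left (hu φ B h) (norm_nonneg _)

theorem TestFn.continuous {lam : Ioo (0 : ℝ) 1} (φ : TestFn lam) :
    Continuous (φ : Torus lam → ℂ) := by
  have h : Continuous fun x : ℝ => (φ : Torus lam → ℂ) (x : Torus lam) :=
    ContDiff.continuous (𝕜 := ℝ) (n := ∞) φ.2
  exact continuous_quot_lift (fun a b hab => by
    have : (a : Torus lam) = b := Quotient.sound hab
    exact congrArg (φ : Torus lam → ℂ) this) h |>.congr fun t => by
      induction t using QuotientAddGroup.induction_on with
      | H x => rfl

/-- The mode `e^{i c(λ) k θ}` as a smooth function on the torus. -/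
def modeFn (lam : Ioo (0 : ℝ) 1) (k : ℤ) : TestFn lam :=
  ⟨fun t => fourier k t, by
    change ContDiff ℝ ∞ fun x : ℝ => (fourier k (x : Torus lam) : ℂ)
    simp only [fourier_coe_apply]
    have h : ContDiff ℝ ∞ (fun x : ℝ => (x : ℂ)) := Complex.ofRealCLM.contDiff
    exact (((contDiff_const (c := (2 * Real.pi * Complex.I * k : ℂ))).mul h).div_const _).cexp⟩

/-- `û(k) = (c(λ)/2π) ∫ e^{-i c(λ) k θ} u`. -/
def coeff {lam : Ioo (0 : ℝ) 1} (u : Module.Dual ℂ (TestFn lam)) (k : ℤ) : ℂ :=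
  ((period lam : ℝ) : ℂ)⁻¹ * u (modeFn lam (-k))

/-- Distributional one-forms `u` on the torus with `∫ u = 0`. -/
def DistrZero (lam : Ioo (0 : ℝ) 1) : Submodule ℂ (Module.Dual ℂ (TestFn lam)) :=
  Distr lam ⊓ LinearMap.ker (Module.Dual.eval ℂ (TestFn lam) (modeFn lam 0))

theorem integrable_mul_test {lam : Ioo (0 : ℝ) 1} (g : L2 lam) (φ : TestFn lam) :
    Integrable (fun t => g t * (φ : Torus lam → ℂ) t) (volume : Measure (Torus lam)) := by
  rw [AddCircle.volume_eq_smul_haarAddCircle]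
  refine Integrable.smul_measure ?_ ENNReal.ofReal_ne_top
  have h1 := (Lp.memLp g).integrable (by norm_num)
  obtain ⟨C, hC⟩ := isCompact_univ.exists_bound_of_continuousOn (TestFn.continuous φ).continuousOn
  exact h1.mul_bdd (c := C) (TestFn.continuous φ).aestronglyMeasurable
    (ae_of_all _ fun t => hC t (mem_univ t))

/-- The one-form `g dx₁`, `g ∈ L²(𝕋_λ)`, as a distribution: `φ ↦ ∫ g φ dx₁`. -/
def formPairing {lam : Ioo (0 : ℝ) 1} (g : L2 lam) : Module.Dual ℂ (TestFn lam) where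
  toFun φ := ∫ t : Torus lam, g t * (φ : Torus lam → ℂ) t
  map_add' φ ψ := by
    rw [← integral_add (integrable_mul_test g φ) (integrable_mul_test g ψ)]
    refine integral_congr_ae (ae_of_all _ fun t => ?_)
    simp [mul_add]
  map_smul' a φ := by
    rw [RingHom.id_apply, ← integral_smul]
    refine integral_congr_ae (ae_of_all _ fun t => ?_)
    simp only [Submodule.coe_smul, Pi.smul_apply, smul_eq_mul]
    ring

theorem formPairing_mem {lam : Ioo (0 : ℝ) 1} (g : L2 lam) : formPairing g ∈ Distr lam := by
  refine ⟨0, ∫ t : Torus lam, ‖g t‖, fun φ B h => ?_⟩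
  have hB : ∀ t : Torus lam, ‖(φ : Torus lam → ℂ) t‖ ≤ B := by
    intro t
    induction t using QuotientAddGroup.induction_on with
    | H x => simpa using h 0 le_rfl x
  have hg : Integrable (fun t => g t) (volume : Measure (Torus lam)) := by
    rw [AddCircle.volume_eq_smul_haarAddCircle]
    exact ((Lp.memLp g).integrable (by norm_num)).smul_measure ENNReal.ofReal_ne_top
  rw [← integral_mul_const]
  refine norm_integral_le_of_norm_le (hg.norm.mul_const B) (ae_of_all _ fun t => ?_)
  rw [norm_mul]
  exact mul_le_mul_of_nonneg_left (hB t) (norm_nonneg _)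

/-- `formPairing` as a map into the distributional one-forms. -/
def toDistr {lam : Ioo (0 : ℝ) 1} (g : L2 lam) : Distr lam := ⟨formPairing g, formPairing_mem g⟩

/-- `formPairing` for one-forms of mean zero. -/
def toDistrZero {lam : Ioo (0 : ℝ) 1} (g : L2zero lam) : DistrZero lam :=
  ⟨formPairing (g : L2 lam), formPairing_mem _, by
    have h : ∫ t, (g : L2 lam) t ∂(AddCircle.haarAddCircle : Measure (Torus lam)) = 0 := g.2
    change ∫ t : Torus lam, (g : L2 lam) t * (fourier 0 t : ℂ) = 0
    rw [AddCircle.volume_eq_smul_haarAddCircle, integral_smul_measure]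
    simp [h]⟩

/-- A smoothing operator `𝓓' → C^∞`: an operator with a smooth kernel,
`(R u)(x) = ⟨u, K(x, ·)⟩`. -/
def IsSmoothing {lam : Ioo (0 : ℝ) 1} (R : Distr lam →ₗ[ℂ] TestFn lam) : Prop :=
  ∃ K : Torus lam → TestFn lam,
    (ContDiff ℝ ∞ fun p : ℝ × ℝ => (K (p.1 : Torus lam) : Torus lam → ℂ) (p.2 : Torus lam)) ∧
    ∀ (u : Distr lam) (x : Torus lam),
      (R u : Torus lam → ℂ) x = (u : Module.Dual ℂ (TestFn lam)) (K x)

/-- The squared norm `∑_{k ≠ 0} |k|^{2s} |û(k)|²` of the Sobolev space of order `s` of one-forms of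
mean zero; the space consists of the `u` of mean zero for which it is finite. -/
def sobolevSq {lam : Ioo (0 : ℝ) 1} (s : ℝ) (u : DistrZero lam) : ℝ≥0∞ :=
  ∑' k : {k : ℤ // k ≠ 0},
    ENNReal.ofReal (|((k : ℤ) : ℝ)| ^ (2 * s)) * ‖coeff (u : Module.Dual ℂ (TestFn lam)) k‖ₑ ^ 2

/-- The squared homogeneous norm `∑_{k ≠ 0} |k| |ŵ(k)|²` of order `1/2` of the primitive `w`,
`dw = u`, of a one-form of mean zero: `û(k) = i c(λ) k ŵ(k)`. -/
def halfSq {lam : Ioo (0 : ℝ) 1} (u : DistrZero lam) : ℝ≥0∞ :=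
  ∑' k : {k : ℤ // k ≠ 0},
    ENNReal.ofReal |((k : ℤ) : ℝ)| *
      ‖coeff (u : Module.Dual ℂ (TestFn lam)) k /
        (Complex.I * ((slope lam : ℝ) : ℂ) * ((k : ℤ) : ℂ))‖ₑ ^ 2

/-! ### The homogeneous stationary problem -/

/-- Test functions `C_c^∞(ℝ²)`. -/
def IsTest (φ : ℝ × ℝ → ℂ) : Prop := ContDiff ℝ ∞ φ ∧ HasCompactSupport φ

/-- The derivative in the direction `e`. -/
def dirDeriv (e : ℝ × ℝ) (φ : ℝ × ℝ → ℂ) : ℝ × ℝ → ℂ := fun p => fderiv ℝ φ p e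

/-- `L²_loc(ℝ²)`. -/
def L2Loc (v : ℝ × ℝ → ℂ) : Prop :=
  ∀ K : Set (ℝ × ℝ), IsCompact K → MemLp v 2 (volume.restrict K)

/-- `v` is the weak derivative of `u` on `ℝ²` in the direction `e`, and it is in `L²_loc`. -/
def HasWeakDeriv (e : ℝ × ℝ) (u v : ℝ × ℝ → ℂ) : Prop :=
  L2Loc v ∧ ∀ φ, IsTest φ → ∫ p, u p * dirDeriv e φ p = -∫ p, v p * φ p

/-- `u ∈ Ḣ¹_loc(Ω)`: `u ∈ H¹_loc(ℝ²)` with support in the closure of `Ω`; in particular `u` vanishes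
on `∂Ω`. -/
structure InH1LocDot (Ω : Channel) (u : ℝ × ℝ → ℂ) : Prop where
  l2 : L2Loc u
  d1 : ∃ v, HasWeakDeriv (1, 0) u v
  d2 : ∃ v, HasWeakDeriv (0, 1) u v
  supp : ∀ᵐ p : ℝ × ℝ, p ∉ closure Ω.dom → u p = 0

/-- `P(λ) = -λ² ∂₁² + (1 - λ²) ∂₂²`. -/
def waveOp (lam : Ioo (0 : ℝ) 1) (φ : ℝ × ℝ → ℂ) : ℝ × ℝ → ℂ := fun p =>
  -((lam : ℝ) : ℂ) ^ 2 * dirDeriv (1, 0) (dirDeriv (1, 0) φ) p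
    + (1 - ((lam : ℝ) : ℂ) ^ 2) * dirDeriv (0, 1) (dirDeriv (0, 1) φ) p

/-- `P(λ)u = 0` in `Ω` in the sense of distributions (`P(λ)` is its own formal transpose). -/
def IsHomogeneous (Ω : Channel) (lam : Ioo (0 : ℝ) 1) (u : ℝ × ℝ → ℂ) : Prop :=
  ∀ φ, IsTest φ → tsupport φ ⊆ Ω.dom → ∫ p, u p * waveOp lam φ p = 0

/-- `∂_{x₂}u|_{(a, a + 2π/c) × {0}} = g`, the interval being identified with the torus: the boundary
value from below of the weak derivative, as a limit in `L²` of averages over thin strips (so that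
the choice of representatives does not matter). -/
def HasNeumann {lam : Ioo (0 : ℝ) 1} (u : ℝ × ℝ → ℂ) (a : ℝ) (g : L2 lam) : Prop :=
  ∃ v, HasWeakDeriv (0, 1) u v ∧
    Tendsto (fun ε : ℝ => (ENNReal.ofReal ε)⁻¹ *
      ∫⁻ p in Ioo a (a + period lam) ×ˢ Ioo (-ε) 0, ‖v p - g (p.1 : Torus lam)‖ₑ ^ 2)
      (𝓝[>] 0) (𝓝 0)

/-- `u ∈ Ḣ¹_loc(Ω)` solves the homogeneous problem with incoming datum `gi` and outgoing
datum `go`. -/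
structure IsScattering {Ω : Channel} {lam : Ioo (0 : ℝ) 1} (J : FundamentalIntervals Ω lam)
    (gi go : L2zero lam) (u : ℝ × ℝ → ℂ) : Prop where
  mem : InH1LocDot Ω u
  eqn : IsHomogeneous Ω lam u
  left : HasNeumann u J.aL (projPos lam gi + projNeg lam go)
  right : HasNeumann u J.aR (projNeg lam gi + projPos lam go)

end ChannelScattering

end

open ChannelScattering

open MeasureTheory Set Filter Topology
open scoped ENNReal ContDiff

noncomputable section

namespace ChannelScattering

/-! ### Orientation preserving diffeomorphisms of the line -/

/-! In the characteristic coordinates s = x₁ + x₂/c, t = x₁ - x₂/c the operator P(λ) is a multiple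
of ∂ₛ∂ₜ, the upper boundary is the diagonal t = s and the lower boundary is the graph t = b(s).
Subcriticality makes b an orientation preserving diffeomorphism of the line. A solution has ∂ₛU =
V(s) and ∂ₜU = W(t) inside the strip s < t < b(s). As U vanishes outside, equality of the mixed
derivatives across the two boundary curves forces W = -V and V = b' · (V ∘ b). So u is encoded by
one function h such that h dx is a b-invariant one-form, and the Neumann datum on the upper boundary
is 2h/c. Conversely, if F is a primitive of h, then U = F(s) - F(t) is a solution as soon as F ∘ b =
F, that is, as soon as h has integral zero over one fundamental interval; this is the role of mean
zero. The lemmas are `IsCharSol.exists_profile`, `exists_isCharSol_of_profile` and `hasNeumann_iff`.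

A b-invariant form is determined by its values on 𝓙_L, and these can be prescribed. Hence the
boundary value problem is equivalent to one equation on the circle, Π⁺gⁱ + Π⁻gᵒ = 𝐛^*(Π⁻gⁱ + Π⁺gᵒ);
see `exists_isScattering_iff`. Here 𝐛 is a smooth diffeomorphism of the circle, also across the
endpoints of the intervals: a map X conjugates b to the translation by a period, 𝐛 is a shifted X on
𝓙_L, and b is itself a translation on the right (`FundamentalIntervals.exists_lift`).

Write U = 𝐛^* and W = (𝐛⁻¹)^*. On primitives U is a composition, so it preserves ∫ w̄ dw, that is,
the indefinite form ∑ k|ŵ(k)|², the difference of the squared H^{1/2} norms of the positive and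
negative parts. The equation reads (Π⁻ - UΠ⁺)gᵒ = (UΠ⁻ - Π⁺)gⁱ. The form makes the operator on the
left bounded below and its adjoint injective, hence the operator is invertible; equality of the form
on the two sides of the equation rearranges to ‖gᵒ‖ = ‖gⁱ‖. This is the abstract part, carried by
`KreinPair`.

For the structure, project the equation by Π⁻, and its image under W by Π⁺: gᵒ = Π⁺WΠ⁺gⁱ + Π⁻UΠ⁻gⁱ +
(Π⁺WΠ⁻ + Π⁻UΠ⁺)gᵒ. The off-diagonal blocks have rapidly decaying entries, because the phase lβ(x) -
kx has no critical point when k and l have opposite signs and β' > 0. This gives decay of the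
remainder in the row index; decay in the column index follows because the adjoint of S is the
scattering operator of the inverse pair.

The same phase estimate shows that the matrices of U and W decay rapidly away from a band around the
diagonal. A matrix that is bounded on ℓ² and has this property is bounded on all weighted ℓ² spaces,
by a decomposition in dyadic blocks (`IsBand.wsq_le`). With the structure formula this bounds S on
every Sobolev space, in particular on L². -/

/-- An orientation preserving smooth diffeomorphism of `ℝ`. -/
structure IsDiffeo (f : ℝ → ℝ) : Prop where
  smooth : ContDiff ℝ ∞ f
  deriv_pos : ∀ x, 0 < deriv f x
  surj : Function.Surjective f

namespace IsDiffeo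

variable {f g : ℝ → ℝ}

theorem strictMono (hf : IsDiffeo f) : StrictMono f := strictMono_of_deriv_pos hf.deriv_pos

theorem injective (hf : IsDiffeo f) : Function.Injective f := hf.strictMono.injective

theorem differentiable (hf : IsDiffeo f) : Differentiable ℝ f :=
  hf.smooth.differentiable (by simp)

theorem hasDerivAt (hf : IsDiffeo f) (x : ℝ) : HasDerivAt f (deriv f x) x :=
  (hf.differentiable x).hasDerivAt

theorem continuous (hf : IsDiffeo f) : Continuous f := hf.smooth.continuous

theorem contDiff_deriv (hf : IsDiffeo f) : ContDiff ℝ ∞ (deriv f) :=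
  (contDiff_infty_iff_deriv.1 hf.smooth).2

theorem continuous_deriv (hf : IsDiffeo f) : Continuous (deriv f) := hf.contDiff_deriv.continuous

theorem inv_apply (hf : IsDiffeo f) (x : ℝ) : Function.invFun f (f x) = x :=
  Function.leftInverse_invFun hf.injective x

theorem apply_inv (hf : IsDiffeo f) (x : ℝ) : f (Function.invFun f x) = x :=
  Function.rightInverse_invFun hf.surj x

/-- The underlying homeomorphism. -/
def toHomeo (hf : IsDiffeo f) : ℝ ≃ₜ ℝ :=
  (hf.strictMono.orderIsoOfSurjective f hf.surj).toHomeomorph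

theorem toHomeo_symm (hf : IsDiffeo f) : (hf.toHomeo.symm : ℝ → ℝ) = Function.invFun f := by
  funext x
  apply hf.injective
  rw [hf.apply_inv]
  exact hf.toHomeo.apply_symm_apply x

theorem deriv_inv (hf : IsDiffeo f) (x : ℝ) :
    deriv (Function.invFun f) x = (deriv f (Function.invFun f x))⁻¹ := by
  have h : HasDerivAt (Function.invFun f) (deriv f (Function.invFun f x))⁻¹ x := by
    refine HasDerivAt.of_local_left_inverse (f := f) ?_ (hf.hasDerivAt (Function.invFun f x)) (hf.deriv_pos _).ne' ?_
    · rw [← hf.toHomeo_symm]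
      exact hf.toHomeo.symm.continuous.continuousAt
    · exact Eventually.of_forall hf.apply_inv
  exact h.deriv

theorem inv (hf : IsDiffeo f) : IsDiffeo (Function.invFun f) where
  smooth := by
    rw [← hf.toHomeo_symm]
    exact hf.toHomeo.contDiff_symm_deriv (fun x => (hf.deriv_pos x).ne') hf.hasDerivAt hf.smooth
  deriv_pos x := by
    rw [hf.deriv_inv]
    exact inv_pos.2 (hf.deriv_pos _)
  surj x := ⟨f x, hf.inv_apply x⟩

theorem deriv_mul_deriv_inv (hf : IsDiffeo f) (x : ℝ) :
    deriv (Function.invFun f) x * deriv f (Function.invFun f x) = 1 := by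
  rw [hf.deriv_inv, inv_mul_cancel₀ (hf.deriv_pos _).ne']

theorem deriv_inv_mul_deriv (hf : IsDiffeo f) (x : ℝ) :
    deriv (Function.invFun f) (f x) * deriv f x = 1 := by
  have := hf.deriv_mul_deriv_inv (f x)
  rwa [hf.inv_apply] at this

theorem invFun_invFun (hf : IsDiffeo f) : Function.invFun (Function.invFun f) = f := by
  funext x
  apply hf.inv.injective
  rw [hf.inv.apply_inv, hf.inv_apply]

protected theorem id : IsDiffeo fun x => x where
  smooth := contDiff_id
  deriv_pos x := by simp
  surj x := ⟨x, rfl⟩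

theorem deriv_comp (hg : IsDiffeo g) (hf : IsDiffeo f) (x : ℝ) :
    deriv (fun x => g (f x)) x = deriv g (f x) * deriv f x :=
  ((hg.hasDerivAt (f x)).comp x (hf.hasDerivAt x)).deriv

theorem comp (hg : IsDiffeo g) (hf : IsDiffeo f) : IsDiffeo fun x => g (f x) where
  smooth := hg.smooth.comp hf.smooth
  deriv_pos x := by
    rw [hg.deriv_comp hf]
    exact mul_pos (hg.deriv_pos _) (hf.deriv_pos _)
  surj := hg.surj.comp hf.surj

theorem iterate (hf : IsDiffeo f) (n : ℕ) : IsDiffeo f^[n] := by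
  induction n with
  | zero => exact IsDiffeo.id
  | succ n ih =>
    rw [Function.iterate_succ]
    exact ih.comp hf

theorem add_const (hf : IsDiffeo f) (a d : ℝ) : IsDiffeo fun x => f (x + a) + d where
  smooth := (hf.smooth.comp (contDiff_id.add contDiff_const)).add contDiff_const
  deriv_pos x := by
    rw [deriv_add_const, deriv_comp_add_const]
    exact hf.deriv_pos _
  surj y := by
    obtain ⟨x, hx⟩ := hf.surj (y - d)
    exact ⟨x - a, by simp [hx]⟩

/-- A map that is locally a diffeomorphism onto its image, and surjective, is a diffeomorphism. -/
theorem of_local (h : ∀ x, ∃ g, IsDiffeo g ∧ f =ᶠ[𝓝 x] g) (hs : Function.Surjective f) :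
    IsDiffeo f where
  smooth := by
    rw [contDiff_iff_contDiffAt]
    intro x
    obtain ⟨g, hg, he⟩ := h x
    exact hg.smooth.contDiffAt.congr_of_eventuallyEq he
  deriv_pos x := by
    obtain ⟨g, hg, he⟩ := h x
    rw [he.deriv_eq]
    exact hg.deriv_pos x
  surj := hs

theorem image_univ (hf : IsDiffeo f) : f '' univ = univ := Set.image_univ_of_surjective hf.surj

theorem image_Ioc (hf : IsDiffeo f) (a b : ℝ) : f '' Ioc a b = Ioc (f a) (f b) :=
  (hf.strictMono.orderIsoOfSurjective f hf.surj).image_Ioc a b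

theorem lintegral_image (hf : IsDiffeo f) {s : Set ℝ} (hs : MeasurableSet s) (g : ℝ → ℝ≥0∞) :
    ∫⁻ x in f '' s, g x = ∫⁻ x in s, ENNReal.ofReal (deriv f x) * g (f x) := by
  rw [lintegral_image_eq_lintegral_abs_deriv_mul hs
    (fun x _ => (hf.hasDerivAt x).hasDerivWithinAt) hf.injective.injOn]
  simp_rw [abs_of_pos (hf.deriv_pos _)]

theorem integral_image (hf : IsDiffeo f) {s : Set ℝ} (hs : MeasurableSet s) (g : ℝ → ℂ) :
    ∫ x in f '' s, g x = ∫ x in s, ((deriv f x : ℝ) : ℂ) * g (f x) := by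
  rw [integral_image_eq_integral_abs_deriv_smul hs
    (fun x _ => (hf.hasDerivAt x).hasDerivWithinAt) hf.injective.injOn]
  simp_rw [abs_of_pos (hf.deriv_pos _), Complex.real_smul]

theorem integral_comp (hf : IsDiffeo f) (g : ℝ → ℂ) :
    ∫ x, g x = ∫ x, ((deriv f x : ℝ) : ℂ) * g (f x) := by
  rw [← setIntegral_univ, ← hf.image_univ, hf.integral_image MeasurableSet.univ, setIntegral_univ]

/-- The integral of f' over the preimage of a null set is the measure of the null set, and f' is
positive. -/
theorem quasiMeasurePreserving (hf : IsDiffeo f) :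
    Measure.QuasiMeasurePreserving f volume volume := by
  refine ⟨hf.continuous.measurable, Measure.AbsolutelyContinuous.mk fun s hs h0 => ?_⟩
  rw [Measure.map_apply hf.continuous.measurable hs]
  have himg : f '' (f ⁻¹' s) = s := image_preimage_eq s hf.surj
  have h1 : ∫⁻ x in f ⁻¹' s, ENNReal.ofReal (deriv f x) * 1 = 0 := by
    rw [← hf.lintegral_image (hf.continuous.measurable hs) (fun _ => 1), himg]
    simp [h0]
  rw [lintegral_eq_zero_iff (by
    exact (hf.continuous_deriv.measurable.ennreal_ofReal).mul_const 1)] at h1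
  rw [← Measure.restrict_apply_self, measure_eq_zero_iff_ae_notMem]
  filter_upwards [h1] with x hx
  simp [(hf.deriv_pos x).not_ge] at hx

theorem ae_comp (hf : IsDiffeo f) {P : ℝ → Prop} (h : ∀ᵐ x, P x) : ∀ᵐ x, P (f x) :=
  hf.quasiMeasurePreserving.ae h

end IsDiffeo

/-! ### The bounce map -/

section Bounce

variable (Ω : Channel) (lam : Ioo (0 : ℝ) 1)

theorem lam_pos : 0 < (lam : ℝ) := lam.2.1

theorem sqrt_pos : 0 < √(1 - (lam : ℝ) ^ 2) := by
  have h0 := lam.2.1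
  have h1 := lam.2.2
  exact Real.sqrt_pos.2 (by nlinarith)

theorem period_pos : 0 < period lam := Fact.out

theorem period_eq : period lam = 2 * (Real.pi / slope lam) := by
  rw [period]; ring

theorem charFn_eq (σ : ℝ) (x : ℝ × ℝ) :
    charFn σ lam x = (σ * x.1 + x.2 / slope lam) / lam := by
  have h1 := lam_pos lam
  have h2 := sqrt_pos lam
  rw [charFn, slope]
  field_simp

/-- The bottom point `(x, G x)` lies on the characteristic `x₁ ± x₂ / c` through
`(x ± G x / c, 0)`. -/
def Channel.foot (σ : ℝ) (x : ℝ) : ℝ := x + σ * (Ω.G x / slope lam)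

variable {Ω lam}

theorem Channel.foot_flat (σ : ℝ) {x : ℝ} (hx : x ∉ Icc (-Ω.R₀) Ω.R₀) :
    Ω.foot lam σ x = x - σ * (Real.pi / slope lam) := by
  rw [Channel.foot, Ω.flat x hx]; ring

/-- Subcriticality is |G'|/c < 1, which keeps the derivative 1 + σG'/c positive. Surjectivity is
free, because the map is a translation where the bottom is flat. -/
theorem Channel.foot_isDiffeo (hsub : Ω.Subcritical lam) {σ : ℝ} (hσ : |σ| = 1) :
    IsDiffeo (Ω.foot lam σ) := by
  have hc := slope_pos lam
  have hG : Differentiable ℝ Ω.G := Ω.smooth.differentiable (by simp)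
  have hsm : ContDiff ℝ ∞ (Ω.foot lam σ) :=
    contDiff_id.add (contDiff_const.mul (Ω.smooth.div_const _))
  refine ⟨hsm, fun x => ?_, ?_⟩
  · have h : HasDerivAt (Ω.foot lam σ) (1 + σ * (deriv Ω.G x / slope lam)) x :=
      (hasDerivAt_id x).add (((hG x).hasDerivAt.div_const _).const_mul σ)
    rw [h.deriv]
    have h1 : |σ * (deriv Ω.G x / slope lam)| < 1 := by
      rw [abs_mul, hσ, one_mul, abs_div, abs_of_pos hc, div_lt_one hc]
      exact hsub x
    linarith [(abs_lt.1 h1).1]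
  · refine hsm.continuous.surjective ?_ ?_
    · have h : Tendsto (fun x : ℝ => x - σ * (Real.pi / slope lam)) atTop atTop :=
        tendsto_atTop_add_const_right _ _ tendsto_id
      refine h.congr' ?_
      filter_upwards [eventually_gt_atTop Ω.R₀] with x hx
      exact (Ω.foot_flat σ fun h => absurd h.2 (not_le.2 hx)).symm
    · have h : Tendsto (fun x : ℝ => x - σ * (Real.pi / slope lam)) atBot atBot :=
        tendsto_atBot_add_const_right _ _ tendsto_id
      refine h.congr' ?_
      filter_upwards [eventually_lt_atBot (-Ω.R₀)] with x hx
      exact (Ω.foot_flat σ fun h => absurd h.1 (not_le.2 hx)).symm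

theorem epsilon_eq {α : Type*} [Nonempty α] {p : α → Prop} {a : α} (h : ∀ y, p y ↔ y = a) :
    Classical.epsilon p = a :=
  (h _).1 (Classical.epsilon_spec ⟨a, (h a).2 rfl⟩)

/-- The choice operator in `Channel.gam` is forced: by bijectivity of `Channel.foot`, the
characteristic through (θ, 0) meets the bottom exactly once. As G < 0 the two boundaries are
disjoint, so only one of the two alternatives in the definition can occur. -/
theorem Channel.gam_up (hsub : Ω.Subcritical lam) (θ : ℝ) :
    Ω.gam 1 lam (θ, 0) = (Function.invFun (Ω.foot lam 1) θ,
      Ω.G (Function.invFun (Ω.foot lam 1) θ)) := by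
  have hd := Ω.foot_isDiffeo hsub (σ := 1) (by simp)
  have key : ∀ y : ℝ × ℝ, (charFn 1 lam y = charFn 1 lam (θ, 0) ∧
      (((θ, (0 : ℝ)) ∈ bdryUp ∧ y ∈ Ω.bdryDown) ∨ ((θ, (0 : ℝ)) ∈ Ω.bdryDown ∧ y ∈ bdryUp))) ↔
      y = (Function.invFun (Ω.foot lam 1) θ, Ω.G (Function.invFun (Ω.foot lam 1) θ)) := by
    rintro ⟨y1, y2⟩
    have hlam := (lam_pos lam).ne'
    have hup : (θ, (0 : ℝ)) ∈ bdryUp := rfl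
    have hdn : (θ, (0 : ℝ)) ∉ Ω.bdryDown := fun h => (Ω.neg θ).ne (Eq.symm h)
    simp only [hup, hdn, true_and, false_and, or_false, charFn_eq, Prod.mk.injEq, one_mul, zero_div,
      add_zero]
    rw [div_left_inj' hlam]
    constructor
    · rintro ⟨h1, h2⟩
      have h2' : y2 = Ω.G y1 := h2
      have h3 : Ω.foot lam 1 y1 = θ := by rw [Channel.foot, ← h1, h2']; ring
      have h4 : y1 = Function.invFun (Ω.foot lam 1) θ := by rw [← h3, hd.inv_apply]
      exact ⟨h4, by rw [h2', h4]⟩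
    · rintro ⟨h1, h2⟩
      have h3 : Ω.foot lam 1 y1 = θ := by rw [h1, hd.apply_inv]
      have h4 : y2 = Ω.G y1 := by rw [h2, h1]
      refine ⟨?_, h4⟩
      rw [Channel.foot] at h3
      rw [h4, ← h3]; ring
  rw [Channel.gam]
  exact epsilon_eq key

theorem Channel.gam_down (x : ℝ) :
    Ω.gam (-1) lam (x, Ω.G x) = (Ω.foot lam (-1) x, 0) := by
  have key : ∀ y : ℝ × ℝ, (charFn (-1) lam y = charFn (-1) lam (x, Ω.G x) ∧
      (((x, Ω.G x) ∈ bdryUp ∧ y ∈ Ω.bdryDown) ∨ ((x, Ω.G x) ∈ Ω.bdryDown ∧ y ∈ bdryUp))) ↔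
      y = (Ω.foot lam (-1) x, 0) := by
    rintro ⟨y1, y2⟩
    have hlam := (lam_pos lam).ne'
    have hup : (x, Ω.G x) ∉ bdryUp := fun h => (Ω.neg x).ne h
    have hdn : (x, Ω.G x) ∈ Ω.bdryDown := rfl
    simp only [hup, hdn, true_and, false_and, false_or, charFn_eq, Prod.mk.injEq]
    rw [div_left_inj' hlam]
    constructor
    · rintro ⟨h1, h2⟩
      have h2' : y2 = 0 := h2
      refine ⟨?_, h2'⟩
      rw [h2'] at h1
      rw [Channel.foot]
      linarith [zero_div (slope lam)]
    · rintro ⟨h1, h2⟩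
      refine ⟨?_, h2⟩
      rw [h1, h2, Channel.foot, zero_div]
      ring
  rw [Channel.gam]
  exact epsilon_eq key

theorem Channel.bounce_eq (hsub : Ω.Subcritical lam) (θ : ℝ) :
    Ω.bounce lam θ = Ω.foot lam (-1) (Function.invFun (Ω.foot lam 1) θ) := by
  rw [Channel.bounce, Ω.gam_up hsub, Ω.gam_down]

theorem Channel.bounce_foot (hsub : Ω.Subcritical lam) (x : ℝ) :
    Ω.bounce lam (Ω.foot lam 1 x) = Ω.foot lam (-1) x := by
  rw [Ω.bounce_eq hsub, (Ω.foot_isDiffeo hsub (σ := 1) (by simp)).inv_apply]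

theorem Channel.bounce_isDiffeo (hsub : Ω.Subcritical lam) : IsDiffeo (Ω.bounce lam) := by
  have h := (Ω.foot_isDiffeo hsub (σ := -1) (by simp)).comp
    (Ω.foot_isDiffeo hsub (σ := 1) (by simp)).inv
  have he : Ω.bounce lam = fun θ => Ω.foot lam (-1) (Function.invFun (Ω.foot lam 1) θ) :=
    funext fun θ => Ω.bounce_eq hsub θ
  rw [he]; exact h

/-- The threshold is where the bottom point θ + π/c leaves the flat part on the left. Over depth π
each of the two segments advances by π/c, half a period. -/
theorem Channel.bounce_of_lt (hsub : Ω.Subcritical lam) {θ : ℝ}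
    (h : θ < -Ω.R₀ - Real.pi / slope lam) : Ω.bounce lam θ = θ + period lam := by
  have h1 : θ + Real.pi / slope lam ∉ Icc (-Ω.R₀) Ω.R₀ := fun h' => by linarith [h'.1]
  have h2 : θ = Ω.foot lam 1 (θ + Real.pi / slope lam) := by rw [Ω.foot_flat 1 h1]; ring
  rw [h2, Ω.bounce_foot hsub, Ω.foot_flat _ h1, ← h2, period_eq]; ring

theorem Channel.bounce_of_gt (hsub : Ω.Subcritical lam) {θ : ℝ}
    (h : Ω.R₀ - Real.pi / slope lam < θ) : Ω.bounce lam θ = θ + period lam := by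
  have h1 : θ + Real.pi / slope lam ∉ Icc (-Ω.R₀) Ω.R₀ := fun h' => by linarith [h'.2]
  have h2 : θ = Ω.foot lam 1 (θ + Real.pi / slope lam) := by rw [Ω.foot_flat 1 h1]; ring
  rw [h2, Ω.bounce_foot hsub, Ω.foot_flat _ h1, ← h2, period_eq]; ring

theorem Channel.exists_depth (Ω : Channel) : ∃ d > 0, ∀ x, Ω.G x ≤ -d := by
  obtain ⟨x₀, -, h₀⟩ := (isCompact_Icc (a := -Ω.R₀) (b := Ω.R₀)).exists_isMaxOn
    ⟨0, by simp [Ω.R₀_pos.le]⟩ Ω.smooth.continuous.continuousOn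
  refine ⟨min (-Ω.G x₀) Real.pi, lt_min (by linarith [Ω.neg x₀]) Real.pi_pos, fun x => ?_⟩
  by_cases hx : x ∈ Icc (-Ω.R₀) Ω.R₀
  · have h1 : Ω.G x ≤ Ω.G x₀ := h₀ hx
    linarith [min_le_left (-Ω.G x₀) Real.pi]
  · rw [Ω.flat x hx]
    linarith [min_le_right (-Ω.G x₀) Real.pi]

/-- The bounce at the bottom point x advances by -2G(x)/c, at least 2d/c when the depth is at least
d. The uniform gap keeps the curves t = s and t = b(s) apart and drives orbits to infinity. -/
theorem Channel.exists_gap (hsub : Ω.Subcritical lam) :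
    ∃ δ > 0, ∀ θ, θ + δ ≤ Ω.bounce lam θ := by
  obtain ⟨d, hd, hG⟩ := Ω.exists_depth
  have hc := slope_pos lam
  refine ⟨d / slope lam, div_pos hd hc, fun θ => ?_⟩
  obtain ⟨x, rfl⟩ := (Ω.foot_isDiffeo hsub (σ := 1) (by simp)).surj θ
  rw [Ω.bounce_foot hsub, Channel.foot, Channel.foot]
  have h1 : Ω.G x / slope lam ≤ -d / slope lam := by gcongr; exact hG x
  have h2 : -d / slope lam = -(d / slope lam) := by ring
  have h3 := div_pos hd hc
  linarith

end Bounce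

/-! ### Straightening of the bounce map -/

section Straighten

variable {Ω : Channel} {lam : Ioo (0 : ℝ) 1}

variable (Ω lam) in
/-- The map `X` with `X (y + 2π/c) = b (X y)` which is the identity far to the left. -/
def Channel.unroll (y : ℝ) : ℝ :=
  (Ω.bounce lam)^[⌈(y + Ω.R₀ + Real.pi / slope lam) / period lam⌉₊ + 1]
    (y - ((⌈(y + Ω.R₀ + Real.pi / slope lam) / period lam⌉₊ + 1 : ℕ) : ℝ) * period lam)

theorem Channel.iterate_bounce_sub (hsub : Ω.Subcritical lam) {y : ℝ} {n : ℕ}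
    (hn : y - n * period lam < -Ω.R₀ - Real.pi / slope lam) (m : ℕ) :
    (Ω.bounce lam)^[n + m] (y - ((n + m : ℕ) : ℝ) * period lam)
      = (Ω.bounce lam)^[n] (y - n * period lam) := by
  induction m with
  | zero => rfl
  | succ m ih =>
    have hp := period_pos lam
    have hm : (0 : ℝ) ≤ m * period lam := by positivity
    rw [← ih, ← add_assoc, Function.iterate_succ_apply, Ω.bounce_of_lt hsub]
    · congr 1; push_cast; ring
    · push_cast; nlinarith

/-- Every admissible number of shifts gives the same value, since far to the left an extra shift by
a period is undone by one more bounce. Freezing the number near a point exhibits `Channel.unroll`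
locally as an iterate of the bounce after a translation. -/
theorem Channel.unroll_eq (hsub : Ω.Subcritical lam) {y : ℝ} {n : ℕ}
    (hn : y - n * period lam < -Ω.R₀ - Real.pi / slope lam) :
    Ω.unroll lam y = (Ω.bounce lam)^[n] (y - n * period lam) := by
  have hp := period_pos lam
  set k := ⌈(y + Ω.R₀ + Real.pi / slope lam) / period lam⌉₊ + 1 with hk
  have hk' : y - k * period lam < -Ω.R₀ - Real.pi / slope lam := by
    -- The ceiling gives only a non-strict bound; the extra `+ 1` in the exponent makes it strict by
    -- a whole period.
    have h1 := Nat.le_ceil ((y + Ω.R₀ + Real.pi / slope lam) / period lam)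
    rw [div_le_iff₀ hp] at h1
    rw [hk]; push_cast; nlinarith
  change (Ω.bounce lam)^[k] (y - (k : ℝ) * period lam) = _
  rcases le_total n k with h | h
  · obtain ⟨m, hm⟩ := Nat.exists_eq_add_of_le h
    rw [hm, Ω.iterate_bounce_sub hsub hn]
  · obtain ⟨m, hm⟩ := Nat.exists_eq_add_of_le h
    rw [hm, Ω.iterate_bounce_sub hsub hk']

theorem exists_nat_sub_mul_lt {p : ℝ} (hp : 0 < p) (y a : ℝ) : ∃ n : ℕ, y - n * p < a := by
  obtain ⟨n, hn⟩ := exists_nat_gt ((y - a) / p)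
  rw [div_lt_iff₀ hp] at hn
  exact ⟨n, by linarith⟩

theorem Channel.unroll_of_lt (hsub : Ω.Subcritical lam) {y : ℝ}
    (hy : y < -Ω.R₀ - Real.pi / slope lam) : Ω.unroll lam y = y := by
  rw [Ω.unroll_eq hsub (n := 0) (by simpa using hy)]
  simp

theorem Channel.unroll_add_period (hsub : Ω.Subcritical lam) (y : ℝ) :
    Ω.unroll lam (y + period lam) = Ω.bounce lam (Ω.unroll lam y) := by
  obtain ⟨n, hn⟩ := exists_nat_sub_mul_lt (period_pos lam) y (-Ω.R₀ - Real.pi / slope lam)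
  rw [Ω.unroll_eq hsub hn, Ω.unroll_eq hsub (n := n + 1) (by push_cast; linarith),
    Function.iterate_succ_apply']
  congr 2; push_cast; ring

theorem Channel.unroll_add_nat (hsub : Ω.Subcritical lam) (y : ℝ) (n : ℕ) :
    Ω.unroll lam (y + n * period lam) = (Ω.bounce lam)^[n] (Ω.unroll lam y) := by
  induction n with
  | zero => simp
  | succ n ih =>
    rw [Function.iterate_succ_apply', ← ih, ← Ω.unroll_add_period hsub]
    congr 1; push_cast; ring

theorem Channel.unroll_isDiffeo (hsub : Ω.Subcritical lam) : IsDiffeo (Ω.unroll lam) := by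
  have hloc : ∀ x, ∃ g, IsDiffeo g ∧ Ω.unroll lam =ᶠ[𝓝 x] g := by
    intro x
    obtain ⟨n, hn⟩ := exists_nat_sub_mul_lt (period_pos lam) x (-Ω.R₀ - Real.pi / slope lam)
    refine ⟨fun y => (Ω.bounce lam)^[n] (y - n * period lam), ?_, ?_⟩
    · have := ((Ω.bounce_isDiffeo hsub).iterate n).add_const (-(n * period lam)) 0
      simpa [sub_eq_add_neg] using this
    · have : ∀ᶠ y in 𝓝 x, y - n * period lam < -Ω.R₀ - Real.pi / slope lam :=
        (continuous_id.sub continuous_const).continuousAt.eventually_lt continuousAt_const hn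
      filter_upwards [this] with y hy using Ω.unroll_eq hsub hy
  have hcont : Continuous (Ω.unroll lam) := by
    rw [continuous_iff_continuousAt]
    intro x
    obtain ⟨g, hg, he⟩ := hloc x
    exact hg.continuous.continuousAt.congr he.symm
  have hmono : StrictMono (Ω.unroll lam) := by
    refine strictMono_of_deriv_pos fun x => ?_
    obtain ⟨g, hg, he⟩ := hloc x
    rw [he.deriv_eq]; exact hg.deriv_pos x
  refine IsDiffeo.of_local hloc (hcont.surjective ?_ ?_)
  -- The points X(n · 2π/c) form the orbit of X(0) under the bounce, which escapes to the right in
  -- steps of at least δ.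
  · refine hmono.monotone.tendsto_atTop_atTop fun a => ?_
    obtain ⟨δ, hδ, hgap⟩ := Ω.exists_gap hsub
    have hn : ∀ n : ℕ, Ω.unroll lam 0 + n * δ ≤ Ω.unroll lam (0 + n * period lam) := by
      intro n
      rw [Ω.unroll_add_nat hsub]
      induction n with
      | zero => simp
      | succ n ih =>
        rw [Function.iterate_succ_apply']
        have := hgap ((Ω.bounce lam)^[n] (Ω.unroll lam 0))
        push_cast; linarith
    obtain ⟨n, h⟩ := exists_nat_sub_mul_lt hδ a (Ω.unroll lam 0)
    exact ⟨0 + n * period lam, by linarith [hn n]⟩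
  · refine tendsto_id.congr' ?_
    filter_upwards [eventually_lt_atBot (-Ω.R₀ - Real.pi / slope lam)] with y hy
    exact (Ω.unroll_of_lt hsub hy).symm

/-- A diffeomorphism which commutes with a translation beyond some point agrees there with a
diffeomorphism which commutes with it everywhere. -/
theorem exists_periodic_extension {f : ℝ → ℝ} (hf : IsDiffeo f) {p a : ℝ} (hp : 0 < p)
    (h : ∀ x, a < x → f (x + p) = f x + p) :
    ∃ β, IsDiffeo β ∧ (∀ x, β (x + p) = β x + p) ∧ ∀ x, a < x → β x = f x := by
  have hit : ∀ (m : ℕ) x, a < x → f (x + m * p) = f x + m * p := by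
    intro m x hx
    induction m with
    | zero => simp
    | succ m ih =>
      have : x + ((m + 1 : ℕ) : ℝ) * p = x + m * p + p := by push_cast; ring
      have hm : (0 : ℝ) ≤ m * p := by positivity
      rw [this, h _ (by linarith), ih]; push_cast; ring
  have hex : ∀ x, ∃ m : ℕ, a < x + m * p := fun x => by
    obtain ⟨m, hm⟩ := exists_nat_sub_mul_lt hp a x
    exact ⟨m, by linarith⟩
  choose n hn using hex
  -- Shift x beyond a by whole periods, apply f, shift back. Commutation beyond a makes the result
  -- independent of the number of periods.
  set β : ℝ → ℝ := fun x => f (x + n x * p) - n x * p with hβ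
  have hβm : ∀ x (m : ℕ), a < x + m * p → β x = f (x + m * p) - m * p := by
    intro x m hm
    rcases le_total m (n x) with hle | hle
    · obtain ⟨k, hk⟩ := Nat.exists_eq_add_of_le hle
      have : x + (n x : ℝ) * p = x + m * p + k * p := by rw [hk]; push_cast; ring
      simp only [hβ]
      rw [this, hit k _ hm, hk]; push_cast; ring
    · obtain ⟨k, hk⟩ := Nat.exists_eq_add_of_le hle
      have : x + (m : ℝ) * p = x + n x * p + k * p := by rw [hk]; push_cast; ring
      simp only [hβ]
      rw [this, hit k _ (hn x), hk]; push_cast; ring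
  have hper : ∀ x, β (x + p) = β x + p := by
    intro x
    have h1 := hn (x + p)
    rw [hβm (x + p) _ h1, hβm x (n (x + p) + 1) (by push_cast; linarith)]
    have : x + ((n (x + p) + 1 : ℕ) : ℝ) * p = x + p + n (x + p) * p := by push_cast; ring
    rw [this]; push_cast; ring
  have hloc : ∀ x, ∃ g, IsDiffeo g ∧ β =ᶠ[𝓝 x] g := by
    intro x
    refine ⟨_, hf.add_const (n x * p) (-(n x * p)), ?_⟩
    have : ∀ᶠ y in 𝓝 x, a < y + n x * p :=
      continuousAt_const.eventually_lt (continuous_id.add continuous_const).continuousAt (hn x)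
    filter_upwards [this] with y hy
    rw [hβm y _ hy]; ring
  have hcont : Continuous β := by
    rw [continuous_iff_continuousAt]
    intro x
    obtain ⟨g, hg, he⟩ := hloc x
    exact hg.continuous.continuousAt.congr he.symm
  have hmono : StrictMono β := by
    refine strictMono_of_deriv_pos fun x => ?_
    obtain ⟨g, hg, he⟩ := hloc x
    rw [he.deriv_eq]; exact hg.deriv_pos x
  have hnat : ∀ (m : ℕ) x, β (x + m * p) = β x + m * p := by
    intro m x
    induction m with
    | zero => simp
    | succ m ih =>
      have : x + ((m + 1 : ℕ) : ℝ) * p = x + m * p + p := by push_cast; ring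
      rw [this, hper, ih]; push_cast; ring
  refine ⟨β, IsDiffeo.of_local hloc (hcont.surjective ?_ ?_), hper, fun x hx => ?_⟩
  · refine hmono.monotone.tendsto_atTop_atTop fun y => ?_
    obtain ⟨m, hm⟩ := exists_nat_sub_mul_lt hp y (β 0)
    exact ⟨0 + m * p, by rw [hnat]; linarith⟩
  · refine hmono.monotone.tendsto_atBot_atBot fun y => ?_
    obtain ⟨m, hm⟩ := exists_nat_sub_mul_lt hp (β 0) y
    refine ⟨0 - m * p, ?_⟩
    have := hnat m (0 - m * p)
    rw [sub_add_cancel] at this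
    linarith
  · rw [hβm x 0 (by simpa using hx)]; simp

end Straighten

/-! ### The multi-bounce map -/

/-- A lift to `ℝ` of an orientation preserving diffeomorphism of the circle of length `p`. -/
structure IsLift (p : ℝ) (β : ℝ → ℝ) : Prop extends IsDiffeo β where
  add_period : ∀ x, β (x + p) = β x + p

theorem IsLift.inv {p : ℝ} {β : ℝ → ℝ} (h : IsLift p β) : IsLift p (Function.invFun β) where
  toIsDiffeo := h.toIsDiffeo.inv
  add_period x := by
    apply h.injective
    rw [h.apply_inv, h.add_period, h.apply_inv]

theorem IsLift.deriv_add {p : ℝ} {β : ℝ → ℝ} (h : IsLift p β) (x : ℝ) :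
    deriv β (x + p) = deriv β x := by
  rw [← deriv_comp_add_const]
  simp_rw [h.add_period]
  exact deriv_add_const _

namespace FundamentalIntervals

variable {Ω : Channel} {lam : Ioo (0 : ℝ) 1} (J : FundamentalIntervals Ω lam)

theorem aL_add_lt (J : FundamentalIntervals Ω lam) :
    J.aL + period lam < -Ω.R₀ - 2 * (Real.pi / slope lam) := by
  have hp := period_pos lam
  have hpi : 0 < Real.pi / slope lam := div_pos Real.pi_pos (slope_pos lam)
  have h1 : J.aL + period lam ≤ -J.M := by
    by_contra! hlt
    have h2 : max (J.aL + period lam / 2) ((J.aL + period lam + -J.M) / 2) ∈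
        Ioo J.aL (J.aL + period lam) :=
      ⟨lt_max_of_lt_left (by linarith), max_lt (by linarith) (by linarith)⟩
    have h3 := J.left h2
    have h4 : (J.aL + period lam + -J.M) / 2 < -J.M := lt_of_le_of_lt (le_max_right _ _) h3
    linarith
  have h2 := J.M_gt
  have h3 : 3 * Real.pi / slope lam = 3 * (Real.pi / slope lam) := by ring
  linarith

theorem lt_aR (J : FundamentalIntervals Ω lam) :
    Ω.R₀ + 3 * (Real.pi / slope lam) < J.aR := by
  have hp := period_pos lam
  have h1 : J.M ≤ J.aR := by
    by_contra! hlt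
    have h2 : min (J.aR + period lam / 2) ((J.aR + J.M) / 2) ∈
        Ioo J.aR (J.aR + period lam) :=
      ⟨lt_min (by linarith) (by linarith), min_lt_of_left_lt (by linarith)⟩
    have h3 := J.right h2
    have h4 : J.M < (J.aR + J.M) / 2 := lt_of_lt_of_le h3 (min_le_right _ _)
    linarith
  have h2 := J.M_gt
  have h3 : 3 * Real.pi / slope lam = 3 * (Real.pi / slope lam) := by ring
  linarith

theorem mb_isDiffeo (hsub : Ω.Subcritical lam) : IsDiffeo J.mb :=
  (Ω.bounce_isDiffeo hsub).iterate J.N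

/-- Only the image of the open interval is given. By monotonicity it is the open interval between
the images of the endpoints, and the infima are compared. -/
theorem mb_aL (hsub : Ω.Subcritical lam) : J.mb J.aL = J.aR := by
  have hd := J.mb_isDiffeo hsub
  have hp := period_pos lam
  have h1 : Ioo (J.mb J.aL) (J.mb (J.aL + period lam)) = Ioo J.aR (J.aR + period lam) := by
    rw [← J.image]
    exact ((hd.strictMono.orderIsoOfSurjective _ hd.surj).image_Ioo _ _).symm
  have h2 := congrArg sInf h1
  rwa [csInf_Ioo (hd.strictMono (by linarith)), csInf_Ioo (by linarith)] at h2

theorem mb_eq_unroll (hsub : Ω.Subcritical lam) {x : ℝ}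
    (hx : x < -Ω.R₀ - Real.pi / slope lam) : J.mb x = Ω.unroll lam (x + J.N * period lam) := by
  rw [Ω.unroll_add_nat hsub, Ω.unroll_of_lt hsub hx]; rfl

/-- The multi-bounce map extends to a lift of a circle diffeomorphism. -/
theorem exists_lift (hsub : Ω.Subcritical lam) :
    ∃ β, IsLift (period lam) β ∧ ∀ x ∈ Icc J.aL (J.aL + period lam), J.mb =ᶠ[𝓝 x] β := by
  have hp := period_pos lam
  have hpi : 0 < Real.pi / slope lam := div_pos Real.pi_pos (slope_pos lam)
  have hL := J.aL_add_lt
  have hR := J.lt_aR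
  have hX := Ω.unroll_isDiffeo hsub
  -- On the far left f is the N-th iterate of the bounce. Where f exceeds R₀ it commutes with the
  -- period, because X(y + 2π/c) = b(X(y)) and b is a translation there. Since f sends aL to aR >
  -- R₀, both descriptions hold on 𝓙_L.
  set f : ℝ → ℝ := fun x => Ω.unroll lam (x + J.N * period lam) + 0 with hf
  have hfd : IsDiffeo f := hX.add_const _ _
  obtain ⟨a, ha⟩ := hfd.surj Ω.R₀
  have hfL : f J.aL = J.aR := by
    rw [hf]; simp only
    rw [add_zero, ← J.mb_eq_unroll hsub (by linarith), J.mb_aL hsub]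
  have haL : a < J.aL := by
    rw [← hfd.strictMono.lt_iff_lt, ha, hfL]; linarith
  obtain ⟨β, hβ, hper, hext⟩ := exists_periodic_extension hfd hp (a := a) fun x hx => by
    have h1 : Ω.R₀ < f x := by rw [← ha]; exact hfd.strictMono hx
    have h2 : x + period lam + J.N * period lam = x + J.N * period lam + period lam := by ring
    simp only [hf, add_zero] at h1 ⊢
    rw [h2, Ω.unroll_add_period hsub, Ω.bounce_of_gt hsub (by linarith)]
  -- Agreement near every point of the closed interval makes the derivatives agree at its right end
  -- too, which belongs to the half-open interval used to pass to the circle.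
  refine ⟨β, ⟨hβ, hper⟩, fun x hx => ?_⟩
  filter_upwards [Ioo_mem_nhds (lt_of_lt_of_le haL hx.1)
    (show x < -Ω.R₀ - Real.pi / slope lam by linarith [hx.2])] with y hy
  rw [hext y hy.1, J.mb_eq_unroll hsub hy.2, hf]; simp

theorem lift_aL {β : ℝ → ℝ} (he : ∀ x ∈ Icc J.aL (J.aL + period lam), J.mb =ᶠ[𝓝 x] β)
    (hsub : Ω.Subcritical lam) : β J.aL = J.aR := by
  have hp := period_pos lam
  rw [← J.mb_aL hsub]
  exact ((he J.aL ⟨le_rfl, by linarith⟩).eq_of_nhds).symm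

theorem invFun_eventuallyEq {β : ℝ → ℝ} (hβ : IsLift (period lam) β)
    (he : ∀ x ∈ Icc J.aL (J.aL + period lam), J.mb =ᶠ[𝓝 x] β) (hsub : Ω.Subcritical lam) {y : ℝ}
    (hy : y ∈ Icc J.aR (J.aR + period lam)) :
    Function.invFun J.mb =ᶠ[𝓝 y] Function.invFun β := by
  have hmb := J.mb_isDiffeo hsub
  set x := Function.invFun β y with hx
  have hxm : x ∈ Icc J.aL (J.aL + period lam) := by
    rw [← J.lift_aL he hsub, ← hβ.add_period] at hy
    have h1 := hβ.inv.strictMono.monotone hy.1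
    have h2 := hβ.inv.strictMono.monotone hy.2
    rw [hβ.inv_apply] at h1 h2
    exact ⟨h1, h2⟩
  have h1 := hβ.inv.continuous.continuousAt.eventually (he x hxm)
  filter_upwards [h1] with z hz
  apply hmb.injective
  rw [hmb.apply_inv, hz, hβ.apply_inv]

theorem _root_.ChannelScattering.torus_induction {P : Torus lam → Prop} (a : ℝ)
    (h : ∀ x ∈ Ioc a (a + period lam), P x) (t : Torus lam) : P t := by
  obtain ⟨x, hx, rfl⟩ : ∃ x ∈ Ioc a (a + period lam), (x : Torus lam) = t := by
    have := AddCircle.coe_image_Ioc_eq (period lam) a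
    exact (this.symm ▸ mem_univ t : t ∈ _ '' _)
  exact h x hx

end FundamentalIntervals

/-- The pullback `β^*(v dx)` of a one-form on the circle by the diffeomorphism with lift `β`. -/
def pullback {lam : Ioo (0 : ℝ) 1} (β : ℝ → ℝ) (v : Torus lam → ℂ) : Torus lam → ℂ :=
  AddCircle.liftIoc (period lam) 0 fun x => ((deriv β x : ℝ) : ℂ) * v ((β x : ℝ) : Torus lam)

/-! ### One-forms pulled back by a circle diffeomorphism. -/

section

variable {lam : Ioo (0 : ℝ) 1} {β : ℝ → ℝ}

theorem liftIoc_coe_of_periodic {f : ℝ → ℂ} (hf : Function.Periodic f (period lam)) (a x : ℝ) :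
    AddCircle.liftIoc (period lam) a f (x : Torus lam) = f x := by
  have hp := period_pos lam
  obtain ⟨y, hy, hxy⟩ : ∃ y ∈ Ioc a (a + period lam), (y : Torus lam) = x := by
    have := AddCircle.coe_image_Ioc_eq (period lam) a
    exact (this.symm ▸ mem_univ (x : Torus lam) : (x : Torus lam) ∈ _ '' _)
  rw [← hxy, AddCircle.liftIoc_coe_apply hy]
  obtain ⟨n, hn⟩ := AddSubgroup.mem_zmultiples_iff.1 (QuotientAddGroup.eq_iff_sub_mem.1 hxy)
  have h1 : y = x + n • period lam := by rw [hn]; ring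
  rw [h1]
  exact hf.zsmul n x

theorem IsLift.periodic (hβ : IsLift (period lam) β) (v : Torus lam → ℂ) :
    Function.Periodic (fun x => ((deriv β x : ℝ) : ℂ) * v ((β x : ℝ) : Torus lam))
      (period lam) := by
  intro x
  simp only
  rw [hβ.deriv_add, hβ.add_period, AddCircle.coe_add_period]

theorem pullback_coe (hβ : IsLift (period lam) β) (v : Torus lam → ℂ) (x : ℝ) :
    pullback β v (x : Torus lam) = ((deriv β x : ℝ) : ℂ) * v ((β x : ℝ) : Torus lam) :=
  liftIoc_coe_of_periodic (hβ.periodic v) 0 x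

theorem pullback_inv (hβ : IsLift (period lam) β) (v : Torus lam → ℂ) :
    pullback β (pullback (Function.invFun β) v) = v := by
  funext t
  induction t using QuotientAddGroup.induction_on with
  | H x =>
    refine (pullback_coe hβ _ x).trans ?_
    rw [pullback_coe hβ.inv, hβ.inv_apply, ← mul_assoc, ← Complex.ofReal_mul, mul_comm (deriv β x),
      hβ.deriv_inv_mul_deriv]
    simp

namespace FundamentalIntervals

variable {Ω : Channel} (J : FundamentalIntervals Ω lam)

theorem pull_eq (he : ∀ x ∈ Icc J.aL (J.aL + period lam), J.mb =ᶠ[𝓝 x] β) (hβ : IsLift (period lam) β) (v : Torus lam → ℂ) : J.pull v = pullback β v := by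
  funext t
  refine torus_induction (P := fun t => J.pull v t = pullback β v t) J.aL (fun x hx => ?_) t
  rw [pull, AddCircle.liftIoc_coe_apply hx, pullback_coe hβ]
  have h := he x (Ioc_subset_Icc_self hx)
  rw [h.deriv_eq, h.eq_of_nhds]

theorem pullInv_eq (he : ∀ x ∈ Icc J.aL (J.aL + period lam), J.mb =ᶠ[𝓝 x] β) (hsub : Ω.Subcritical lam) (hβ : IsLift (period lam) β) (v : Torus lam → ℂ) :
    J.pullInv v = pullback (Function.invFun β) v := by
  funext t
  refine torus_induction (P := fun t => J.pullInv v t = pullback (Function.invFun β) v t)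
    J.aR (fun x hx => ?_) t
  rw [pullInv, AddCircle.liftIoc_coe_apply hx, pullback_coe hβ.inv]
  have h := J.invFun_eventuallyEq hβ he hsub (Ioc_subset_Icc_self hx)
  rw [h.deriv_eq, h.eq_of_nhds]

end FundamentalIntervals

end

/-! ### Pullbacks on the circle and their Fourier matrices -/

section Torus

variable {lam : Ioo (0 : ℝ) 1}

theorem ae_haar_iff {P : Torus lam → Prop} :
    (∀ᵐ t ∂(AddCircle.haarAddCircle : Measure (Torus lam)), P t) ↔ ∀ᵐ t : Torus lam, P t := by
  rw [AddCircle.volume_eq_smul_haarAddCircle, Measure.ae_ennreal_smul_measure_iff]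
  simpa using period_pos lam

theorem ae_torus_iff (a : ℝ) {P : Torus lam → Prop} :
    (∀ᵐ t ∂(AddCircle.haarAddCircle : Measure (Torus lam)), P t) ↔
      ∀ᵐ x : ℝ ∂(volume.restrict (Ioc a (a + period lam))), P (x : Torus lam) := by
  rw [ae_haar_iff]
  constructor
  · have h1 := (AddCircle.measurePreserving_mk (period lam) a).quasiMeasurePreserving
    exact fun h => h1.ae h
  · intro h
    rw [ae_restrict_iff_subtype measurableSet_Ioc] at h
    have h1 := (AddCircle.measurePreserving_equivIoc (period lam)
      (a := a)).quasiMeasurePreserving.ae h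
    filter_upwards [h1] with t ht
    rwa [AddCircle.coe_equivIoc] at ht

theorem ae_torus_iff_real {P : Torus lam → Prop} :
    (∀ᵐ t ∂(AddCircle.haarAddCircle : Measure (Torus lam)), P t) ↔ ∀ᵐ x : ℝ, P (x : Torus lam) := by
  constructor
  · intro h
    rw [← Measure.restrict_univ (μ := (volume : Measure ℝ)),
      ← iUnion_Ioc_add_zsmul (period_pos lam) 0, ae_restrict_iUnion_iff]
    intro n
    have := (ae_torus_iff (0 + n • period lam)).1 h
    have e : (0 : ℝ) + (n + 1) • period lam = 0 + n • period lam + period lam := by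
      rw [add_one_zsmul, add_assoc]
    rwa [e]
  · exact fun h => (ae_torus_iff 0).2 (ae_restrict_of_ae h)

theorem quasiMeasurePreserving_coe :
    Measure.QuasiMeasurePreserving (fun x : ℝ => (x : Torus lam)) volume
      AddCircle.haarAddCircle := by
  refine ⟨AddCircle.measurable_mk', Measure.AbsolutelyContinuous.mk fun s hs h0 => ?_⟩
  rw [Measure.map_apply AddCircle.measurable_mk' hs]
  have h1 : ∀ᵐ t ∂(AddCircle.haarAddCircle : Measure (Torus lam)), t ∉ s :=
    measure_eq_zero_iff_ae_notMem.1 h0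
  exact measure_eq_zero_iff_ae_notMem.2 (ae_torus_iff_real.1 h1)

theorem lintegral_torus (a : ℝ) (f : Torus lam → ℝ≥0∞) :
    ∫⁻ t, f t ∂(AddCircle.haarAddCircle : Measure (Torus lam))
      = (ENNReal.ofReal (period lam))⁻¹ * ∫⁻ x in Ioc a (a + period lam), f (x : Torus lam) := by
  rw [AddCircle.lintegral_preimage, AddCircle.volume_eq_smul_haarAddCircle, lintegral_smul_measure,
    smul_eq_mul, ← mul_assoc, ENNReal.inv_mul_cancel, one_mul]
  · simpa using period_pos lam
  · exact ENNReal.ofReal_ne_top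

theorem integral_torus (a : ℝ) (f : Torus lam → ℂ) :
    ∫ t, f t ∂(AddCircle.haarAddCircle : Measure (Torus lam))
      = ((period lam : ℝ) : ℂ)⁻¹ * ∫ x in Ioc a (a + period lam), f (x : Torus lam) := by
  rw [AddCircle.integral_preimage, AddCircle.integral_haarAddCircle, Complex.real_smul]
  push_cast; rfl

theorem L2_ext {f g : L2 lam} (h : ∀ k, fourierCoeff f k = fourierCoeff g k) : f = g := by
  apply fourierBasis.repr.injective
  ext k
  rw [fourierBasis_repr, fourierBasis_repr, h]

theorem fourierCoeff_toLp' {f : Torus lam → ℂ} (hf : MemLp f 2 AddCircle.haarAddCircle) (k : ℤ) :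
    fourierCoeff (hf.toLp f) k = fourierCoeff f k :=
  congrFun (fourierCoeff_congr_ae hf.coeFn_toLp) k

/-- Parseval's identity for the inner product. -/
theorem hasSum_conj_mul_fourierCoeff {f g : Torus lam → ℂ}
    (hf : MemLp f 2 AddCircle.haarAddCircle) (hg : MemLp g 2 AddCircle.haarAddCircle) :
    HasSum (fun l => (starRingEnd ℂ) (fourierCoeff f l) * fourierCoeff g l)
      (∫ t, (starRingEnd ℂ) (f t) * g t ∂AddCircle.haarAddCircle) := by
  have h := fourierBasis.hasSum_inner_mul_inner (hf.toLp f) (hg.toLp g)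
  rw [L2.inner_def] at h
  have e1 : ∀ l, inner ℂ (hf.toLp f) (fourierBasis l) * inner ℂ (fourierBasis l) (hg.toLp g)
      = (starRingEnd ℂ) (fourierCoeff f l) * fourierCoeff g l := by
    intro l
    rw [← fourierBasis.repr_apply_apply, fourierBasis_repr, fourierCoeff_toLp', ← inner_conj_symm,
      ← fourierBasis.repr_apply_apply, fourierBasis_repr, fourierCoeff_toLp']
  have e2 : ∫ t, inner ℂ (hf.toLp f t) (hg.toLp g t)
      ∂(AddCircle.haarAddCircle : Measure (Torus lam)) =
      ∫ t, (starRingEnd ℂ) (f t) * g t ∂AddCircle.haarAddCircle := by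
    refine integral_congr_ae ?_
    filter_upwards [hf.coeFn_toLp, hg.coeFn_toLp] with t h1 h2
    rw [h1, h2, RCLike.inner_apply']
  simp_rw [e1] at h
  rwa [e2] at h

theorem tsum_enorm_sq_fourierCoeff {f : Torus lam → ℂ} (hf : MemLp f 2 AddCircle.haarAddCircle) :
    ∑' k, ‖fourierCoeff f k‖ₑ ^ 2 = ∫⁻ t, ‖f t‖ₑ ^ 2 ∂AddCircle.haarAddCircle := by
  have h := hasSum_sq_fourierCoeff (hf.toLp f)
  simp_rw [fourierCoeff_toLp'] at h
  have h0 : ∫ t, ‖hf.toLp f t‖ ^ 2 ∂(AddCircle.haarAddCircle : Measure (Torus lam))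
      = ∫ t, ‖f t‖ ^ 2 ∂(AddCircle.haarAddCircle : Measure (Torus lam)) :=
    integral_congr_ae (hf.coeFn_toLp.mono fun t ht => by simp only [ht])
  rw [h0] at h
  have h1 := ENNReal.ofReal_tsum_of_nonneg (fun k => by positivity) h.summable
  have h2 : ∀ z : ℂ, ENNReal.ofReal (‖z‖ ^ 2) = ‖z‖ₑ ^ 2 := fun z => by
    rw [ENNReal.ofReal_pow (norm_nonneg _), ofReal_norm]
  rw [h.tsum_eq, ofReal_integral_eq_lintegral_ofReal] at h1
  · simp_rw [h2] at h1
    exact h1.symm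
  · exact (memLp_two_iff_integrable_sq_norm hf.1).1 hf
  · exact ae_of_all _ fun t => by positivity

end Torus

/-! ### The matrix of a pullback in the Fourier basis. -/

section Pullback

variable {lam : Ioo (0 : ℝ) 1} {β : ℝ → ℝ}

theorem IsLift.exists_deriv_bounds (hβ : IsLift (period lam) β) :
    ∃ b₀ b₁ : ℝ, 0 < b₀ ∧ ∀ x, b₀ ≤ deriv β x ∧ deriv β x ≤ b₁ := by
  have hp := period_pos lam
  have hne : (Icc (0 : ℝ) (0 + period lam)).Nonempty := ⟨0, by simp [hp.le]⟩
  obtain ⟨x₀, -, h₀⟩ := isCompact_Icc.exists_isMinOn hne hβ.continuous_deriv.continuousOn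
  obtain ⟨x₁, -, h₁⟩ := isCompact_Icc.exists_isMaxOn hne hβ.continuous_deriv.continuousOn
  have hper : Function.Periodic (deriv β) (period lam) := hβ.deriv_add
  refine ⟨deriv β x₀, deriv β x₁, hβ.deriv_pos _, fun x => ?_⟩
  obtain ⟨y, hy, hxy⟩ := hper.exists_mem_Ico₀ hp x
  have hy' : y ∈ Icc (0 : ℝ) (0 + period lam) := by
    rw [zero_add]; exact Ico_subset_Icc_self hy
  rw [hxy]
  exact ⟨h₀ hy', h₁ hy'⟩

/-- Squaring produces (β')². The substitution y = β(x) uses one factor, and the other is bounded by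
its maximum over a period. -/
theorem lintegral_pullback_le (hβ : IsLift (period lam) β) :
    ∃ M : NNReal, ∀ v : Torus lam → ℂ,
      ∫⁻ t, ‖pullback β v t‖ₑ ^ 2 ∂AddCircle.haarAddCircle
        ≤ M * ∫⁻ t, ‖v t‖ₑ ^ 2 ∂AddCircle.haarAddCircle := by
  obtain ⟨b₀, b₁, hb₀, hb⟩ := hβ.exists_deriv_bounds
  refine ⟨b₁.toNNReal, fun v => ?_⟩
  rw [lintegral_torus 0, lintegral_torus (β 0), ← mul_assoc, mul_comm (b₁.toNNReal : ℝ≥0∞),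
    mul_assoc]
  gcongr
  rw [← hβ.add_period, ← hβ.image_Ioc, hβ.lintegral_image measurableSet_Ioc,
    ← lintegral_const_mul' _ _ ENNReal.coe_ne_top]
  refine lintegral_mono fun x => ?_
  simp only
  rw [pullback_coe hβ, enorm_mul, mul_pow, ← mul_assoc, sq ‖((deriv β x : ℝ) : ℂ)‖ₑ]
  have h1 : ‖((deriv β x : ℝ) : ℂ)‖ₑ = ENNReal.ofReal (deriv β x) := by
    rw [← ofReal_norm, Complex.norm_real, Real.norm_of_nonneg (hβ.deriv_pos x).le]
  rw [h1]
  gcongr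
  exact ENNReal.ofReal_le_ofReal (hb x).2

theorem pullback_memLp (hβ : IsLift (period lam) β) {v : Torus lam → ℂ}
    (hv : MemLp v 2 AddCircle.haarAddCircle) :
    MemLp (pullback β v) 2 AddCircle.haarAddCircle := by
  have hmeas : AEStronglyMeasurable (pullback β v)
      (AddCircle.haarAddCircle : Measure (Torus lam)) := by
    have h1 : AEStronglyMeasurable
        (fun x : ℝ => ((deriv β x : ℝ) : ℂ) * v ((β x : ℝ) : Torus lam)) volume := by
      refine (Complex.continuous_ofReal.comp hβ.continuous_deriv).aestronglyMeasurable.mul ?_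
      exact hv.1.comp_quasiMeasurePreserving
        (quasiMeasurePreserving_coe.comp hβ.quasiMeasurePreserving)
    have h2 : AEStronglyMeasurable (pullback β v) (volume : Measure (Torus lam)) := by
      have h3 := (h1.restrict (s := Ioc (0 : ℝ) (0 + period lam)))
      refine (h3.comp_measurePreserving (f := fun t : Torus lam =>
        ((AddCircle.equivIoc (period lam) 0 t : Ioc (0 : ℝ) (0 + period lam)) : ℝ)) ?_)
      exact (measurePreserving_subtype_coe measurableSet_Ioc).comp
        (AddCircle.measurePreserving_equivIoc (period lam))
    refine h2.mono_ac (Measure.AbsolutelyContinuous.mk fun s _ h0 => ?_)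
    rw [measure_eq_zero_iff_ae_notMem] at h0 ⊢
    exact ae_haar_iff.2 h0
  refine ⟨hmeas, ?_⟩
  obtain ⟨M, hM⟩ := lintegral_pullback_le hβ
  have h1 := hv.2
  rw [eLpNorm_lt_top_iff_lintegral_rpow_enorm_lt_top (by simp) (by simp)] at h1 ⊢
  simp only [ENNReal.toReal_ofNat, ENNReal.rpow_ofNat] at h1 ⊢
  exact (hM v).trans_lt (ENNReal.mul_lt_top ENNReal.coe_lt_top h1)

variable (lam) in
/-- The matrix of `β^*` in the basis of Fourier modes. -/
def pullMatrix (β : ℝ → ℝ) (k l : ℤ) : ℂ :=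
  fourierCoeff (pullback β (fourier l) : Torus lam → ℂ) k

theorem fourierCoeff_pullback (hβ : IsLift (period lam) β) (v : Torus lam → ℂ) (k : ℤ) :
    fourierCoeff (pullback β v) k = ((period lam : ℝ) : ℂ)⁻¹ *
      ∫ x in Ioc 0 (0 + period lam), fourier (-k) (x : Torus lam) *
        (((deriv β x : ℝ) : ℂ) * v ((β x : ℝ) : Torus lam)) := by
  rw [fourierCoeff, integral_torus 0]
  simp_rw [pullback_coe hβ, smul_eq_mul]

/-- The composition of a function on the circle with the diffeomorphism with lift `β`. -/
def compLift (β : ℝ → ℝ) (v : Torus lam → ℂ) : Torus lam → ℂ :=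
  AddCircle.liftIoc (period lam) 0 fun x => v ((β x : ℝ) : Torus lam)

theorem compLift_coe (hβ : IsLift (period lam) β) (v : Torus lam → ℂ) (x : ℝ) :
    compLift β v (x : Torus lam) = v ((β x : ℝ) : Torus lam) :=
  liftIoc_coe_of_periodic (f := fun x => v ((β x : ℝ) : Torus lam)) (fun x => by
    simp only
    rw [hβ.add_period, AddCircle.coe_add_period]) 0 x

theorem compLift_fourier_memLp (hβ : IsLift (period lam) β) (k : ℤ) :
    MemLp (compLift β (fourier k) : Torus lam → ℂ) 2 AddCircle.haarAddCircle := by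
  rw [memLp_haarAddCircle_iff]
  refine MemLp.memLp_liftIoc (MemLp.of_bound (C := 1) ?_ (ae_of_all _ fun x => ?_))
  · have : Continuous fun x : ℝ => (fourier k ((β x : ℝ) : Torus lam) : ℂ) :=
      (fourier k).continuous.comp ((AddCircle.continuous_mk' _).comp hβ.continuous)
    exact this.aestronglyMeasurable
  · rw [fourier_apply, Circle.norm_coe]

/-- The substitution moves the diffeomorphism from the form to the exponential: the coefficient
becomes the pairing of v with the bounded function e_k ∘ β⁻¹, to which Parseval applies. -/
theorem fourierCoeff_pullback' (hβ : IsLift (period lam) β) (v : Torus lam → ℂ) (k : ℤ) :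
    fourierCoeff (pullback β v) k =
      ∫ t, (starRingEnd ℂ) (compLift (Function.invFun β) (fourier k) t) * v t
        ∂AddCircle.haarAddCircle := by
  rw [fourierCoeff_pullback hβ, integral_torus (β 0), ← hβ.add_period, ← hβ.image_Ioc,
    hβ.integral_image measurableSet_Ioc]
  congr 1
  refine integral_congr_ae (ae_of_all _ fun x => ?_)
  simp only
  rw [compLift_coe hβ.inv, hβ.inv_apply, fourier_neg]
  ring

/-- Parseval for the pairing with e_k ∘ β⁻¹, whose Fourier coefficients are the conjugates of the
entries of row k. -/
theorem hasSum_pullMatrix (hβ : IsLift (period lam) β) {v : Torus lam → ℂ}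
    (hv : MemLp v 2 AddCircle.haarAddCircle) (k : ℤ) :
    HasSum (fun l => pullMatrix lam β k l * fourierCoeff v l) (fourierCoeff (pullback β v) k) := by
  rw [fourierCoeff_pullback' hβ]
  have e : ∀ l, pullMatrix lam β k l =
      (starRingEnd ℂ) (fourierCoeff (compLift (Function.invFun β) (fourier k) : Torus lam → ℂ) l) := by
    intro l
    rw [pullMatrix, fourierCoeff_pullback' hβ, fourierCoeff, ← integral_conj]
    refine integral_congr_ae (ae_of_all _ fun t => ?_)
    simp only [smul_eq_mul, map_mul, fourier_neg, Complex.conj_conj]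
    ring
  simp_rw [e]
  exact hasSum_conj_mul_fourierCoeff (compLift_fourier_memLp hβ.inv k) hv

theorem continuousMap_memLp (v : C(Torus lam, ℂ)) :
    MemLp v 2 (AddCircle.haarAddCircle : Measure (Torus lam)) :=
  MemLp.of_bound (C := ‖v‖) v.continuous.aestronglyMeasurable (ae_of_all _ v.norm_coe_le_norm)

/-- The Fourier matrix is bounded on `ℓ²`, tested on finite sequences. -/
theorem pullMatrix_bounded (hβ : IsLift (period lam) β) :
    ∃ M : NNReal, ∀ (s : Finset ℤ) (a : ℤ → ℂ),
      ∑' k, ‖∑ l ∈ s, pullMatrix lam β k l * a l‖ₑ ^ 2 ≤ M * ∑ l ∈ s, ‖a l‖ₑ ^ 2 := by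
  obtain ⟨M, hM⟩ := lintegral_pullback_le hβ
  refine ⟨M, fun s a => ?_⟩
  -- The trigonometric polynomial with the given coefficients; Parseval on both sides turns the L²
  -- bound for the pullback into the bound for the matrix.
  let v : C(Torus lam, ℂ) := ∑ l ∈ s, a l • fourier l
  have hv : MemLp v 2 (AddCircle.haarAddCircle : Measure (Torus lam)) :=
    continuousMap_memLp v
  have hc : ∀ l, fourierCoeff v l = if l ∈ s then a l else 0 := by
    intro l
    have h1 : (v : Torus lam → ℂ) = ∑ i ∈ s, (a i • ⇑(fourier i : C(Torus lam, ℂ))) := by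
      funext t; simp [v]
    rw [h1, fourierCoeff.sum s _ fun i _ =>
      ((continuousMap_memLp (fourier i)).const_smul (a i)).integrable (by norm_num)]
    · simp only [Finset.sum_apply, fourierCoeff.const_smul, fourierCoeff_fourier, smul_eq_mul,
        Pi.single_apply, mul_ite, mul_one, mul_zero]
      rw [Finset.sum_ite_eq]
  have h1 := hM v
  rw [← tsum_enorm_sq_fourierCoeff hv, ← tsum_enorm_sq_fourierCoeff (pullback_memLp hβ hv)] at h1
  have h2 : ∀ k, fourierCoeff (pullback β v) k = ∑ l ∈ s, pullMatrix lam β k l * a l := by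
    intro k
    rw [← (hasSum_pullMatrix hβ hv k).tsum_eq, tsum_eq_sum (s := s)]
    · exact Finset.sum_congr rfl fun l hl => by rw [hc, if_pos hl]
    · intro l hl
      rw [hc, if_neg hl, mul_zero]
  simp_rw [h2] at h1
  refine h1.trans_eq ?_
  rw [tsum_eq_sum (s := s)]
  · congr 1
    exact Finset.sum_congr rfl fun l hl => by rw [hc, if_pos hl]
  · intro l hl
    rw [hc, if_neg hl]; simp

/-- A pullback preserves the total integral of a one-form, hence mean zero, so the zero frequency
can be split off. -/
theorem pullMatrix_zero (hβ : IsLift (period lam) β) (l : ℤ) (hl : l ≠ 0) :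
    pullMatrix lam β 0 l = 0 := by
  have h0 : ∀ t, compLift (Function.invFun β) (fourier 0) t = (1 : ℂ) := fun t => by
    refine torus_induction (lam := lam)
      (P := fun t => compLift (Function.invFun β) (fourier 0) t = 1) 0 (fun x _ => ?_) t
    rw [compLift_coe hβ.inv, fourier_zero]
  rw [pullMatrix, fourierCoeff_pullback' hβ]
  have h1 := congrFun (fourierCoeff_fourier (T := period lam) l) 0
  rw [Pi.single_eq_of_ne hl.symm, fourierCoeff] at h1
  simpa [h0] using h1

/-- This is the row expansion of β^* at the square-integrable form (β⁻¹)^* e_l, which β^* sends back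
to e_l. -/
theorem hasSum_pullMatrix_mul_inv (hβ : IsLift (period lam) β) (k l : ℤ) :
    HasSum (fun m => pullMatrix lam β k m * pullMatrix lam (Function.invFun β) m l)
      (if k = l then 1 else 0) := by
  have hv : MemLp (fourier l : C(Torus lam, ℂ)) 2 (AddCircle.haarAddCircle : Measure (Torus lam)) :=
    continuousMap_memLp (fourier l)
  have h := hasSum_pullMatrix hβ (pullback_memLp hβ.inv hv) k
  rw [pullback_inv hβ, fourierCoeff_fourier, Pi.single_apply] at h
  exact h

/-- The relation `l (β^{-1})^*_{kl} = k \overline{β^*_{lk}}`: it expresses that `β^*` preserves the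
symplectic form `∫ v dw` on functions. -/
theorem mul_pullMatrix_inv (hβ : IsLift (period lam) β) (k l : ℤ) :
    (l : ℂ) * pullMatrix lam (Function.invFun β) k l
      = k * (starRingEnd ℂ) (pullMatrix lam β l k) := by
  have hp := period_pos lam
  have hpC : ((period lam : ℝ) : ℂ) ≠ 0 := by exact_mod_cast hp.ne'
  have h1 : pullMatrix lam (Function.invFun β) k l = ((period lam : ℝ) : ℂ)⁻¹ *
      ∫ x in Ioc 0 (0 + period lam), fourier (-k) ((β x : ℝ) : Torus lam) *
        fourier l (x : Torus lam) := by
    rw [pullMatrix, fourierCoeff_pullback' hβ.inv, hβ.invFun_invFun, integral_torus 0]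
    simp_rw [compLift_coe hβ, fourier_neg]
  have h2 : (starRingEnd ℂ) (pullMatrix lam β l k) = ((period lam : ℝ) : ℂ)⁻¹ *
      ∫ x in Ioc 0 (0 + period lam), ((deriv β x : ℝ) : ℂ) *
        fourier (-k) ((β x : ℝ) : Torus lam) * fourier l (x : Torus lam) := by
    rw [pullMatrix, fourierCoeff_pullback hβ, map_mul, map_inv₀, Complex.conj_ofReal,
      ← integral_conj]
    congr 1
    refine integral_congr_ae (ae_of_all _ fun x => ?_)
    simp only [map_mul, fourier_neg, Complex.conj_conj, Complex.conj_ofReal]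
    ring
  -- Up to a constant, the difference of the two sides is the integral over a period of the
  -- derivative of the periodic function e_{-k}(β(x)) e_l(x).
  have hd : ∀ x : ℝ, HasDerivAt (fun x : ℝ => (fourier (-k) ((β x : ℝ) : Torus lam) : ℂ) *
      fourier l (x : Torus lam))
      (2 * Real.pi * Complex.I / (period lam : ℝ) * (l * (fourier (-k) ((β x : ℝ) : Torus lam) *
        fourier l (x : Torus lam)) - k * (((deriv β x : ℝ) : ℂ) *
        fourier (-k) ((β x : ℝ) : Torus lam) * fourier l (x : Torus lam)))) x := by
    intro x
    have e1 := (hasDerivAt_fourier (period lam) (-k) (β x)).scomp x (hβ.hasDerivAt x)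
    have e2 := e1.mul (hasDerivAt_fourier (period lam) l x)
    refine e2.congr_deriv ?_
    simp only [Function.comp, Complex.real_smul]
    push_cast
    ring
  have hc1 : Continuous fun x : ℝ => (fourier (-k) ((β x : ℝ) : Torus lam) : ℂ) :=
    (fourier (-k)).continuous.comp ((AddCircle.continuous_mk' _).comp hβ.continuous)
  have hc2 : Continuous fun x : ℝ => (fourier l (x : Torus lam) : ℂ) :=
    (fourier l).continuous.comp (AddCircle.continuous_mk' _)
  have hc3 : Continuous fun x : ℝ => ((deriv β x : ℝ) : ℂ) :=
    Complex.continuous_ofReal.comp hβ.continuous_deriv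
  have hint := intervalIntegral.integral_eq_sub_of_hasDerivAt (a := 0) (b := 0 + period lam)
    (fun x _ => hd x) (by
      refine Continuous.intervalIntegrable ?_ _ _
      fun_prop)
  have hend : (fourier (-k) ((β (0 + period lam) : ℝ) : Torus lam) : ℂ) *
      fourier l ((0 + period lam : ℝ) : Torus lam) =
      fourier (-k) ((β 0 : ℝ) : Torus lam) * fourier l ((0 : ℝ) : Torus lam) := by
    rw [hβ.add_period, AddCircle.coe_add_period, AddCircle.coe_add_period]
  rw [hend, sub_self, intervalIntegral.integral_const_mul, intervalIntegral.integral_sub,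
    intervalIntegral.integral_const_mul, intervalIntegral.integral_const_mul,
    intervalIntegral.integral_of_le (by linarith), intervalIntegral.integral_of_le (by linarith),
    mul_eq_zero, sub_eq_zero] at hint
  · have hne : (2 * Real.pi * Complex.I / (period lam : ℝ) : ℂ) ≠ 0 := by
      simp [Real.pi_ne_zero, hp.ne', Complex.I_ne_zero]
    have h3 := hint.resolve_left hne
    rw [h1, h2, mul_left_comm, h3, mul_left_comm]
  · exact Continuous.intervalIntegrable (by fun_prop) _ _
  · exact Continuous.intervalIntegrable (by fun_prop) _ _

end Pullback

/-! ### Non-stationary phase for the Fourier matrix of a pullback -/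

section Decay

variable {lam : Ioo (0 : ℝ) 1} {β : ℝ → ℝ}

/-- The normalized derivative `μ β'(x) - κ` of the phase, at `q = ((κ, μ), x)`. -/
def phaseDeriv (β : ℝ → ℝ) (q : (ℝ × ℝ) × ℝ) : ℝ := q.1.2 * deriv β q.2 - q.1.1

/-- One integration by parts. -/
def phaseStep (β : ℝ → ℝ) (A : (ℝ × ℝ) × ℝ → ℂ) (q : (ℝ × ℝ) × ℝ) : ℂ :=
  fderiv ℝ (fun q => A q / ((phaseDeriv β q : ℝ) : ℂ)) q ((0, 0), 1)

theorem phaseDeriv_contDiff (hβ : IsDiffeo β) : ContDiff ℝ ∞ (phaseDeriv β) := by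
  have h := hβ.contDiff_deriv
  have h1 : ContDiff ℝ ∞ fun q : (ℝ × ℝ) × ℝ => deriv β q.2 := h.comp contDiff_snd
  have h2 : ContDiff ℝ ∞ fun q : (ℝ × ℝ) × ℝ => q.1.2 := contDiff_snd.comp contDiff_fst
  have h3 : ContDiff ℝ ∞ fun q : (ℝ × ℝ) × ℝ => q.1.1 := contDiff_fst.comp contDiff_fst
  exact (h2.mul h1).sub h3

theorem isOpen_phase (hβ : IsDiffeo β) : IsOpen {q | phaseDeriv β q ≠ 0} :=
  isOpen_ne.preimage (phaseDeriv_contDiff hβ).continuous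

theorem contDiffOn_div_phase (hβ : IsDiffeo β) {A : (ℝ × ℝ) × ℝ → ℂ}
    (hA : ContDiffOn ℝ ∞ A {q | phaseDeriv β q ≠ 0}) :
    ContDiffOn ℝ ∞ (fun q => A q / ((phaseDeriv β q : ℝ) : ℂ)) {q | phaseDeriv β q ≠ 0} := by
  have h : ContDiff ℝ ∞ fun q => ((phaseDeriv β q : ℝ) : ℂ) :=
    Complex.ofRealCLM.contDiff.comp (phaseDeriv_contDiff hβ)
  have hi : ContDiffOn ℝ ∞ (fun q => ((phaseDeriv β q : ℝ) : ℂ)⁻¹) {q | phaseDeriv β q ≠ 0} :=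
    h.contDiffOn.inv fun q hq => by simpa using hq
  simp_rw [div_eq_mul_inv]
  exact hA.mul hi

theorem phaseStep_contDiffOn (hβ : IsDiffeo β) {A : (ℝ × ℝ) × ℝ → ℂ}
    (hA : ContDiffOn ℝ ∞ A {q | phaseDeriv β q ≠ 0}) :
    ContDiffOn ℝ ∞ (phaseStep β A) {q | phaseDeriv β q ≠ 0} := by
  have h := (contDiffOn_div_phase hβ hA).fderiv_of_isOpen (m := ∞) (isOpen_phase hβ) (by simp)
  exact h.clm_apply contDiffOn_const

theorem phaseStep_periodic (hβ : IsLift (period lam) β) {A : (ℝ × ℝ) × ℝ → ℂ}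
    (hA : ∀ π x, A (π, x + period lam) = A (π, x)) (π : ℝ × ℝ) (x : ℝ) :
    phaseStep β A (π, x + period lam) = phaseStep β A (π, x) := by
  have h1 : ∀ q : (ℝ × ℝ) × ℝ, (fun q => A q / ((phaseDeriv β q : ℝ) : ℂ))
      (q + ((0, 0), period lam)) = A q / ((phaseDeriv β q : ℝ) : ℂ) := by
    rintro ⟨⟨κ, μ⟩, x⟩
    simp only [phaseDeriv, Prod.mk_add_mk, add_zero, hA, hβ.deriv_add]
  have h2 := fderiv_comp_add_right (𝕜 := ℝ) (f := fun q => A q / ((phaseDeriv β q : ℝ) : ℂ))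
    (x := (π, x)) ((0, 0), period lam)
  have h3 : (π, x) + (((0, 0), period lam) : (ℝ × ℝ) × ℝ) = (π, x + period lam) := by
    ext <;> simp
  rw [h3] at h2
  rw [phaseStep, phaseStep, ← h2]
  simp_rw [h1]

/-- The frequencies of size one for which the phase is uniformly non-stationary. -/
def nonstationary (β : ℝ → ℝ) (ε : ℝ) : Set (ℝ × ℝ) :=
  {π | |π.1| + |π.2| = 1 ∧ ∀ x, ε ≤ |π.2 * deriv β x - π.1|}

theorem isCompact_nonstationary (β : ℝ → ℝ) (ε : ℝ) : IsCompact (nonstationary β ε) := by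
  refine (isCompact_closedBall (0 : ℝ × ℝ) 1).of_isClosed_subset ?_ ?_
  · have h1 : IsClosed {π : ℝ × ℝ | |π.1| + |π.2| = 1} :=
      isClosed_eq (by fun_prop) continuous_const
    have h2 : IsClosed {π : ℝ × ℝ | ∀ x, ε ≤ |π.2 * deriv β x - π.1|} := by
      rw [ofPred_forall]
      exact isClosed_iInter fun x => isClosed_le continuous_const (by fun_prop)
    exact h1.inter h2
  · rintro ⟨κ, μ⟩ ⟨h, -⟩
    simp only at h
    rw [mem_closedBall_zero_iff, Prod.norm_def, Real.norm_eq_abs, Real.norm_eq_abs]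
    exact max_le (by linarith [abs_nonneg μ]) (by linarith [abs_nonneg κ])

variable (lam) in
/-- The oscillating factor `e^{i c (l β(x) - k x)}`. -/
def osc (β : ℝ → ℝ) (k l : ℤ) (x : ℝ) : ℂ :=
  fourier (-k) (x : Torus lam) * fourier l ((β x : ℝ) : Torus lam)

theorem osc_norm (k l : ℤ) (x : ℝ) : ‖osc lam β k l x‖ = 1 := by
  rw [osc, norm_mul, fourier_apply, fourier_apply, Circle.norm_coe, Circle.norm_coe, one_mul]

theorem osc_hasDerivAt (hβ : IsDiffeo β) (k l : ℤ) (x : ℝ) :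
    HasDerivAt (osc lam β k l) (2 * Real.pi * Complex.I / (period lam : ℝ) *
      ((l * deriv β x - k : ℝ) : ℂ) * osc lam β k l x) x := by
  have e1 := (hasDerivAt_fourier (period lam) l (β x)).scomp x (hβ.hasDerivAt x)
  have e2 := (hasDerivAt_fourier (period lam) (-k) x).mul e1
  refine e2.congr_deriv ?_
  simp only [Function.comp, Complex.real_smul, osc]
  push_cast
  ring

theorem osc_continuous (hβ : IsDiffeo β) (k l : ℤ) : Continuous (osc lam β k l) :=
  continuous_iff_continuousAt.2 fun x => (osc_hasDerivAt hβ k l x).continuousAt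

theorem osc_periodic (hβ : IsLift (period lam) β) (k l : ℤ) (x : ℝ) :
    osc lam β k l (x + period lam) = osc lam β k l x := by
  rw [osc, osc, hβ.add_period, AddCircle.coe_add_period, AddCircle.coe_add_period]

/-- Where the phase is not stationary, the oscillating factor is its own derivative divided by a
constant multiple of r times the normalized phase derivative. Integration by parts therefore gains
1/r, and periodicity removes the boundary terms. -/
theorem integral_osc_step (hβ : IsLift (period lam) β) {A : (ℝ × ℝ) × ℝ → ℂ}
    (hA : ContDiffOn ℝ ∞ A {q | phaseDeriv β q ≠ 0})
    (hper : ∀ π x, A (π, x + period lam) = A (π, x)) (k l : ℤ) {r : ℝ} (hr : r ≠ 0)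
    (hne : ∀ x, phaseDeriv β ((k / r, l / r), x) ≠ 0) :
    ∫ x in (0 : ℝ)..period lam, A ((k / r, l / r), x) * osc lam β k l x =
      -(2 * Real.pi * Complex.I / (period lam : ℝ) * r)⁻¹ *
        ∫ x in (0 : ℝ)..period lam, phaseStep β A ((k / r, l / r), x) * osc lam β k l x := by
  have hp := period_pos lam
  set π : ℝ × ℝ := (k / r, l / r) with hπ
  set F : ℝ → ℂ := fun x => A (π, x) / ((phaseDeriv β (π, x) : ℝ) : ℂ) with hF
  have hFd : ∀ x, HasDerivAt F (phaseStep β A (π, x)) x := by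
    intro x
    have h1 : DifferentiableAt ℝ (fun q => A q / ((phaseDeriv β q : ℝ) : ℂ)) (π, x) :=
      ((contDiffOn_div_phase hβ.toIsDiffeo hA).contDiffAt
        ((isOpen_phase hβ.toIsDiffeo).mem_nhds (hne x))).differentiableAt (by simp)
    have h2 : HasDerivAt (fun x : ℝ => (π, x)) ((0, 0), 1) x :=
      (hasDerivAt_const x π).prodMk (hasDerivAt_id x)
    exact h1.hasFDerivAt.comp_hasDerivAt x h2
  have hFcont : Continuous F := continuous_iff_continuousAt.2 fun x => (hFd x).continuousAt
  have hScont : Continuous fun x => phaseStep β A (π, x) := by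
    have := (phaseStep_contDiffOn hβ.toIsDiffeo hA).continuousOn
    exact this.comp_continuous (by fun_prop) hne
  have hparts := intervalIntegral.integral_mul_deriv_eq_deriv_mul (a := 0) (b := period lam)
    (fun x _ => hFd x) (fun x _ => osc_hasDerivAt (lam := lam) hβ.toIsDiffeo k l x)
    (hScont.intervalIntegrable _ _) (by
      refine Continuous.intervalIntegrable ?_ _ _
      have h1 := osc_continuous (lam := lam) hβ.toIsDiffeo k l
      have h2 := hβ.continuous_deriv
      fun_prop)
  have hend : F (period lam) * osc lam β k l (period lam) = F 0 * osc lam β k l 0 := by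
    have h1 := osc_periodic hβ k l 0
    have h2 : F (0 + period lam) = F 0 := by
      simp only [hF, hper, phaseDeriv, hβ.deriv_add]
    rw [zero_add] at h1 h2
    rw [h1, h2]
  rw [hend, sub_self, zero_sub] at hparts
  have hω : (2 * Real.pi * Complex.I / (period lam : ℝ) * r : ℂ) ≠ 0 := by
    simp [Real.pi_ne_zero, hp.ne', Complex.I_ne_zero, hr]
  have hl : ∀ x, F x * (2 * Real.pi * Complex.I / (period lam : ℝ) *
      ((l * deriv β x - k : ℝ) : ℂ) * osc lam β k l x) =
      (2 * Real.pi * Complex.I / (period lam : ℝ) * r) * (A (π, x) * osc lam β k l x) := by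
    intro x
    have h1 : ((l * deriv β x - k : ℝ) : ℂ) = r * ((phaseDeriv β (π, x) : ℝ) : ℂ) := by
      rw [← Complex.ofReal_mul, phaseDeriv, hπ]
      congr 1
      field_simp
    have h2 : ((phaseDeriv β (π, x) : ℝ) : ℂ) ≠ 0 := by exact_mod_cast hne x
    rw [h1, hF]
    field_simp
  simp_rw [hl] at hparts
  rw [intervalIntegral.integral_const_mul] at hparts
  rw [neg_mul, ← mul_neg, ← hparts, inv_mul_cancel_left₀ hω]

/-- Uniformity in k and l comes from treating the frequency direction as a variable of the
amplitude: each integration by parts keeps joint smoothness, and in the end the amplitude is bounded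
on the compact set of non-stationary directions times one period. -/
theorem integral_osc_decay (hβ : IsLift (period lam) β) {ε : ℝ} (hε : 0 < ε) (m : ℕ) :
    ∀ A : (ℝ × ℝ) × ℝ → ℂ, ContDiffOn ℝ ∞ A {q | phaseDeriv β q ≠ 0} →
    (∀ π x, A (π, x + period lam) = A (π, x)) →
    ∃ C : ℝ, ∀ (k l : ℤ) (r : ℝ), 0 < r → ((k / r, l / r) : ℝ × ℝ) ∈ nonstationary β ε →
      ‖∫ x in (0 : ℝ)..period lam, A ((k / r, l / r), x) * osc lam β k l x‖ * r ^ m ≤ C := by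
  have hp := period_pos lam
  have hne : ∀ π ∈ nonstationary β ε, ∀ x, phaseDeriv β (π, x) ≠ 0 := by
    intro π hπ x h0
    have := hπ.2 x
    rw [phaseDeriv] at h0
    simp only at h0
    rw [h0, abs_zero] at this
    linarith
  induction m with
  | zero =>
    intro A hA hper
    have hK : IsCompact (nonstationary β ε ×ˢ Icc 0 (period lam)) :=
      (isCompact_nonstationary β ε).prod isCompact_Icc
    obtain ⟨C, hC⟩ := hK.exists_bound_of_continuousOn
      (hA.continuousOn.mono fun q hq => hne q.1 hq.1 q.2)
    refine ⟨C * |period lam - 0|, fun k l r _ hm => ?_⟩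
    rw [pow_zero, mul_one]
    refine intervalIntegral.norm_integral_le_of_norm_le_const fun x hx => ?_
    rw [uIoc_of_le hp.le] at hx
    rw [norm_mul, osc_norm, mul_one]
    exact hC _ ⟨hm, Ioc_subset_Icc_self hx⟩
  | succ m ih =>
    intro A hA hper
    obtain ⟨C, hC⟩ := ih _ (phaseStep_contDiffOn hβ.toIsDiffeo hA) (phaseStep_periodic hβ hper)
    refine ⟨(2 * Real.pi / period lam)⁻¹ * C, fun k l r hr hm => ?_⟩
    rw [integral_osc_step hβ hA hper k l hr.ne' (hne _ hm), norm_mul, norm_neg, norm_inv]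
    have h1 : ‖(2 * Real.pi * Complex.I / (period lam : ℝ) * r : ℂ)‖ = 2 * Real.pi / period lam * r := by
      simp only [norm_mul, norm_div, Complex.norm_I, Complex.norm_real, Real.norm_eq_abs,
        abs_of_pos hr, abs_of_pos hp, abs_of_pos Real.pi_pos, mul_one, RCLike.norm_ofNat]
    rw [h1, mul_inv]
    have h2 := hC k l r hr hm
    have h3 : (0 : ℝ) < (2 * Real.pi / period lam)⁻¹ := by positivity
    calc _ = (2 * Real.pi / period lam)⁻¹ * (‖∫ x in (0 : ℝ)..period lam,
          phaseStep β A ((k / r, l / r), x) * osc lam β k l x‖ * r ^ m) := by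
            rw [pow_succ]; field_simp
      _ ≤ _ := by gcongr

/-- The non-stationarity condition is homogeneous in (k, l), so division by |k| + |l| brings the
frequency into the compact set `nonstationary`. -/
theorem pullMatrix_decay (hβ : IsLift (period lam) β) {ε : ℝ} (hε : 0 < ε) (m : ℕ) :
    ∃ C : ℝ, ∀ k l : ℤ, (∀ x, ε * (|(k : ℝ)| + |(l : ℝ)|) ≤ |l * deriv β x - k|) →
      (k, l) ≠ 0 → ‖pullMatrix lam β k l‖ * (|(k : ℝ)| + |(l : ℝ)|) ^ m ≤ C := by
  have hp := period_pos lam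
  have hA : ContDiffOn ℝ ∞ (fun q : (ℝ × ℝ) × ℝ => ((deriv β q.2 : ℝ) : ℂ))
      {q | phaseDeriv β q ≠ 0} :=
    (Complex.ofRealCLM.contDiff.comp (hβ.contDiff_deriv.comp contDiff_snd)).contDiffOn
  obtain ⟨C, hC⟩ := integral_osc_decay hβ hε m _ hA fun π x => by simp only [hβ.deriv_add]
  refine ⟨(period lam)⁻¹ * C, fun k l h h0 => ?_⟩
  set r : ℝ := |(k : ℝ)| + |(l : ℝ)| with hr
  have hr0 : 0 < r := by
    rcases eq_or_ne k 0 with hk | hk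
    · have hl : l ≠ 0 := fun hl => h0 (by rw [hk, hl]; rfl)
      have : 0 < |(l : ℝ)| := abs_pos.2 (by exact_mod_cast hl)
      linarith [abs_nonneg (k : ℝ)]
    · have : 0 < |(k : ℝ)| := abs_pos.2 (by exact_mod_cast hk)
      linarith [abs_nonneg (l : ℝ)]
  have hmem : ((k / r, l / r) : ℝ × ℝ) ∈ nonstationary β ε := by
    refine ⟨?_, fun x => ?_⟩
    · simp only [abs_div, abs_of_pos hr0]
      rw [← add_div, ← hr, div_self hr0.ne']
    · have h1 : (l / r * deriv β x - k / r : ℝ) = (l * deriv β x - k) / r := by ring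
      simp only
      rw [h1, abs_div, abs_of_pos hr0, le_div_iff₀ hr0]
      exact h x
  have h1 := hC k l r hr0 hmem
  have h2 : pullMatrix lam β k l = ((period lam : ℝ) : ℂ)⁻¹ *
      ∫ x in (0 : ℝ)..period lam, ((deriv β x : ℝ) : ℂ) * osc lam β k l x := by
    rw [pullMatrix, fourierCoeff_pullback hβ, intervalIntegral.integral_of_le hp.le, zero_add]
    congr 1
    refine integral_congr_ae (ae_of_all _ fun x => ?_)
    simp only [osc]; ring
  rw [h2, norm_mul, norm_inv, Complex.norm_real, Real.norm_of_nonneg hp.le, mul_assoc]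
  gcongr

/-- The Fourier matrix of a pullback decays rapidly away from a band around the diagonal. -/
theorem exists_pullMatrix_band (hβ : IsLift (period lam) β) :
    ∃ K : ℕ, 2 ≤ K ∧ ∀ m : ℕ, ∃ C : ℝ, ∀ k l : ℤ, (k, l) ≠ 0 →
      ((K * |(l : ℝ)| ≤ |(k : ℝ)|) ∨ (K * |(k : ℝ)| ≤ |(l : ℝ)|) ∨ (k : ℝ) * l ≤ 0) →
      ‖pullMatrix lam β k l‖ * (|(k : ℝ)| + |(l : ℝ)|) ^ m ≤ C := by
  obtain ⟨b₀, b₁, hb₀, hb⟩ := hβ.exists_deriv_bounds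
  -- K is so large that off the band one of the two terms of lβ'(x) - k is at most half the other:
  -- 2b₁ serves |k| ≥ K|l|, and 2/b₀ serves |l| ≥ K|k|.
  obtain ⟨K, hK⟩ := exists_nat_ge (max 2 (max (2 * b₁) (2 / b₀)))
  have hK2 : (2 : ℝ) ≤ K := (le_max_left _ _).trans hK
  have hKb₁ : 2 * b₁ ≤ K := ((le_max_left _ _).trans (le_max_right _ _)).trans hK
  have hKb₀ : 2 / b₀ ≤ K := ((le_max_right _ _).trans (le_max_right _ _)).trans hK
  rw [div_le_iff₀ hb₀] at hKb₀
  refine ⟨K, by exact_mod_cast hK2, fun m => ?_⟩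
  have hε : 0 < min (1 / 4) (b₀ / 4) := lt_min (by norm_num) (by positivity)
  obtain ⟨C, hC⟩ := pullMatrix_decay hβ hε m
  refine ⟨C, fun k l h0 h => hC k l (fun x => ?_) h0⟩
  obtain ⟨hx0, hx1⟩ := hb x
  have hε1 := min_le_left (1 / 4 : ℝ) (b₀ / 4)
  have hε2 := min_le_right (1 / 4 : ℝ) (b₀ / 4)
  set ε := min (1 / 4 : ℝ) (b₀ / 4)
  have hk := abs_nonneg (k : ℝ)
  have hl := abs_nonneg (l : ℝ)
  have hbl : |(l : ℝ) * deriv β x| = |(l : ℝ)| * deriv β x := by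
    rw [abs_mul, abs_of_pos (hβ.deriv_pos x)]
  rcases h with h | h | h
  · have h1 : |(k : ℝ)| - |(l : ℝ)| * deriv β x ≤ |l * deriv β x - k| := by
      rw [← hbl, abs_sub_comm]
      exact abs_sub_abs_le_abs_sub _ _
    have h2 : |(l : ℝ)| * deriv β x ≤ |(l : ℝ)| * b₁ := by gcongr
    have h3 : |(l : ℝ)| * (2 * b₁) ≤ |(l : ℝ)| * K := by gcongr
    have h4 : |(l : ℝ)| * 2 ≤ |(l : ℝ)| * K := by gcongr
    have h5 : ε * (|(k : ℝ)| + |(l : ℝ)|) ≤ 1 / 4 * (|(k : ℝ)| + |(l : ℝ)|) := by gcongr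
    linarith
  · have h1 : |(l : ℝ)| * deriv β x - |(k : ℝ)| ≤ |l * deriv β x - k| := by
      rw [← hbl]
      exact abs_sub_abs_le_abs_sub _ _
    have h2 : |(l : ℝ)| * b₀ ≤ |(l : ℝ)| * deriv β x := by gcongr
    have h3 : |(k : ℝ)| * 2 ≤ |(k : ℝ)| * (K * b₀) := by gcongr
    have h4 : |(k : ℝ)| * 2 ≤ |(k : ℝ)| * K := by gcongr
    have h5 : ε * (|(k : ℝ)| + |(l : ℝ)|) ≤ b₀ / 4 * (|(k : ℝ)| + |(l : ℝ)|) := by gcongr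
    have h6 : b₀ * (K * |(k : ℝ)|) ≤ b₀ * |(l : ℝ)| := by gcongr
    have h7 : b₀ * (|(k : ℝ)| * 2) ≤ b₀ * (|(k : ℝ)| * K) := by gcongr
    linarith
  -- For k and l of opposite signs the terms lβ'(x) and -k have the same sign, as β' > 0, so nothing
  -- cancels.
  · have h1 : |(k : ℝ)| + |(l : ℝ)| * deriv β x ≤ |l * deriv β x - k| := by
      rw [← hbl, ← abs_neg (k : ℝ), add_comm, sub_eq_add_neg]
      refine (abs_add_eq_add_abs_iff _ _).2 ?_ |>.ge
      have hd := hβ.deriv_pos x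
      rcases le_total 0 (k : ℝ) with hk0 | hk0
      · rcases le_total 0 (l : ℝ) with hl0 | hl0
        · rcases hk0.eq_or_lt with hk1 | hk1
          · left; exact ⟨by positivity, by rw [← hk1]; simp⟩
          · have : (l : ℝ) = 0 := by
              nlinarith [mul_nonneg hk0 hl0]
            right; rw [this]; simpa using hk0
        · right; exact ⟨mul_nonpos_of_nonpos_of_nonneg hl0 hd.le, by linarith⟩
      · rcases le_total 0 (l : ℝ) with hl0 | hl0
        · left; exact ⟨by positivity, by linarith⟩
        · rcases hk0.eq_or_lt with hk1 | hk1
          · right; exact ⟨mul_nonpos_of_nonpos_of_nonneg hl0 hd.le, by rw [hk1]; simp⟩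
          · have : (l : ℝ) = 0 := by
              nlinarith [mul_nonneg_of_nonpos_of_nonpos hk0 hl0]
            left; rw [this]; simpa using hk0
    have h2 : |(l : ℝ)| * b₀ ≤ |(l : ℝ)| * deriv β x := by gcongr
    have h5 : ε * |(k : ℝ)| ≤ 1 / 4 * |(k : ℝ)| := by gcongr
    have h6 : ε * |(l : ℝ)| ≤ b₀ / 4 * |(l : ℝ)| := by gcongr
    have h7 : 0 ≤ b₀ * |(l : ℝ)| := by positivity
    linarith

end Decay

/-! ### Band matrices on weighted sequence spaces -/

/-- The nonzero frequencies. -/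
abbrev NZ : Type := {k : ℤ // k ≠ 0}

/-- The size `|k|` of a nonzero frequency. -/
def freq (k : NZ) : ℝ := |((k : ℤ) : ℝ)|

theorem one_le_freq (k : NZ) : 1 ≤ freq k := by
  rw [freq, ← Int.cast_abs]
  exact_mod_cast Int.one_le_abs k.2

theorem freq_pos (k : NZ) : 0 < freq k := one_pos.trans_le (one_le_freq k)

theorem freq_eq (k : NZ) : freq k = ((k : ℤ).natAbs : ℝ) := by
  rw [freq, Nat.cast_natAbs, Int.cast_abs]

theorem summable_freq : Summable fun k : NZ => (freq k ^ 2)⁻¹ := by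
  have h := (Real.summable_one_div_int_pow (p := 2)).2 (by norm_num)
  have h1 := h.comp_injective (i := fun k : NZ => (k : ℤ)) Subtype.val_injective
  refine h1.congr fun k => ?_
  simp [freq]

/-- The weighted squared norm `∑ |k|^{2s} |a_k|²`. -/
def wsq (s : ℝ) (a : NZ → ℂ) : ℝ≥0∞ := ∑' k, ENNReal.ofReal (freq k ^ (2 * s)) * ‖a k‖ₑ ^ 2

/-- The action of an infinite matrix. -/
def mulVec (T : NZ → NZ → ℂ) (a : NZ → ℂ) (k : NZ) : ℂ := ∑' l, T k l * a l

/-- Sequences of polynomial growth. -/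
def Tempered (a : NZ → ℂ) : Prop := ∃ (m : ℕ) (C : ℝ), ∀ k, ‖a k‖ ≤ C * freq k ^ m

/-- Matrices which are bounded on `ℓ²` and decay rapidly away from a band around the diagonal. -/
structure IsBand (T : NZ → NZ → ℂ) : Prop where
  bounded : ∃ M : NNReal, ∀ (s : Finset NZ) (a : NZ → ℂ),
    ∑' k, ‖∑ l ∈ s, T k l * a l‖ₑ ^ 2 ≤ M * ∑ l ∈ s, ‖a l‖ₑ ^ 2
  band : ∃ K : ℕ, 2 ≤ K ∧ ∀ m : ℕ, ∃ C : ℝ, ∀ k l, (K * freq l ≤ freq k ∨ K * freq k ≤ freq l) →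
    ‖T k l‖ * (freq k + freq l) ^ m ≤ C

/-- Matrices with rapidly decaying entries. -/
def IsRapid (T : NZ → NZ → ℂ) : Prop :=
  ∀ m : ℕ, ∃ C : ℝ, ∀ k l, ‖T k l‖ * (freq k + freq l) ^ m ≤ C

theorem finite_freq_le (r : ℝ) : {k : NZ | freq k ≤ r}.Finite := by
  have h : {k : ℤ | |(k : ℝ)| ≤ r}.Finite := by
    refine (Set.finite_Icc (-⌈r⌉) ⌈r⌉).subset fun k hk => ?_
    have h1 : |(k : ℝ)| ≤ ⌈r⌉ := le_trans hk (Int.le_ceil r)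
    rw [abs_le] at h1
    exact ⟨by exact_mod_cast h1.1, by exact_mod_cast h1.2⟩
  exact h.preimage Subtype.val_injective.injOn

/-- A row has finitely many entries with |l| ≤ K|k|, and the others decay by hypothesis. So each row
decreases rapidly, not uniformly in k, and can be applied to sequences of polynomial growth. -/
theorem IsBand.row {T : NZ → NZ → ℂ} (hT : IsBand T) (k : NZ) (m : ℕ) :
    ∃ C : ℝ, 0 ≤ C ∧ ∀ l, ‖T k l‖ * freq l ^ m ≤ C := by
  obtain ⟨K, hK, h⟩ := hT.band
  obtain ⟨C, hC⟩ := h m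
  have hfin := finite_freq_le (K * freq k)
  obtain ⟨D, hD⟩ := (hfin.image fun l => ‖T k l‖ * freq l ^ m).bddAbove
  refine ⟨max 0 (max C D), le_max_left _ _, fun l => ?_⟩
  have hl := freq_pos l
  have hk := freq_pos k
  rcases le_total (freq l) (K * freq k) with hle | hle
  · exact (hD ⟨l, hle, rfl⟩).trans ((le_max_right _ _).trans (le_max_right _ _))
  · refine le_trans ?_ ((hC k l (Or.inr hle)).trans ((le_max_left _ _).trans (le_max_right _ _)))
    gcongr
    linarith

theorem summable_of_row {t a : NZ → ℂ} (ht : ∀ m : ℕ, ∃ C : ℝ, ∀ l, ‖t l‖ * freq l ^ m ≤ C)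
    (ha : Tempered a) : Summable fun l => t l * a l := by
  obtain ⟨m, C, hC⟩ := ha
  obtain ⟨D, hD⟩ := ht (m + 2)
  refine Summable.of_norm_bounded (summable_freq.mul_left (D * C)) fun l => ?_
  have hl := freq_pos l
  have hC0 : 0 ≤ C := by
    by_contra! h
    have := (norm_nonneg _).trans (hC l)
    nlinarith [pow_pos hl m]
  rw [norm_mul]
  calc ‖t l‖ * ‖a l‖ ≤ ‖t l‖ * (C * freq l ^ m) := by gcongr; exact hC l
    _ = (‖t l‖ * freq l ^ (m + 2)) * C * (freq l ^ 2)⁻¹ := by rw [pow_add]; field_simp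
    _ ≤ D * C * (freq l ^ 2)⁻¹ := by gcongr; exact hD l

theorem IsBand.summable {T : NZ → NZ → ℂ} (hT : IsBand T) {a : NZ → ℂ} (ha : Tempered a) (k : NZ) :
    Summable fun l => T k l * a l :=
  summable_of_row (fun m => (hT.row k m).imp fun _ h => h.2) ha

theorem norm_le_of_wsq {s : ℝ} {a : NZ → ℂ} (ha : wsq s a < ⊤) (k : NZ) :
    ‖a k‖ ≤ √(wsq s a).toReal * freq k ^ (-s) := by
  have hk := freq_pos k
  have h1 : ENNReal.ofReal (freq k ^ (2 * s)) * ‖a k‖ₑ ^ 2 ≤ wsq s a :=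
    ENNReal.le_tsum (f := fun k => ENNReal.ofReal (freq k ^ (2 * s)) * ‖a k‖ₑ ^ 2) k
  have h2 := ENNReal.toReal_mono ha.ne h1
  rw [ENNReal.toReal_mul, ENNReal.toReal_ofReal (by positivity), ENNReal.toReal_pow,
    toReal_enorm] at h2
  have h3 : freq k ^ (2 * s) * ‖a k‖ ^ 2 = (freq k ^ s * ‖a k‖) ^ 2 := by
    rw [mul_pow, ← Real.rpow_natCast (freq k ^ s), ← Real.rpow_mul hk.le]
    congr 2; push_cast; ring
  rw [h3] at h2
  have h4 := Real.le_sqrt_of_sq_le h2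
  rw [Real.rpow_neg hk.le, ← div_eq_mul_inv, le_div_iff₀ (by positivity), mul_comm]
  exact h4

theorem tempered_of_wsq {s : ℝ} {a : NZ → ℂ} (ha : wsq s a < ⊤) : Tempered a := by
  obtain ⟨m, hm⟩ := exists_nat_ge (-s)
  refine ⟨m, √(wsq s a).toReal, fun k => (norm_le_of_wsq ha k).trans ?_⟩
  gcongr
  rw [← Real.rpow_natCast]
  exact Real.rpow_le_rpow_of_exponent_le (one_le_freq k) hm

/-- Comparability in both directions is assumed because a negative exponent reverses the inequality.
-/
theorem rpow_le_mul_rpow {x y Q t : ℝ} (hx : 0 < x) (hy : 0 < y) (hQ : 1 ≤ Q) (h1 : x ≤ Q * y)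
    (h2 : y ≤ Q * x) : x ^ t ≤ Q ^ |t| * y ^ t := by
  have hQ0 : 0 < Q := one_pos.trans_le hQ
  rcases le_total 0 t with ht | ht
  · rw [abs_of_nonneg ht, ← Real.mul_rpow hQ0.le hy.le]
    exact Real.rpow_le_rpow hx.le h1 ht
  · rw [abs_of_nonpos ht, Real.rpow_neg hQ0.le, ← Real.inv_rpow hQ0.le,
      ← Real.mul_rpow (inv_nonneg.2 hQ0.le) hy.le]
    refine Real.rpow_le_rpow_of_nonpos (by positivity) ?_ ht
    rw [inv_mul_le_iff₀ hQ0]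
    exact h2

/-- The dyadic block (in base `K`) of a frequency. -/
def block (K : ℕ) (k : NZ) : ℕ := Nat.log K (k : ℤ).natAbs

theorem pow_block_le (K : ℕ) (k : NZ) : (K : ℝ) ^ block K k ≤ freq k := by
  rw [freq_eq]
  exact_mod_cast Nat.pow_log_le_self K (Int.natAbs_ne_zero.2 k.2)

theorem lt_pow_block {K : ℕ} (hK : 2 ≤ K) (k : NZ) : freq k < (K : ℝ) ^ (block K k + 1) := by
  rw [freq_eq]
  exact_mod_cast Nat.lt_pow_succ_log_self (by omega) _

/-- The frequencies in the blocks adjacent to the block `j`. -/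
def nearBlock (K j : ℕ) : Set NZ := {l | block K l ≤ j + 1 ∧ j ≤ block K l + 1}

theorem finite_nearBlock {K : ℕ} (hK : 2 ≤ K) (j : ℕ) : (nearBlock K j).Finite := by
  refine (finite_freq_le ((K : ℝ) ^ (j + 2))).subset fun l hl => (lt_pow_block hK l).le.trans ?_
  have h1 : (1 : ℝ) ≤ K := by exact_mod_cast (by omega : 1 ≤ K)
  exact pow_le_pow_right₀ h1 (by have := hl.1; omega)

/-- Non-adjacent blocks are separated by a full block, hence by a factor K. -/
theorem off_band {K : ℕ} (hK : 2 ≤ K) {k l : NZ} (h : l ∉ nearBlock K (block K k)) :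
    K * freq l ≤ freq k ∨ K * freq k ≤ freq l := by
  have h1 : (1 : ℝ) ≤ K := by exact_mod_cast (by omega : 1 ≤ K)
  have hK0 : (0 : ℝ) ≤ K := by linarith
  have key : ∀ k l : NZ, block K k + 2 ≤ block K l → K * freq k ≤ freq l := by
    intro k l hkl
    calc (K : ℝ) * freq k ≤ K * (K : ℝ) ^ (block K k + 1) := by
          gcongr; exact (lt_pow_block hK k).le
      _ = (K : ℝ) ^ (block K k + 2) := by ring
      _ ≤ (K : ℝ) ^ block K l := pow_le_pow_right₀ h1 hkl
      _ ≤ freq l := pow_block_le K l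
  by_cases h2 : block K k + 2 ≤ block K l
  · exact Or.inr (key _ _ h2)
  · refine Or.inl (key _ _ ?_)
    by_contra h3
    exact h ⟨by omega, by omega⟩

theorem near_weight {K : ℕ} (hK : 2 ≤ K) {j : ℕ} {l : NZ} (h : l ∈ nearBlock K j) :
    (K : ℝ) ^ j ≤ (K : ℝ) ^ 2 * freq l ∧ freq l ≤ (K : ℝ) ^ 2 * (K : ℝ) ^ j := by
  have h1 : (1 : ℝ) ≤ K := by exact_mod_cast (by omega : 1 ≤ K)
  constructor
  · calc (K : ℝ) ^ j ≤ (K : ℝ) ^ (2 + block K l) := pow_le_pow_right₀ h1 (by have := h.2; omega)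
      _ = (K : ℝ) ^ 2 * (K : ℝ) ^ block K l := pow_add _ _ _
      _ ≤ _ := by gcongr; exact pow_block_le K l
  · rw [← pow_add]
    exact (lt_pow_block hK l).le.trans (pow_le_pow_right₀ h1 (by have := h.1; omega))

/-- On adjacent blocks the weight is constant up to a fixed factor. So the ℓ² bound may be applied
to the part of the sequence near each block j, multiplied by the weight of that block, and summed
over j; every frequency is near at most three blocks. -/
theorem near_sum_le {T : NZ → NZ → ℂ} {K : ℕ} (hK : 2 ≤ K) {M : NNReal}
    (hM : ∀ (s : Finset NZ) (a : NZ → ℂ),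
      ∑' k, ‖∑ l ∈ s, T k l * a l‖ₑ ^ 2 ≤ M * ∑ l ∈ s, ‖a l‖ₑ ^ 2) (s : ℝ) :
    ∃ D : NNReal, ∀ a : NZ → ℂ, wsq s (fun k =>
      ∑ l ∈ (finite_nearBlock hK (block K k)).toFinset, T k l * a l) ≤ D * wsq s a := by
  classical
  have h1 : (1 : ℝ) ≤ K := by exact_mod_cast (by omega : 1 ≤ K)
  have hQ : (1 : ℝ) ≤ (K : ℝ) ^ 2 := one_le_pow₀ h1
  set Q : ℝ := ((K : ℝ) ^ 2) ^ |2 * s| with hQdef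
  have hQ0 : 0 ≤ Q := by positivity
  set W : ℕ → ℝ≥0∞ := fun j => ENNReal.ofReal (Q * ((K : ℝ) ^ j) ^ (2 * s)) with hW
  have hnearL : ∀ j l, l ∈ nearBlock K j →
      W j ≤ ENNReal.ofReal (Q * Q) * ENNReal.ofReal (freq l ^ (2 * s)) := by
    intro j l hl
    have hkj : (0 : ℝ) < (K : ℝ) ^ j := by positivity
    rw [← ENNReal.ofReal_mul (by positivity)]
    refine ENNReal.ofReal_le_ofReal ?_
    rw [mul_assoc]
    gcongr
    exact rpow_le_mul_rpow hkj (freq_pos l) hQ (near_weight hK hl).1 (near_weight hK hl).2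
  have hself : ∀ k, ENNReal.ofReal (freq k ^ (2 * s)) ≤ W (block K k) := by
    intro k
    have hk : k ∈ nearBlock K (block K k) := ⟨by omega, by omega⟩
    have hkj : (0 : ℝ) < (K : ℝ) ^ block K k := by positivity
    exact ENNReal.ofReal_le_ofReal
      (rpow_le_mul_rpow (freq_pos k) hkj hQ (near_weight hK hk).2 (near_weight hK hk).1)
  refine ⟨M * (3 * (Q * Q).toNNReal), fun a => ?_⟩
  set N : ℕ → NZ → ℝ≥0∞ := fun j k =>
    ‖∑ l ∈ (finite_nearBlock hK j).toFinset, T k l * a l‖ₑ ^ 2 with hN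
  calc wsq s (fun k => ∑ l ∈ (finite_nearBlock hK (block K k)).toFinset, T k l * a l)
      ≤ ∑' k, W (block K k) * N (block K k) k := by
        refine ENNReal.tsum_le_tsum fun k => ?_
        gcongr
        exact hself k
    -- The term with j the block of k is enlarged to the sum over all j, so that for each fixed j
    -- the ℓ² bound, which concerns all rows at once, can be used.
    _ ≤ ∑' k, ∑' j, W j * N j k := ENNReal.tsum_le_tsum fun k => ENNReal.le_tsum (block K k)
    _ = ∑' j, ∑' k, W j * N j k := ENNReal.tsum_comm
    _ = ∑' j, W j * ∑' k, N j k := by simp_rw [ENNReal.tsum_mul_left]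
    _ ≤ ∑' j, W j * (M * ∑ l ∈ (finite_nearBlock hK j).toFinset, ‖a l‖ₑ ^ 2) := by
        gcongr with j
        exact hM _ _
    _ = ∑' j, ∑' l, M * ((if l ∈ nearBlock K j then W j else 0) * ‖a l‖ₑ ^ 2) := by
        congr 1
        funext j
        rw [ENNReal.tsum_mul_left, mul_left_comm]
        congr 1
        rw [tsum_eq_sum (s := (finite_nearBlock hK j).toFinset), Finset.mul_sum]
        · refine Finset.sum_congr rfl fun l hl => ?_
          rw [if_pos (by simpa using hl)]
        · intro l hl
          rw [if_neg (by simpa using hl), zero_mul]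
    _ = M * ∑' l, (∑' j, if l ∈ nearBlock K j then W j else 0) * ‖a l‖ₑ ^ 2 := by
        rw [ENNReal.tsum_comm, ← ENNReal.tsum_mul_left]
        congr 1
        funext l
        rw [ENNReal.tsum_mul_left, ENNReal.tsum_mul_right]
    _ ≤ M * ∑' l, (3 * ENNReal.ofReal (Q * Q) * ENNReal.ofReal (freq l ^ (2 * s))) *
          ‖a l‖ₑ ^ 2 := by
        gcongr with l
        rw [tsum_eq_sum (s := Finset.Icc (block K l - 1) (block K l + 1))]
        · calc _ ≤ ∑ j ∈ Finset.Icc (block K l - 1) (block K l + 1),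
                ENNReal.ofReal (Q * Q) * ENNReal.ofReal (freq l ^ (2 * s)) := by
                refine Finset.sum_le_sum fun j _ => ?_
                split_ifs with h
                · exact hnearL j l h
                · exact zero_le
            _ ≤ _ := by
                rw [Finset.sum_const, nsmul_eq_mul, mul_assoc]
                gcongr
                rw [Nat.card_Icc]
                exact_mod_cast (by omega : block K l + 1 + 1 - (block K l - 1) ≤ 3)
        · intro j hj
          rw [if_neg]
          rintro ⟨h2, h3⟩
          exact hj (Finset.mem_Icc.2 ⟨by omega, by omega⟩)
    _ = _ := by
        simp_rw [mul_assoc]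
        rw [ENNReal.tsum_mul_left, ENNReal.tsum_mul_left]
        push_cast
        rw [wsq, mul_assoc, mul_assoc]
        rfl

/-- A rapidly decaying matrix is dominated by a product of arbitrarily negative powers of the two
frequencies, and such a bound absorbs any weight. The predicate P marks the entries where decay is
known; the others vanish. -/
theorem far_sum_le {T : NZ → NZ → ℂ} {P : NZ → NZ → Prop} {s : ℝ}
    (hT : ∀ m : ℕ, ∃ C : ℝ, ∀ k l, P k l → ‖T k l‖ * (freq k + freq l) ^ m ≤ C)
    (h0 : ∀ k l, ¬P k l → T k l = 0) :
    ∃ D : NNReal, ∀ a : NZ → ℂ, wsq s a < ⊤ → wsq s (mulVec T a) ≤ D * wsq s a := by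
  -- The power |s| compensates the weight on either side, and two more powers ensure summability in
  -- each variable.
  obtain ⟨n, hn⟩ := exists_nat_ge (|s| + 2)
  obtain ⟨C₀, hC₀⟩ := hT (2 * n)
  set C := max C₀ 0
  have hC : ∀ k l, ‖T k l‖ ≤ C * ((freq k ^ n)⁻¹ * (freq l ^ n)⁻¹) := by
    intro k l
    have hk := freq_pos k
    have hl := freq_pos l
    by_cases hP : P k l
    · have h1 : ‖T k l‖ * (freq k ^ n * freq l ^ n) ≤ C := by
        refine le_trans ?_ ((hC₀ k l hP).trans (le_max_left _ _))
        gcongr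
        rw [two_mul, pow_add]
        gcongr <;> linarith
      rw [← mul_inv, ← div_eq_mul_inv, le_div_iff₀ (by positivity)]
      exact h1
    · rw [h0 k l hP, norm_zero]
      have : 0 ≤ C := le_max_right _ _
      positivity
  have hC0 : 0 ≤ C := le_max_right _ _
  set Z := ∑' l : NZ, (freq l ^ 2)⁻¹ with hZ
  have hZ0 : 0 ≤ Z := tsum_nonneg fun l => by have := freq_pos l; positivity
  have hpow : ∀ (t : ℝ), t ≤ -2 → ∀ k : NZ, freq k ^ t ≤ (freq k ^ 2)⁻¹ := by
    intro t ht k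
    have : (freq k ^ 2)⁻¹ = freq k ^ (-2 : ℝ) := by
      rw [Real.rpow_neg (freq_pos k).le]; norm_num
    rw [this]
    exact Real.rpow_le_rpow_of_exponent_le (one_le_freq k) ht
  have hinv : ∀ k : NZ, (freq k ^ n)⁻¹ = freq k ^ (-(n : ℝ)) := fun k => by
    rw [Real.rpow_neg (freq_pos k).le, Real.rpow_natCast]
  refine ⟨(C * Z).toNNReal ^ 2 * Z.toNNReal, fun a ha => ?_⟩
  set A := √(wsq s a).toReal with hA
  have hrow : ∀ k, ‖mulVec T a k‖ ≤ C * Z * A * (freq k ^ n)⁻¹ := by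
    intro k
    have hk := freq_pos k
    have hb : ∀ l, ‖T k l * a l‖ ≤ C * A * (freq k ^ n)⁻¹ * (freq l ^ 2)⁻¹ := by
      intro l
      have hl := freq_pos l
      rw [norm_mul]
      calc ‖T k l‖ * ‖a l‖ ≤ (C * ((freq k ^ n)⁻¹ * (freq l ^ n)⁻¹)) * (A * freq l ^ (-s)) := by
            gcongr
            · exact hC k l
            · exact norm_le_of_wsq ha l
        _ = C * A * (freq k ^ n)⁻¹ * (freq l ^ (-(n : ℝ) + -s)) := by
            rw [Real.rpow_add hl, hinv l]; ring
        _ ≤ _ := by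
            gcongr
            exact hpow _ (by linarith [neg_abs_le s]) l
    refine (tsum_of_norm_bounded (summable_freq.mul_left _).hasSum hb).trans_eq ?_
    rw [tsum_mul_left]; ring
  have hA2 : ENNReal.ofReal (A ^ 2) = wsq s a := by
    rw [hA, Real.sq_sqrt ENNReal.toReal_nonneg, ENNReal.ofReal_toReal ha.ne]
  calc wsq s (mulVec T a)
      ≤ ∑' k, ENNReal.ofReal ((C * Z) ^ 2 * A ^ 2) * ENNReal.ofReal ((freq k ^ 2)⁻¹) := by
        refine ENNReal.tsum_le_tsum fun k => ?_
        have hk := freq_pos k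
        rw [← ofReal_norm, ← ENNReal.ofReal_pow (norm_nonneg _),
          ← ENNReal.ofReal_mul (by positivity), ← ENNReal.ofReal_mul (by positivity)]
        refine ENNReal.ofReal_le_ofReal ?_
        calc freq k ^ (2 * s) * ‖mulVec T a k‖ ^ 2
            ≤ freq k ^ (2 * s) * (C * Z * A * (freq k ^ n)⁻¹) ^ 2 := by gcongr; exact hrow k
          _ = (C * Z) ^ 2 * A ^ 2 * freq k ^ (2 * s + (-(n : ℝ) + -(n : ℝ))) := by
              rw [Real.rpow_add hk, Real.rpow_add hk, hinv]; ring
          _ ≤ _ := by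
              gcongr
              exact hpow _ (by linarith [le_abs_self s, abs_nonneg s]) k
    _ = _ := by
        rw [ENNReal.tsum_mul_left, ← ENNReal.ofReal_tsum_of_nonneg
          (fun l => by have := freq_pos l; positivity) summable_freq, ← hZ,
          ENNReal.ofReal_mul (by positivity), hA2, ENNReal.ofReal_pow (by positivity)]
        push_cast
        change _ * _ * _ = ENNReal.ofReal _ ^ 2 * ENNReal.ofReal _ * _
        ring

theorem wsq_add_le (s : ℝ) (a b : NZ → ℂ) :
    wsq s (fun k => a k + b k) ≤ 2 * (wsq s a + wsq s b) := by
  rw [wsq, wsq, wsq, ← ENNReal.tsum_add, ← ENNReal.tsum_mul_left]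
  refine ENNReal.tsum_le_tsum fun k => ?_
  rw [← mul_add, mul_left_comm]
  gcongr
  have h : ‖a k + b k‖ ^ 2 ≤ 2 * (‖a k‖ ^ 2 + ‖b k‖ ^ 2) := by
    have := norm_add_le (a k) (b k)
    nlinarith [sq_nonneg (‖a k‖ - ‖b k‖), norm_nonneg (a k + b k)]
  have h2 := ENNReal.ofReal_le_ofReal h
  rw [ENNReal.ofReal_mul (by norm_num), ENNReal.ofReal_add (by positivity) (by positivity),
    ENNReal.ofReal_pow (norm_nonneg _), ENNReal.ofReal_pow (norm_nonneg _),
    ENNReal.ofReal_pow (norm_nonneg _), ofReal_norm, ofReal_norm, ofReal_norm] at h2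
  simpa using h2

/-- Band matrices are bounded on all weighted spaces. -/
theorem IsBand.wsq_le {T : NZ → NZ → ℂ} (hT : IsBand T) (s : ℝ) :
    ∃ D : NNReal, ∀ a : NZ → ℂ, wsq s a < ⊤ → wsq s (mulVec T a) ≤ D * wsq s a := by
  classical
  obtain ⟨M, hM⟩ := hT.bounded
  obtain ⟨K, hK, hband⟩ := hT.band
  obtain ⟨D₁, hD₁⟩ := near_sum_le hK hM s
  -- The entries outside the adjacent blocks lie off the band, by `off_band`, so what remains of T
  -- decays rapidly.
  obtain ⟨D₂, hD₂⟩ := far_sum_le (s := s)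
    (T := fun k l => if l ∈ nearBlock K (block K k) then 0 else T k l)
    (P := fun k l => l ∉ nearBlock K (block K k))
    (fun m => by
      obtain ⟨C, hC⟩ := hband m
      exact ⟨C, fun k l h => by rw [if_neg h]; exact hC k l (off_band hK h)⟩)
    (fun k l h => by rw [if_pos (not_not.1 h)])
  refine ⟨2 * (D₁ + D₂), fun a ha => ?_⟩
  have hsplit : mulVec T a = fun k =>
      (∑ l ∈ (finite_nearBlock hK (block K k)).toFinset, T k l * a l) +
      mulVec (fun k l => if l ∈ nearBlock K (block K k) then 0 else T k l) a k := by
    funext k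
    have hs := hT.summable (tempered_of_wsq ha) k
    rw [mulVec, mulVec, ← hs.sum_add_tsum_subtype_compl (finite_nearBlock hK (block K k)).toFinset]
    congr 1
    have : ∀ l, (if l ∈ nearBlock K (block K k) then 0 else T k l) * a l =
        indicator ((nearBlock K (block K k))ᶜ) (fun l => T k l * a l) l := by
      intro l
      by_cases h : l ∈ nearBlock K (block K k)
      · simp [h]
      · simp [h]
    simp_rw [this]
    rw [← tsum_subtype]
    exact tsum_congr_set_coe (s := {x | x ∉ (finite_nearBlock hK (block K k)).toFinset})
      (fun l => T k l * a l) (by ext; simp)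
  rw [hsplit]
  refine (wsq_add_le s _ _).trans ?_
  push_cast
  rw [mul_assoc, add_mul]
  gcongr
  · exact hD₁ a
  · exact hD₂ a ha

theorem IsRapid.wsq_le {T : NZ → NZ → ℂ} (hT : IsRapid T) (s : ℝ) :
    ∃ D : NNReal, ∀ a : NZ → ℂ, wsq s a < ⊤ → wsq s (mulVec T a) ≤ D * wsq s a :=
  far_sum_le (P := fun _ _ => True) (fun m => (hT m).imp fun _ h k l _ => h k l) (by simp)

/-! ### Scattering for a symplectic transformation of a Hilbert space -/

section Krein

open scoped InnerProductSpace
open ContinuousLinearMap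

variable {H : Type*} [NormedAddCommGroup H] [InnerProductSpace ℂ H] [CompleteSpace H]

/-- Orthogonal projections `P`, `N` with `P + N = 1` and a pair `U`, `W` of inverse operators which
preserve the indefinite form `‖P x‖² - ‖N x‖²`. -/
structure KreinPair (P N U W : H →L[ℂ] H) : Prop where
  adjP : adjoint P = P
  adjN : adjoint N = N
  PP : ∀ x, P (P x) = P x
  NN : ∀ x, N (N x) = N x
  PN : ∀ x, P (N x) = 0
  NP : ∀ x, N (P x) = 0
  add : ∀ x, P x + N x = x
  UW : ∀ x, U (W x) = x
  WU : ∀ x, W (U x) = x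
  adjU : ∀ x, adjoint U x = P (W (P x)) - P (W (N x)) - N (W (P x)) + N (W (N x))
  adjW : ∀ x, adjoint W x = P (U (P x)) - P (U (N x)) - N (U (P x)) + N (U (N x))

namespace KreinPair

variable {P N U W : H →L[ℂ] H}

theorem symm (h : KreinPair P N U W) : KreinPair P N W U :=
  ⟨h.adjP, h.adjN, h.PP, h.NN, h.PN, h.NP, h.add, h.WU, h.UW, h.adjW, h.adjU⟩

theorem inner_PN (h : KreinPair P N U W) (x y : H) : ⟪P x, N y⟫_ℂ = 0 := by
  rw [← adjoint_inner_right, h.adjP, h.PN, inner_zero_right]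

theorem norm_sq (h : KreinPair P N U W) (x : H) : ‖x‖ ^ 2 = ‖P x‖ ^ 2 + ‖N x‖ ^ 2 := by
  conv_lhs => rw [← h.add x]
  rw [sq, sq, sq]
  exact norm_add_sq_eq_norm_sq_add_norm_sq_of_inner_eq_zero (𝕜 := ℂ) _ _ (h.inner_PN x x)

theorem norm_P_le (h : KreinPair P N U W) (x : H) : ‖P x‖ ≤ ‖x‖ := by
  have := h.norm_sq x
  exact le_of_sq_le_sq (by nlinarith [sq_nonneg ‖N x‖]) (norm_nonneg _)

theorem norm_N_le (h : KreinPair P N U W) (x : H) : ‖N x‖ ≤ ‖x‖ := by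
  have := h.norm_sq x
  exact le_of_sq_le_sq (by nlinarith [sq_nonneg ‖P x‖]) (norm_nonneg _)

/-- `U` preserves the indefinite form. -/
theorem form_eq (h : KreinPair P N U W) (x : H) :
    ‖P (U x)‖ ^ 2 - ‖N (U x)‖ ^ 2 = ‖P x‖ ^ 2 - ‖N x‖ ^ 2 := by
  have key : ∀ y : H, ((‖P y‖ ^ 2 - ‖N y‖ ^ 2 : ℝ) : ℂ) = ⟪P y - N y, y⟫_ℂ := by
    intro y
    have h1 : ⟪P y, y⟫_ℂ = ((‖P y‖ ^ 2 : ℝ) : ℂ) := by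
      rw [← h.PP, ← h.adjP, adjoint_inner_left, h.adjP, inner_self_eq_norm_sq_to_K, h.PP]; norm_cast
    have h2 : ⟪N y, y⟫_ℂ = ((‖N y‖ ^ 2 : ℝ) : ℂ) := by
      rw [← h.NN, ← h.adjN, adjoint_inner_left, h.adjN, inner_self_eq_norm_sq_to_K, h.NN]; norm_cast
    rw [inner_sub_left, h1, h2]; push_cast; rfl
  -- With J = P - N, the relation `adjU` says U* = JWJ. As J² = 1 and WU = 1, it follows that U*JU =
  -- J.
  have h1 : adjoint U (P (U x) - N (U x)) = P x - N x := by
    rw [h.adjU]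
    simp only [map_sub, h.PP, h.PN, h.NP, h.NN, sub_zero, zero_sub, map_neg]
    have h2 : U x = P (U x) + N (U x) := (h.add _).symm
    have h3 : x = W (P (U x)) + W (N (U x)) := by rw [← map_add, ← h2, h.WU]
    have h4 : P x = P (W (P (U x))) + P (W (N (U x))) := by rw [← map_add, ← h3]
    have h5 : N x = N (W (P (U x))) + N (W (N (U x))) := by rw [← map_add, ← h3]
    rw [h4, h5]; abel
  have h2 := key (U x)
  rw [← adjoint_inner_left, h1, ← key] at h2
  exact_mod_cast h2

/-- The operator `N - U P`. -/
def outOp (P N U : H →L[ℂ] H) : H →L[ℂ] H := N - U.comp P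

/-- For y = Nx - UPx one has U(Px) = Nx - y, and preservation of the form at Px reads ‖Py‖² - ‖Nx -
Ny‖² = ‖Px‖². Hence Py controls both Px and Nx - Ny, and y controls x; the three terms Py, Py, Ny
give the constant 3. -/
theorem outOp_bound (h : KreinPair P N U W) (x : H) : ‖x‖ ≤ 3 * ‖outOp P N U x‖ := by
  set y := outOp P N U x with hy
  have h0 : U (P x) = N x - y := by
    rw [hy, outOp]; simp
  have h1 := h.form_eq (P x)
  rw [h0, h.PP, h.NP, map_sub, map_sub, h.PN, h.NN, zero_sub, norm_neg, norm_zero] at h1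
  have h2 : ‖P x‖ ≤ ‖P y‖ :=
    le_of_sq_le_sq (by nlinarith [sq_nonneg ‖N x - N y‖]) (norm_nonneg _)
  have h3 : ‖N x - N y‖ ≤ ‖P y‖ :=
    le_of_sq_le_sq (by nlinarith [sq_nonneg ‖P x‖]) (norm_nonneg _)
  have h4 : ‖x‖ ≤ ‖P x‖ + ‖N x‖ := by
    conv_lhs => rw [← h.add x]
    exact norm_add_le _ _
  have h5 : ‖N x‖ ≤ ‖N x - N y‖ + ‖N y‖ := by
    have := norm_add_le (N x - N y) (N y)
    rwa [sub_add_cancel] at this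
  linarith [h.norm_P_le y, h.norm_N_le y]

/-- The adjoint is N - PU*. If it kills y, then Ny = 0 and PWy = 0, so W maps the positive vector y
to a negative one; preservation of the form leaves only y = 0. -/
theorem outOp_adjoint_injective (h : KreinPair P N U W) {y : H}
    (hy : adjoint (outOp P N U) y = 0) : y = 0 := by
  have h0 : adjoint (outOp P N U) y = N y - P (adjoint U y) := by
    rw [outOp, map_sub, adjoint_comp, h.adjN, h.adjP]; rfl
  rw [h0] at hy
  have hN : N y = 0 := by
    have := congrArg N hy
    rwa [map_sub, h.NN, h.NP, sub_zero, map_zero] at this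
  have hP : P y = y := by rw [← add_zero (P y), ← hN, h.add]
  rw [hN, zero_sub, neg_eq_zero, h.adjU, hN, hP] at hy
  simp only [map_sub, map_zero, h.PP, h.PN, sub_zero, add_zero] at hy
  have h1 := h.symm.form_eq y
  rw [hy, hN, hP, norm_zero] at h1
  have h2 : ‖y‖ ^ 2 = 0 := by nlinarith [sq_nonneg ‖N (W y)‖, sq_nonneg ‖y‖]
  simpa using h2

/-- The lower bound gives injectivity and closed range, and injectivity of the adjoint gives dense
range. -/
theorem outOp_bijective (h : KreinPair P N U W) : Function.Bijective (outOp P N U) := by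
  have hanti : AntilipschitzWith 3 (outOp P N U) :=
    AddMonoidHomClass.antilipschitz_of_bound _ fun x => by simpa using h.outOp_bound x
  refine ⟨hanti.injective, ?_⟩
  have hclosed : IsClosed ((outOp P N U).range : Set H) := by
    rw [LinearMap.coe_range]
    exact hanti.isClosed_range (outOp P N U).uniformContinuous
  have hperp : (outOp P N U).rangeᗮ = ⊥ := by
    rw [ContinuousLinearMap.orthogonal_range, eq_bot_iff]
    intro y hy
    exact h.outOp_adjoint_injective hy
  have : CompleteSpace (outOp P N U).range := hclosed.completeSpace_coe
  exact LinearMap.range_eq_top.1 ((Submodule.orthogonal_eq_bot_iff).1 hperp)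

/-- The scattering operator. -/
theorem exists_scattering (h : KreinPair P N U W) :
    ∃ S : H →L[ℂ] H, ∀ g o, P g + N o = U (N g + P o) ↔ o = S g := by
  let e := ContinuousLinearEquiv.ofBijective (outOp P N U)
    (LinearMap.ker_eq_bot.2 h.outOp_bijective.1) (LinearMap.range_eq_top.2 h.outOp_bijective.2)
  -- Collecting o on one side, the scattering equation is (N - UP)o = (UN - P)g.
  refine ⟨(e.symm : H →L[ℂ] H).comp (U.comp N - P), fun g o => ?_⟩
  have h1 : o = ((e.symm : H →L[ℂ] H).comp (U.comp N - P)) g ↔ outOp P N U o = U (N g) - P g := by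
    change o = e.symm (U (N g) - P g) ↔ e o = _
    rw [ContinuousLinearEquiv.eq_symm_apply]
  rw [h1, outOp, map_add]
  change _ ↔ N o - U (P o) = _
  rw [sub_eq_sub_iff_add_eq_add, add_comm (N o)]

section

variable {S S' : H →L[ℂ] H}

/-- Comparing the form on the two sides of the scattering equation gives ‖Pg‖² - ‖No‖² = ‖Po‖² -
‖Ng‖², which rearranges to equality of the norms of g and o. -/
theorem norm_scattering (h : KreinPair P N U W)
    (hS : ∀ g o, P g + N o = U (N g + P o) ↔ o = S g) (g : H) : ‖S g‖ = ‖g‖ := by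
  have h1 := h.form_eq (N g + P (S g))
  rw [← (hS g (S g)).2 rfl] at h1
  simp only [map_add, h.PP, h.PN, h.NP, h.NN, add_zero, zero_add] at h1
  have h2 := h.norm_sq g
  have h3 := h.norm_sq (S g)
  rw [← abs_norm, ← abs_norm g, ← sq_eq_sq_iff_abs_eq_abs]
  linarith

/-- Applying W to the scattering equation gives the scattering equation of the pair (W, U) with the
roles of g and o exchanged. -/
theorem scattering_inv (h : KreinPair P N U W)
    (hS : ∀ g o, P g + N o = U (N g + P o) ↔ o = S g)
    (hS' : ∀ g o, P g + N o = W (N g + P o) ↔ o = S' g) (g : H) : S' (S g) = g := by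
  symm
  rw [← hS', ← h.WU (P (S g) + N g), add_comm (P (S g)), ← (hS g (S g)).2 rfl, add_comm]

/-- S' is isometric, so its adjoint is a left inverse of it, and S' is a left inverse of S. -/
theorem adjoint_scattering (h : KreinPair P N U W)
    (hS : ∀ g o, P g + N o = U (N g + P o) ↔ o = S g)
    (hS' : ∀ g o, P g + N o = W (N g + P o) ↔ o = S' g) : adjoint S' = S := by
  have h1 : adjoint S' ∘L S' = 1 :=
    (norm_map_iff_adjoint_comp_self S').1 (h.symm.norm_scattering hS')
  ext x
  have h2 := DFunLike.congr_fun h1 (S x)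
  change adjoint S' (S' (S x)) = S x at h2
  rwa [h.scattering_inv hS hS'] at h2

/-- The N component is read off the scattering equation, the P component off its image under W. Only
the off-diagonal blocks of U and W remain, acting on the outgoing vector. -/
theorem scattering_sub (h : KreinPair P N U W)
    (hS : ∀ g o, P g + N o = U (N g + P o) ↔ o = S g) (g : H) :
    S g - (P (W (P g)) + N (U (N g))) = P (W (N (S g))) + N (U (P (S g))) := by
  have h0 := (hS g (S g)).2 rfl
  have h1 : N (S g) = N (U (N g)) + N (U (P (S g))) := by
    have := congrArg N h0
    rwa [map_add, map_add, map_add, h.NP, h.NN, zero_add] at this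
  have h2 : P (S g) = P (W (P g)) + P (W (N (S g))) := by
    have := congrArg (fun x => P (W x)) h0
    simp only [h.WU] at this
    rw [map_add, map_add, map_add, h.PN, h.PP, zero_add] at this
    exact this.symm
  calc S g - (P (W (P g)) + N (U (N g)))
      = (P (W (P g)) + P (W (N (S g)))) + (N (U (N g)) + N (U (P (S g)))) -
          (P (W (P g)) + N (U (N g))) := by rw [← h1, ← h2, h.add]
    _ = _ := by abel

/-- Adjoints move the off-diagonal blocks from S g to e. The adjoint relations exchange U and W
there, with a minus sign, and S is isometric. For e a basis vector this bounds a row of the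
remainder. -/
theorem inner_scattering_sub (h : KreinPair P N U W)
    (hS : ∀ g o, P g + N o = U (N g + P o) ↔ o = S g) (e g : H) :
    ‖⟪e, S g - (P (W (P g)) + N (U (N g)))⟫_ℂ‖ ≤ ‖N (U (P e)) + P (W (N e))‖ * ‖g‖ := by
  rw [h.scattering_sub hS, ← h.norm_scattering hS g]
  have h1 : ⟪e, P (W (N (S g))) + N (U (P (S g)))⟫_ℂ
      = ⟪N (adjoint W (P e)) + P (adjoint U (N e)), S g⟫_ℂ := by
    rw [inner_add_left, inner_add_right]
    congr 1
    · conv_rhs => rw [← h.adjN, adjoint_inner_left, adjoint_inner_left]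
      rw [← h.adjP, adjoint_inner_left, h.adjP]
    · conv_rhs => rw [← h.adjP, adjoint_inner_left, adjoint_inner_left]
      rw [← h.adjN, adjoint_inner_left, h.adjN]
  have h2 : N (adjoint W (P e)) + P (adjoint U (N e)) = -(N (U (P e)) + P (W (N e))) := by
    rw [h.adjW, h.adjU]
    simp only [map_add, map_sub, h.PP, h.NN, h.PN, h.NP, map_zero, sub_zero, zero_sub, add_zero, map_neg]
    abel
  rw [h1, h2, ← norm_neg (N (U (P e)) + P (W (N e)))]
  exact norm_inner_le_norm _ _

/-- The companion bound for columns: S is the adjoint of the scattering operator of (W, U), so the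
row bound for that pair applies with e and g exchanged. -/
theorem inner_scattering_sub' (h : KreinPair P N U W)
    (hS : ∀ g o, P g + N o = U (N g + P o) ↔ o = S g) (e g : H) :
    ‖⟪e, S g - (P (W (P g)) + N (U (N g)))⟫_ℂ‖ ≤ ‖N (W (P g)) + P (U (N g))‖ * ‖e‖ := by
  obtain ⟨S', hS'⟩ := h.symm.exists_scattering
  have h1 := h.symm.inner_scattering_sub hS' g e
  have h2 : ⟪e, S g - (P (W (P g)) + N (U (N g)))⟫_ℂ
      = ⟪S' e - (P (U (P e)) + N (W (N e))), g⟫_ℂ := by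
    rw [← h.adjoint_scattering hS hS', inner_sub_left, inner_sub_right, adjoint_inner_right]
    congr 1
    have h3 : P (adjoint U (P g)) + N (adjoint W (N g)) = P (W (P g)) + N (U (N g)) := by
      rw [h.adjW, h.adjU]
      simp only [map_add, map_sub, h.PP, h.NN, h.PN, h.NP, map_zero, sub_zero, add_zero, zero_add]
    rw [← h3, inner_add_left, inner_add_right]
    congr 1
    · conv_rhs => rw [← h.adjP, adjoint_inner_left, ← adjoint_inner_right, h.adjP]
      rw [← h.adjP, adjoint_inner_right, h.adjP]
    · conv_rhs => rw [← h.adjN, adjoint_inner_left, ← adjoint_inner_right, h.adjN]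
      rw [← h.adjN, adjoint_inner_right, h.adjN]
  rw [h2, ← inner_conj_symm, RCLike.norm_conj]
  exact h1

end

end KreinPair

end Krein

/-! ### The scattering matrix of a symplectic pair of band matrices -/

section Seq

open scoped InnerProductSpace

/-- `ℓ²` of the nonzero frequencies. -/
abbrev SeqH : Type := lp (fun _ : NZ => ℂ) 2

theorem ofReal_norm_sq (z : ℂ) : ENNReal.ofReal (‖z‖ ^ 2) = ‖z‖ₑ ^ 2 := by
  rw [ENNReal.ofReal_pow (norm_nonneg _), ofReal_norm]

theorem wsq_zero_eq (a : NZ → ℂ) : wsq 0 a = ∑' k, ENNReal.ofReal (‖a k‖ ^ 2) := by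
  simp [wsq]

theorem wsq_zero_coe (x : SeqH) : wsq 0 x = ENNReal.ofReal (‖x‖ ^ 2) := by
  have h := lp.hasSum_norm (p := 2) (by simp) x
  simp only [ENNReal.toReal_ofNat, Real.rpow_ofNat] at h
  rw [wsq_zero_eq, ← ENNReal.ofReal_tsum_of_nonneg (fun k => by positivity) h.summable, h.tsum_eq]

theorem memlp_of_wsq {a : NZ → ℂ} (ha : wsq 0 a < ⊤) : Memℓp a 2 := by
  rw [wsq_zero_eq] at ha
  refine memℓp_gen ?_
  simp only [ENNReal.toReal_ofNat, Real.rpow_ofNat]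
  have h := ENNReal.summable_toReal ha.ne
  refine h.congr fun k => ?_
  rw [ENNReal.toReal_ofReal (by positivity)]

/-- The operator on `ℓ²` with a given matrix. -/
theorem exists_op {T : NZ → NZ → ℂ}
    (hsum : ∀ a, wsq 0 a < ⊤ → ∀ k, Summable fun l => T k l * a l)
    (hb : ∃ D : NNReal, ∀ a, wsq 0 a < ⊤ → wsq 0 (mulVec T a) ≤ D * wsq 0 a) :
    ∃ A : SeqH →L[ℂ] SeqH, ∀ x k, A x k = mulVec T x k := by
  obtain ⟨D, hD⟩ := hb
  have hfin : ∀ x : SeqH, wsq 0 x < ⊤ := fun x => by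
    rw [wsq_zero_coe]; exact ENNReal.ofReal_lt_top
  have hmem : ∀ x : SeqH, wsq 0 (mulVec T x) < ⊤ := fun x =>
    (hD x (hfin x)).trans_lt (ENNReal.mul_lt_top ENNReal.coe_lt_top (hfin x))
  let L : SeqH →ₗ[ℂ] SeqH :=
    { toFun := fun x => ⟨mulVec T x, memlp_of_wsq (hmem x)⟩
      map_add' := fun x y => by
        ext k
        change mulVec T (x + y : SeqH) k = mulVec T x k + mulVec T y k
        rw [mulVec, mulVec, mulVec, ← (hsum x (hfin x) k).tsum_add (hsum y (hfin y) k)]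
        congr 1
        funext l
        rw [lp.coeFn_add, Pi.add_apply, mul_add]
      map_smul' := fun c x => by
        ext k
        change mulVec T (c • x : SeqH) k = c * mulVec T x k
        rw [mulVec, mulVec, ← tsum_mul_left]
        congr 1
        funext l
        rw [lp.coeFn_smul, Pi.smul_apply, smul_eq_mul]
        ring }
  refine ⟨L.mkContinuous (√D) fun x => ?_, fun x k => rfl⟩
  have h1 := hD x (hfin x)
  have h2 : wsq 0 (mulVec T x) = ENNReal.ofReal (‖L x‖ ^ 2) := wsq_zero_coe (L x)
  rw [h2, wsq_zero_coe, ← ENNReal.ofReal_coe_nnreal, ← ENNReal.ofReal_mul D.coe_nonneg,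
    ENNReal.ofReal_le_ofReal_iff (by positivity)] at h1
  refine le_of_sq_le_sq ?_ (by positivity)
  rw [mul_pow, Real.sq_sqrt D.coe_nonneg]
  exact h1

/-- The standard basis of `ℓ²`. -/
def seqBasis (k : NZ) : SeqH := lp.single 2 k 1

theorem seqBasis_apply (k l : NZ) : seqBasis k l = if l = k then 1 else 0 := by
  rw [seqBasis, lp.single_apply, Pi.single_apply]

theorem inner_seqBasis (k : NZ) (x : SeqH) : ⟪seqBasis k, x⟫_ℂ = x k := by
  rw [seqBasis, lp.inner_single_left]; simp

theorem norm_seqBasis (k : NZ) : ‖seqBasis k‖ = 1 := by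
  rw [seqBasis, lp.norm_single (by simp)]; simp

theorem hasSum_op (A : SeqH →L[ℂ] SeqH) (x : SeqH) (k : NZ) :
    HasSum (fun l => A (seqBasis l) k * x l) (A x k) := by
  have h := ((innerSL ℂ (seqBasis k)).comp A).hasSum (lp.hasSum_single (by simp) x)
  rw [ContinuousLinearMap.comp_apply, innerSL_apply_apply, inner_seqBasis] at h
  refine h.congr_fun fun l => ?_
  have : (lp.single 2 l (x l) : SeqH) = x l • seqBasis l := by
    rw [seqBasis, ← lp.single_smul, smul_eq_mul, mul_one]
  rw [this, ContinuousLinearMap.comp_apply, map_smul, innerSL_apply_apply, inner_smul_right,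
    inner_seqBasis, mul_comm]

theorem op_ext {A B : SeqH →L[ℂ] SeqH} (h : ∀ k l, A (seqBasis l) k = B (seqBasis l) k) : A = B := by
  ext x k
  have h1 := hasSum_op A x k
  simp_rw [h] at h1
  exact h1.unique (hasSum_op B x k)

/-- The part of a sequence with frequencies in `s`. -/
def cut (s : Set NZ) (a : NZ → ℂ) : NZ → ℂ := s.indicator a

theorem wsq_cut_le (t : ℝ) (s : Set NZ) (a : NZ → ℂ) : wsq t (cut s a) ≤ wsq t a := by
  refine ENNReal.tsum_le_tsum fun k => ?_
  gcongr
  rw [cut]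
  by_cases hk : k ∈ s
  · rw [indicator_of_mem hk]
  · rw [indicator_of_notMem hk, enorm_zero]; exact zero_le

theorem exists_cutOp (s : Set NZ) : ∃ A : SeqH →L[ℂ] SeqH, ∀ x k, A x k = cut s x k := by
  have hfin : ∀ x : SeqH, wsq 0 x < ⊤ := fun x => by
    rw [wsq_zero_coe]; exact ENNReal.ofReal_lt_top
  let L : SeqH →ₗ[ℂ] SeqH :=
    { toFun := fun x => ⟨cut s x, memlp_of_wsq ((wsq_cut_le 0 s x).trans_lt (hfin x))⟩
      map_add' := fun x y => by
        ext k
        exact congrFun (indicator_add s (x : NZ → ℂ) (y : NZ → ℂ)) k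
      map_smul' := fun c x => by
        ext k
        exact indicator_const_smul_apply s c (x : NZ → ℂ) k }
  refine ⟨L.mkContinuous 1 fun x => ?_, fun x k => rfl⟩
  have h1 := wsq_cut_le 0 s x
  have h2 : wsq 0 (cut s x) = ENNReal.ofReal (‖L x‖ ^ 2) := wsq_zero_coe (L x)
  rw [h2, wsq_zero_coe, ENNReal.ofReal_le_ofReal_iff (by positivity)] at h1
  rw [one_mul]
  exact le_of_sq_le_sq h1 (norm_nonneg _)

/-- The positive frequencies. -/
def posFreq : Set NZ := {k | 0 < (k : ℤ)}

/-- The negative frequencies. -/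
def negFreq : Set NZ := {k | (k : ℤ) < 0}

theorem mem_negFreq_iff {k : NZ} : k ∈ negFreq ↔ k ∉ posFreq := by
  have := k.2
  change (k : ℤ) < 0 ↔ ¬0 < (k : ℤ)
  omega

/-- A pair of mutually inverse band matrices which preserve the symplectic form. -/
structure SymplecticPair (U W : NZ → NZ → ℂ) : Prop where
  bandU : IsBand U
  bandW : IsBand W
  UW : ∀ k l, HasSum (fun m => U k m * W m l) (if k = l then 1 else 0)
  WU : ∀ k l, HasSum (fun m => W k m * U m l) (if k = l then 1 else 0)
  rel : ∀ k l : NZ, ((l : ℤ) : ℂ) * W k l = ((k : ℤ) : ℂ) * (starRingEnd ℂ) (U l k)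
  oppU : ∀ m : ℕ, ∃ C : ℝ, ∀ k l : NZ, (k ∈ posFreq ↔ l ∈ negFreq) →
    ‖U k l‖ * (freq k + freq l) ^ m ≤ C
  oppW : ∀ m : ℕ, ∃ C : ℝ, ∀ k l : NZ, (k ∈ posFreq ↔ l ∈ negFreq) →
    ‖W k l‖ * (freq k + freq l) ^ m ≤ C

theorem SymplecticPair.symm {U W : NZ → NZ → ℂ} (h : SymplecticPair U W) : SymplecticPair W U where
  bandU := h.bandW
  bandW := h.bandU
  UW := h.WU
  WU := h.UW
  rel k l := by
    have := congrArg (starRingEnd ℂ) (h.rel l k)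
    simp only [map_mul, Complex.conj_conj, map_intCast] at this
    exact this.symm
  oppU := h.oppW
  oppW := h.oppU

/-- `|k|^{1/2}`. -/
def rt (k : NZ) : ℝ := √(freq k)

theorem rt_pos (k : NZ) : 0 < rt k := Real.sqrt_pos.2 (freq_pos k)

theorem rt_ne (k : NZ) : ((rt k : ℝ) : ℂ) ≠ 0 := by exact_mod_cast (rt_pos k).ne'

theorem rt_sq (k : NZ) : rt k * rt k = freq k := Real.mul_self_sqrt (freq_pos k).le

theorem one_le_rt (k : NZ) : 1 ≤ rt k := Real.one_le_sqrt.2 (one_le_freq k)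

theorem rt_le (k : NZ) : rt k ≤ freq k := by
  rw [← rt_sq]; nlinarith [one_le_rt k]

/-- Multiplication by `|k|^{1/2}`. -/
def up (a : NZ → ℂ) (k : NZ) : ℂ := (rt k : ℝ) * a k

/-- Multiplication by `|k|^{-1/2}`. -/
def down (a : NZ → ℂ) (k : NZ) : ℂ := ((rt k : ℝ) : ℂ)⁻¹ * a k

theorem up_down (a : NZ → ℂ) : up (down a) = a := by
  funext k
  rw [up, down, mul_inv_cancel_left₀ (rt_ne k)]

theorem down_up (a : NZ → ℂ) : down (up a) = a := by
  funext k
  rw [down, up, inv_mul_cancel_left₀ (rt_ne k)]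

theorem wsq_up (a : NZ → ℂ) : wsq (-1 / 2) (up a) = wsq 0 a := by
  rw [wsq, wsq]
  congr 1
  funext k
  have hk := freq_pos k
  have hu : up a k = (rt k : ℝ) * a k := rfl
  rw [hu, ← ofReal_norm_sq, ← ofReal_norm_sq, ← ENNReal.ofReal_mul (by positivity),
    ← ENNReal.ofReal_mul (by positivity), norm_mul, Complex.norm_real,
    Real.norm_of_nonneg (rt_pos k).le, mul_pow, sq (rt k), rt_sq]
  congr 1
  have h1 : (2 * (-1 / 2) : ℝ) = -1 := by norm_num
  rw [h1, Real.rpow_neg_one, inv_mul_cancel_left₀ hk.ne', mul_zero, Real.rpow_zero, one_mul]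

theorem wsq_down (a : NZ → ℂ) : wsq 0 (down a) = wsq (-1 / 2) a := by
  rw [← wsq_up, up_down]

/-- The matrix in the normalized basis `|k|^{1/2} e_k`. -/
def normalize (T : NZ → NZ → ℂ) (k l : NZ) : ℂ := ((rt k : ℝ) : ℂ)⁻¹ * T k l * (rt l : ℝ)

theorem mulVec_normalize (T : NZ → NZ → ℂ) (a : NZ → ℂ) :
    mulVec (normalize T) a = down (mulVec T (up a)) := by
  funext k
  rw [mulVec, down, mulVec, ← tsum_mul_left]
  congr 1
  funext l
  rw [normalize, up]; ring

theorem IsBand.exists_op {T : NZ → NZ → ℂ} (hT : IsBand T) :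
    ∃ A : SeqH →L[ℂ] SeqH, ∀ x k, A x k = mulVec (normalize T) x k := by
  refine ChannelScattering.exists_op (fun a ha k => ?_) ?_
  · rw [← wsq_up] at ha
    refine ((hT.summable (tempered_of_wsq ha) k).mul_left ((rt k : ℝ) : ℂ)⁻¹).congr fun l => ?_
    rw [normalize, up]; ring
  · obtain ⟨D, hD⟩ := hT.wsq_le (-1 / 2)
    refine ⟨D, fun a ha => ?_⟩
    rw [mulVec_normalize, wsq_down, ← wsq_up a]
    exact hD _ (by rwa [wsq_up])

theorem mulVec_seqBasis (T : NZ → NZ → ℂ) (k l : NZ) : mulVec T (seqBasis l) k = T k l := by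
  rw [mulVec, tsum_eq_single l]
  · rw [seqBasis_apply, if_pos rfl, mul_one]
  · intro m hm
    rw [seqBasis_apply, if_neg hm, mul_zero]

theorem cut_apply (s : Set NZ) [DecidablePred (· ∈ s)] (a : NZ → ℂ) (k : NZ) :
    cut s a k = if k ∈ s then a k else 0 := by
  rw [cut, indicator_apply]

theorem cutOp_seqBasis {s : Set NZ} [DecidablePred (· ∈ s)] {P : SeqH →L[ℂ] SeqH}
    (hP : ∀ x k, P x k = cut s x k) (l : NZ) :
    P (seqBasis l) = if l ∈ s then seqBasis l else 0 := by
  ext k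
  rw [hP, cut_apply, seqBasis_apply]
  by_cases hl : l ∈ s
  · rw [if_pos hl, seqBasis_apply]
    rcases eq_or_ne k l with rfl | hkl
    · rw [if_pos hl]
    · rw [if_neg hkl, ite_self]
  · rw [if_neg hl]
    rcases eq_or_ne k l with rfl | hkl
    · rw [if_neg hl]; rfl
    · rw [if_neg hkl, ite_self]; rfl

/-- The sign of a frequency. -/
def sg (k : NZ) : ℂ := if 0 < (k : ℤ) then 1 else -1

theorem sg_mul_self (k : NZ) : sg k * sg k = 1 := by
  rw [sg]; split_ifs <;> norm_num

theorem coe_eq_sg_mul (k : NZ) : ((k : ℤ) : ℂ) = sg k * (freq k : ℝ) := by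
  rw [sg, freq]
  split_ifs with h
  · rw [abs_of_pos (by exact_mod_cast h)]; push_cast; ring
  · rw [abs_of_nonpos (by exact_mod_cast not_lt.1 h)]; push_cast; ring

/-- Writing k = sgn(k)|k|, the factors |k|^{1/2} of the normalization absorb the moduli in the
symplectic relation, and only the signs remain: the normalized matrices satisfy U* = JWJ. -/
theorem SymplecticPair.normalize_adj {U W : NZ → NZ → ℂ} (h : SymplecticPair U W) (k l : NZ) :
    (starRingEnd ℂ) (normalize U l k) = sg k * sg l * normalize W k l := by
  have h1 := h.rel k l
  rw [coe_eq_sg_mul k, coe_eq_sg_mul l, ← rt_sq, ← rt_sq] at h1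
  have hk0 := rt_ne k
  have hl0 := rt_ne l
  simp only [normalize, map_mul, map_inv₀, Complex.conj_ofReal]
  push_cast at h1
  field_simp
  linear_combination (-sg k) * h1 -
    (starRingEnd ℂ) (U l k) * (rt k : ℂ) * (rt k : ℂ) * sg_mul_self k

/-- Conjugation by |k|^{1/2} turns the space of order -1/2 into ℓ². The operators are bounded there
by `IsBand.wsq_le` with s = -1/2, and the algebraic relations can be checked on matrix entries. -/
theorem SymplecticPair.exists_kreinPair {U W : NZ → NZ → ℂ} (h : SymplecticPair U W) :
    ∃ P N A B : SeqH →L[ℂ] SeqH, KreinPair P N A B ∧ (∀ x k, P x k = cut posFreq x k) ∧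
      (∀ x k, N x k = cut negFreq x k) ∧ (∀ x k, A x k = mulVec (normalize U) x k) ∧
      (∀ x k, B x k = mulVec (normalize W) x k) := by
  classical
  obtain ⟨P, hP⟩ := exists_cutOp posFreq
  obtain ⟨N, hN⟩ := exists_cutOp negFreq
  -- Stated for an arbitrary pair, so that it serves both for (U, W) and for (W, U).
  have key : ∀ {U W : NZ → NZ → ℂ} (A B : SeqH →L[ℂ] SeqH), SymplecticPair U W →
      (∀ x k, A x k = mulVec (normalize U) x k) → (∀ x k, B x k = mulVec (normalize W) x k) →
      (∀ x, A (B x) = x) ∧ ∀ x, ContinuousLinearMap.adjoint A x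
        = P (B (P x)) - P (B (N x)) - N (B (P x)) + N (B (N x)) := by
    intro U W A B h hA hB
    have hPe := cutOp_seqBasis hP
    have hNe := cutOp_seqBasis hN
    simp only [mem_negFreq_iff] at hNe
    constructor
    · have : A.comp B = ContinuousLinearMap.id ℂ SeqH := by
        refine op_ext fun k l => ?_
        rw [ContinuousLinearMap.comp_apply, hA, ContinuousLinearMap.id_apply, seqBasis_apply, mulVec]
        have h1 := ((h.UW k l).mul_left ((rt k : ℝ) : ℂ)⁻¹).mul_right ((rt l : ℝ) : ℂ)
        have h2 : ∀ m, normalize U k m * B (seqBasis l) m =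
            ((rt k : ℝ) : ℂ)⁻¹ * (U k m * W m l) * ((rt l : ℝ) : ℂ) := by
          intro m
          rw [hB, mulVec_seqBasis, normalize, normalize]
          have := rt_ne m
          field_simp
        simp_rw [h2]
        rw [h1.tsum_eq]
        split_ifs with h3
        · rw [h3, mul_one, inv_mul_cancel₀ (rt_ne l)]
        · simp
      exact fun x => DFunLike.congr_fun this x
    · have : ContinuousLinearMap.adjoint A = P.comp (B.comp P) - P.comp (B.comp N)
          - N.comp (B.comp P) + N.comp (B.comp N) := by
        refine op_ext fun k l => ?_
        rw [← inner_seqBasis k, ContinuousLinearMap.adjoint_inner_right, ← inner_conj_symm,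
          inner_seqBasis, hA, mulVec_seqBasis, h.normalize_adj]
        change _ = P (B (P (seqBasis l))) k - P (B (N (seqBasis l))) k -
          N (B (P (seqBasis l))) k + N (B (N (seqBasis l))) k
        rw [hP, hP, hN, hN, hPe, hNe, cut_apply, cut_apply, cut_apply, cut_apply]
        have hk : sg k = if k ∈ posFreq then 1 else -1 := if_congr Iff.rfl rfl rfl
        have hl : sg l = if l ∈ posFreq then 1 else -1 := if_congr Iff.rfl rfl rfl
        by_cases h1 : k ∈ posFreq <;> by_cases h2 : l ∈ posFreq <;>
          simp [h1, h2, hk, hl, mem_negFreq_iff, hB, mulVec_seqBasis]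
      intro x
      rw [this]; rfl
  obtain ⟨A, hA⟩ := h.bandU.exists_op
  obtain ⟨B, hB⟩ := h.bandW.exists_op
  have hadj : ∀ (s : Set NZ) (P : SeqH →L[ℂ] SeqH), (∀ x k, P x k = cut s x k) →
      ContinuousLinearMap.adjoint P = P := by
    intro s P hP
    refine op_ext fun k l => ?_
    rw [← inner_seqBasis k, ContinuousLinearMap.adjoint_inner_right, ← inner_conj_symm,
      inner_seqBasis, hP, hP, cut_apply, cut_apply, seqBasis_apply, seqBasis_apply]
    rcases eq_or_ne k l with rfl | hkl
    · by_cases hk : k ∈ s <;> simp [hk]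
    · simp [hkl, hkl.symm]
  refine ⟨P, N, A, B, ⟨hadj _ P hP, hadj _ N hN, fun x => ?_, fun x => ?_, fun x => ?_, fun x => ?_,
    fun x => ?_, (key A B h hA hB).1, (key B A h.symm hB hA).1, (key A B h hA hB).2,
    (key B A h.symm hB hA).2⟩, hP, hN, hA, hB⟩
  · ext k
    rw [hP, cut_apply, hP, cut_apply]; split_ifs <;> rfl
  · ext k
    rw [hN, cut_apply, hN, cut_apply]; split_ifs <;> rfl
  · ext k
    rw [hP, cut_apply, hN, cut_apply]
    simp only [mem_negFreq_iff]
    split_ifs <;> rfl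
  · ext k
    rw [hN, cut_apply, hP, cut_apply]
    simp only [mem_negFreq_iff]
    split_ifs <;> rfl
  · ext k
    change P x k + N x k = x k
    rw [hP, cut_apply, hN, cut_apply]
    simp only [mem_negFreq_iff]
    split_ifs <;> simp

end Seq

/-! ### The scattering matrix on frequencies and its remainder. -/

section ScatteringMatrix

open scoped InnerProductSpace

/-- The block of a matrix with both frequencies in `s`. -/
def mask (s : Set NZ) (T : NZ → NZ → ℂ) (k l : NZ) : ℂ := cut s (fun k => cut s (T k) l) k

theorem norm_cut_le (s : Set NZ) (a : NZ → ℂ) (k : NZ) : ‖cut s a k‖ ≤ ‖a k‖ :=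
  norm_indicator_le_norm_self a k

theorem enorm_cut_le (s : Set NZ) (a : NZ → ℂ) (k : NZ) : ‖cut s a k‖ₑ ≤ ‖a k‖ₑ :=
  enorm_indicator_le_enorm_self a k

theorem norm_mask_le (s : Set NZ) (T : NZ → NZ → ℂ) (k l : NZ) : ‖mask s T k l‖ ≤ ‖T k l‖ :=
  (norm_cut_le s _ k).trans (norm_cut_le s _ l)

theorem mask_apply (s : Set NZ) [DecidablePred (· ∈ s)] (T : NZ → NZ → ℂ) (k l : NZ) :
    mask s T k l = if k ∈ s then if l ∈ s then T k l else 0 else 0 := by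
  rw [mask, cut_apply, cut_apply]

theorem mask_mul (s : Set NZ) (T : NZ → NZ → ℂ) (a : NZ → ℂ) (k l : NZ) :
    mask s T k l * a l = cut s (fun k => T k l * cut s a l) k := by
  classical
  simp only [mask_apply, cut_apply]
  split_ifs <;> simp

theorem mulVec_mask (s : Set NZ) (T : NZ → NZ → ℂ) (a : NZ → ℂ) :
    mulVec (mask s T) a = cut s (mulVec T (cut s a)) := by
  classical
  funext k
  rw [mulVec, cut_apply, mulVec]
  simp_rw [mask_mul, cut_apply s (fun k => T k _ * _)]
  split_ifs <;> simp

theorem IsBand.mask {T : NZ → NZ → ℂ} (hT : IsBand T) (s : Set NZ) :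
    IsBand (ChannelScattering.mask s T) where
  bounded := by
    classical
    obtain ⟨M, hM⟩ := hT.bounded
    refine ⟨M, fun F a => ?_⟩
    calc ∑' k, ‖∑ l ∈ F, ChannelScattering.mask s T k l * a l‖ₑ ^ 2
        ≤ ∑' k, ‖∑ l ∈ F, T k l * cut s a l‖ₑ ^ 2 := by
          refine ENNReal.tsum_le_tsum fun k => ?_
          gcongr
          have : ∑ l ∈ F, ChannelScattering.mask s T k l * a l
              = cut s (fun k => ∑ l ∈ F, T k l * cut s a l) k := by
            simp_rw [mask_mul, cut_apply s (fun k => T k _ * _)]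
            rw [cut_apply]
            split_ifs <;> simp
          rw [this]
          exact enorm_cut_le s (fun k => ∑ l ∈ F, T k l * cut s a l) k
      _ ≤ M * ∑ l ∈ F, ‖cut s a l‖ₑ ^ 2 := hM F _
      _ ≤ M * ∑ l ∈ F, ‖a l‖ₑ ^ 2 := by
          gcongr with l
          exact enorm_cut_le s a l
  band := by
    obtain ⟨K, hK, h⟩ := hT.band
    refine ⟨K, hK, fun m => ?_⟩
    obtain ⟨C, hC⟩ := h m
    refine ⟨C, fun k l hkl => le_trans ?_ (hC k l hkl)⟩
    have := freq_pos k
    have := freq_pos l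
    gcongr
    exact norm_mask_le s T k l

theorem IsRapid.summable {T : NZ → NZ → ℂ} (hT : IsRapid T) {a : NZ → ℂ} (ha : Tempered a)
    (k : NZ) : Summable fun l => T k l * a l := by
  refine summable_of_row (fun m => ?_) ha
  obtain ⟨C, hC⟩ := hT m
  refine ⟨C, fun l => le_trans ?_ (hC k l)⟩
  have := freq_pos k
  have := freq_pos l
  gcongr
  linarith

theorem norm_le_of_coord {y : SeqH} {c : ℝ} (h : ∀ l, ‖y l‖ ≤ c * (freq l)⁻¹) :
    ‖y‖ ≤ c * √(∑' l : NZ, (freq l ^ 2)⁻¹) := by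
  have hc : 0 ≤ c := by
    have h1 := (norm_nonneg _).trans (h ⟨1, one_ne_zero⟩)
    have h2 := freq_pos ⟨1, one_ne_zero⟩
    by_contra! h3
    have := mul_neg_of_neg_of_pos h3 (inv_pos.2 h2)
    linarith
  have h1 := lp.hasSum_norm (p := 2) (by simp) y
  simp only [ENNReal.toReal_ofNat, Real.rpow_ofNat] at h1
  have h2 := hasSum_le (fun l => ?_) h1 (summable_freq.hasSum.mul_left (c ^ 2))
  · refine le_of_sq_le_sq ?_ (by positivity)
    rwa [mul_pow, Real.sq_sqrt (tsum_nonneg fun l => by positivity)]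
  · rw [← inv_pow, ← mul_pow]
    exact pow_le_pow_left₀ (norm_nonneg _) (h l) 2

/-- Of the n + 2 powers, one pays for the normalizing factor |k|^{1/2} ≤ |k| and one leaves the
factor 1/|l| that makes the column square-summable. -/
theorem norm_normalize_le {T : NZ → NZ → ℂ} {n : ℕ} {C : ℝ} {l k : NZ}
    (h : ‖T l k‖ * (freq l + freq k) ^ (n + 2) ≤ C) :
    ‖normalize T l k‖ ≤ C * (freq k ^ n)⁻¹ * (freq l)⁻¹ := by
  have hk := freq_pos k
  have hl := freq_pos l
  have h1 : ‖normalize T l k‖ ≤ ‖T l k‖ * freq k := by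
    rw [normalize, norm_mul, norm_mul, norm_inv, Complex.norm_real, Complex.norm_real,
      Real.norm_of_nonneg (rt_pos k).le, Real.norm_of_nonneg (rt_pos l).le]
    exact mul_le_mul (mul_le_of_le_one_left (norm_nonneg _) (inv_le_one_of_one_le₀ (one_le_rt l)))
      (rt_le k) (rt_pos k).le (norm_nonneg _)
  have h2 : freq k ^ (n + 1) * freq l ≤ (freq l + freq k) ^ (n + 2) := by
    rw [pow_succ (freq l + freq k)]
    gcongr <;> linarith
  have h3 : ‖T l k‖ * (freq k ^ (n + 1) * freq l) ≤ C :=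
    (mul_le_mul_of_nonneg_left h2 (norm_nonneg _)).trans h
  rw [mul_assoc, ← mul_inv, ← div_eq_mul_inv, le_div_iff₀ (by positivity)]
  calc ‖normalize T l k‖ * (freq k ^ n * freq l) ≤ ‖T l k‖ * freq k * (freq k ^ n * freq l) := by
        gcongr
    _ = ‖T l k‖ * (freq k ^ (n + 1) * freq l) := by ring
    _ ≤ C := h3

/-- Only entries between frequencies of opposite signs survive in the off-diagonal blocks, and these
decay rapidly. -/
theorem SymplecticPair.column_decay {U W : NZ → NZ → ℂ} (h : SymplecticPair U W)
    {P N A B : SeqH →L[ℂ] SeqH} (hP : ∀ x k, P x k = cut posFreq x k)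
    (hN : ∀ x k, N x k = cut negFreq x k) (hA : ∀ x k, A x k = mulVec (normalize U) x k)
    (hB : ∀ x k, B x k = mulVec (normalize W) x k) (n : ℕ) :
    ∃ C : ℝ, ∀ k, ‖N (A (P (seqBasis k))) + P (B (N (seqBasis k)))‖ * freq k ^ n ≤ C := by
  classical
  obtain ⟨C₁, hC₁⟩ := h.oppU (n + 2)
  obtain ⟨C₂, hC₂⟩ := h.oppW (n + 2)
  have h0 : 0 ≤ max 0 (max C₁ C₂) := le_max_left _ _
  refine ⟨max 0 (max C₁ C₂) * √(∑' l : NZ, (freq l ^ 2)⁻¹), fun k => ?_⟩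
  have hk := freq_pos k
  have key := norm_le_of_coord (y := N (A (P (seqBasis k))) + P (B (N (seqBasis k))))
    (c := max 0 (max C₁ C₂) * (freq k ^ n)⁻¹) (fun l => ?_)
  · calc _ ≤ _ := mul_le_mul_of_nonneg_right key (by positivity)
      _ = _ := by field_simp
  have hl := freq_pos l
  change ‖N (A (P (seqBasis k))) l + P (B (N (seqBasis k))) l‖ ≤ _
  rw [hN, hP, cutOp_seqBasis hP, cutOp_seqBasis hN, cut_apply, cut_apply]
  simp only [mem_negFreq_iff]
  have h00 : (0 : SeqH) l = 0 := rfl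
  by_cases hkp : k ∈ posFreq <;> by_cases hlp : l ∈ posFreq
  · simp only [hkp, hlp, not_true_eq_false, if_true, if_false, map_zero]
    rw [h00, add_zero, norm_zero]
    positivity
  · simp only [hkp, hlp, not_true_eq_false, not_false_eq_true, if_true, if_false, add_zero]
    rw [hA, mulVec_seqBasis]
    refine norm_normalize_le ((hC₁ l k ?_).trans ((le_max_left _ _).trans (le_max_right _ _)))
    rw [mem_negFreq_iff]; tauto
  · simp only [hkp, hlp, not_true_eq_false, not_false_eq_true, if_true, if_false, zero_add]
    rw [hB, mulVec_seqBasis]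
    refine norm_normalize_le ((hC₂ l k ?_).trans ((le_max_right _ _).trans (le_max_right _ _)))
    rw [mem_negFreq_iff]; tauto
  · simp only [hkp, hlp, not_false_eq_true, if_true, if_false, map_zero]
    rw [h00, add_zero, norm_zero]
    positivity

/-- `S` is the scattering matrix of the pair `(U, W)`, with smoothing remainder `R`. -/
structure IsScatteringMatrix (U W S R : NZ → NZ → ℂ) : Prop where
  rapid : IsRapid R
  eq : ∀ k l, S k l = mask posFreq W k l + mask negFreq U k l + R k l
  norm : ∀ a, wsq (-1 / 2) a < ⊤ → wsq (-1 / 2) (mulVec S a) = wsq (-1 / 2) a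
  surj : ∀ b, wsq (-1 / 2) b < ⊤ → ∃ a, wsq (-1 / 2) a < ⊤ ∧ mulVec S a = b
  iff : ∀ a o, wsq (-1 / 2) a < ⊤ → wsq (-1 / 2) o < ⊤ →
    ((∀ k, cut posFreq a k + cut negFreq o k
      = mulVec U (fun l => cut negFreq a l + cut posFreq o l) k) ↔ o = mulVec S a)

/-- Each entry is bounded by a rapidly decreasing function of k and by one of l. The bound in the
larger frequency gives decay in |k| + |l|; the factor |k|^{1/2}|l|^{-1/2} costs one power. -/
theorem IsRapid.of_op {X : SeqH →L[ℂ] SeqH} {Y : SeqH → SeqH} {Z : SeqH → SeqH}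
    (h1 : ∀ k l, ‖X (seqBasis l) k‖ ≤ ‖Y (seqBasis k)‖)
    (h2 : ∀ k l, ‖X (seqBasis l) k‖ ≤ ‖Z (seqBasis l)‖)
    (hY : ∀ n : ℕ, ∃ C : ℝ, ∀ k, ‖Y (seqBasis k)‖ * freq k ^ n ≤ C)
    (hZ : ∀ n : ℕ, ∃ C : ℝ, ∀ k, ‖Z (seqBasis k)‖ * freq k ^ n ≤ C) :
    IsRapid fun k l => (rt k : ℂ) * X (seqBasis l) k * ((rt l : ℝ) : ℂ)⁻¹ := by
  intro m
  obtain ⟨C, hC⟩ := hY (m + 1)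
  obtain ⟨D, hD⟩ := hZ (m + 1)
  refine ⟨2 ^ m * max C D, fun k l => ?_⟩
  have hk := freq_pos k
  have hl := freq_pos l
  have h3 : ‖(rt k : ℂ) * X (seqBasis l) k * ((rt l : ℝ) : ℂ)⁻¹‖ ≤ freq k * ‖X (seqBasis l) k‖ := by
    rw [norm_mul, norm_mul, norm_inv, Complex.norm_real, Complex.norm_real,
      Real.norm_of_nonneg (rt_pos k).le, Real.norm_of_nonneg (rt_pos l).le]
    calc _ ≤ rt k * ‖X (seqBasis l) k‖ := mul_le_of_le_one_right
          (mul_nonneg (rt_pos k).le (norm_nonneg _)) (inv_le_one_of_one_le₀ (one_le_rt l))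
      _ ≤ _ := by gcongr; exact rt_le k
  refine (mul_le_mul_of_nonneg_right h3 (by positivity)).trans ?_
  rcases le_total (freq l) (freq k) with hle | hle
  · calc freq k * ‖X (seqBasis l) k‖ * (freq k + freq l) ^ m
        ≤ freq k * ‖Y (seqBasis k)‖ * (2 * freq k) ^ m := by
          gcongr
          · exact h1 k l
          · linarith
      _ = 2 ^ m * (‖Y (seqBasis k)‖ * freq k ^ (m + 1)) := by rw [mul_pow]; ring
      _ ≤ _ := by gcongr; exact (hC k).trans (le_max_left _ _)
  · calc freq k * ‖X (seqBasis l) k‖ * (freq k + freq l) ^ m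
        ≤ freq l * ‖Z (seqBasis l)‖ * (2 * freq l) ^ m := by
          gcongr
          · exact h2 k l
          · linarith
      _ = 2 ^ m * (‖Z (seqBasis l)‖ * freq l ^ (m + 1)) := by rw [mul_pow]; ring
      _ ≤ _ := by gcongr; exact (hD l).trans (le_max_right _ _)

/-- The point of `ℓ²` with coordinates `|k|^{-1/2} a_k`. -/
def toSeq (a : NZ → ℂ) (ha : wsq (-1 / 2) a < ⊤) : SeqH :=
  ⟨down a, memlp_of_wsq (by rwa [wsq_down])⟩

theorem wsq_coe_lt (x : SeqH) : wsq (-1 / 2) (up x) < ⊤ := by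
  rw [wsq_up, wsq_zero_coe]; exact ENNReal.ofReal_lt_top

theorem toSeq_up (x : SeqH) : toSeq (up x) (wsq_coe_lt x) = x := by
  ext k
  exact congrFun (down_up x) k

theorem wsq_eq_toSeq (a : NZ → ℂ) (ha : wsq (-1 / 2) a < ⊤) :
    wsq (-1 / 2) a = ENNReal.ofReal (‖toSeq a ha‖ ^ 2) := by
  rw [← wsq_zero_coe, ← wsq_down]; rfl

theorem cut_down (s : Set NZ) (a : NZ → ℂ) : cut s (down a) = down (cut s a) := by
  classical
  funext k
  rw [cut_apply, down, down, cut_apply]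
  split_ifs <;> simp

theorem down_injective : Function.Injective down := fun a b h => by
  rw [← up_down a, h, up_down]

/-- The normalization is undone: S is the matrix of the Krein scattering operator conjugated by
|k|^{1/2}, and R that of its difference from the diagonal blocks. The rows of R are controlled by
the pair (U, W), its columns by the inverse pair, which also gives surjectivity. -/
theorem SymplecticPair.exists_isScatteringMatrix {U W : NZ → NZ → ℂ} (h : SymplecticPair U W) :
    ∃ S R, IsScatteringMatrix U W S R := by
  classical
  obtain ⟨P, N, A, B, hK, hP, hN, hA, hB⟩ := h.exists_kreinPair
  obtain ⟨S, hS⟩ := hK.exists_scattering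
  obtain ⟨S', hS'⟩ := hK.symm.exists_scattering
  have hmul : ∀ a ha, mulVec (fun k l => (rt k : ℂ) * S (seqBasis l) k * ((rt l : ℝ) : ℂ)⁻¹) a
      = up (S (toSeq a ha)) := by
    intro a ha
    funext k
    rw [up, ← (hasSum_op S (toSeq a ha) k).tsum_eq, ← tsum_mul_left, mulVec]
    congr 1
    funext l
    change _ = _ * (_ * (((rt l : ℝ) : ℂ)⁻¹ * a l))
    ring
  let X : SeqH →L[ℂ] SeqH := S - (P.comp (B.comp P) + N.comp (A.comp N))
  refine ⟨fun k l => (rt k : ℂ) * S (seqBasis l) k * ((rt l : ℝ) : ℂ)⁻¹,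
    fun k l => (rt k : ℂ) * X (seqBasis l) k * ((rt l : ℝ) : ℂ)⁻¹, ?_, fun k l => ?_,
    fun a ha => ?_, fun b hb => ?_, fun a o ha ho => ?_⟩
  · refine IsRapid.of_op (Y := fun x => N (A (P x)) + P (B (N x)))
      (Z := fun x => N (B (P x)) + P (A (N x))) (fun k l => ?_) (fun k l => ?_)
      (h.column_decay hP hN hA hB) (h.symm.column_decay hP hN hB hA)
    · have := hK.inner_scattering_sub hS (seqBasis k) (seqBasis l)
      rwa [inner_seqBasis, norm_seqBasis, mul_one] at this
    · have := hK.inner_scattering_sub' hS (seqBasis k) (seqBasis l)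
      rwa [inner_seqBasis, norm_seqBasis, mul_one] at this
  · have h1 : S (seqBasis l) k = P (B (P (seqBasis l))) k + N (A (N (seqBasis l))) k
        + X (seqBasis l) k := by
      change _ = _ + _ + (S (seqBasis l) k - (P (B (P (seqBasis l))) k + N (A (N (seqBasis l))) k))
      ring
    have hk := rt_ne k
    have hl := rt_ne l
    have h2 : P (B (P (seqBasis l))) k = ((rt k : ℝ) : ℂ)⁻¹ * mask posFreq W k l * (rt l : ℝ) := by
      rw [hP, cut_apply, cutOp_seqBasis hP, mask_apply]
      split_ifs
      · rw [hB, mulVec_seqBasis, normalize]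
      · simp
      · simp
    have h3 : N (A (N (seqBasis l))) k = ((rt k : ℝ) : ℂ)⁻¹ * mask negFreq U k l * (rt l : ℝ) := by
      rw [hN, cut_apply, cutOp_seqBasis hN, mask_apply]
      split_ifs
      · rw [hA, mulVec_seqBasis, normalize]
      · simp
      · simp
    rw [h1, h2, h3]
    field_simp
  · rw [hmul a ha, wsq_up, wsq_zero_coe, hK.norm_scattering hS, ← wsq_eq_toSeq]
  · refine ⟨up (S' (toSeq b hb)), wsq_coe_lt _, ?_⟩
    rw [hmul _ (wsq_coe_lt _), toSeq_up, hK.symm.scattering_inv hS' hS]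
    exact up_down b
  · rw [hmul a ha, ← down_injective.eq_iff, down_up]
    have h1 := hS (toSeq a ha) (toSeq o ho)
    have h2 : toSeq o ho = S (toSeq a ha) ↔ down o = S (toSeq a ha) := by
      rw [Subtype.ext_iff]; rfl
    rw [← h2, ← h1]
    have h3 : (P (toSeq a ha) + N (toSeq o ho) = A (N (toSeq a ha) + P (toSeq o ho))) ↔
        ∀ k, P (toSeq a ha) k + N (toSeq o ho) k = A (N (toSeq a ha) + P (toSeq o ho)) k := by
      constructor
      · intro h k
        rw [← h]; rfl
      · intro h
        ext k
        exact h k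
    rw [h3]
    refine forall_congr' fun k => ?_
    have h4 : (N (toSeq a ha) + P (toSeq o ho) : SeqH)
        = down (fun l => cut negFreq a l + cut posFreq o l) := by
      funext l
      change N (toSeq a ha) l + P (toSeq o ho) l = _
      rw [hN, hP]
      change cut negFreq (down a) l + cut posFreq (down o) l = _
      rw [cut_down, cut_down, down, down, down, mul_add]
    rw [hA, h4, mulVec_normalize, up_down, hP, hN]
    change _ ↔ cut posFreq (down a) k + cut negFreq (down o) k = _
    rw [cut_down, cut_down, down, down, down, ← mul_add,
      mul_right_inj' (inv_ne_zero (rt_ne k))]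

namespace IsScatteringMatrix

variable {U W S R : NZ → NZ → ℂ}

theorem summable (hS : IsScatteringMatrix U W S R) (h : SymplecticPair U W) {a : NZ → ℂ}
    (ha : Tempered a) (k : NZ) : Summable fun l => S k l * a l := by
  refine ((((h.bandW.mask posFreq).summable ha k).add
    ((h.bandU.mask negFreq).summable ha k)).add (hS.rapid.summable ha k)).congr fun l => ?_
  rw [hS.eq]; ring

theorem mulVec_eq (hS : IsScatteringMatrix U W S R) (h : SymplecticPair U W) {a : NZ → ℂ}
    (ha : Tempered a) (k : NZ) :
    mulVec S a k = mulVec (mask posFreq W) a k + mulVec (mask negFreq U) a k + mulVec R a k := by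
  have h1 := (h.bandW.mask posFreq).summable ha k
  have h2 := (h.bandU.mask negFreq).summable ha k
  rw [mulVec, mulVec, mulVec, mulVec, ← h1.tsum_add h2,
    ← (h1.add h2).tsum_add (hS.rapid.summable ha k)]
  congr 1
  funext l
  rw [hS.eq]; ring

/-- The isometry concerns the order -1/2 only. For general s the bound comes from writing S as two
band matrices plus a rapidly decaying one. -/
theorem wsq_le (hS : IsScatteringMatrix U W S R) (h : SymplecticPair U W) (s : ℝ) :
    ∃ D : NNReal, ∀ a : NZ → ℂ, wsq s a < ⊤ → wsq s (mulVec S a) ≤ D * wsq s a := by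
  obtain ⟨D₁, hD₁⟩ := (h.bandW.mask posFreq).wsq_le s
  obtain ⟨D₂, hD₂⟩ := (h.bandU.mask negFreq).wsq_le s
  obtain ⟨D₃, hD₃⟩ := hS.rapid.wsq_le s
  refine ⟨2 * (2 * (D₁ + D₂) + D₃), fun a ha => ?_⟩
  have : mulVec S a = fun k => (mulVec (mask posFreq W) a k + mulVec (mask negFreq U) a k)
      + mulVec R a k := by
    funext k
    exact hS.mulVec_eq h (tempered_of_wsq ha) k
  rw [this]
  refine (wsq_add_le s _ _).trans ?_
  push_cast
  rw [mul_assoc, add_mul, mul_assoc, add_mul]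
  gcongr
  · refine (wsq_add_le s _ _).trans ?_
    gcongr
    · exact hD₁ a ha
    · exact hD₂ a ha
  · exact hD₃ a ha

end IsScatteringMatrix

/-- For growth of order m the weight |k|^{-2m-2} leaves the convergent series of |k|^{-2}. This lets
a matrix that is bounded on all weighted spaces act on all distributions. -/
theorem Tempered.exists_wsq {a : NZ → ℂ} (ha : Tempered a) : ∃ s : ℝ, wsq s a < ⊤ := by
  obtain ⟨m, C, hC⟩ := ha
  refine ⟨-(m : ℝ) - 1, ?_⟩
  have hs : Summable fun k : NZ => C ^ 2 * (freq k ^ 2)⁻¹ := summable_freq.mul_left _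
  refine lt_of_le_of_lt (ENNReal.tsum_le_tsum fun k => ?_)
    (hs.tsum_ofReal_lt_top)
  have hk := freq_pos k
  rw [← ofReal_norm_sq, ← ENNReal.ofReal_mul (by positivity)]
  refine ENNReal.ofReal_le_ofReal ?_
  have h1 : freq k ^ (2 * (-(m : ℝ) - 1)) = (freq k ^ m)⁻¹ ^ 2 * (freq k ^ 2)⁻¹ := by
    rw [show 2 * (-(m : ℝ) - 1) = -((2 * m + 2 : ℕ) : ℝ) by push_cast; ring, Real.rpow_neg hk.le,
      Real.rpow_natCast, pow_add, mul_inv, inv_pow, ← pow_mul,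
      mul_comm 2 m]
  rw [h1]
  calc (freq k ^ m)⁻¹ ^ 2 * (freq k ^ 2)⁻¹ * ‖a k‖ ^ 2
      ≤ (freq k ^ m)⁻¹ ^ 2 * (freq k ^ 2)⁻¹ * (C * freq k ^ m) ^ 2 := by
        gcongr; exact hC k
    _ = _ := by field_simp

end ScatteringMatrix

/-! ### The pair given by a lift of a diffeomorphism of the torus -/

section Pair

variable {lam : Ioo (0 : ℝ) 1} {β : ℝ → ℝ}

/-- The matrix of `β^*` on the nonzero frequencies. -/
def pullNZ (lam : Ioo (0 : ℝ) 1) (β : ℝ → ℝ) (k l : NZ) : ℂ := pullMatrix lam β k l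

theorem pullNZ_isBand (hβ : IsLift (period lam) β) : IsBand (pullNZ lam β) where
  bounded := by
    classical
    obtain ⟨M, hM⟩ := pullMatrix_bounded (lam := lam) hβ
    refine ⟨M, fun s a => ?_⟩
    have h := hM (s.map (Function.Embedding.subtype _))
      (Function.extend (Subtype.val : NZ → ℤ) a 0)
    simp only [Finset.sum_map, Function.Embedding.subtype_apply,
      Subtype.val_injective.extend_apply] at h
    refine le_trans ?_ h
    exact ENNReal.tsum_comp_le_tsum_of_injective Subtype.val_injective
      (fun k : ℤ => ‖∑ l ∈ s, pullMatrix lam β k l * a l‖ₑ ^ 2)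
  band := by
    obtain ⟨K, hK, h⟩ := exists_pullMatrix_band (lam := lam) hβ
    refine ⟨K, hK, fun m => ?_⟩
    obtain ⟨C, hC⟩ := h m
    refine ⟨C, fun k l hkl => hC k l (fun h0 => k.2 (Prod.ext_iff.1 h0).1) ?_⟩
    rcases hkl with h1 | h1
    · exact Or.inl h1
    · exact Or.inr (Or.inl h1)

theorem pullNZ_opp (hβ : IsLift (period lam) β) (m : ℕ) :
    ∃ C : ℝ, ∀ k l : NZ, (k ∈ posFreq ↔ l ∈ negFreq) →
      ‖pullNZ lam β k l‖ * (freq k + freq l) ^ m ≤ C := by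
  obtain ⟨K, hK, h⟩ := exists_pullMatrix_band (lam := lam) hβ
  obtain ⟨C, hC⟩ := h m
  refine ⟨C, fun k l hkl => hC k l (fun h0 => k.2 (Prod.ext_iff.1 h0).1) (Or.inr (Or.inr ?_))⟩
  have hkl' : 0 < (k : ℤ) ↔ (l : ℤ) < 0 := hkl
  have hk := k.2
  have hl := l.2
  rcases lt_or_gt_of_ne hk with h1 | h1
  · have h2 : 0 < (l : ℤ) := by omega
    exact mul_nonpos_of_nonpos_of_nonneg (by exact_mod_cast h1.le) (by exact_mod_cast h2.le)
  · have h2 : (l : ℤ) < 0 := by omega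
    exact mul_nonpos_of_nonneg_of_nonpos (by exact_mod_cast h1.le) (by exact_mod_cast h2.le)

/-- The intermediate frequency 0 contributes nothing, since pullbacks preserve mean zero, so the
inverse relation survives the restriction to nonzero frequencies. -/
theorem pullNZ_mul_inv (hβ : IsLift (period lam) β) (k l : NZ) :
    HasSum (fun m => pullNZ lam β k m * pullNZ lam (Function.invFun β) m l)
      (if k = l then 1 else 0) := by
  have h := hasSum_pullMatrix_mul_inv (lam := lam) hβ k l
  have h1 : Function.support (fun m : ℤ => pullMatrix lam β k m *
      pullMatrix lam (Function.invFun β) m l) ⊆ range (Subtype.val : NZ → ℤ) := by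
    intro m hm
    rw [Subtype.range_coe_subtype]
    rintro rfl
    exact hm (by simp only [pullMatrix_zero hβ.inv l l.2, mul_zero])
  rw [← Subtype.val_injective.hasSum_iff (fun m hm => by_contra fun h2 => hm (h1 h2))] at h
  simp only [Subtype.val_inj] at h
  exact h

theorem symplecticPair_pullNZ (hβ : IsLift (period lam) β) :
    SymplecticPair (pullNZ lam β) (pullNZ lam (Function.invFun β)) where
  bandU := pullNZ_isBand hβ
  bandW := pullNZ_isBand hβ.inv
  UW := pullNZ_mul_inv hβ
  WU k l := by
    have := pullNZ_mul_inv hβ.inv k l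
    rwa [hβ.invFun_invFun] at this
  rel k l := mul_pullMatrix_inv hβ k l
  oppU := pullNZ_opp hβ
  oppW := pullNZ_opp hβ.inv

end Pair

/-! ### Fourier series of smooth functions and of distributions -/

section Distributions

variable {lam : Ioo (0 : ℝ) 1}

/-- The factor `i c k` by which the derivative acts on the mode `k`. -/
def modeFactor (lam : Ioo (0 : ℝ) 1) (k : ℤ) : ℂ :=
  2 * Real.pi * Complex.I * k / ((period lam : ℝ) : ℂ)

theorem hasDerivAt_mode (k : ℤ) (x : ℝ) :
    HasDerivAt (fun y : ℝ => (fourier k (y : Torus lam) : ℂ))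
      (modeFactor lam k * fourier k (x : Torus lam)) x := by
  have := hasDerivAt_fourier (period lam) k x
  exact this

theorem norm_modeFactor (k : ℤ) : ‖modeFactor lam k‖ = 2 * Real.pi / period lam * |(k : ℝ)| := by
  have hp := period_pos lam
  rw [modeFactor, norm_div, norm_mul, norm_mul, norm_mul, Complex.norm_I, Complex.norm_real,
    Complex.norm_real, Complex.norm_intCast, Real.norm_of_nonneg hp.le,
    Real.norm_of_nonneg Real.pi_pos.le, Complex.norm_ofNat]
  ring

theorem iteratedDeriv_mode (k : ℤ) (j : ℕ) (x : ℝ) :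
    iteratedDeriv j (fun y : ℝ => (fourier k (y : Torus lam) : ℂ)) x
      = modeFactor lam k ^ j * fourier k (x : Torus lam) := by
  induction j generalizing x with
  | zero => simp
  | succ j ih =>
    rw [iteratedDeriv_succ, funext ih, ((hasDerivAt_mode k x).const_mul _).deriv]
    ring

theorem TestFn.contDiff (φ : TestFn lam) :
    ContDiff ℝ ∞ fun x : ℝ => (φ : Torus lam → ℂ) (x : Torus lam) := φ.2

theorem TestFn.periodic (φ : TestFn lam) :
    Function.Periodic (fun x : ℝ => (φ : Torus lam → ℂ) (x : Torus lam)) (period lam) := fun x => by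
  simp only [AddCircle.coe_add_period]

/-- A test function as a continuous map. -/
def TestFn.toC (φ : TestFn lam) : C(Torus lam, ℂ) := ⟨φ, TestFn.continuous φ⟩

theorem TestFn.exists_deriv (φ : TestFn lam) :
    ∃ ψ : TestFn lam, (∀ x : ℝ, (ψ : Torus lam → ℂ) x
      = deriv (fun y : ℝ => (φ : Torus lam → ℂ) (y : Torus lam)) x) ∧
      ∀ k, fourierCoeff (ψ : Torus lam → ℂ) k
        = modeFactor lam k * fourierCoeff (φ : Torus lam → ℂ) k := by
  set f : ℝ → ℂ := fun y : ℝ => (φ : Torus lam → ℂ) (y : Torus lam) with hf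
  have hsm : ContDiff ℝ ∞ (deriv f) := ((contDiff_infty_iff_deriv).1 (TestFn.contDiff φ)).2
  have hper : Function.Periodic (deriv f) (period lam) := by
    intro x
    rw [← deriv_comp_add_const, funext (TestFn.periodic φ)]
  have hcoe : ∀ x : ℝ, AddCircle.liftIoc (period lam) 0 (deriv f) (x : Torus lam) = deriv f x :=
    liftIoc_coe_of_periodic hper 0
  refine ⟨⟨AddCircle.liftIoc (period lam) 0 (deriv f), ?_⟩, hcoe, fun k => ?_⟩
  · change ContDiff ℝ ∞ fun x : ℝ => AddCircle.liftIoc (period lam) 0 (deriv f) (x : Torus lam)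
    rwa [funext hcoe]
  · have hp := period_pos lam
    rw [fourierCoeff, fourierCoeff, integral_torus 0, integral_torus 0]
    simp only [hcoe, smul_eq_mul]
    rw [mul_left_comm]
    congr 1
    rw [← intervalIntegral.integral_of_le (by linarith), ← intervalIntegral.integral_of_le (by linarith),
      intervalIntegral.integral_mul_deriv_eq_deriv_mul
        (u' := fun x => modeFactor lam (-k) * fourier (-k) (x : Torus lam))
        (fun x _ => hasDerivAt_mode (-k) x)
        (fun x _ => ((TestFn.contDiff φ).differentiable (by simp) x).hasDerivAt), ← intervalIntegral.integral_const_mul]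
    · have h1 := (TestFn.periodic φ) 0
      have h2 : (fourier (-k) ((0 + period lam : ℝ) : Torus lam) : ℂ)
          = fourier (-k) ((0 : ℝ) : Torus lam) := by rw [AddCircle.coe_add_period]
      simp only at h1
      rw [h1, h2, sub_self, zero_sub, ← intervalIntegral.integral_neg]
      congr 1
      funext x
      rw [modeFactor, modeFactor]
      push_cast
      ring
    · exact (continuous_const.mul ((map_continuous (fourier (-k))).comp
        (AddCircle.continuous_mk' _))).intervalIntegrable _ _
    · exact hsm.continuous.intervalIntegrable _ _

theorem TestFn.exists_iteratedDeriv (φ : TestFn lam) (j : ℕ) :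
    ∃ ψ : TestFn lam, (∀ x : ℝ, (ψ : Torus lam → ℂ) x
      = iteratedDeriv j (fun y : ℝ => (φ : Torus lam → ℂ) (y : Torus lam)) x) ∧
      ∀ k, fourierCoeff (ψ : Torus lam → ℂ) k
        = modeFactor lam k ^ j * fourierCoeff (φ : Torus lam → ℂ) k := by
  induction j with
  | zero => exact ⟨φ, by simp, by simp⟩
  | succ j ih =>
    obtain ⟨ψ, h1, h2⟩ := ih
    obtain ⟨χ, h3, h4⟩ := (TestFn.exists_deriv ψ)
    refine ⟨χ, fun x => ?_, fun k => ?_⟩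
    · rw [h3, funext h1, iteratedDeriv_succ]
    · rw [h4, h2, pow_succ']; ring

theorem norm_fourierCoeff_le_of_bound {f : Torus lam → ℂ} {B : ℝ} (h : ∀ t, ‖f t‖ ≤ B) (k : ℤ) :
    ‖fourierCoeff f k‖ ≤ B := by
  rw [fourierCoeff]
  refine (norm_integral_le_of_norm_le_const (C := B) (ae_of_all _ fun t => ?_)).trans (by simp)
  rw [norm_smul, fourier_apply, Circle.norm_coe, one_mul]
  exact h t

theorem norm_fourierCoeff_mul_le (φ : TestFn lam) {j : ℕ} {B : ℝ}
    (h : ∀ x : ℝ, ‖iteratedDeriv j (fun y : ℝ => (φ : Torus lam → ℂ) (y : Torus lam)) x‖ ≤ B)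
    (k : ℤ) : ‖fourierCoeff (φ : Torus lam → ℂ) k‖ * ‖modeFactor lam k‖ ^ j ≤ B := by
  obtain ⟨ψ, h1, h2⟩ := (TestFn.exists_iteratedDeriv φ) j
  rw [← norm_pow, mul_comm, ← norm_mul, ← h2]
  refine norm_fourierCoeff_le_of_bound (fun t => ?_) k
  refine torus_induction (P := fun t => ‖(ψ : Torus lam → ℂ) t‖ ≤ B) 0 (fun x _ => ?_) t
  rw [h1]; exact h x

theorem TestFn.exists_bound (φ : TestFn lam) : ∃ B, ∀ t, ‖(φ : Torus lam → ℂ) t‖ ≤ B :=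
  ⟨‖(TestFn.toC φ)‖, (TestFn.toC φ).norm_coe_le_norm⟩

theorem TestFn.rapid (φ : TestFn lam) (j : ℕ) :
    ∃ B, ∀ k : ℤ, ‖fourierCoeff (φ : Torus lam → ℂ) k‖ * ‖modeFactor lam k‖ ^ j ≤ B := by
  obtain ⟨ψ, h1, -⟩ := (TestFn.exists_iteratedDeriv φ) j
  obtain ⟨B, hB⟩ := (TestFn.exists_bound ψ)
  refine ⟨B, norm_fourierCoeff_mul_le φ fun x => ?_⟩
  rw [← h1]; exact hB _

theorem TestFn.summable (φ : TestFn lam) : Summable (fourierCoeff (φ : Torus lam → ℂ)) := by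
  obtain ⟨B, hB⟩ := (TestFn.rapid φ) 2
  have hp := period_pos lam
  have hq : 0 < 2 * Real.pi / period lam := by positivity
  have h1 : Summable fun k : ℤ => B * ((2 * Real.pi / period lam) ^ 2)⁻¹ * (1 / (k : ℝ) ^ 2) :=
    (Real.summable_one_div_int_pow.2 (by norm_num)).mul_left _
  refine Summable.of_norm_bounded_eventually h1 ?_
  refine (Set.finite_singleton (0 : ℤ)).subset fun k hk => ?_
  by_contra hk0
  refine hk ?_
  have hk1 : (k : ℝ) ≠ 0 := by exact_mod_cast hk0
  have h2 := hB k
  rw [norm_modeFactor, mul_pow, sq_abs] at h2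
  change ‖_‖ ≤ _
  rw [one_div, mul_assoc, ← mul_inv, ← div_eq_mul_inv, le_div_iff₀ (by positivity)]
  exact h2

theorem TestFn.hasSum (φ : TestFn lam) :
    HasSum (fun k => fourierCoeff (φ : Torus lam → ℂ) k • (fourier k : C(Torus lam, ℂ))) (TestFn.toC φ) :=
  hasSum_fourier_series_of_summable (f := (TestFn.toC φ)) (TestFn.summable φ)

/-- A distribution acts on the Fourier series of a smooth function termwise. -/
theorem Distr.hasSum (u : Distr lam) (φ : TestFn lam) :
    HasSum (fun k => fourierCoeff (φ : Torus lam → ℂ) k * (u : Module.Dual ℂ (TestFn lam)) (modeFn lam k))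
      ((u : Module.Dual ℂ (TestFn lam)) φ) := by
  obtain ⟨u, m, C, hu⟩ := u
  have hC : 0 ≤ C := by
    have := (norm_nonneg _).trans (hu 0 1 fun j _ x => by
      have : (fun y : ℝ => ((0 : TestFn lam) : Torus lam → ℂ) (y : Torus lam)) = fun _ => 0 := rfl
      rw [this, iteratedDeriv_const]; simp)
    linarith
  -- The Fourier series converges uniformly with its derivatives up to order m, the order that
  -- controls u: the j-th derivative of a partial sum is the partial sum of the Fourier series of
  -- the j-th derivative.
  have hev : ∀ ε > 0, ∀ᶠ F : Finset ℤ in atTop, ∀ j ∈ Finset.range (m + 1), ∀ x : ℝ,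
      ‖iteratedDeriv j (fun y : ℝ => ((φ - ∑ k ∈ F, fourierCoeff (φ : Torus lam → ℂ) k • modeFn lam k :
        TestFn lam) : Torus lam → ℂ) y) x‖ ≤ ε := by
    intro ε hε
    rw [Filter.eventually_all_finset]
    intro j _
    obtain ⟨ψ, h1, h2⟩ := (TestFn.exists_iteratedDeriv φ) j
    have h3 := (TestFn.hasSum ψ)
    rw [HasSum, SummationFilter.unconditional_filter, Metric.tendsto_nhds] at h3
    filter_upwards [h3 ε hε] with F hF x
    rw [dist_comm, dist_eq_norm] at hF
    have h4 : iteratedDeriv j (fun y : ℝ => ((φ - ∑ k ∈ F, fourierCoeff (φ : Torus lam → ℂ) k • modeFn lam k :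
        TestFn lam) : Torus lam → ℂ) y) x = ((TestFn.toC ψ) - ∑ k ∈ F, fourierCoeff (ψ : Torus lam → ℂ) k •
          (fourier k : C(Torus lam, ℂ))) (x : Torus lam) := by
      have e1 : (fun y : ℝ => ((φ - ∑ k ∈ F, fourierCoeff (φ : Torus lam → ℂ) k • modeFn lam k :
        TestFn lam) : Torus lam → ℂ) y) = fun y : ℝ => (φ : Torus lam → ℂ) y
          - ∑ k ∈ F, fourierCoeff (φ : Torus lam → ℂ) k * fourier k (y : Torus lam) := by
        funext y
        simp [modeFn]
      have hm : ∀ k, ContDiff ℝ ∞ fun y : ℝ => (fourier k (y : Torus lam) : ℂ) :=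
        fun k => TestFn.contDiff (modeFn lam k)
      have hs : ∀ k ∈ F, ContDiffAt ℝ j (fun y : ℝ => fourierCoeff (φ : Torus lam → ℂ) k * fourier k (y : Torus lam)) x :=
        fun k _ => (contDiff_infty.1 (contDiff_const.mul (hm k)) j).contDiffAt
      rw [e1, iteratedDeriv_fun_sub (contDiff_infty.1 (TestFn.contDiff φ) j).contDiffAt (ContDiffAt.sum hs),
        iteratedDeriv_fun_sum hs, ← h1]
      simp only [ContinuousMap.sub_apply, ContinuousMap.coe_sum, Finset.sum_apply,
        ContinuousMap.smul_apply, h2, smul_eq_mul]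
      congr 1
      refine Finset.sum_congr rfl fun k _ => ?_
      rw [iteratedDeriv_const_mul_field, iteratedDeriv_mode]
      ring
    rw [h4]
    exact (ContinuousMap.norm_coe_le_norm _ _).trans hF.le
  rw [HasSum, SummationFilter.unconditional_filter, Metric.tendsto_nhds]
  intro ε hε
  filter_upwards [hev (ε / (C + 1)) (by positivity)] with F hF
  rw [dist_comm, dist_eq_norm]
  have h1 := hu _ _ fun j hj x => hF j (Finset.mem_range.2 (by omega)) x
  have h2 : u φ - ∑ k ∈ F, fourierCoeff (φ : Torus lam → ℂ) k * u (modeFn lam k)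
      = u (φ - ∑ k ∈ F, fourierCoeff (φ : Torus lam → ℂ) k • modeFn lam k) := by
    rw [map_sub, map_sum]
    simp
  rw [h2]
  refine h1.trans_lt ?_
  rw [mul_div_assoc', div_lt_iff₀ (by positivity)]
  nlinarith

theorem Distr.ext_coeff {u v : Distr lam}
    (h : ∀ k, coeff (u : Module.Dual ℂ (TestFn lam)) k = coeff (v : Module.Dual ℂ (TestFn lam)) k) :
    u = v := by
  have hp : ((period lam : ℝ) : ℂ)⁻¹ ≠ 0 := inv_ne_zero (by exact_mod_cast (period_pos lam).ne')
  ext φ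
  have h1 : ∀ k, (u : Module.Dual ℂ (TestFn lam)) (modeFn lam k)
      = (v : Module.Dual ℂ (TestFn lam)) (modeFn lam k) := fun k => by
    have := h (-k)
    rw [coeff, coeff, neg_neg] at this
    exact mul_left_cancel₀ hp this
  have h2 := (Distr.hasSum u) φ
  simp_rw [h1] at h2
  exact h2.unique ((Distr.hasSum v) φ)

theorem fourierCoeff_add' {f g : Torus lam → ℂ} (hf : Continuous f) (hg : Continuous g) (k : ℤ) :
    fourierCoeff (fun t => f t + g t) k = fourierCoeff f k + fourierCoeff g k :=
  congrFun (fourierCoeff.add (f := f) (g := g)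
    (hf.integrable_of_hasCompactSupport (HasCompactSupport.of_compactSpace _))
    (hg.integrable_of_hasCompactSupport (HasCompactSupport.of_compactSpace _))) k

/-- The coefficients with nonzero frequency. -/
def coeffNZ (u : Module.Dual ℂ (TestFn lam)) (k : NZ) : ℂ := coeff u k

theorem Distr.tempered (u : Distr lam) : Tempered (coeffNZ (u : Module.Dual ℂ (TestFn lam))) := by
  obtain ⟨u, m, C, hu⟩ := u
  have hp := period_pos lam
  set q := 2 * Real.pi / period lam with hq
  have hq0 : 0 < q := by positivity
  refine ⟨m, (period lam)⁻¹ * (C * (1 + q) ^ m), fun k => ?_⟩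
  have h1 := hu (modeFn lam (-k)) (((1 + q) * freq k) ^ m) fun j hj x => ?_
  · rw [coeffNZ, coeff, norm_mul, norm_inv, Complex.norm_real, Real.norm_of_nonneg hp.le, mul_assoc]
    refine mul_le_mul_of_nonneg_left (h1.trans_eq ?_) (by positivity)
    rw [mul_pow]; ring
  · change ‖iteratedDeriv j (fun y : ℝ => (fourier (-(k : ℤ)) (y : Torus lam) : ℂ)) x‖ ≤ _
    rw [iteratedDeriv_mode, norm_mul, fourier_apply, Circle.norm_coe, mul_one, norm_pow,
      norm_modeFactor, Int.cast_neg, abs_neg]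
    have h2 : q * freq k ≤ (1 + q) * freq k := by nlinarith [freq_pos k]
    have h3 : 1 ≤ (1 + q) * freq k := by nlinarith [one_le_freq k]
    calc (q * freq k) ^ j ≤ ((1 + q) * freq k) ^ j := by
          have := freq_pos k
          gcongr
      _ ≤ _ := pow_le_pow_right₀ h3 hj

/-- The series ∑ a_k φ̂(-k) converges because φ̂ decreases rapidly. For growth of order m it is
bounded by the derivative of φ of order m + 2, the two extra derivatives giving summability, so it
defines a distribution. -/
theorem exists_distr {a : NZ → ℂ} (ha : Tempered a) :
    ∃ u : DistrZero lam, coeffNZ (u : Module.Dual ℂ (TestFn lam)) = a := by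
  obtain ⟨m, C, hC⟩ := ha
  have hp := period_pos lam
  have hpC : ((period lam : ℝ) : ℂ) ≠ 0 := by exact_mod_cast hp.ne'
  set q := 2 * Real.pi / period lam with hq
  have hq0 : 0 < q := by positivity
  have hC0 : 0 ≤ C := by
    have h1 := (norm_nonneg _).trans (hC ⟨1, one_ne_zero⟩)
    have h2 := pow_pos (freq_pos ⟨1, one_ne_zero⟩) m
    by_contra! h3
    have := mul_neg_of_neg_of_pos h3 h2
    linarith
  have hterm : ∀ (φ : TestFn lam) (B : ℝ), (∀ x : ℝ, ‖iteratedDeriv (m + 2) (fun y : ℝ =>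
      (φ : Torus lam → ℂ) (y : Torus lam)) x‖ ≤ B) → ∀ k : NZ,
      ‖a k * fourierCoeff (φ : Torus lam → ℂ) (-k)‖ ≤ C * (q ^ (m + 2))⁻¹ * B * (freq k ^ 2)⁻¹ := by
    intro φ B hB k
    have hk := freq_pos k
    have h1 := norm_fourierCoeff_mul_le φ hB (-k)
    rw [norm_modeFactor, Int.cast_neg, abs_neg, mul_pow] at h1
    change _ * (_ * freq k ^ (m + 2)) ≤ _ at h1
    have h2 : ‖fourierCoeff (φ : Torus lam → ℂ) (-k)‖ ≤ B * (q ^ (m + 2) * freq k ^ (m + 2))⁻¹ := by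
      rw [← div_eq_mul_inv, le_div_iff₀ (by positivity)]
      exact h1
    rw [norm_mul]
    calc _ ≤ (C * freq k ^ m) * (B * (q ^ (m + 2) * freq k ^ (m + 2))⁻¹) := by
          gcongr
          exact hC k
      _ = _ := by rw [pow_add (freq k)]; field_simp
  have hbd : ∀ φ : TestFn lam, ∃ B, ∀ x : ℝ, ‖iteratedDeriv (m + 2) (fun y : ℝ =>
      (φ : Torus lam → ℂ) (y : Torus lam)) x‖ ≤ B := by
    intro φ
    obtain ⟨ψ, h1, -⟩ := (TestFn.exists_iteratedDeriv φ) (m + 2)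
    obtain ⟨B, hB⟩ := (TestFn.exists_bound ψ)
    exact ⟨B, fun x => by rw [← h1]; exact hB _⟩
  have hsum : ∀ φ : TestFn lam, Summable fun k : NZ => a k * fourierCoeff (φ : Torus lam → ℂ) (-k) := by
    intro φ
    obtain ⟨B, hB⟩ := hbd φ
    exact Summable.of_norm_bounded (summable_freq.mul_left _) (hterm φ B hB)
  let v : Module.Dual ℂ (TestFn lam) :=
    { toFun := fun φ => ((period lam : ℝ) : ℂ) * ∑' k : NZ, a k * fourierCoeff (φ : Torus lam → ℂ) (-k)
      map_add' := fun φ ψ => by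
        rw [← mul_add, ← (hsum φ).tsum_add (hsum ψ)]
        congr 2
        funext k
        rw [← mul_add, ← fourierCoeff_add' (TestFn.continuous φ) (TestFn.continuous ψ)]
        rfl
      map_smul' := fun c φ => by
        rw [RingHom.id_apply, smul_eq_mul, mul_left_comm, ← tsum_mul_left (a := c)]
        congr 2
        funext k
        rw [mul_left_comm]
        congr 1
        exact fourierCoeff.const_mul (φ : Torus lam → ℂ) c (-k) }
  have hmode : ∀ n : ℤ, v (modeFn lam n) = ((period lam : ℝ) : ℂ) *
      ∑' k : NZ, a k * if (-k : ℤ) = n then 1 else 0 := by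
    intro n
    change _ * ∑' k : NZ, a k * fourierCoeff (fourier n : Torus lam → ℂ) (-k) = _
    congr 2
    funext k
    rw [fourierCoeff_fourier, Pi.single_apply]
  refine ⟨⟨v, ⟨m + 2, period lam * (C * (q ^ (m + 2))⁻¹ * ∑' k : NZ, (freq k ^ 2)⁻¹), fun φ B hB => ?_⟩,
    ?_⟩, ?_⟩
  · change ‖((period lam : ℝ) : ℂ) * ∑' k : NZ, a k * fourierCoeff (φ : Torus lam → ℂ) (-k)‖ ≤ _
    rw [norm_mul, Complex.norm_real, Real.norm_of_nonneg hp.le, mul_assoc (period lam)]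
    refine mul_le_mul_of_nonneg_left ?_ hp.le
    have h1 := tsum_of_norm_bounded (summable_freq.mul_left _).hasSum (hterm φ B (hB (m + 2) le_rfl))
    refine h1.trans_eq ?_
    rw [tsum_mul_left]; ring
  · change v (modeFn lam 0) = 0
    rw [hmode, tsum_eq_single ⟨1, one_ne_zero⟩, if_neg (by norm_num)]
    · simp
    · intro k _
      rw [if_neg (neg_ne_zero.2 k.2), mul_zero]
  · funext n
    change _ * v (modeFn lam (-n)) = _
    rw [hmode, inv_mul_cancel_left₀ hpC, tsum_eq_single n]
    · simp
    · intro k hk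
      rw [if_neg fun h => hk (Subtype.ext (neg_injective h)), mul_zero]

theorem coeff_zero (u : DistrZero lam) : coeff (u : Module.Dual ℂ (TestFn lam)) 0 = 0 := by
  have h : (u : Module.Dual ℂ (TestFn lam)) (modeFn lam 0) = 0 := u.2.2
  rw [coeff, neg_zero, h, mul_zero]

theorem DistrZero.ext_coeff {u v : DistrZero lam}
    (h : coeffNZ (u : Module.Dual ℂ (TestFn lam)) = coeffNZ (v : Module.Dual ℂ (TestFn lam))) :
    u = v := by
  have := Distr.ext_coeff (u := ⟨u.1, u.2.1⟩) (v := ⟨v.1, v.2.1⟩) fun k => by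
    by_cases hk : k = 0
    · rw [hk]
      exact (coeff_zero u).trans (coeff_zero v).symm
    · exact congrFun h ⟨k, hk⟩
  exact Subtype.ext (congrArg (fun w : Distr lam => w.1) this)

theorem DistrZero.tempered (u : DistrZero lam) :
    Tempered (coeffNZ (u : Module.Dual ℂ (TestFn lam))) :=
  Distr.tempered ⟨u.1, u.2.1⟩

theorem coeff_formPairing (g : L2 lam) (k : ℤ) : coeff (formPairing g) k = fourierCoeff g k := by
  have hpC : ((period lam : ℝ) : ℂ) ≠ 0 := by exact_mod_cast (period_pos lam).ne'
  rw [coeff, fourierCoeff]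
  change _ * (∫ t : Torus lam, g t * fourier (-k) t) = _
  rw [AddCircle.volume_eq_smul_haarAddCircle, integral_smul_measure,
    ENNReal.toReal_ofReal (period_pos lam).le, Complex.real_smul, inv_mul_cancel_left₀ hpC]
  congr 1
  funext t
  rw [smul_eq_mul, mul_comm]

/-- The operator on distributions of mean zero with a given matrix. -/
theorem exists_distr_op {T : NZ → NZ → ℂ} (hs : ∀ a, Tempered a → ∀ k, Summable fun l => T k l * a l)
    (ht : ∀ a, Tempered a → Tempered (mulVec T a)) :
    ∃ A : DistrZero lam →ₗ[ℂ] DistrZero lam, ∀ u,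
      coeffNZ (A u : Module.Dual ℂ (TestFn lam)) = mulVec T (coeffNZ (u : Module.Dual ℂ (TestFn lam))) := by
  choose A hA using fun u : DistrZero lam => exists_distr (lam := lam) (ht _ (DistrZero.tempered u))
  refine ⟨⟨⟨A, fun u v => DistrZero.ext_coeff ?_⟩, fun c u => DistrZero.ext_coeff ?_⟩, hA⟩
  · funext k
    have h1 : coeffNZ (A u + A v : DistrZero lam).1 k = coeffNZ (A u).1 k + coeffNZ (A v).1 k :=
      mul_add _ _ _
    rw [h1, hA, hA, hA, mulVec, mulVec, mulVec, ← (hs _ (DistrZero.tempered u) k).tsum_add (hs _ (DistrZero.tempered v) k)]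
    congr 1
    funext l
    rw [← mul_add]
    congr 1
    exact mul_add _ _ _
  · funext k
    have h1 : ∀ (u : DistrZero lam) k, coeffNZ (c • u : DistrZero lam).1 k = c * coeffNZ u.1 k :=
      fun u k => mul_left_comm _ _ _
    rw [RingHom.id_apply, h1, hA, hA, mulVec, mulVec, ← tsum_mul_left]
    congr 1
    funext l
    rw [h1, mul_left_comm]

end Distributions

/-! ### Smoothing operators from rapidly decaying matrices -/

section Smoothing

/-- Termwise differentiation: the n-th derivative of each term has norm at most ‖a i‖ ‖L i‖ⁿ, since
the exponential has modulus one. -/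
theorem contDiff_tsum_exp {ι E : Type*} [NormedAddCommGroup E] [NormedSpace ℝ E] {a : ι → ℂ}
    {L : ι → E →L[ℝ] ℝ} (h : ∀ n : ℕ, Summable fun i => ‖a i‖ * ‖L i‖ ^ n) :
    ContDiff ℝ ∞ fun x => ∑' i, a i * Complex.exp (Complex.I * ((L i x : ℝ) : ℂ)) := by
  have hg : ∀ i, ContDiff ℝ ∞ fun y : ℝ => a i * Complex.exp (Complex.I * (y : ℂ)) := fun i =>
    contDiff_const.mul (contDiff_const.mul Complex.ofRealCLM.contDiff).cexp
  have h1 : ∀ i (n : ℕ) y, iteratedDeriv n (fun y : ℝ => a i * Complex.exp (Complex.I * (y : ℂ))) y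
      = a i * (Complex.I ^ n * Complex.exp (Complex.I * (y : ℂ))) := by
    intro i n y
    induction n generalizing y with
    | zero => simp
    | succ n ih =>
      have h2 : HasDerivAt (fun y : ℝ => Complex.exp (Complex.I * (y : ℂ)))
          (Complex.exp (Complex.I * (y : ℂ)) * (Complex.I * 1)) y :=
        ((Complex.ofRealCLM.hasDerivAt (x := y)).const_mul Complex.I).cexp
      rw [iteratedDeriv_succ, funext ih, ((h2.const_mul _).const_mul _).deriv]
      ring
  refine contDiff_tsum (v := fun n i => ‖a i‖ * ‖L i‖ ^ n) (fun i => (hg i).comp (L i).contDiff)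
    (fun n _ => h n) fun n i x _ => ?_
  have h3 := (L i).iteratedFDeriv_comp_right (hg i) x
    (i := n) (by exact_mod_cast le_top)
  change ‖iteratedFDeriv ℝ n ((fun y : ℝ => a i * Complex.exp (Complex.I * (y : ℂ))) ∘ L i) x‖ ≤ _
  rw [h3]
  refine (ContinuousMultilinearMap.norm_compContinuousLinearMap_le _ _).trans_eq ?_
  rw [norm_iteratedFDeriv_eq_norm_iteratedDeriv, h1, norm_mul, norm_mul, norm_pow, Complex.norm_I,
    one_pow, one_mul, mul_comm Complex.I, Complex.norm_exp_ofReal_mul_I, mul_one]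
  simp

variable {lam : Ioo (0 : ℝ) 1}

theorem fourier_eq_exp (k : ℤ) (x : ℝ) : (fourier k (x : Torus lam) : ℂ)
    = Complex.exp (Complex.I * ((2 * Real.pi / period lam * k * x : ℝ) : ℂ)) := by
  rw [fourier_coe_apply]
  congr 1
  push_cast
  ring

theorem norm_fourier_apply (k : ℤ) (t : Torus lam) : ‖(fourier k t : ℂ)‖ = 1 := by
  rw [fourier_apply, Circle.norm_coe]

theorem hasSum_fourierCoeff_tsum {ι : Type*} [Countable ι] {a : ι → ℂ} (ha : Summable fun i => ‖a i‖)
    (n : ι → ℤ) (m : ℤ) :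
    HasSum (fun i => a i * if n i = m then 1 else 0)
      (fourierCoeff (fun t : Torus lam => ∑' i, a i * fourier (n i) t) m) := by
  have hint : ∀ i, Integrable (fun t : Torus lam => (fourier (-m) t : ℂ) * (a i * fourier (n i) t))
      AddCircle.haarAddCircle := fun i => by
    refine Continuous.integrable_of_hasCompactSupport ?_ (HasCompactSupport.of_compactSpace _)
    exact (map_continuous (fourier (-m))).mul (continuous_const.mul (map_continuous (fourier (n i))))
  have h := hasSum_integral_of_summable_integral_norm hint (by
    refine ha.congr fun i => ?_
    simp only [norm_mul, norm_fourier_apply, one_mul, mul_one, integral_const, probReal_univ,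
      smul_eq_mul])
  have e : ∀ i, ∫ t : Torus lam, (fourier (-m) t : ℂ) * (a i * fourier (n i) t) ∂AddCircle.haarAddCircle
      = a i * if n i = m then 1 else 0 := by
    intro i
    have h1 := congrFun (fourierCoeff_fourier (T := period lam) (n i)) m
    rw [Pi.single_apply, fourierCoeff] at h1
    simp_rw [mul_left_comm _ (a i)]
    rw [integral_const_mul]
    congr 1
    simp only [eq_comm (a := n i)]
    exact h1
  simp_rw [e] at h
  rw [fourierCoeff]
  simp_rw [smul_eq_mul, ← tsum_mul_left]
  exact h

/-- Of the n + m + 4 powers of decay, n meet the factor in the sum, m the growth of b, and two in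
each index give convergence. -/
theorem IsRapid.summable_mul_pow {R : NZ → NZ → ℂ} (hR : IsRapid R) {b : NZ → ℂ} (hb : Tempered b)
    (n : ℕ) : Summable fun q : NZ × NZ => ‖R q.2 q.1 * b q.1‖ * (freq q.2 + freq q.1) ^ n := by
  obtain ⟨m, D, hD⟩ := hb
  obtain ⟨C, hC⟩ := hR (n + m + 4)
  have hs := summable_freq.mul_of_nonneg summable_freq (fun k => by positivity) (fun k => by positivity)
  refine Summable.of_nonneg_of_le (fun q => ?_) (fun q => ?_) (hs.mul_left (C * D))
  · have := freq_pos q.1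
    have := freq_pos q.2
    positivity
  · have h1 := freq_pos q.1
    have h2 := freq_pos q.2
    have hD0 : 0 ≤ D := by
      have := (norm_nonneg _).trans (hD q.1)
      by_contra! h3
      have := mul_neg_of_neg_of_pos h3 (pow_pos h1 m)
      linarith
    rw [norm_mul]
    calc ‖R q.2 q.1‖ * ‖b q.1‖ * (freq q.2 + freq q.1) ^ n
        ≤ ‖R q.2 q.1‖ * (D * (freq q.2 + freq q.1) ^ m) * (freq q.2 + freq q.1) ^ n := by
          gcongr
          refine (hD q.1).trans ?_
          gcongr
          linarith
      _ = ‖R q.2 q.1‖ * (freq q.2 + freq q.1) ^ (n + m + 4) * D *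
            ((freq q.2 + freq q.1) ^ 2 * (freq q.2 + freq q.1) ^ 2)⁻¹ := by
          rw [pow_add, pow_add]; field_simp
      _ ≤ C * D * (freq q.1 ^ 2 * freq q.2 ^ 2)⁻¹ := by
          have := hC q.2 q.1
          gcongr
          · exact mul_nonneg ((by positivity : (0:ℝ) ≤ _).trans this) hD0
          · linarith
          · linarith
      _ = _ := by rw [mul_inv]

theorem summable_norm_of_pow {R : NZ → NZ → ℂ} (hR : IsRapid R) {b : NZ → ℂ} (hb : Tempered b) :
    Summable fun q : NZ × NZ => ‖R q.2 q.1 * b q.1‖ := by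
  simpa using hR.summable_mul_pow hb 0

theorem tempered_one : Tempered fun _ => 1 := ⟨0, 1, fun k => by simp⟩

theorem tsum_prod_right_single {f : NZ × NZ → ℂ} (hf : Summable fun q => ‖f q‖) (l : NZ) :
    ∑' q : NZ × NZ, f q * (if (-q.1 : ℤ) = -l then 1 else 0) = ∑' k, f (l, k) := by
  have hs : Summable fun q : NZ × NZ => f q * (if (-q.1 : ℤ) = -l then 1 else 0) := by
    refine Summable.of_norm_bounded hf fun q => ?_
    split_ifs <;> simp
  rw [hs.tsum_prod, tsum_eq_single l]
  · simp
  · intro m hm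
    have h0 : ∀ k, f (m, k) * (if (-m : ℤ) = -l then 1 else 0) = 0 := fun k => by
      rw [if_neg fun h => hm (Subtype.ext (neg_injective h)), mul_zero]
    rw [tsum_congr h0, tsum_zero]

theorem tsum_prod_left_single {f : NZ × NZ → ℂ} (hf : Summable fun q => ‖f q‖) (k : NZ) :
    ∑' q : NZ × NZ, f q * (if (q.2 : ℤ) = k then 1 else 0) = ∑' l, f (l, k) := by
  have hs : Summable fun q : NZ × NZ => f q * (if (q.2 : ℤ) = k then 1 else 0) := by
    refine Summable.of_norm_bounded hf fun q => ?_
    split_ifs <;> simp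
  rw [hs.tsum_prod]
  congr 1
  funext l
  rw [tsum_eq_single k]
  · simp
  · intro m hm
    rw [if_neg fun h => hm (Subtype.ext h), mul_zero]

variable (lam) in
/-- The phase `(x, y) ↦ c (k x - l y)`. -/
def phase (q : NZ × NZ) : ℝ × ℝ →L[ℝ] ℝ :=
  (2 * Real.pi / period lam) • (((q.2 : ℤ) : ℝ) • ContinuousLinearMap.fst ℝ ℝ ℝ
    - ((q.1 : ℤ) : ℝ) • ContinuousLinearMap.snd ℝ ℝ ℝ)

theorem phase_apply (q : NZ × NZ) (p : ℝ × ℝ) : phase lam q p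
    = 2 * Real.pi / period lam * (((q.2 : ℤ) : ℝ) * p.1 - ((q.1 : ℤ) : ℝ) * p.2) := rfl

theorem norm_phase_le (q : NZ × NZ) :
    ‖phase lam q‖ ≤ 2 * Real.pi / period lam * (freq q.2 + freq q.1) := by
  have hp := period_pos lam
  rw [phase, norm_smul, Real.norm_of_nonneg (by positivity)]
  gcongr
  refine (norm_sub_le _ _).trans ?_
  rw [norm_smul, norm_smul, Real.norm_eq_abs, Real.norm_eq_abs]
  refine add_le_add ?_ ?_
  · exact mul_le_of_le_one_right (abs_nonneg _) (ContinuousLinearMap.norm_fst_le ℝ ℝ ℝ)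
  · exact mul_le_of_le_one_right (abs_nonneg _) (ContinuousLinearMap.norm_snd_le ℝ ℝ ℝ)

variable (lam) in
/-- The kernel with matrix `R`. -/
def kernel (R : NZ → NZ → ℂ) (t s : Torus lam) : ℂ :=
  ∑' q : NZ × NZ, (R q.2 q.1 * (((period lam : ℝ) : ℂ)⁻¹ * fourier q.2 t)) * fourier (-(q.1 : ℤ)) s

theorem kernel_contDiff {R : NZ → NZ → ℂ} (hR : IsRapid R) :
    ContDiff ℝ ∞ fun p : ℝ × ℝ => kernel lam R (p.1 : Torus lam) (p.2 : Torus lam) := by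
  have hp := period_pos lam
  have h := contDiff_tsum_exp (a := fun q : NZ × NZ => R q.2 q.1 * ((period lam : ℝ) : ℂ)⁻¹)
    (L := phase lam) fun n => by
      refine Summable.of_nonneg_of_le (fun q => by positivity) (fun q => ?_)
        ((hR.summable_mul_pow tempered_one n).mul_left
          ((period lam)⁻¹ * (2 * Real.pi / period lam) ^ n))
      have h1 := norm_phase_le (lam := lam) q
      have hk := freq_pos q.1
      have hl := freq_pos q.2
      calc _ ≤ ‖R q.2 q.1 * ((period lam : ℝ) : ℂ)⁻¹‖ *
              (2 * Real.pi / period lam * (freq q.2 + freq q.1)) ^ n := by gcongr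
        _ = _ := by
          rw [norm_mul, norm_inv, Complex.norm_real, Real.norm_of_nonneg hp.le, mul_one, mul_pow]
          ring
  refine (congrArg (ContDiff ℝ ∞) (funext fun p => ?_)).mpr h
  rw [kernel]
  congr 1
  funext q
  rw [fourier_eq_exp, fourier_eq_exp, phase_apply, ← mul_assoc (R q.2 q.1), mul_assoc (_ * _),
    ← Complex.exp_add]
  congr 2
  push_cast
  ring

theorem kernel_mem {R : NZ → NZ → ℂ} (hR : IsRapid R) (t : Torus lam) :
    kernel lam R t ∈ TestFn lam := by
  obtain ⟨x, rfl⟩ := QuotientAddGroup.mk_surjective t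
  have h : ContDiff ℝ ∞ fun y : ℝ => (x, y) := contDiff_const.prodMk contDiff_id
  change ContDiff ℝ ∞ ((fun p : ℝ × ℝ => kernel lam R (p.1 : Torus lam) (p.2 : Torus lam)) ∘
    fun y : ℝ => (x, y))
  exact (kernel_contDiff hR).comp h

theorem contDiff_series {R : NZ → NZ → ℂ} (hR : IsRapid R) {b : NZ → ℂ} (hb : Tempered b) :
    ContDiff ℝ ∞ fun x : ℝ => ∑' q : NZ × NZ, (R q.2 q.1 * b q.1) * fourier (q.2 : ℤ) (x : Torus lam) := by
  have hp := period_pos lam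
  have h := contDiff_tsum_exp (a := fun q : NZ × NZ => R q.2 q.1 * b q.1)
    (L := fun q => (2 * Real.pi / period lam * ((q.2 : ℤ) : ℝ)) • ContinuousLinearMap.id ℝ ℝ) fun n => by
      refine Summable.of_nonneg_of_le (fun q => by positivity) (fun q => ?_)
        ((hR.summable_mul_pow hb n).mul_left ((2 * Real.pi / period lam) ^ n))
      have hk := freq_pos q.1
      have hl := freq_pos q.2
      have h1 : ‖(2 * Real.pi / period lam * ((q.2 : ℤ) : ℝ)) • ContinuousLinearMap.id ℝ ℝ‖
          ≤ 2 * Real.pi / period lam * (freq q.2 + freq q.1) := by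
        rw [norm_smul, ContinuousLinearMap.norm_id, mul_one, norm_mul,
          Real.norm_of_nonneg (by positivity), Real.norm_eq_abs]
        gcongr
        change freq q.2 ≤ _
        linarith
      calc _ ≤ ‖R q.2 q.1 * b q.1‖ *
              (2 * Real.pi / period lam * (freq q.2 + freq q.1)) ^ n := by gcongr
        _ = _ := by rw [mul_pow]; ring
  refine (congrArg (ContDiff ℝ ∞) (funext fun x => ?_)).mpr h
  congr 1
  funext q
  rw [fourier_eq_exp]
  simp

/-- A distribution acts termwise on the Fourier series of the kernel in its second variable. The
mode -l and the factor (2π/c)⁻¹ in `kernel` are those of `coeff`, so the result is the series ∑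
R_{kl} û(l) e_k. -/
theorem exists_smoothing {R : NZ → NZ → ℂ} (hR : IsRapid R) :
    ∃ A : Distr lam →ₗ[ℂ] TestFn lam, IsSmoothing A ∧ ∀ u : Distr lam,
      fourierCoeff (A u : Torus lam → ℂ) 0 = 0 ∧ ∀ k : NZ, fourierCoeff (A u : Torus lam → ℂ) k
        = mulVec R (coeffNZ (u : Module.Dual ℂ (TestFn lam))) k := by
  have hpC : ((period lam : ℝ) : ℂ) ≠ 0 := by exact_mod_cast (period_pos lam).ne'
  let K : Torus lam → TestFn lam := fun t => ⟨kernel lam R t, kernel_mem hR t⟩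
  have hKs : ∀ t : Torus lam, Summable fun q : NZ × NZ =>
      ‖R q.2 q.1 * (((period lam : ℝ) : ℂ)⁻¹ * fourier q.2 t)‖ := fun t => by
    refine ((summable_norm_of_pow hR tempered_one).mul_right ‖((period lam : ℝ) : ℂ)⁻¹‖).congr
      fun q => ?_
    rw [norm_mul, norm_mul, norm_mul, norm_fourier_apply, norm_one]
    ring
  have hus : ∀ u : Distr lam, Summable fun q : NZ × NZ =>
      ‖R q.2 q.1 * coeffNZ (u : Module.Dual ℂ (TestFn lam)) q.1‖ := fun u =>
    summable_norm_of_pow hR (Distr.tempered u)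
  have hA : ∀ (u : Distr lam) (t : Torus lam), (u : Module.Dual ℂ (TestFn lam)) (K t)
      = ∑' q : NZ × NZ, (R q.2 q.1 * coeffNZ (u : Module.Dual ℂ (TestFn lam)) q.1) * fourier (q.2 : ℤ) t := by
    intro u t
    have h1 := Distr.hasSum u (K t)
    have hc : ∀ m, fourierCoeff (K t : Torus lam → ℂ) m = ∑' q : NZ × NZ,
        (R q.2 q.1 * (((period lam : ℝ) : ℂ)⁻¹ * fourier q.2 t)) * if (-q.1 : ℤ) = m then 1 else 0 :=
      fun m => (hasSum_fourierCoeff_tsum (hKs t) (fun q => -(q.1 : ℤ)) m).tsum_eq.symm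
    have hinj : Function.Injective fun l : NZ => (-(l : ℤ)) := fun l m h =>
      Subtype.ext (neg_injective h)
    rw [← hinj.hasSum_iff] at h1
    · have hs : Summable fun q : NZ × NZ =>
          (R q.2 q.1 * coeffNZ (u : Module.Dual ℂ (TestFn lam)) q.1) * fourier (q.2 : ℤ) t := by
        refine Summable.of_norm_bounded (hus u) fun q => ?_
        rw [norm_mul, norm_fourier_apply, mul_one]
      rw [hs.tsum_prod, ← h1.tsum_eq]
      congr 1
      funext l
      simp only [Function.comp_apply]
      rw [hc, tsum_prod_right_single (hKs t), ← tsum_mul_right]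
      congr 1
      funext k
      rw [coeffNZ, coeff]
      ring
    · intro m hm
      have hm0 : m = 0 := by
        by_contra h
        exact hm ⟨⟨-m, neg_ne_zero.2 h⟩, neg_neg m⟩
      rw [hc, hm0]
      have : ∀ q : NZ × NZ, (-(q.1 : ℤ)) ≠ 0 := fun q => neg_ne_zero.2 q.1.2
      simp [this]
  let A : Distr lam →ₗ[ℂ] TestFn lam :=
    { toFun := fun u => ⟨fun t => (u : Module.Dual ℂ (TestFn lam)) (K t), by
        change ContDiff ℝ ∞ fun x : ℝ => (u : Module.Dual ℂ (TestFn lam)) (K (x : Torus lam))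
        simp_rw [hA]
        exact contDiff_series hR (Distr.tempered u)⟩
      map_add' := fun u v => rfl
      map_smul' := fun c u => rfl }
  refine ⟨A, ⟨K, kernel_contDiff hR, fun u t => rfl⟩, fun u => ?_⟩
  have hc : ∀ m, fourierCoeff (A u : Torus lam → ℂ) m = ∑' q : NZ × NZ,
      (R q.2 q.1 * coeffNZ (u : Module.Dual ℂ (TestFn lam)) q.1) * if (q.2 : ℤ) = m then 1 else 0 := by
    intro m
    rw [(hasSum_fourierCoeff_tsum (hus u) (fun q => (q.2 : ℤ)) m).tsum_eq, ← funext (hA u)]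
    rfl
  refine ⟨?_, fun k => ?_⟩
  · rw [hc]
    have : ∀ q : NZ × NZ, (q.2 : ℤ) ≠ 0 := fun q => q.2.2
    simp [this]
  · rw [hc, tsum_prod_left_single (hus u)]; rfl

end Smoothing

/-! ### The projections and the Sobolev norms in Fourier coefficients -/

section Projections

variable {lam : Ioo (0 : ℝ) 1}

theorem fourierCoeff_eq_inner (g : L2 lam) (k : ℤ) :
    fourierCoeff g k = inner ℂ (fourierLp 2 k : L2 lam) g := by
  refine (fourierBasis_repr g k).symm.trans ((HilbertBasis.repr_apply_apply _ _ _).trans ?_)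
  rw [coe_fourierBasis]

theorem fourierCoeff_starProjection (A : Set ℤ) [DecidablePred (· ∈ A)] (g : L2 lam) (k : ℤ) :
    fourierCoeff ((modes lam A).starProjection g : L2 lam) k
      = if k ∈ A then fourierCoeff g k else 0 := by
  rw [fourierCoeff_eq_inner, fourierCoeff_eq_inner]
  split_ifs with hk
  · have hmem : (fourierLp 2 k : L2 lam) ∈ modes lam A :=
      Submodule.le_topologicalClosure _ (Submodule.subset_span ⟨k, hk, rfl⟩)
    rw [← Submodule.inner_starProjection_left_eq_right,
      Submodule.starProjection_eq_self_iff.2 hmem]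
  · have horth : (fourierLp 2 k : L2 lam) ∈ (modes lam A)ᗮ := by
      rw [modes, Submodule.orthogonal_closure]
      rw [Submodule.mem_orthogonal]
      intro v hv
      induction hv using Submodule.span_induction with
      | mem x hx =>
        obtain ⟨m, hm, rfl⟩ := hx
        exact orthonormal_fourier.2 fun h => hk (h ▸ hm)
      | zero => exact inner_zero_left _
      | add x y _ _ hx hy => rw [inner_add_left, hx, hy, add_zero]
      | smul a x _ hx => rw [inner_smul_left, hx, mul_zero]
    exact Submodule.inner_left_of_mem_orthogonal (Submodule.starProjection_apply_mem _ _) horth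

theorem mem_L2zero_iff (g : L2 lam) : g ∈ L2zero lam ↔ fourierCoeff g 0 = 0 := by
  change ∫ t, g t ∂_ = 0 ↔ _
  rw [fourierCoeff]
  simp

theorem sobolevSq_eq (s : ℝ) (u : DistrZero lam) :
    sobolevSq s u = wsq s (coeffNZ (u : Module.Dual ℂ (TestFn lam))) := rfl

/-- Division by ick turns |k||ŵ(k)|² into c⁻²|k|⁻¹|û(k)|², so unitarity for primitives is the
isometry of order -1/2 for forms. -/
theorem halfSq_eq (u : DistrZero lam) : halfSq u = ENNReal.ofReal ((slope lam ^ 2)⁻¹) *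
    wsq (-1 / 2) (coeffNZ (u : Module.Dual ℂ (TestFn lam))) := by
  rw [halfSq, wsq, ← ENNReal.tsum_mul_left]
  congr 1
  funext k
  have hc := slope_pos lam
  have hk := freq_pos k
  change ENNReal.ofReal (freq k) * ‖coeffNZ (u : Module.Dual ℂ (TestFn lam)) k / _‖ₑ ^ 2 = _
  rw [← ofReal_norm_sq, ← ofReal_norm_sq, ← ENNReal.ofReal_mul hk.le,
    ← ENNReal.ofReal_mul (by positivity), ← ENNReal.ofReal_mul (by positivity), norm_div, norm_mul,
    norm_mul, Complex.norm_I, Complex.norm_real, Real.norm_of_nonneg hc.le, Complex.norm_intCast]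
  change ENNReal.ofReal (freq k * (_ / (1 * slope lam * freq k)) ^ 2) = _
  have h1 : (2 * (-1 / 2) : ℝ) = -1 := by norm_num
  rw [h1, Real.rpow_neg_one]
  congr 1
  field_simp

end Projections

/-! ### Weak derivatives -/

section Weak

theorem L2Loc.locallyIntegrable {v : ℝ × ℝ → ℂ} (hv : L2Loc v) : LocallyIntegrable v := by
  rw [locallyIntegrable_iff]
  intro K hK
  have : IsFiniteMeasure (volume.restrict K) := isFiniteMeasure_restrict.2 hK.measure_lt_top.ne
  exact (hv K hK).integrable (by norm_num)

theorem L2Loc.congr {v w : ℝ × ℝ → ℂ} (hv : L2Loc v) (h : v =ᵐ[volume] w) : L2Loc w := fun K hK =>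
  (hv K hK).ae_eq (ae_restrict_of_ae h)

theorem L2Loc.add {v w : ℝ × ℝ → ℂ} (hv : L2Loc v) (hw : L2Loc w) : L2Loc fun p => v p + w p :=
  fun K hK => (hv K hK).add (hw K hK)

theorem L2Loc.const_mul {v : ℝ × ℝ → ℂ} (hv : L2Loc v) (a : ℂ) : L2Loc fun p => a * v p :=
  fun K hK => (hv K hK).const_mul a

theorem IsTest.continuous {φ : ℝ × ℝ → ℂ} (hφ : IsTest φ) : Continuous φ := hφ.1.continuous

theorem LocallyIntegrable.integrable_mul_test {v : ℝ × ℝ → ℂ} (hv : LocallyIntegrable v)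
    {φ : ℝ × ℝ → ℂ} (hφ : IsTest φ) : Integrable fun p => v p * φ p := by
  have := hv.integrable_smul_left_of_hasCompactSupport hφ.continuous hφ.2
  refine this.congr (ae_of_all _ fun p => ?_)
  simp [mul_comm]

theorem L2Loc.integrable_mul_test {v : ℝ × ℝ → ℂ} (hv : L2Loc v) {φ : ℝ × ℝ → ℂ} (hφ : IsTest φ) :
    Integrable fun p => v p * φ p :=
  LocallyIntegrable.integrable_mul_test hv.locallyIntegrable hφ

theorem dirDeriv_apply (e : ℝ × ℝ) (φ : ℝ × ℝ → ℂ) (p : ℝ × ℝ) :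
    dirDeriv e φ p = fderiv ℝ φ p e := rfl

theorem IsTest.dirDeriv {φ : ℝ × ℝ → ℂ} (hφ : IsTest φ) (e : ℝ × ℝ) : IsTest (dirDeriv e φ) := by
  refine ⟨?_, hφ.2.fderiv_apply ℝ e⟩
  exact (hφ.1.fderiv_right (m := ∞) (by simp)).clm_apply contDiff_const

theorem IsTest.differentiable {φ : ℝ × ℝ → ℂ} (hφ : IsTest φ) : Differentiable ℝ φ :=
  hφ.1.differentiable (by simp)

theorem IsTest.ofReal {g : ℝ × ℝ → ℝ} (h1 : ContDiff ℝ ∞ g) (h2 : HasCompactSupport g) :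
    IsTest fun p => (g p : ℂ) :=
  ⟨Complex.ofRealCLM.contDiff.comp h1, h2.comp_left (g := fun x : ℝ => (x : ℂ)) Complex.ofReal_zero⟩

theorem IsTest.comp_equiv {φ : ℝ × ℝ → ℂ} (hφ : IsTest φ) (Ψ : (ℝ × ℝ) ≃L[ℝ] (ℝ × ℝ)) :
    IsTest (φ ∘ Ψ) :=
  ⟨hφ.1.comp Ψ.contDiff, hφ.2.comp_homeomorph Ψ.toHomeomorph⟩

theorem dirDeriv_comp_equiv {φ : ℝ × ℝ → ℂ} (Ψ : (ℝ × ℝ) ≃L[ℝ] (ℝ × ℝ))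
    (e : ℝ × ℝ) : dirDeriv e (φ ∘ Ψ) = dirDeriv (Ψ e) φ ∘ Ψ := by
  funext p
  rw [dirDeriv_apply, Ψ.comp_right_fderiv]
  rfl

theorem dirDeriv_combo (a b : ℝ) (e e' : ℝ × ℝ) (φ : ℝ × ℝ → ℂ) (p : ℝ × ℝ) :
    dirDeriv (a • e + b • e') φ p = a * dirDeriv e φ p + b * dirDeriv e' φ p := by
  simp only [dirDeriv_apply, map_add, map_smul, Complex.real_smul]

theorem dirDeriv_dirDeriv {φ : ℝ × ℝ → ℂ} (hφ : ContDiff ℝ ∞ φ) (e e' p : ℝ × ℝ) :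
    dirDeriv e (dirDeriv e' φ) p = fderiv ℝ (fderiv ℝ φ) p e e' := by
  have h : DifferentiableAt ℝ (fderiv ℝ φ) p :=
    ((hφ.fderiv_right (m := ∞) (by simp)).differentiable (by simp)) p
  change fderiv ℝ (fun q => fderiv ℝ φ q e') p e = _
  rw [fderiv_clm_apply h (differentiableAt_const e')]
  simp

theorem minSmoothness_two_le : minSmoothness ℝ 2 ≤ ((⊤ : ℕ∞) : WithTop ℕ∞) := by
  rw [minSmoothness_of_isRCLikeNormedField]
  exact WithTop.coe_le_coe.2 (le_top : (2 : ℕ∞) ≤ ⊤)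

theorem dirDeriv_comm {φ : ℝ × ℝ → ℂ} (hφ : ContDiff ℝ ∞ φ) (e e' p : ℝ × ℝ) :
    dirDeriv e (dirDeriv e' φ) p = dirDeriv e' (dirDeriv e φ) p := by
  rw [dirDeriv_dirDeriv hφ, dirDeriv_dirDeriv hφ]
  exact hφ.contDiffAt.isSymmSndFDerivAt minSmoothness_two_le e e'

theorem exists_map_volume_eq (Ψ : (ℝ × ℝ) ≃L[ℝ] (ℝ × ℝ)) : ∃ κ : ℝ≥0∞, κ ≠ ⊤ ∧
    (volume : Measure (ℝ × ℝ)).map Ψ = κ • volume :=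
  ⟨_, ENNReal.ofReal_ne_top, Measure.map_linearMap_addHaar_eq_smul_addHaar volume
    (f := (Ψ : (ℝ × ℝ) →ₗ[ℝ] (ℝ × ℝ))) (by
      have := LinearEquiv.isUnit_det' Ψ.toLinearEquiv
      exact this.ne_zero)⟩

theorem measurableEmbedding_equiv (Ψ : (ℝ × ℝ) ≃L[ℝ] (ℝ × ℝ)) : MeasurableEmbedding Ψ :=
  Ψ.toHomeomorph.measurableEmbedding

theorem exists_integral_comp_equiv (Ψ : (ℝ × ℝ) ≃L[ℝ] (ℝ × ℝ)) : ∃ κ : ℝ,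
    ∀ F : ℝ × ℝ → ℂ, ∫ p, F (Ψ p) = κ * ∫ p, F p := by
  obtain ⟨κ, -, h⟩ := exists_map_volume_eq Ψ
  refine ⟨κ.toReal, fun F => ?_⟩
  rw [← (measurableEmbedding_equiv Ψ).integral_map, h, integral_smul_measure, Complex.real_smul]

theorem quasiMeasurePreserving_equiv (Ψ : (ℝ × ℝ) ≃L[ℝ] (ℝ × ℝ)) :
    Measure.QuasiMeasurePreserving Ψ := by
  obtain ⟨κ, -, h⟩ := exists_map_volume_eq Ψ
  exact ⟨Ψ.continuous.measurable, h ▸ Measure.smul_absolutelyContinuous⟩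

theorem L2Loc.comp_equiv {v : ℝ × ℝ → ℂ} (hv : L2Loc v) (Ψ : (ℝ × ℝ) ≃L[ℝ] (ℝ × ℝ)) :
    L2Loc (v ∘ Ψ) := by
  obtain ⟨κ, hκ, h⟩ := exists_map_volume_eq Ψ
  intro K hK
  have h1 := (measurableEmbedding_equiv Ψ).restrict_map volume (Ψ '' K)
  rw [preimage_image_eq _ Ψ.injective, h, Measure.restrict_smul] at h1
  refine MemLp.comp_of_map ?_ Ψ.continuous.measurable.aemeasurable
  rw [← h1]
  exact (hv _ (hK.image Ψ.continuous)).smul_measure hκ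

/-- The test function is carried over by Ψ⁻¹, and the constant Jacobian multiplies both sides of the
defining identity. -/
theorem HasWeakDeriv.comp_equiv {u v : ℝ × ℝ → ℂ} {Ψ : (ℝ × ℝ) ≃L[ℝ] (ℝ × ℝ)} {e : ℝ × ℝ}
    (h : HasWeakDeriv (Ψ e) u v) : HasWeakDeriv e (u ∘ Ψ) (v ∘ Ψ) := by
  refine ⟨h.1.comp_equiv Ψ, fun φ hφ => ?_⟩
  obtain ⟨κ, hκ⟩ := exists_integral_comp_equiv Ψ
  set ψ : ℝ × ℝ → ℂ := φ ∘ Ψ.symm with hψ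
  have h1 : φ = ψ ∘ Ψ := by
    funext p
    simp [hψ]
  have h2 := h.2 ψ (hφ.comp_equiv Ψ.symm)
  rw [h1, dirDeriv_comp_equiv]
  have h3 := hκ fun p => u p * dirDeriv (Ψ e) ψ p
  have h4 := hκ fun p => v p * ψ p
  simp only [Function.comp_apply]
  rw [h3, h4, h2]
  ring

theorem HasWeakDeriv.congr {e : ℝ × ℝ} {u u' v v' : ℝ × ℝ → ℂ} (h : HasWeakDeriv e u v)
    (hu : u =ᵐ[volume] u') (hv : v =ᵐ[volume] v') : HasWeakDeriv e u' v' := by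
  refine ⟨h.1.congr hv, fun φ hφ => ?_⟩
  have h1 : ∫ p, u' p * dirDeriv e φ p = ∫ p, u p * dirDeriv e φ p :=
    integral_congr_ae (hu.symm.mul (ae_eq_refl (dirDeriv e φ)))
  have h2 : ∫ p, v' p * φ p = ∫ p, v p * φ p := integral_congr_ae (hv.symm.mul (ae_eq_refl φ))
  rw [h1, h2]
  exact h.2 φ hφ

theorem HasWeakDeriv.combo {e e' : ℝ × ℝ} {u v v' : ℝ × ℝ → ℂ} (hu : L2Loc u)
    (h : HasWeakDeriv e u v) (h' : HasWeakDeriv e' u v') (a b : ℝ) :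
    HasWeakDeriv (a • e + b • e') u fun p => a * v p + b * v' p := by
  refine ⟨(h.1.const_mul a).add (h'.1.const_mul b), fun φ hφ => ?_⟩
  have h1 := hu.integrable_mul_test (hφ.dirDeriv e)
  have h2 := hu.integrable_mul_test (hφ.dirDeriv e')
  have h3 := h.1.integrable_mul_test hφ
  have h4 := h'.1.integrable_mul_test hφ
  have e1 : ∀ p, u p * dirDeriv (a • e + b • e') φ p
      = a * (u p * dirDeriv e φ p) + b * (u p * dirDeriv e' φ p) := fun p => by
    rw [dirDeriv_combo]; ring
  have e2 : ∀ p, (a * v p + b * v' p) * φ p = a * (v p * φ p) + b * (v' p * φ p) := fun p => by ring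
  simp_rw [e1, e2]
  rw [integral_add (h1.const_mul _) (h2.const_mul _), integral_add (h3.const_mul _) (h4.const_mul _),
    integral_const_mul, integral_const_mul, integral_const_mul, integral_const_mul, h.2 φ hφ, h'.2 φ hφ]
  ring

/-- A locally integrable function which is orthogonal to the test functions in an open set vanishes
there. -/
theorem ae_eq_zero_of_test {v : ℝ × ℝ → ℂ} (hv : LocallyIntegrable v) {O : Set (ℝ × ℝ)}
    (hO : IsOpen O) (h : ∀ φ, IsTest φ → tsupport φ ⊆ O → ∫ p, v p * φ p = 0) :
    ∀ᵐ p, p ∈ O → v p = 0 := by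
  refine hO.ae_eq_zero_of_integral_contDiff_smul_eq_zero (hv.locallyIntegrableOn O)
    fun g h1 h2 h3 => ?_
  rw [← h _ (IsTest.ofReal h1 h2) ((closure_mono ?_).trans h3)]
  · refine integral_congr_ae (ae_of_all _ fun p => ?_)
    simp [mul_comm]
  · intro p hp
    simpa using hp

theorem HasWeakDeriv.unique {e : ℝ × ℝ} {u v v' : ℝ × ℝ → ℂ} (h : HasWeakDeriv e u v)
    (h' : HasWeakDeriv e u v') : v =ᵐ[volume] v' := by
  have h1 : LocallyIntegrable fun p => v p + (-1) * v' p :=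
    (h.1.add (h'.1.const_mul (-1))).locallyIntegrable
  have h2 := ae_eq_zero_of_test h1 isOpen_univ fun φ hφ _ => ?_
  · filter_upwards [h2] with p hp
    have := hp (mem_univ p)
    linear_combination this
  · have e2 : ∀ p, (v p + (-1) * v' p) * φ p = v p * φ p + (-1) * (v' p * φ p) := fun p => by ring
    simp_rw [e2]
    rw [integral_add (h.1.integrable_mul_test hφ) ((h'.1.integrable_mul_test hφ).const_mul _),
      integral_const_mul]
    linear_combination h.2 φ hφ - h'.2 φ hφ

end Weak

/-! ### Characteristic coordinates -/

section Char

/-- The region between the graphs of the identity and of `b`. -/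
def strip (b : ℝ → ℝ) : Set (ℝ × ℝ) := {p | p.1 < p.2 ∧ p.2 < b p.1}

/-- `U ∈ Ḣ¹_loc` solves the wave equation in characteristic coordinates. -/
structure IsCharSol (b : ℝ → ℝ) (U VS VT : ℝ × ℝ → ℂ) : Prop where
  l2 : L2Loc U
  dS : HasWeakDeriv (1, 0) U VS
  dT : HasWeakDeriv (0, 1) U VT
  supp : ∀ᵐ p, p ∉ strip b → U p = 0
  eqn : ∀ φ, IsTest φ → tsupport φ ⊆ strip b → ∫ p, U p * dirDeriv (1, 0) (dirDeriv (0, 1) φ) p = 0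

variable {Ω : Channel} {lam : Ioo (0 : ℝ) 1}

variable (lam) in
/-- The characteristic coordinates `(s, t) ↦ x`, with `s = x₁ + x₂/c`, `t = x₁ - x₂/c`. -/
def charEquiv : (ℝ × ℝ) ≃L[ℝ] (ℝ × ℝ) :=
  LinearEquiv.toContinuousLinearEquiv
    { toFun := fun p => ((p.1 + p.2) / 2, slope lam * (p.1 - p.2) / 2)
      invFun := fun x => (x.1 + x.2 / slope lam, x.1 - x.2 / slope lam)
      map_add' := fun p q => by
        ext <;> simp only [Prod.fst_add, Prod.snd_add] <;> ring
      map_smul' := fun a p => by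
        ext <;> simp only [Prod.smul_fst, Prod.smul_snd, smul_eq_mul, RingHom.id_apply] <;> ring
      left_inv := fun p => by
        have := (slope_pos lam).ne'
        ext <;> field_simp <;> ring
      right_inv := fun p => by
        have := (slope_pos lam).ne'
        ext <;> field_simp <;> ring }

theorem charEquiv_apply (p : ℝ × ℝ) :
    charEquiv lam p = ((p.1 + p.2) / 2, slope lam * (p.1 - p.2) / 2) := rfl

theorem charEquiv_symm_apply (x : ℝ × ℝ) :
    (charEquiv lam).symm x = (x.1 + x.2 / slope lam, x.1 - x.2 / slope lam) := rfl

/-- The bottom point (y, G(y)) has as coordinates s and t its two feet on the upper boundary, and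
the bounce maps the first foot to the second. So the bottom is the graph of b, and the top x₂ = 0 is
the diagonal. -/
theorem mem_dom_iff (hsub : Ω.Subcritical lam) (x : ℝ × ℝ) :
    x ∈ Ω.dom ↔ (charEquiv lam).symm x ∈ strip (Ω.bounce lam) := by
  have hc := slope_pos lam
  have hF : IsDiffeo (Ω.foot lam 1) := Channel.foot_isDiffeo hsub (by simp)
  rw [charEquiv_symm_apply]
  change Ω.G x.1 < x.2 ∧ x.2 < 0 ↔ x.1 + x.2 / slope lam < x.1 - x.2 / slope lam ∧
    x.1 - x.2 / slope lam < Ω.bounce lam (x.1 + x.2 / slope lam)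
  have h1 : x.2 < 0 ↔ x.1 + x.2 / slope lam < x.1 - x.2 / slope lam := by
    have h0 : x.2 < 0 ↔ x.2 / slope lam < 0 := by rw [div_lt_iff₀ hc, zero_mul]
    rw [h0]
    constructor <;> intro h <;> linarith
  have h2 : Ω.G x.1 < x.2 ↔ x.1 - x.2 / slope lam < Ω.bounce lam (x.1 + x.2 / slope lam) := by
    obtain ⟨y, hy⟩ := hF.surj (x.1 + x.2 / slope lam)
    have e1 : Ω.foot lam 1 y = y + Ω.G y / slope lam := by rw [Channel.foot]; ring
    have e2 : Ω.foot lam (-1) y = y - Ω.G y / slope lam := by rw [Channel.foot]; ring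
    have e3 : Ω.foot lam 1 x.1 = x.1 + Ω.G x.1 / slope lam := by rw [Channel.foot]; ring
    rw [← hy, Channel.bounce_foot hsub, e2]
    have h3 : Ω.G x.1 < x.2 ↔ Ω.foot lam 1 x.1 < Ω.foot lam 1 y := by
      rw [hy, e3, add_lt_add_iff_left, div_lt_div_iff_of_pos_right hc]
    rw [h3, hF.strictMono.lt_iff_lt]
    constructor <;> intro h <;> linarith
  rw [h1, h2, and_comm]

theorem volume_graph {f : ℝ → ℝ} (hf : Measurable f) :
    (volume : Measure (ℝ × ℝ)) {p | p.2 = f p.1} = 0 := by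
  have hm : MeasurableSet {p : ℝ × ℝ | p.2 = f p.1} :=
    measurableSet_eq_fun measurable_snd (hf.comp measurable_fst)
  rw [Measure.volume_eq_prod, Measure.measure_prod_null hm]
  refine ae_of_all _ fun x => ?_
  change volume {y : ℝ | y = f x} = 0
  simp

/-- The closure adds only points of the two boundary graphs, which are null sets; the support
condition may thus be stated with the open channel. -/
theorem ae_notMem_closure_dom (Ω : Channel) :
    ∀ᵐ x : ℝ × ℝ, x ∉ Ω.dom → x ∉ closure Ω.dom := by
  have h1 : ∀ᵐ x : ℝ × ℝ, ¬ x.2 = Ω.G x.1 := by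
    rw [ae_iff]
    simpa using volume_graph Ω.smooth.continuous.measurable
  have h2 : ∀ᵐ x : ℝ × ℝ, ¬ x.2 = (fun _ : ℝ => (0 : ℝ)) x.1 := by
    rw [ae_iff]
    simpa using volume_graph (f := fun _ => 0) measurable_const
  have hcl : closure Ω.dom ⊆ {x | Ω.G x.1 ≤ x.2 ∧ x.2 ≤ 0} := by
    refine closure_minimal (fun x hx => ⟨hx.1.le, hx.2.le⟩) ?_
    exact (isClosed_le (Ω.smooth.continuous.comp continuous_fst) continuous_snd).inter
      (isClosed_le continuous_snd continuous_const)
  filter_upwards [h1, h2] with x hx1 hx2 hx hx'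
  have := hcl hx'
  exact hx ⟨lt_of_le_of_ne this.1 (Ne.symm hx1), lt_of_le_of_ne this.2 hx2⟩

/-- Since c²λ² = 1 - λ², the operator factors as -λ²(∂₁ + c∂₂)(∂₁ - c∂₂), and the two factors are
2∂ₛ and 2∂ₜ. -/
theorem waveOp_comp {φ : ℝ × ℝ → ℂ} (hφ : ContDiff ℝ ∞ φ) (p : ℝ × ℝ) :
    waveOp lam φ (charEquiv lam p) = -4 * ((lam : ℝ) : ℂ) ^ 2 *
      dirDeriv (1, 0) (dirDeriv (0, 1) (φ ∘ charEquiv lam)) p := by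
  have hl := lam_pos lam
  have hc2 : ((slope lam : ℝ) : ℂ) ^ 2 * ((lam : ℝ) : ℂ) ^ 2 = 1 - ((lam : ℝ) : ℂ) ^ 2 := by
    have h0 : 0 ≤ 1 - (lam : ℝ) ^ 2 := by
      have := lam.2.1
      have := lam.2.2
      nlinarith
    have : slope lam ^ 2 * (lam : ℝ) ^ 2 = 1 - (lam : ℝ) ^ 2 := by
      rw [slope, div_pow, Real.sq_sqrt h0, div_mul_cancel₀ _ (by positivity)]
    exact_mod_cast this
  have e1 : charEquiv lam (1, 0) = (1 / 2 : ℝ) • (1, 0) + (slope lam / 2) • (0, 1) := by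
    rw [charEquiv_apply]; ext <;> simp
  have e2 : charEquiv lam (0, 1) = (1 / 2 : ℝ) • (1, 0) + (-(slope lam / 2)) • (0, 1) := by
    rw [charEquiv_apply]; ext <;> (simp; try ring)
  rw [dirDeriv_comp_equiv, dirDeriv_comp_equiv, Function.comp_apply, waveOp,
    dirDeriv_dirDeriv hφ, dirDeriv_dirDeriv hφ, dirDeriv_dirDeriv hφ, e1, e2]
  have hsymm := hφ.contDiffAt (x := charEquiv lam p) |>.isSymmSndFDerivAt minSmoothness_two_le (0, 1) (1, 0)
  simp only [map_add, map_smul, add_apply, smul_apply, Complex.real_smul, hsymm]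
  rw [← hc2]
  push_cast
  ring

theorem exists_isCharSol (hsub : Ω.Subcritical lam) {u : ℝ × ℝ → ℂ} (hu : InH1LocDot Ω u)
    (hP : IsHomogeneous Ω lam u) :
    ∃ VS VT, IsCharSol (Ω.bounce lam) (u ∘ charEquiv lam) VS VT := by
  obtain ⟨v₁, h₁⟩ := hu.d1
  obtain ⟨v₂, h₂⟩ := hu.d2
  have hl2 := hu.l2.comp_equiv (charEquiv lam)
  have hc := slope_pos lam
  have hd := fun a b : ℝ => (h₁.combo hu.l2 h₂ a b)
  have hS := hd (1 / 2) (slope lam / 2)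
  have hT := hd (1 / 2) (-(slope lam / 2))
  have e1 : charEquiv lam (1, 0) = (1 / 2 : ℝ) • (1, 0) + (slope lam / 2) • (0, 1) := by
    rw [charEquiv_apply]; ext <;> simp
  have e2 : charEquiv lam (0, 1) = (1 / 2 : ℝ) • (1, 0) + (-(slope lam / 2)) • (0, 1) := by
    rw [charEquiv_apply]; ext <;> (simp; try ring)
  rw [← e1] at hS
  rw [← e2] at hT
  refine ⟨_, _, hl2, hS.comp_equiv, hT.comp_equiv, ?_, fun φ hφ hs => ?_⟩
  · have h3 : ∀ᵐ x, x ∉ Ω.dom → u x = 0 := by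
      filter_upwards [hu.supp, ae_notMem_closure_dom Ω] with x h4 h5 h6
      exact h4 (h5 h6)
    filter_upwards [(quasiMeasurePreserving_equiv (charEquiv lam)).ae h3] with p hp hp'
    refine hp fun h => hp' ?_
    rw [mem_dom_iff hsub, ContinuousLinearEquiv.symm_apply_apply] at h
    exact h
  · have hψ : IsTest (φ ∘ (charEquiv lam).symm) := hφ.comp_equiv (charEquiv lam).symm
    have hsup : tsupport (φ ∘ (charEquiv lam).symm) ⊆ Ω.dom := by
      intro x hx
      rw [mem_dom_iff hsub]
      exact hs (tsupport_comp_subset_preimage φ (charEquiv lam).symm.continuous hx)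
    have h4 := hP _ hψ hsup
    obtain ⟨κ, hκ⟩ := exists_integral_comp_equiv (charEquiv lam)
    have h5 := hκ fun x => u x * waveOp lam (φ ∘ (charEquiv lam).symm) x
    rw [h4, mul_zero] at h5
    have h6 : (φ ∘ (charEquiv lam).symm) ∘ charEquiv lam = φ := by
      funext p; simp
    simp_rw [waveOp_comp hψ.1, h6, mul_left_comm (u _)] at h5
    rw [integral_const_mul] at h5
    have hl : ((lam : ℝ) : ℂ) ≠ 0 := by exact_mod_cast (lam_pos lam).ne'
    simpa [hl] using h5

theorem IsCharSol.inH1LocDot (hsub : Ω.Subcritical lam) {u VS VT : ℝ × ℝ → ℂ}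
    (h : IsCharSol (Ω.bounce lam) (u ∘ charEquiv lam) VS VT) :
    InH1LocDot Ω u ∧ IsHomogeneous Ω lam u ∧ HasWeakDeriv (0, 1) u fun x =>
      ((slope lam : ℝ) : ℂ)⁻¹ * (VS ((charEquiv lam).symm x) - VT ((charEquiv lam).symm x)) := by
  have hc := slope_pos lam
  have hu : (u ∘ charEquiv lam) ∘ (charEquiv lam).symm = u := by
    funext p; simp
  have hl2 : L2Loc u := by
    have := h.l2.comp_equiv (charEquiv lam).symm
    rwa [hu] at this
  have hd := fun a b : ℝ => (h.dS.combo h.l2 h.dT a b)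
  have h1 := hd 1 1
  have h2 := hd (slope lam)⁻¹ (-(slope lam)⁻¹)
  have e1 : (charEquiv lam).symm (1, 0) = (1 : ℝ) • (1, 0) + (1 : ℝ) • (0, 1) := by
    rw [charEquiv_symm_apply]; ext <;> simp
  have e2 : (charEquiv lam).symm (0, 1) = (slope lam)⁻¹ • (1, 0) + (-(slope lam)⁻¹) • (0, 1) := by
    rw [charEquiv_symm_apply]; ext <;> simp
  rw [← e1] at h1
  rw [← e2] at h2
  have h1' := h1.comp_equiv
  have h2' := h2.comp_equiv
  rw [hu] at h1' h2'
  refine ⟨⟨hl2, ⟨_, h1'⟩, ⟨_, h2'⟩, ?_⟩, fun φ hφ hs => ?_, ?_⟩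
  · filter_upwards [(quasiMeasurePreserving_equiv (charEquiv lam).symm).ae h.supp] with x hx hx'
    rw [← hu]
    refine hx fun hmem => hx' (subset_closure ?_)
    rwa [mem_dom_iff hsub]
  · have hψ : IsTest (φ ∘ charEquiv lam) := hφ.comp_equiv (charEquiv lam)
    have h4 := h.eqn _ hψ fun p hp => by
      have := hs (tsupport_comp_subset_preimage φ (charEquiv lam).continuous hp)
      rwa [mem_dom_iff hsub, ContinuousLinearEquiv.symm_apply_apply] at this
    obtain ⟨κ, hκ⟩ := exists_integral_comp_equiv (charEquiv lam).symm
    have h5 := hκ fun p => (u ∘ charEquiv lam) p * dirDeriv (1, 0) (dirDeriv (0, 1) (φ ∘ charEquiv lam)) p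
    rw [h4, mul_zero] at h5
    have h6 : ∀ x, u x * waveOp lam φ x = -4 * ((lam : ℝ) : ℂ) ^ 2 *
        ((u ∘ charEquiv lam) ((charEquiv lam).symm x) *
          dirDeriv (1, 0) (dirDeriv (0, 1) (φ ∘ charEquiv lam)) ((charEquiv lam).symm x)) := by
      intro x
      have := waveOp_comp (lam := lam) hφ.1 ((charEquiv lam).symm x)
      rw [ContinuousLinearEquiv.apply_symm_apply] at this
      rw [this, Function.comp_apply, ContinuousLinearEquiv.apply_symm_apply]
      ring
    simp_rw [h6]
    rw [integral_const_mul, h5, mul_zero]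
  · refine h2'.congr (ae_eq_refl _) (ae_of_all _ fun x => ?_)
    simp only [Function.comp_apply]
    push_cast
    ring

end Char

/-! ### Functions with vanishing weak derivative on a region with interval fibres -/

section Fibres

/-- The region between the graphs of `α` and `β`. -/
def between (α β : ℝ → ℝ) : Set (ℝ × ℝ) := {p | α p.1 < p.2 ∧ p.2 < β p.1}

theorem isOpen_between {α β : ℝ → ℝ} (hα : Continuous α) (hβ : Continuous β) :
    IsOpen (between α β) :=
  (isOpen_lt (hα.comp continuous_fst) continuous_snd).inter
    (isOpen_lt continuous_snd (hβ.comp continuous_fst))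

theorem IsTest.comp_mk {ψ : ℝ × ℝ → ℂ} (hψ : IsTest ψ) (s : ℝ) :
    Continuous (fun t => ψ (s, t)) ∧ HasCompactSupport fun t => ψ (s, t) := by
  refine ⟨hψ.continuous.comp (Continuous.prodMk_right s), ?_⟩
  refine HasCompactSupport.intro (hψ.2.isCompact.image continuous_snd) fun t ht => ?_
  by_contra h
  exact ht ⟨(s, t), subset_tsupport _ h, rfl⟩

theorem IsTest.integrable_mk {ψ : ℝ × ℝ → ℂ} (hψ : IsTest ψ) (s : ℝ) :
    Integrable fun t => ψ (s, t) :=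
  (hψ.comp_mk s).1.integrable_of_hasCompactSupport (hψ.comp_mk s).2

/-- The integral is the convolution of ψ in its second variable with the Heaviside function, so
joint smoothness is that of a convolution depending on a parameter. -/
theorem IsTest.contDiff_integral_Iic {ψ : ℝ × ℝ → ℂ} (hψ : IsTest ψ) :
    ContDiff ℝ ∞ fun p : ℝ × ℝ => ∫ r in Iic p.2, ψ (p.1, r) := by
  have hf : LocallyIntegrable (indicator (Ici (0 : ℝ)) fun _ => (1 : ℝ)) :=
    (locallyIntegrable_const 1).indicator measurableSet_Ici
  have h := contDiffOn_convolution_right_with_param (𝕜 := ℝ) (n := ⊤) (μ := volume)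
    (ContinuousLinearMap.lsmul ℝ ℝ) (f := indicator (Ici (0 : ℝ)) fun _ => (1 : ℝ))
    (g := fun (s : ℝ) (t : ℝ) => ψ (s, t)) (s := univ) (k := Prod.snd '' tsupport ψ) isOpen_univ
    (hψ.2.isCompact.image continuous_snd) (fun s t _ ht => by
      by_contra h
      exact ht ⟨(s, t), subset_tsupport _ h, rfl⟩) hf (hψ.1.contDiffOn)
  rw [univ_prod_univ, contDiffOn_univ] at h
  refine (congrArg (ContDiff ℝ ∞) (funext fun p => ?_)).mpr h
  rw [convolution, ← integral_indicator measurableSet_Iic, ← integral_sub_left_eq_self _ _ p.2]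
  congr 1
  funext r
  simp only [ContinuousLinearMap.lsmul_apply, indicator_apply, mem_Iic, mem_Ici]
  by_cases hr : 0 ≤ r
  · rw [if_pos (by linarith), if_pos hr, one_smul]
  · rw [if_neg (by linarith), if_neg hr, zero_smul]

theorem dirDeriv_eq_of_hasDerivAt {χ : ℝ × ℝ → ℂ} {s t : ℝ} (hχ : DifferentiableAt ℝ χ (s, t)) {d : ℂ}
    (h : HasDerivAt (fun t => χ (s, t)) d t) : dirDeriv (0, 1) χ (s, t) = d := by
  have h1 : HasDerivAt (fun t : ℝ => (s, t)) ((0, 1) : ℝ × ℝ) t :=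
    (hasDerivAt_const t s).prodMk (hasDerivAt_id t)
  exact (hχ.hasFDerivAt.comp_hasDerivAt t h1).unique h

theorem hasDerivAt_snd {χ : ℝ × ℝ → ℂ} (hχ : Differentiable ℝ χ) (s t : ℝ) :
    HasDerivAt (fun t => χ (s, t)) (dirDeriv (0, 1) χ (s, t)) t := by
  have h1 : HasDerivAt (fun t : ℝ => (s, t)) ((0, 1) : ℝ × ℝ) t :=
    (hasDerivAt_const t s).prodMk (hasDerivAt_id t)
  exact (hχ (s, t)).hasFDerivAt.comp_hasDerivAt t h1

theorem hasDerivAt_fst {χ : ℝ × ℝ → ℂ} (hχ : Differentiable ℝ χ) (s t : ℝ) :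
    HasDerivAt (fun s => χ (s, t)) (dirDeriv (1, 0) χ (s, t)) s := by
  have h1 : HasDerivAt (fun s : ℝ => (s, t)) ((1, 0) : ℝ × ℝ) s :=
    (hasDerivAt_id s).prodMk (hasDerivAt_const s t)
  exact (hχ (s, t)).hasFDerivAt.comp_hasDerivAt s h1

theorem dirDeriv_integral_Iic {ψ : ℝ × ℝ → ℂ} (hψ : IsTest ψ) :
    dirDeriv (0, 1) (fun p : ℝ × ℝ => ∫ r in Iic p.2, ψ (p.1, r)) = ψ := by
  funext ⟨s, t⟩
  refine dirDeriv_eq_of_hasDerivAt (hψ.contDiff_integral_Iic.differentiable (by simp) _) ?_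
  have hi := hψ.integrable_mk s
  have h1 : ∀ t, ∫ r in Iic t, ψ (s, r) = (∫ r in Iic 0, ψ (s, r)) + ∫ r in (0 : ℝ)..t, ψ (s, r) :=
    fun t => by
      rw [intervalIntegral.integral_Iic_sub_Iic (hi.integrableOn) (hi.integrableOn) |>.symm]
      ring
  change HasDerivAt (fun t => ∫ r in Iic t, ψ (s, r)) _ t
  rw [funext h1]
  exact ((hψ.comp_mk s).1.integral_hasStrictDerivAt 0 t).hasDerivAt.const_add _

/-- A test function with vanishing integrals over the fibres is the derivative of a test function in
the same region. -/
theorem exists_test_antideriv {α β : ℝ → ℝ} {ψ : ℝ × ℝ → ℂ} (hψ : IsTest ψ)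
    (hs : tsupport ψ ⊆ between α β) (h0 : ∀ s, ∫ t, ψ (s, t) = 0) :
    ∃ χ, IsTest χ ∧ tsupport χ ⊆ between α β ∧ dirDeriv (0, 1) χ = ψ := by
  set K := tsupport ψ with hK
  have hKc : IsCompact K := hψ.2.isCompact
  -- The image of A under F is the fibrewise convex hull of the support of ψ. It is compact and, the
  -- fibres being intervals, stays in the region. It contains the support of the primitive, which
  -- vanishes below the support of ψ and, by the zero integrals, above it.
  let A : Set (((ℝ × ℝ) × (ℝ × ℝ)) × ℝ) := ((K ×ˢ K) ∩ {q | q.1.1 = q.2.1}) ×ˢ Icc 0 1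
  have hA : IsCompact A := ((hKc.prod hKc).inter_right
    (isClosed_eq (by fun_prop) (by fun_prop))).prod isCompact_Icc
  let F : ((ℝ × ℝ) × (ℝ × ℝ)) × ℝ → ℝ × ℝ := fun q =>
    (q.1.1.1, (1 - q.2) * q.1.1.2 + q.2 * q.1.2.2)
  have hF : Continuous F := by fun_prop
  have hsupp : ∀ p : ℝ × ℝ, ∫ r in Iic p.2, ψ (p.1, r) ≠ 0 → p ∈ F '' A := by
    rintro ⟨s, t⟩ hp
    obtain ⟨r, hr, hr'⟩ : ∃ r ∈ Iic t, ψ (s, r) ≠ 0 := by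
      by_contra! h
      exact hp (setIntegral_eq_zero_of_forall_eq_zero h)
    obtain ⟨r', hr1, hr2⟩ : ∃ r ∈ Ioi t, ψ (s, r) ≠ 0 := by
      by_contra! h
      have h1 : ∫ r in Ioi t, ψ (s, r) = 0 := setIntegral_eq_zero_of_forall_eq_zero h
      have h2 := intervalIntegral.integral_Iic_add_Ioi (b := t) (hψ.integrable_mk s).integrableOn
        (hψ.integrable_mk s).integrableOn
      rw [h0, h1, add_zero] at h2
      exact hp h2
    have hlt : 0 < r' - r := by
      have h1 : r ≤ t := hr
      have h2 : t < r' := hr1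
      linarith
    refine ⟨(((s, r), (s, r')), (t - r) / (r' - r)), ⟨⟨⟨subset_tsupport _ hr', subset_tsupport _ hr2⟩,
      rfl⟩, ⟨div_nonneg (sub_nonneg.2 hr) hlt.le, ?_⟩⟩, ?_⟩
    · have h2 : t < r' := hr1
      rw [div_le_one hlt]; linarith
    · simp only [F]
      ext
      · rfl
      · simp only
        field_simp
        ring
  have hsub : F '' A ⊆ between α β := by
    rintro _ ⟨⟨⟨p, q⟩, θ⟩, ⟨⟨⟨hp, hq⟩, hpq⟩, h1, h2⟩, rfl⟩
    have hp' := hs hp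
    have hq' := hs hq
    have hpq' : p.1 = q.1 := hpq
    obtain ⟨a1, a2⟩ := hp'
    obtain ⟨b1, b2⟩ := hq'
    rw [← hpq'] at b1 b2
    simp only at h1 h2
    constructor
    · change α p.1 < (1 - θ) * p.2 + θ * q.2
      rcases h1.eq_or_lt with h | h
      · rw [← h]; linarith
      · nlinarith
    · change (1 - θ) * p.2 + θ * q.2 < β p.1
      rcases h1.eq_or_lt with h | h
      · rw [← h]; linarith
      · nlinarith
  have hcl : tsupport (fun p : ℝ × ℝ => ∫ r in Iic p.2, ψ (p.1, r)) ⊆ F '' A :=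
    closure_minimal (fun p hp => hsupp p hp) (hA.image hF).isClosed
  exact ⟨_, ⟨hψ.contDiff_integral_Iic, (hA.image hF).of_isClosed_subset (isClosed_tsupport _) hcl⟩,
    hcl.trans hsub, dirDeriv_integral_Iic hψ⟩

theorem IsTest.exists_integral_fibre {φ : ℝ × ℝ → ℂ} (hφ : IsTest φ) :
    ContDiff ℝ ∞ fun s => ∫ t, φ (s, t) := by
  obtain ⟨T, hT⟩ := (hφ.2.isCompact.image continuous_snd).bddAbove
  have h : ∀ s, ∫ t, φ (s, t) = ∫ r in Iic T, φ (s, r) := by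
    intro s
    refine (setIntegral_eq_integral_of_forall_compl_eq_zero fun t ht => ?_).symm
    by_contra h
    exact ht (hT ⟨(s, t), subset_tsupport _ h, rfl⟩)
  rw [funext h]
  exact hφ.contDiff_integral_Iic.comp (contDiff_id.prodMk contDiff_const)

theorem LocallyIntegrable.integrable_mul_of_support {v η : ℝ × ℝ → ℂ} (hv : LocallyIntegrable v)
    {K : Set (ℝ × ℝ)} (hK : IsCompact K) (hη : Measurable η) {B : ℝ} (hB : ∀ p, ‖η p‖ ≤ B)
    (h0 : ∀ p, p ∉ K → η p = 0) : Integrable fun p => v p * η p := by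
  have h1 : Integrable (fun p => v p * η p) (volume.restrict K) :=
    (hv.integrableOn_isCompact hK).mul_bdd (c := B) hη.aestronglyMeasurable (ae_of_all _ hB)
  rw [← integrableOn_univ]
  refine IntegrableOn.of_forall_sdiff_eq_zero (s := K) h1 MeasurableSet.univ fun p hp => ?_
  rw [h0 p hp.2, mul_zero]

/-- A smooth bump of integral one, supported in `[-r, r]`. -/
theorem exists_bump {r : ℝ} (hr : 0 < r) : ∃ k : ℝ → ℝ, ContDiff ℝ ∞ k ∧
    (∀ t, t ∉ Icc (-r) r → k t = 0) ∧ ∫ t, k t = 1 := by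
  let f : ContDiffBump (0 : ℝ) := ⟨r / 2, r, by positivity, by linarith⟩
  refine ⟨f.normed volume, f.contDiff_normed, fun t ht => ?_, f.integral_normed⟩
  by_contra h
  have h1 := f.support_normed_eq (μ := volume) ▸ (Function.mem_support.2 h)
  rw [Metric.mem_ball, dist_zero_right, Real.norm_eq_abs, abs_lt] at h1
  exact ht ⟨h1.1.le, h1.2.le⟩

theorem locallyIntegrable_comp_fst {V : ℝ → ℂ} (hV : LocallyIntegrable V) :
    LocallyIntegrable fun p : ℝ × ℝ => V p.1 := by
  rw [locallyIntegrable_iff]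
  intro K hK
  have h1 := hV.integrableOn_isCompact (hK.image continuous_fst)
  have hK2 := hK.image continuous_snd
  have : IsFiniteMeasure (volume.restrict (Prod.snd '' K)) :=
    isFiniteMeasure_restrict.2 hK2.measure_lt_top.ne
  have h2 : Integrable (fun p : ℝ × ℝ => V p.1 * 1)
      ((volume.restrict (Prod.fst '' K)).prod (volume.restrict (Prod.snd '' K))) :=
    Integrable.mul_prod (f := V) (g := fun _ => (1 : ℂ)) h1 (integrable_const 1)
  rw [Measure.prod_restrict, ← Measure.volume_eq_prod] at h2
  simp only [mul_one] at h2
  exact IntegrableOn.mono_set h2 fun p hp => ⟨⟨p, hp, rfl⟩, ⟨p, hp, rfl⟩⟩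

/-- A locally integrable function whose weak derivative in the second variable vanishes in the region
between two graphs depends there only on the first variable. -/
theorem exists_eq_fst {v : ℝ × ℝ → ℂ} (hv : LocallyIntegrable v) {α β m : ℝ → ℝ} (hα : Continuous α)
    (hβ : Continuous β) (hm : ContDiff ℝ ∞ m) {r : ℝ} (hr : 0 < r) (h1 : ∀ s, α s < m s - r)
    (h2 : ∀ s, m s + r < β s)
    (h : ∀ χ, IsTest χ → tsupport χ ⊆ between α β → ∫ p, v p * dirDeriv (0, 1) χ p = 0) :
    ∃ (k : ℝ → ℝ) (V : ℝ → ℂ), (∀ t, t ∉ Icc (-r) r → k t = 0) ∧ LocallyIntegrable V ∧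
      (∀ s, V s = ∫ t, v (s, t) * (k (t - m s) : ℂ)) ∧ ∀ᵐ p, p ∈ between α β → v p = V p.1 := by
  obtain ⟨k, hk, hk0, hk1⟩ := exists_bump hr
  set η : ℝ × ℝ → ℂ := fun p => (k (p.2 - m p.1) : ℂ) with hη
  have hηs : ContDiff ℝ ∞ η := Complex.ofRealCLM.contDiff.comp
    (hk.comp (contDiff_snd.sub (hm.comp contDiff_fst)))
  have hkc : HasCompactSupport k := HasCompactSupport.intro isCompact_Icc hk0
  obtain ⟨B, hB⟩ := hk.continuous.bounded_above_of_compact_support hkc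
  have hηB : ∀ p, ‖η p‖ ≤ B := fun p => by
    rw [hη, Complex.norm_real]; exact hB _
  -- the compact pieces of the support of `η`
  have hcpt : ∀ L : Set ℝ, IsCompact L → IsCompact ((fun q : ℝ × ℝ => (q.1, m q.1 + q.2)) ''
      (L ×ˢ Icc (-r) r)) := fun L hL =>
    (hL.prod isCompact_Icc).image (continuous_fst.prodMk ((hm.continuous.comp continuous_fst).add
      continuous_snd))
  have hη0 : ∀ (L : Set ℝ) (p : ℝ × ℝ), p.1 ∈ L → p ∉ (fun q : ℝ × ℝ => (q.1, m q.1 + q.2)) ''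
      (L ×ˢ Icc (-r) r) → η p = 0 := by
    intro L p hp hp'
    rw [hη]
    simp only
    rw [hk0, Complex.ofReal_zero]
    intro hmem
    exact hp' ⟨(p.1, p.2 - m p.1), ⟨hp, hmem⟩, by ext <;> simp⟩
  have hint : ∀ L : Set ℝ, IsCompact L → ∀ c : ℝ → ℂ, Measurable c → (∃ D, ∀ s, ‖c s‖ ≤ D) →
      (∀ s, s ∉ L → c s = 0) → Integrable fun p : ℝ × ℝ => v p * (c p.1 * η p) := by
    rintro L hL c hc ⟨D, hD⟩ hc0
    refine LocallyIntegrable.integrable_mul_of_support hv (hcpt L hL)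
      ((hc.comp measurable_fst).mul hηs.continuous.measurable) (B := D * B) (fun p => ?_) fun p hp => ?_
    · rw [norm_mul]
      exact mul_le_mul (hD _) (hηB p) (norm_nonneg _) ((norm_nonneg _).trans (hD p.1))
    · by_cases hpL : p.1 ∈ L
      · rw [hη0 L p hpL hp, mul_zero]
      · rw [hc0 _ hpL, zero_mul]
  set V : ℝ → ℂ := fun s => ∫ t, v (s, t) * η (s, t) with hVdef
  have hV : LocallyIntegrable V := by
    rw [locallyIntegrable_iff]
    intro L hL
    have h3 := hint L hL (indicator L fun _ => 1) (measurable_const.indicator hL.measurableSet)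
      ⟨1, fun s => (norm_indicator_le_norm_self _ _).trans (by simp)⟩ fun s hs => indicator_of_notMem hs _
    have h4 := h3.integral_prod_left
    rw [← integrable_indicator_iff hL.measurableSet]
    refine h4.congr (ae_of_all _ fun s => ?_)
    by_cases hs : s ∈ L
    · simp [hs, hVdef]
    · simp [hs]
  refine ⟨k, V, hk0, hV, fun s => rfl, ?_⟩
  have hloc : LocallyIntegrable fun p : ℝ × ℝ => v p - V p.1 :=
    hv.sub (locallyIntegrable_comp_fst hV)
  have key := ae_eq_zero_of_test hloc (isOpen_between hα hβ) fun φ hφ hs => ?_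
  · filter_upwards [key] with p hp hp'
    exact sub_eq_zero.1 (hp hp')
  -- As η has fibre integrals one, φ - Φη has fibre integrals zero, so it is a t-derivative and is
  -- annihilated by v. Thus ∫ vφ = ∫ vΦη = ∫ VΦ = ∫ Vφ.
  set Φ : ℝ → ℂ := fun s => ∫ t, φ (s, t) with hΦ
  have hΦs : ContDiff ℝ ∞ Φ := hφ.exists_integral_fibre
  set L := Prod.fst '' tsupport φ with hL
  have hLc : IsCompact L := hφ.2.isCompact.image continuous_fst
  have hΦ0 : ∀ s, s ∉ L → Φ s = 0 := by
    intro s hs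
    rw [hΦ]
    have : ∀ t, φ (s, t) = 0 := fun t => by
      by_contra h
      exact hs ⟨(s, t), subset_tsupport _ h, rfl⟩
    simp [this]
  have hΦc : HasCompactSupport Φ := HasCompactSupport.intro hLc hΦ0
  obtain ⟨D, hD⟩ := hΦs.continuous.bounded_above_of_compact_support hΦc
  have hΦη : IsTest fun p => Φ p.1 * η p := by
    refine ⟨(hΦs.comp contDiff_fst).mul hηs, HasCompactSupport.intro (hcpt L hLc) fun p hp => ?_⟩
    by_cases hpL : p.1 ∈ L
    · rw [hη0 L p hpL hp, mul_zero]
    · rw [hΦ0 _ hpL, zero_mul]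
  have hΦηs : tsupport (fun p => Φ p.1 * η p) ⊆ between α β := by
    refine (closure_minimal (t := (fun q : ℝ × ℝ => (q.1, m q.1 + q.2)) '' (L ×ˢ Icc (-r) r))
      (fun p hp => ?_) (hcpt L hLc).isClosed).trans ?_
    · by_contra hp'
      refine hp ?_
      by_cases hpL : p.1 ∈ L
      · simp only [hη0 L p hpL hp', mul_zero]
      · simp only [hΦ0 _ hpL, zero_mul]
    · rintro _ ⟨q, ⟨-, hq1, hq2⟩, rfl⟩
      have := h1 q.1
      have := h2 q.1
      constructor
      · change α q.1 < m q.1 + q.2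
        linarith
      · change m q.1 + q.2 < β q.1
        linarith
  have hψ : IsTest fun p => φ p - Φ p.1 * η p := ⟨hφ.1.sub hΦη.1, hφ.2.sub hΦη.2⟩
  have hψs : tsupport (fun p => φ p - Φ p.1 * η p) ⊆ between α β :=
    (tsupport_sub φ _).trans (union_subset hs hΦηs)
  have hη1 : ∀ s, ∫ t, η (s, t) = 1 := by
    intro s
    simp only [hη]
    rw [integral_complex_ofReal, integral_sub_right_eq_self k (m s), hk1, Complex.ofReal_one]
  have hηi : ∀ s, Integrable fun t => η (s, t) := by
    intro s
    have := (hk.continuous.integrable_of_hasCompactSupport (μ := volume) hkc).comp_sub_right (m s)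
    exact this.ofReal
  obtain ⟨χ, hχ, hχs, hχd⟩ := exists_test_antideriv hψ hψs fun s => by
    change ∫ t, φ (s, t) - Φ s * η (s, t) = 0
    rw [integral_sub (hφ.integrable_mk s) ((hηi s).const_mul _), integral_const_mul, hη1, mul_one, sub_self]
  have h3 := h χ hχ hχs
  rw [hχd] at h3
  have hi1 := LocallyIntegrable.integrable_mul_test hv hφ
  have hi2 := LocallyIntegrable.integrable_mul_test hv hΦη
  have hi3 := LocallyIntegrable.integrable_mul_test (locallyIntegrable_comp_fst hV) hφ
  simp_rw [mul_sub] at h3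
  rw [integral_sub hi1 hi2, sub_eq_zero] at h3
  simp_rw [sub_mul]
  rw [integral_sub hi1 hi3, h3, sub_eq_zero]
  rw [Measure.volume_eq_prod] at hi2 hi3 ⊢
  rw [integral_prod _ hi2, integral_prod _ hi3]
  congr 1
  funext s
  simp only
  rw [integral_const_mul]
  simp_rw [mul_left_comm (v _)]
  rw [integral_const_mul, mul_comm]

end Fibres

/-! ### The profile of a solution of the wave equation in the strip -/

section Forward

theorem memLp_two_iff {α : Type*} [MeasurableSpace α] {μ : Measure α} {f : α → ℂ} :
    MemLp f 2 μ ↔ AEStronglyMeasurable f μ ∧ ∫⁻ x, ‖f x‖ₑ ^ 2 ∂μ < ⊤ := by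
  rw [MemLp, eLpNorm_lt_top_iff_lintegral_rpow_enorm_lt_top (by norm_num) (by norm_num)]
  simp

/-- `L²_loc(ℝ)`. -/
def L2Loc1 (h : ℝ → ℂ) : Prop := ∀ K : Set ℝ, IsCompact K → MemLp h 2 (volume.restrict K)

theorem L2Loc1.locallyIntegrable {v : ℝ → ℂ} (hv : L2Loc1 v) : LocallyIntegrable v := by
  rw [locallyIntegrable_iff]
  intro K hK
  have : IsFiniteMeasure (volume.restrict K) := isFiniteMeasure_restrict.2 hK.measure_lt_top.ne
  exact (hv K hK).integrable (by norm_num)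

theorem ae_eq_zero_of_test_real {v : ℝ → ℂ} (hv : LocallyIntegrable v)
    (h : ∀ g : ℝ → ℂ, ContDiff ℝ ∞ g → HasCompactSupport g → ∫ s, v s * g s = 0) :
    ∀ᵐ s, v s = 0 := by
  refine ae_eq_zero_of_integral_contDiff_smul_eq_zero hv fun g h1 h2 => ?_
  rw [← h _ (Complex.ofRealCLM.contDiff.comp h1)
    (h2.comp_left (g := fun x : ℝ => (x : ℂ)) Complex.ofReal_zero)]
  refine integral_congr_ae (ae_of_all _ fun p => ?_)
  simp [mul_comm]

variable {b : ℝ → ℝ}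

theorem measurableSet_strip (hb : Continuous b) : MeasurableSet (strip b) :=
  (isOpen_between continuous_id hb).measurableSet

theorem ae_notMem_strip (hb : Continuous b) :
    ∀ᵐ p : ℝ × ℝ, p ∉ strip b → p.2 < p.1 ∨ b p.1 < p.2 := by
  have h1 : ∀ᵐ x : ℝ × ℝ, ¬ x.2 = b x.1 := by
    rw [ae_iff]
    simpa using volume_graph hb.measurable
  have h2 : ∀ᵐ x : ℝ × ℝ, ¬ x.2 = (fun s : ℝ => s) x.1 := by
    rw [ae_iff]
    simpa using volume_graph (f := fun s => s) measurable_id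
  filter_upwards [h1, h2] with p hp1 hp2 hp
  by_contra! h3
  exact hp ⟨lt_of_le_of_ne h3.1 (Ne.symm hp2), lt_of_le_of_ne h3.2 hp1⟩

/-- Weak derivatives are local, and up to the two boundary curves, which are null, the complement of
the strip is open. -/
theorem HasWeakDeriv.ae_eq_zero {e : ℝ × ℝ} {U V : ℝ × ℝ → ℂ} (h : HasWeakDeriv e U V)
    (hb : Continuous b) (hU : ∀ᵐ p, p ∉ strip b → U p = 0) : ∀ᵐ p, p ∉ strip b → V p = 0 := by
  have hO : IsOpen {p : ℝ × ℝ | p.2 < p.1 ∨ b p.1 < p.2} :=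
    (isOpen_lt continuous_snd continuous_fst).union
      (isOpen_lt (hb.comp continuous_fst) continuous_snd)
  have key := ae_eq_zero_of_test h.1.locallyIntegrable hO fun φ hφ hs => ?_
  · filter_upwards [key, ae_notMem_strip hb] with p h1 h2 h3
    exact h1 (h2 h3)
  · have h1 := h.2 φ hφ
    have h2 : ∫ p, U p * dirDeriv e φ p = 0 := by
      refine integral_eq_zero_of_ae ?_
      filter_upwards [hU] with p hp
      by_cases hps : p ∈ strip b
      · have : p ∉ tsupport φ := fun h => by
          rcases hs h with h4 | h4
          · exact lt_asymm h4 hps.1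
          · exact lt_asymm h4 hps.2
        rw [dirDeriv_apply, fderiv_of_notMem_tsupport ℝ this]
        simp
      · rw [hp hps, zero_mul, Pi.zero_apply]
    rw [h2] at h1
    exact neg_eq_zero.1 h1.symm

/-- Fubini and the fundamental theorem on each fibre: the t-derivative of a function of s cut off to
the strip is carried by the two boundary curves. -/
theorem integral_strip_fst (hb : Continuous b) (hlt : ∀ s, s ≤ b s) {V : ℝ → ℂ} (hV : LocallyIntegrable V)
    {φ : ℝ × ℝ → ℂ} (hφ : IsTest φ) :
    ∫ p, (strip b).indicator (fun p => V p.1) p * dirDeriv (0, 1) φ p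
      = ∫ s, V s * (φ (s, b s) - φ (s, s)) := by
  have hi := LocallyIntegrable.integrable_mul_test
    ((locallyIntegrable_comp_fst hV).indicator (measurableSet_strip hb)) (hφ.dirDeriv (0, 1))
  rw [Measure.volume_eq_prod] at hi ⊢
  rw [integral_prod _ hi]
  congr 1
  funext s
  have h1 : ∀ t, (strip b).indicator (fun p => V p.1) (s, t) * dirDeriv (0, 1) φ (s, t)
      = (Ioo s (b s)).indicator (fun t => V s * dirDeriv (0, 1) φ (s, t)) t := by
    intro t
    by_cases ht : t ∈ Ioo s (b s)
    · rw [indicator_of_mem ht, indicator_of_mem (show (s, t) ∈ strip b from ht)]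
    · rw [indicator_of_notMem ht, indicator_of_notMem (show (s, t) ∉ strip b from ht), zero_mul]
  simp_rw [h1]
  rw [integral_indicator measurableSet_Ioo, ← integral_Ioc_eq_integral_Ioo,
    ← intervalIntegral.integral_of_le (hlt s), intervalIntegral.integral_const_mul,
    intervalIntegral.integral_eq_sub_of_hasDerivAt (fun t _ => hasDerivAt_snd hφ.differentiable s t)]
  exact ((hφ.dirDeriv (0, 1)).comp_mk s).1.intervalIntegrable _ _

theorem mem_strip_iff (hb : IsDiffeo b) {s t : ℝ} : (s, t) ∈ strip b ↔ s ∈ Ioo (Function.invFun b t) t := by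
  have h : t < b s ↔ Function.invFun b t < s := by
    conv_lhs => rw [← hb.apply_inv t, hb.strictMono.lt_iff_lt]
  exact ⟨fun h1 => ⟨h.1 h1.2, h1.1⟩, fun h1 => ⟨h1.2, h.2 h1.1⟩⟩

theorem locallyIntegrable_comp_snd {V : ℝ → ℂ} (hV : LocallyIntegrable V) :
    LocallyIntegrable fun p : ℝ × ℝ => V p.2 := by
  have h := locallyIntegrable_comp_fst hV
  rw [locallyIntegrable_iff] at h ⊢
  intro K hK
  have h1 := h _ (hK.image continuous_swap)
  have h2 := (Measure.measurePreserving_swap (μ := (volume : Measure ℝ)) (ν := (volume : Measure ℝ)))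
  have h3 := h2.integrableOn_comp_preimage (MeasurableEquiv.prodComm (α := ℝ) (β := ℝ)).measurableEmbedding
    (f := fun p : ℝ × ℝ => V p.1) (s := Prod.swap '' K)
  rw [preimage_image_eq _ Prod.swap_injective] at h3
  exact h3.2 h1

theorem integral_strip_snd (hb : IsDiffeo b) (hlt : ∀ s, s ≤ b s) {W : ℝ → ℂ} (hW : LocallyIntegrable W)
    {φ : ℝ × ℝ → ℂ} (hφ : IsTest φ) :
    ∫ p, (strip b).indicator (fun p => W p.2) p * dirDeriv (1, 0) φ p
      = ∫ t, W t * (φ (t, t) - φ (Function.invFun b t, t)) := by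
  have hi := LocallyIntegrable.integrable_mul_test
    ((locallyIntegrable_comp_snd hW).indicator (measurableSet_strip hb.continuous)) (hφ.dirDeriv (1, 0))
  rw [Measure.volume_eq_prod] at hi ⊢
  rw [integral_prod_symm _ hi]
  congr 1
  funext t
  have h1 : ∀ s, (strip b).indicator (fun p => W p.2) (s, t) * dirDeriv (1, 0) φ (s, t)
      = (Ioo (Function.invFun b t) t).indicator (fun s => W t * dirDeriv (1, 0) φ (s, t)) s := by
    intro s
    by_cases ht : s ∈ Ioo (Function.invFun b t) t
    · rw [indicator_of_mem ht, indicator_of_mem ((mem_strip_iff hb).2 ht)]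
    · rw [indicator_of_notMem ht, indicator_of_notMem fun h => ht ((mem_strip_iff hb).1 h), zero_mul]
  have hle : Function.invFun b t ≤ t := by
    have := hlt (Function.invFun b t)
    rwa [hb.apply_inv] at this
  simp_rw [h1]
  rw [integral_indicator measurableSet_Ioo, ← integral_Ioc_eq_integral_Ioo,
    ← intervalIntegral.integral_of_le hle, intervalIntegral.integral_const_mul,
    intervalIntegral.integral_eq_sub_of_hasDerivAt (fun s _ => hasDerivAt_fst hφ.differentiable s t)]
  exact ((hφ.dirDeriv (1, 0)).continuous.comp (Continuous.prodMk_left t)).intervalIntegrable _ _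

theorem isTest_bump {g : ℝ → ℂ} (hg : ContDiff ℝ ∞ g) (hgc : HasCompactSupport g) {k m : ℝ → ℝ} {r : ℝ}
    (hk : ContDiff ℝ ∞ k) (hk0 : ∀ t, t ∉ Icc (-r) r → k t = 0) (hm : ContDiff ℝ ∞ m) :
    IsTest fun p => g p.1 * (k (p.2 - m p.1) : ℂ) := by
  refine ⟨(hg.comp contDiff_fst).mul (Complex.ofRealCLM.contDiff.comp
    (hk.comp (contDiff_snd.sub (hm.comp contDiff_fst)))), ?_⟩
  have hc : IsCompact ((fun q : ℝ × ℝ => (q.1, m q.1 + q.2)) '' (tsupport g ×ˢ Icc (-r) r)) :=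
    (hgc.isCompact.prod isCompact_Icc).image (continuous_fst.prodMk
      ((hm.continuous.comp continuous_fst).add continuous_snd))
  refine HasCompactSupport.intro hc fun p hp => ?_
  by_contra h
  refine hp ⟨(p.1, p.2 - m p.1), ⟨subset_tsupport _ fun h1 => h ?_, ?_⟩, by ext <;> simp⟩
  · simp only [h1, zero_mul]
  · by_contra h1
    exact h (by simp only [hk0 _ h1, Complex.ofReal_zero, mul_zero])

theorem exists_bump_one {r : ℝ} (hr : 0 < r) : ∃ k : ℝ → ℝ, ContDiff ℝ ∞ k ∧
    (∀ t, t ∉ Icc (-r) r → k t = 0) ∧ k 0 = 1 := by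
  let f : ContDiffBump (0 : ℝ) := ⟨r / 2, r, by positivity, by linarith⟩
  refine ⟨f, f.contDiff, fun t ht => ?_, f.one_of_mem_closedBall (by simp only [f, Metric.mem_closedBall, dist_self]; positivity)⟩
  by_contra h
  have h1 := f.support_eq ▸ (Function.mem_support.2 h)
  rw [Metric.mem_ball, dist_zero_right, Real.norm_eq_abs, abs_lt] at h1
  exact ht ⟨h1.1.le, h1.2.le⟩

variable {δ : ℝ}

/-- The hypothesis equates two distributions carried by the curves t = s and t = b(s). Localized at
the diagonal it gives W = -V; localized at the graph, after the substitution t = b(s), it gives V =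
-b' · (W ∘ b). -/
theorem profile_relation (hb : IsDiffeo b) (hδ : 0 < δ) (hgap : ∀ s, s + δ ≤ b s) {V W : ℝ → ℂ} (hV : LocallyIntegrable V) (hW : LocallyIntegrable W)
    (h : ∀ φ, IsTest φ → ∫ s, V s * (φ (s, b s) - φ (s, s))
      = ∫ t, W t * (φ (t, t) - φ (Function.invFun b t, t))) :
    (∀ᵐ s, W s = -V s) ∧ ∀ᵐ s, V s = ((deriv b s : ℝ) : ℂ) * V (b s) := by
  -- The radius is below the gap δ, so a bump around one boundary curve does not see the other.
  obtain ⟨k, hk, hk0, hk1⟩ := exists_bump_one (r := δ / 2) (by positivity)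
  have hgap' : ∀ t, Function.invFun b t + δ ≤ t := fun t => by
    have := hgap (Function.invFun b t)
    rwa [hb.apply_inv] at this
  have hint : ∀ {v : ℝ → ℂ} (_ : LocallyIntegrable v) {g : ℝ → ℂ} (_ : ContDiff ℝ ∞ g)
      (_ : HasCompactSupport g), Integrable fun s => v s * g s := by
    intro v hv g hg hgc
    refine (hv.integrable_smul_left_of_hasCompactSupport hg.continuous hgc).congr
      (ae_of_all _ fun p => ?_)
    simp [mul_comm]
  have h1 : ∀ᵐ s, W s = -V s := by
    have := ae_eq_zero_of_test_real (hV.add hW) fun g hg hgc => ?_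
    · filter_upwards [this] with s hs
      exact eq_neg_of_add_eq_zero_right hs
    · have h2 := h _ (isTest_bump hg hgc hk hk0 contDiff_id)
      have e1 : ∀ s, k (b s - s) = 0 := fun s => hk0 _ fun hm => by
        have := hgap s
        have := hm.2
        linarith
      have e2 : ∀ t, k (t - Function.invFun b t) = 0 := fun t => hk0 _ fun hm => by
        have := hgap' t
        have := hm.2
        linarith
      simp only [id, e1, e2, sub_self, hk1, Complex.ofReal_one, Complex.ofReal_zero, mul_one, mul_zero,
        sub_zero, zero_sub, mul_neg, integral_neg] at h2
      simp only [Pi.add_apply, add_mul]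
      rw [integral_add (hint hV hg hgc) (hint hW hg hgc), ← h2]
      ring
  refine ⟨h1, ?_⟩
  have hWb : LocallyIntegrable fun s => ((deriv b s : ℝ) : ℂ) * W (b s) := by
    rw [locallyIntegrable_iff]
    intro K hK
    have h2 := (integrableOn_image_iff_integrableOn_abs_deriv_smul hK.measurableSet
      (fun s _ => (hb.hasDerivAt s).hasDerivWithinAt) hb.injective.injOn W).1
      (hW.integrableOn_isCompact (hK.image hb.continuous))
    refine h2.congr (ae_of_all _ fun s => ?_)
    simp only [abs_of_pos (hb.deriv_pos s), Complex.real_smul]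
  have h3 := ae_eq_zero_of_test_real (hV.add hWb) fun g hg hgc => ?_
  · have h4 := hb.ae_comp h1
    filter_upwards [h3, h4] with s hs hs'
    have hs2 : V s + ((deriv b s : ℝ) : ℂ) * W (b s) = 0 := hs
    rw [hs'] at hs2
    linear_combination hs2
  · have h2 := h _ (isTest_bump hg hgc hk hk0 hb.smooth)
    have e1 : ∀ s, k (s - b s) = 0 := fun s => hk0 _ fun hm => by
      have := hgap s
      have := hm.1
      linarith
    simp only [e1, sub_self, hk1, Complex.ofReal_one, Complex.ofReal_zero, mul_one, mul_zero,
      sub_zero, hb.apply_inv, zero_sub, mul_neg, integral_neg] at h2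
    rw [hb.integral_comp fun t => W t * g (Function.invFun b t)] at h2
    simp only [hb.inv_apply] at h2
    simp only [Pi.add_apply, add_mul]
    rw [integral_add (hint hV hg hgc) (hint hWb hg hgc), h2, ← integral_neg, ← integral_add]
    · refine integral_eq_zero_of_ae (ae_of_all _ fun s => ?_)
      simp only [Pi.zero_apply]
      ring
    · refine (hint hWb hg hgc).neg.congr (ae_of_all _ fun s => ?_)
      simp only [Pi.neg_apply]
      ring
    · exact hint hWb hg hgc

/-- The equation says that ∂ₛU has vanishing t-derivative in the strip. The curve t = s + δ/2 with
margin δ/3 stays inside, because all fibres have length at least δ. -/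
theorem IsCharSol.exists_fst (hb : IsDiffeo b) (hδ : 0 < δ) (hgap : ∀ s, s + δ ≤ b s) {U VS VT : ℝ × ℝ → ℂ} (h : IsCharSol b U VS VT) :
    ∃ V : ℝ → ℂ, LocallyIntegrable V ∧ VS =ᵐ[volume] (strip b).indicator fun p => V p.1 := by
  obtain ⟨-, V, -, hV, -, hVS⟩ := exists_eq_fst h.dS.1.locallyIntegrable continuous_id hb.continuous
    (m := fun s => s + δ / 2) (contDiff_id.add contDiff_const) (r := δ / 3) (by positivity)
    (fun s => by simp only [id]; linarith) (fun s => by have := hgap s; linarith) fun χ hχ hs => by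
      have h1 := h.dS.2 _ (hχ.dirDeriv (0, 1))
      rw [h.eqn χ hχ hs] at h1
      exact neg_eq_zero.1 h1.symm
  refine ⟨V, hV, ?_⟩
  filter_upwards [hVS, h.dS.ae_eq_zero hb.continuous h.supp] with p h1 h2
  by_cases hp : p ∈ strip b
  · rw [indicator_of_mem hp, h1 hp]
  · rw [indicator_of_notMem hp, h2 hp]

/-- The exchange of the coordinates. -/
def swapEquiv : (ℝ × ℝ) ≃L[ℝ] (ℝ × ℝ) := ContinuousLinearEquiv.prodComm ℝ ℝ ℝ

theorem IsCharSol.exists_snd (hb : IsDiffeo b) (hδ : 0 < δ) (hgap : ∀ s, s + δ ≤ b s) {U VS VT : ℝ × ℝ → ℂ} (h : IsCharSol b U VS VT) :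
    ∃ W : ℝ → ℂ, LocallyIntegrable W ∧ VT =ᵐ[volume] (strip b).indicator fun p => W p.2 := by
  have hgap' : ∀ t, Function.invFun b t + δ ≤ t := fun t => by
    have := hgap (Function.invFun b t)
    rwa [hb.apply_inv] at this
  have hmem : ∀ p : ℝ × ℝ, p ∈ between (Function.invFun b) id ↔ swapEquiv p ∈ strip b := fun p =>
    (mem_strip_iff hb (s := p.2) (t := p.1)).symm
  obtain ⟨-, W, -, hW, -, hVT⟩ := exists_eq_fst (h.dT.1.comp_equiv swapEquiv).locallyIntegrable
    hb.inv.continuous continuous_id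
    (m := fun s => s - δ / 2) (contDiff_id.sub contDiff_const) (r := δ / 3) (by positivity)
    (fun s => by have := hgap' s; linarith) (fun s => by simp only [id]; linarith) fun χ hχ hs => by
      have hψ : IsTest (χ ∘ swapEquiv) := hχ.comp_equiv swapEquiv
      have h1 := h.dT.2 _ (hψ.dirDeriv (1, 0))
      have h2 := h.eqn _ hψ fun p hp => by
        have := hs (tsupport_comp_subset_preimage χ swapEquiv.continuous hp)
        exact (hmem _).1 this
      simp_rw [dirDeriv_comm hψ.1 (0, 1) (1, 0)] at h1
      rw [h2, eq_comm, neg_eq_zero] at h1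
      obtain ⟨κ, hκ⟩ := exists_integral_comp_equiv swapEquiv
      have h3 := hκ fun p => VT p * dirDeriv (1, 0) (χ ∘ swapEquiv) p
      rw [h1, mul_zero, dirDeriv_comp_equiv] at h3
      exact h3
  refine ⟨W, hW, ?_⟩
  have h4 := (quasiMeasurePreserving_equiv swapEquiv).ae hVT
  filter_upwards [h4, h.dT.ae_eq_zero hb.continuous h.supp] with p h1 h2
  by_cases hp : p ∈ strip b
  · rw [indicator_of_mem hp]
    exact h1 ((hmem _).2 hp)
  · rw [indicator_of_notMem hp, h2 hp]

/-- Every fibre contains an interval of length δ on which the function is constant, so δ times the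
squared norm of V over L is bounded by the squared norm over a compact part of the strip. -/
theorem l2Loc1_of_strip (hδ : 0 < δ) (hgap : ∀ s, s + δ ≤ b s) {V : ℝ → ℂ} (hV : LocallyIntegrable V)
    (h : L2Loc ((strip b).indicator fun p => V p.1)) : L2Loc1 V := by
  classical
  intro L hL
  rw [memLp_two_iff]
  refine ⟨hV.aestronglyMeasurable.restrict, ?_⟩
  set K : Set (ℝ × ℝ) := (fun q : ℝ × ℝ => (q.1, q.1 + q.2)) '' (L ×ˢ Icc 0 δ) with hKdef
  have hK : IsCompact K := (hL.prod isCompact_Icc).image (by fun_prop)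
  have h1 := (memLp_two_iff.1 (h K hK)).2
  have hVm : AEMeasurable V := hV.aestronglyMeasurable.aemeasurable
  have h2 : ∫⁻ s in L, ‖V s‖ₑ ^ 2 * ENNReal.ofReal δ
      ≤ ∫⁻ p in K, ‖(strip b).indicator (fun p => V p.1) p‖ₑ ^ 2 := by
    set A : Set (ℝ × ℝ) := {p | p.1 ∈ L ∧ p.1 < p.2 ∧ p.2 < p.1 + δ} with hA
    have hAm : MeasurableSet A := (measurable_fst hL.measurableSet).inter
      ((measurableSet_lt measurable_fst measurable_snd).inter
        (measurableSet_lt measurable_snd (measurable_fst.add_const δ)))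
    have hAK : A ⊆ K := fun p hp =>
      ⟨(p.1, p.2 - p.1), ⟨hp.1, by linarith [hp.2.1], by linarith [hp.2.2]⟩, by ext <;> simp⟩
    have hAs : ∀ p ∈ A, p ∈ strip b := fun p hp => ⟨hp.2.1, hp.2.2.trans_le (hgap p.1)⟩
    calc ∫⁻ s in L, ‖V s‖ₑ ^ 2 * ENNReal.ofReal δ
        = ∫⁻ p, A.indicator (fun p => ‖V p.1‖ₑ ^ 2) p := by
          rw [Measure.volume_eq_prod, lintegral_prod]
          · rw [← lintegral_indicator hL.measurableSet]
            congr 1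
            funext s
            have e1 : ∀ t, A.indicator (fun p : ℝ × ℝ => ‖V p.1‖ₑ ^ 2) (s, t) = if s ∈ L then
                (Ioo s (s + δ)).indicator (fun _ => ‖V s‖ₑ ^ 2) t else 0 := by
              intro t
              by_cases hs : s ∈ L
              · rw [if_pos hs]
                by_cases ht : t ∈ Ioo s (s + δ)
                · rw [indicator_of_mem ht, indicator_of_mem (show (s, t) ∈ A from ⟨hs, ht⟩)]
                · rw [indicator_of_notMem ht, indicator_of_notMem fun h : (s, t) ∈ A => ht h.2]
              · rw [if_neg hs, indicator_of_notMem fun h : (s, t) ∈ A => hs h.1]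
            simp_rw [e1]
            by_cases hs : s ∈ L
            · simp [hs, lintegral_indicator measurableSet_Ioo]
            · simp [hs]
          · exact (((hVm.comp_quasiMeasurePreserving Measure.quasiMeasurePreserving_fst).enorm.pow_const 2).indicator
              hAm)
      _ = ∫⁻ p in A, ‖(strip b).indicator (fun p => V p.1) p‖ₑ ^ 2 := by
          rw [lintegral_indicator hAm]
          refine setLIntegral_congr_fun hAm fun p hp => ?_
          rw [indicator_of_mem (hAs p hp)]
      _ ≤ _ := lintegral_mono_set hAK
  have h3 := h2.trans_lt h1
  rw [lintegral_mul_const'' _ (hVm.restrict.enorm.pow_const 2)] at h3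
  exact ENNReal.lt_top_of_mul_ne_top_left h3.ne (by simpa using hδ)

/-- The derivatives of a solution are given by one function `h` with `h = b' h ∘ b`. -/
theorem IsCharSol.exists_profile (hb : IsDiffeo b) (hδ : 0 < δ) (hgap : ∀ s, s + δ ≤ b s) {U VS VT : ℝ × ℝ → ℂ} (h : IsCharSol b U VS VT) :
    ∃ V : ℝ → ℂ, L2Loc1 V ∧ (∀ᵐ s, V s = ((deriv b s : ℝ) : ℂ) * V (b s)) ∧
      (VS =ᵐ[volume] (strip b).indicator fun p => V p.1) ∧
      VT =ᵐ[volume] (strip b).indicator fun p => -V p.2 := by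
  obtain ⟨V, hV, hVS⟩ := h.exists_fst hb hδ hgap
  obtain ⟨W, hW, hVT⟩ := h.exists_snd hb hδ hgap
  have hle : ∀ s, s ≤ b s := fun s => by have := hgap s; linarith
  -- The derivatives of U are weak derivatives on the whole plane, so the mixed derivatives agree
  -- also across the boundary curves. This is where the Dirichlet condition enters.
  obtain ⟨h1, h2⟩ := profile_relation hb hδ hgap hV hW fun φ hφ => by
    rw [← integral_strip_fst hb.continuous hle hV hφ, ← integral_strip_snd hb hle hW hφ]
    have e1 := h.dS.2 _ (hφ.dirDeriv (0, 1))
    have e2 := h.dT.2 _ (hφ.dirDeriv (1, 0))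
    simp_rw [dirDeriv_comm hφ.1 (0, 1) (1, 0)] at e2
    rw [e1, neg_inj] at e2
    have e3 : ∫ p, VS p * dirDeriv (0, 1) φ p
        = ∫ p, (strip b).indicator (fun p => V p.1) p * dirDeriv (0, 1) φ p :=
      integral_congr_ae (hVS.mul (ae_eq_refl _))
    have e4 : ∫ p, VT p * dirDeriv (1, 0) φ p
        = ∫ p, (strip b).indicator (fun p => W p.2) p * dirDeriv (1, 0) φ p :=
      integral_congr_ae (hVT.mul (ae_eq_refl _))
    rw [← e3, ← e4, e2]
  refine ⟨V, l2Loc1_of_strip hδ hgap hV (h.dS.1.congr hVS), h2, hVS, hVT.trans ?_⟩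
  have h3 : ∀ᵐ p : ℝ × ℝ, W p.2 = -V p.2 := Measure.quasiMeasurePreserving_snd.ae h1
  filter_upwards [h3] with p hp
  by_cases hps : p ∈ strip b
  · rw [indicator_of_mem hps, indicator_of_mem hps, hp]
  · rw [indicator_of_notMem hps, indicator_of_notMem hps]

/-- The difference has vanishing t-derivative on the whole plane, so on the enlarged region s - 3 <
t < b(s) + 1 it depends on s only. That region reaches below the diagonal, where the difference
vanishes; the averaging curve t = s - 3/2 with radius 1 stays there. -/
theorem IsCharSol.ae_eq (hb : IsDiffeo b) (hδ : 0 < δ) (hgap : ∀ s, s + δ ≤ b s) {U U' VS VS' VT VT' : ℝ × ℝ → ℂ} (h : IsCharSol b U VS VT)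
    (h' : IsCharSol b U' VS' VT') (hVT : VT =ᵐ[volume] VT') : U =ᵐ[volume] U' := by
  have hloc : LocallyIntegrable fun p => U p - U' p := h.l2.locallyIntegrable.sub h'.l2.locallyIntegrable
  have hoff : ∀ᵐ p, p ∉ strip b → U p - U' p = 0 := by
    filter_upwards [h.supp, h'.supp] with p h1 h2 h3
    rw [h1 h3, h2 h3, sub_self]
  obtain ⟨k, V, hk, -, hV, hU⟩ := exists_eq_fst hloc (α := fun s => s - 3) (β := fun s => b s + 1)
    (by fun_prop) (hb.continuous.add continuous_const)
    (m := fun s => s - 3 / 2) (contDiff_id.sub contDiff_const) (r := 1) one_pos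
    (fun s => by linarith) (fun s => by have := hgap s; linarith) fun χ hχ _ => by
      simp_rw [sub_mul]
      rw [integral_sub (h.l2.integrable_mul_test (hχ.dirDeriv _))
        (h'.l2.integrable_mul_test (hχ.dirDeriv _)), h.dT.2 χ hχ, h'.dT.2 χ hχ, sub_eq_zero, neg_inj]
      exact integral_congr_ae (hVT.mul (ae_eq_refl χ))
  have hV0 : ∀ᵐ s, V s = 0 := by
    have h1 := Measure.ae_ae_of_ae_prod (μ := (volume : Measure ℝ)) (ν := (volume : Measure ℝ)) hoff
    filter_upwards [h1] with s hs
    rw [hV]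
    refine integral_eq_zero_of_ae ?_
    filter_upwards [hs] with t ht
    by_cases hm : t - (s - 3 / 2) ∈ Icc (-1 : ℝ) 1
    · have : (s, t) ∉ strip b := fun h => by
        have h1 : s < t := h.1
        have h2 := hm.2
        linarith
      have h3 : U (s, t) - U' (s, t) = 0 := ht this
      simp [h3]
    · simp [hk _ hm]
  have hV1 : ∀ᵐ p : ℝ × ℝ, V p.1 = 0 := Measure.quasiMeasurePreserving_fst.ae hV0
  filter_upwards [hU, hV1, hoff] with p h1 h2 h3
  by_cases hp : p ∈ strip b
  · have hp' : p ∈ between (fun s => s - 3) fun s => b s + 1 := by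
      have := hp.1
      have := hp.2
      constructor
      · change p.1 - 3 < p.2
        linarith
      · change p.2 < b p.1 + 1
        linarith
    rw [← sub_eq_zero, h1 hp', h2]
  · exact sub_eq_zero.1 (h3 hp)

end Forward

/-! ### The solution with a given profile -/

section Backward

theorem intervalIntegrable_of_locallyIntegrable {h : ℝ → ℂ} (hh : LocallyIntegrable h) {a b : ℝ} :
    IntervalIntegrable h volume a b :=
  (hh.integrableOn_isCompact isCompact_uIcc).intervalIntegrable

/-- Fubini on the triangle r ≤ s. It replaces the usual integration by parts, because h is only
locally integrable. -/
theorem integral_triangle {h φ φ' : ℝ → ℂ} (hh : LocallyIntegrable h) (hφ : ∀ x, HasDerivAt φ (φ' x) x)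
    (hφ' : Continuous φ') {a b : ℝ} :
    ∫ s in Ioc a b, (∫ r in Ioc a s, h r) * φ' s = ∫ r in Ioc a b, h r * (φ b - φ r) := by
  have hhi : IntegrableOn h (Ioc a b) := (hh.integrableOn_isCompact isCompact_Icc).mono_set Ioc_subset_Icc_self
  have hφi : IntegrableOn φ' (Ioc a b) :=
    (hφ'.locallyIntegrable.integrableOn_isCompact isCompact_Icc).mono_set Ioc_subset_Icc_self
  have hi : Integrable ({q : ℝ × ℝ | q.2 ≤ q.1}.indicator fun q => φ' q.1 * h q.2)
      ((volume.restrict (Ioc a b)).prod (volume.restrict (Ioc a b))) :=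
    (hφi.mul_prod hhi).indicator (measurableSet_le measurable_snd measurable_fst)
  have hswap := integral_integral_swap (f := fun s r => {q : ℝ × ℝ | q.2 ≤ q.1}.indicator
    (fun q => φ' q.1 * h q.2) (s, r)) hi
  have e1 : ∀ s ∈ Ioc a b, (∫ r in Ioc a b, {q : ℝ × ℝ | q.2 ≤ q.1}.indicator
      (fun q => φ' q.1 * h q.2) (s, r)) = (∫ r in Ioc a s, h r) * φ' s := by
    intro s hs
    have h1 : ∀ r, {q : ℝ × ℝ | q.2 ≤ q.1}.indicator (fun q => φ' q.1 * h q.2) (s, r)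
        = (Iic s).indicator (fun r => φ' s * h r) r := fun r => rfl
    rw [show (fun r => {q : ℝ × ℝ | q.2 ≤ q.1}.indicator (fun q => φ' q.1 * h q.2) (s, r))
        = (Iic s).indicator fun r => φ' s * h r from funext h1]
    have h2 : Ioc a b ∩ Iic s = Ioc a s := by
      ext r
      simp only [mem_inter_iff, mem_Ioc, mem_Iic]
      exact ⟨fun h => ⟨h.1.1, h.2⟩, fun h => ⟨⟨h.1, h.2.trans hs.2⟩, h.2⟩⟩
    rw [setIntegral_indicator measurableSet_Iic, h2, integral_const_mul, mul_comm]
  have e2 : ∀ r ∈ Ioc a b, (∫ s in Ioc a b, {q : ℝ × ℝ | q.2 ≤ q.1}.indicator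
      (fun q => φ' q.1 * h q.2) (s, r)) = h r * (φ b - φ r) := by
    intro r hr
    have h1 : ∀ s, {q : ℝ × ℝ | q.2 ≤ q.1}.indicator (fun q => φ' q.1 * h q.2) (s, r)
        = (Ici r).indicator (fun s => φ' s * h r) s := fun s => rfl
    rw [show (fun s => {q : ℝ × ℝ | q.2 ≤ q.1}.indicator (fun q => φ' q.1 * h q.2) (s, r))
        = (Ici r).indicator fun s => φ' s * h r from funext h1]
    have h2 : Ioc a b ∩ Ici r = Icc r b := by
      ext s
      simp only [mem_inter_iff, mem_Ioc, mem_Ici, mem_Icc]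
      exact ⟨fun h => ⟨h.2, h.1.2⟩, fun h => ⟨⟨hr.1.trans_le h.1, h.2⟩, h.1⟩⟩
    rw [setIntegral_indicator measurableSet_Ici, h2, integral_Icc_eq_integral_Ioc,
      ← intervalIntegral.integral_of_le hr.2, intervalIntegral.integral_mul_const,
      intervalIntegral.integral_eq_sub_of_hasDerivAt (fun x _ => hφ x) (hφ'.intervalIntegrable _ _),
      mul_comm]
  rw [← setIntegral_congr_fun measurableSet_Ioc e1, hswap, setIntegral_congr_fun measurableSet_Ioc e2]

/-- Integration by parts against the primitive of a locally integrable function. -/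
theorem integral_primitive_mul_deriv {h φ φ' : ℝ → ℂ} (hh : LocallyIntegrable h)
    (hφ : ∀ x, HasDerivAt φ (φ' x) x) (hφ' : Continuous φ') {a b : ℝ} (hab : a ≤ b) {F : ℝ → ℂ}
    (hF : ∀ x y, F y - F x = ∫ r in x..y, h r) (c : ℂ) :
    ∫ s in a..b, (F s - c) * φ' s
      = (F b - c) * φ b - (F a - c) * φ a - ∫ s in a..b, h s * φ s := by
  have hφc : Continuous φ := continuous_iff_continuousAt.2 fun x => (hφ x).continuousAt
  have hhi : IntegrableOn h (Ioc a b) := (hh.integrableOn_isCompact isCompact_Icc).mono_set Ioc_subset_Icc_self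
  have hi : IntegrableOn (fun r => h r * φ r) (Ioc a b) := by
    refine IntegrableOn.mono_set (IntegrableOn.mul_continuousOn_of_subset (K := Icc a b)
      (hh.integrableOn_isCompact isCompact_Icc) hφc.continuousOn measurableSet_Icc isCompact_Icc
      Subset.rfl) Ioc_subset_Icc_self
  have hFc : ContinuousOn F (Icc a b) := by
    have h1 : F = fun x => F a + ∫ r in a..x, h r := by
      funext x
      rw [← hF]; ring
    rw [h1]
    exact (continuous_const.add (intervalIntegral.continuous_primitive
      (fun _ _ => intervalIntegrable_of_locallyIntegrable hh) a)).continuousOn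
  have h1 : ∀ s ∈ Ioc a b, (F s - c) * φ' s = (F a - c) * φ' s + (∫ r in Ioc a s, h r) * φ' s := by
    intro s hs
    rw [← intervalIntegral.integral_of_le hs.1.le, ← hF]; ring
  have hpi : IntegrableOn φ' (Ioc a b) :=
    (hφ'.locallyIntegrable.integrableOn_isCompact isCompact_Icc).mono_set Ioc_subset_Icc_self
  have hti : IntegrableOn (fun s => (∫ r in Ioc a s, h r) * φ' s) (Ioc a b) := by
    have h2 : IntegrableOn (fun s => (F s - F a) * φ' s) (Icc a b) :=
      ((hFc.sub continuousOn_const).mul hφ'.continuousOn).integrableOn_Icc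
    refine (h2.mono_set Ioc_subset_Icc_self).congr_fun (fun s hs => ?_) measurableSet_Ioc
    simp only
    rw [hF, intervalIntegral.integral_of_le hs.1.le]
  rw [intervalIntegral.integral_of_le hab, setIntegral_congr_fun measurableSet_Ioc h1,
    integral_add (hpi.const_mul _) hti, integral_const_mul, integral_triangle hh hφ hφ',
    ← intervalIntegral.integral_of_le hab,
    intervalIntegral.integral_eq_sub_of_hasDerivAt (fun x _ => hφ x) (hφ'.intervalIntegrable _ _)]
  simp_rw [mul_sub]
  rw [integral_sub (hhi.mul_const _) hi, integral_mul_const, ← intervalIntegral.integral_of_le hab,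
    ← hF, intervalIntegral.integral_of_le hab]
  ring

theorem L2Loc.indicator {v : ℝ × ℝ → ℂ} (hv : L2Loc v) {s : Set (ℝ × ℝ)} (hs : MeasurableSet s) :
    L2Loc (s.indicator v) := fun K hK => (hv K hK).indicator hs

theorem l2Loc_of_continuous {v : ℝ × ℝ → ℂ} (hv : Continuous v) : L2Loc v := by
  intro K hK
  have : IsFiniteMeasure (volume.restrict K) := isFiniteMeasure_restrict.2 hK.measure_lt_top.ne
  obtain ⟨C, hC⟩ := hK.exists_bound_of_continuousOn hv.continuousOn
  exact MemLp.of_bound hv.aestronglyMeasurable C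
    ((ae_restrict_iff' hK.measurableSet).2 (ae_of_all _ fun p hp => hC p hp))

theorem L2Loc1.comp_fst {h : ℝ → ℂ} (hh : L2Loc1 h) : L2Loc fun p => h p.1 := by
  intro K hK
  have hK2 := hK.image continuous_snd
  have : IsFiniteMeasure (volume.restrict (Prod.snd '' K)) :=
    isFiniteMeasure_restrict.2 hK2.measure_lt_top.ne
  have h2 := (hh _ (hK.image continuous_fst)).comp_fst (volume.restrict (Prod.snd '' K))
  rw [Measure.prod_restrict, ← Measure.volume_eq_prod] at h2
  exact h2.mono_measure (Measure.restrict_mono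
    (show K ⊆ (Prod.fst '' K) ×ˢ (Prod.snd '' K) from fun p hp => ⟨⟨p, hp, rfl⟩, ⟨p, hp, rfl⟩⟩) le_rfl)

theorem L2Loc1.comp_snd {h : ℝ → ℂ} (hh : L2Loc1 h) : L2Loc fun p => h p.2 :=
  hh.comp_fst.comp_equiv swapEquiv

theorem L2Loc.neg {v : ℝ × ℝ → ℂ} (hv : L2Loc v) : L2Loc fun p => -v p := fun K hK => (hv K hK).neg

variable {b : ℝ → ℝ}

/-- Invariance of h dx makes its integrals over [x, y] and [b(x), b(y)] equal, so the integral over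
a fundamental interval of b does not depend on where it starts. -/
theorem integral_bounce_const (hb : IsDiffeo b) {h : ℝ → ℂ} (hh : LocallyIntegrable h)
    (hrel : ∀ s, h s = ((deriv b s : ℝ) : ℂ) * h (b s)) (x y : ℝ) :
    ∫ r in x..b x, h r = ∫ r in y..b y, h r := by
  have hi : ∀ x y, IntervalIntegrable h volume x y := fun x y => intervalIntegrable_of_locallyIntegrable hh
  have key : ∀ x y, x ≤ y → ∫ r in x..y, h r = ∫ r in b x..b y, h r := by
    intro x y hxy
    rw [intervalIntegral.integral_of_le hxy, intervalIntegral.integral_of_le (hb.strictMono.monotone hxy),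
      ← hb.image_Ioc, hb.integral_image measurableSet_Ioc]
    exact setIntegral_congr_fun measurableSet_Ioc fun s _ => hrel s
  have key' : ∫ r in x..y, h r = ∫ r in b x..b y, h r := by
    rcases le_total x y with hxy | hxy
    · exact key x y hxy
    · rw [intervalIntegral.integral_symm, key y x hxy, ← intervalIntegral.integral_symm]
  have h1 := intervalIntegral.integral_add_adjacent_intervals (hi x y) (hi y (b y))
  have h2 := intervalIntegral.integral_add_adjacent_intervals (hi x (b x)) (hi (b x) (b y))
  rw [← h2, key'] at h1
  linear_combination -h1

/-- The solution is F(s) - F(t) in the strip, with F a primitive of h. It vanishes on t = s by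
antisymmetry and on t = b(s) because zero flux means F ∘ b = F; so extension by zero creates no
boundary terms in the weak derivatives. -/
theorem exists_isCharSol_of_profile (hb : IsDiffeo b) (hlt : ∀ s, s < b s) {h : ℝ → ℂ} (hh : L2Loc1 h)
    (hrel : ∀ s, h s = ((deriv b s : ℝ) : ℂ) * h (b s)) {x₀ : ℝ} (h0 : ∫ r in x₀..b x₀, h r = 0) :
    ∃ U, IsCharSol b U ((strip b).indicator fun p => h p.1) ((strip b).indicator fun p => -h p.2) := by
  have hloc := hh.locallyIntegrable
  set F : ℝ → ℂ := fun x => ∫ r in (0 : ℝ)..x, h r with hFdef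
  have hF : ∀ x y, F y - F x = ∫ r in x..y, h r := fun x y =>
    intervalIntegral.integral_interval_sub_left
      (intervalIntegrable_of_locallyIntegrable hloc) (intervalIntegrable_of_locallyIntegrable hloc)
  have hFb : ∀ s, F (b s) = F s := fun s => by
    rw [← sub_eq_zero, hF, integral_bounce_const hb hloc hrel s x₀, h0]
  have hFinv : ∀ t, F (Function.invFun b t) = F t := fun t => by
    rw [← hFb (Function.invFun b t), hb.apply_inv]
  have hFc : Continuous F := intervalIntegral.continuous_primitive
    (fun _ _ => intervalIntegrable_of_locallyIntegrable hloc) 0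
  have hms := measurableSet_strip hb.continuous
  have hUl : L2Loc ((strip b).indicator fun p => F p.1 - F p.2) :=
    (l2Loc_of_continuous ((hFc.comp continuous_fst).sub (hFc.comp continuous_snd))).indicator hms
  have hSl : L2Loc ((strip b).indicator fun p => h p.1) := hh.comp_fst.indicator hms
  have hTl : L2Loc ((strip b).indicator fun p => -h p.2) := hh.comp_snd.neg.indicator hms
  have hdS : HasWeakDeriv (1, 0) ((strip b).indicator fun p => F p.1 - F p.2)
      ((strip b).indicator fun p => h p.1) := by
    refine ⟨hSl, fun φ hφ => ?_⟩
    have i1 := hUl.integrable_mul_test (hφ.dirDeriv (1, 0))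
    have i2 := hSl.integrable_mul_test hφ
    rw [Measure.volume_eq_prod] at i1 i2 ⊢
    rw [integral_prod_symm _ i1, integral_prod_symm _ i2, ← integral_neg]
    congr 1
    funext t
    have hle : Function.invFun b t ≤ t := by
      have := (hlt (Function.invFun b t)).le
      rwa [hb.apply_inv] at this
    have e : ∀ (f ψ : ℝ × ℝ → ℂ) (s : ℝ), (strip b).indicator f (s, t) * ψ (s, t)
        = (Ioo (Function.invFun b t) t).indicator (fun s => f (s, t) * ψ (s, t)) s := by
      intro f ψ s
      by_cases ht : s ∈ Ioo (Function.invFun b t) t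
      · rw [indicator_of_mem ht, indicator_of_mem ((mem_strip_iff hb).2 ht)]
      · rw [indicator_of_notMem ht, indicator_of_notMem fun h => ht ((mem_strip_iff hb).1 h), zero_mul]
    simp_rw [e]
    rw [integral_indicator measurableSet_Ioo, ← integral_Ioc_eq_integral_Ioo,
      ← intervalIntegral.integral_of_le hle, integral_indicator measurableSet_Ioo,
      ← integral_Ioc_eq_integral_Ioo, ← intervalIntegral.integral_of_le hle]
    rw [integral_primitive_mul_deriv hloc (fun s => hasDerivAt_fst hφ.differentiable s t)
      ((hφ.dirDeriv (1, 0)).continuous.comp (Continuous.prodMk_left t)) hle hF (F t), hFinv]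
    ring
  have hdT : HasWeakDeriv (0, 1) ((strip b).indicator fun p => F p.1 - F p.2)
      ((strip b).indicator fun p => -h p.2) := by
    refine ⟨hTl, fun φ hφ => ?_⟩
    have i1 := hUl.integrable_mul_test (hφ.dirDeriv (0, 1))
    have i2 := hTl.integrable_mul_test hφ
    rw [Measure.volume_eq_prod] at i1 i2 ⊢
    rw [integral_prod _ i1, integral_prod _ i2, ← integral_neg]
    congr 1
    funext s
    have hle := (hlt s).le
    have e : ∀ (f ψ : ℝ × ℝ → ℂ) (t : ℝ), (strip b).indicator f (s, t) * ψ (s, t)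
        = (Ioo s (b s)).indicator (fun t => f (s, t) * ψ (s, t)) t := by
      intro f ψ t
      by_cases ht : t ∈ Ioo s (b s)
      · rw [indicator_of_mem ht, indicator_of_mem (show (s, t) ∈ strip b from ht)]
      · rw [indicator_of_notMem ht, indicator_of_notMem (show (s, t) ∉ strip b from ht), zero_mul]
    simp_rw [e]
    rw [integral_indicator measurableSet_Ioo, ← integral_Ioc_eq_integral_Ioo,
      ← intervalIntegral.integral_of_le hle, integral_indicator measurableSet_Ioo,
      ← integral_Ioc_eq_integral_Ioo, ← intervalIntegral.integral_of_le hle]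
    have key := integral_primitive_mul_deriv hloc (fun t => hasDerivAt_snd hφ.differentiable s t)
      ((hφ.dirDeriv (0, 1)).comp_mk s).1 hle hF (F s)
    have e1 : ∀ t, (F s - F t) * dirDeriv (0, 1) φ (s, t) = -((F t - F s) * dirDeriv (0, 1) φ (s, t)) :=
      fun t => by ring
    simp_rw [e1, neg_mul]
    rw [intervalIntegral.integral_neg, intervalIntegral.integral_neg, key, hFb]
    ring
  refine ⟨_, hUl, hdS, hdT, ae_of_all _ fun p hp => indicator_of_notMem hp _, fun φ hφ hs => ?_⟩
  rw [hdS.2 _ (hφ.dirDeriv (0, 1)), neg_eq_zero, integral_strip_fst hb.continuous (fun s => (hlt s).le)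
    hloc hφ]
  refine integral_eq_zero_of_ae (ae_of_all _ fun s => ?_)
  have h1 : φ (s, b s) = 0 := by
    by_contra h
    exact lt_irrefl _ (hs (subset_tsupport _ h)).2
  have h2 : φ (s, s) = 0 := by
    by_contra h
    exact lt_irrefl _ (hs (subset_tsupport _ h)).1
  simp [h1, h2]

end Backward

/-! ### Neumann data -/

section Neumann

/-- Continuity of translations in L², after cutting h off to an interval larger by 1 on each side so
that small translates do not see the cut. -/
theorem tendsto_lintegral_translate {h : ℝ → ℂ} (hh : L2Loc1 h) (a b : ℝ) :
    Tendsto (fun τ => ∫⁻ x in Ioo a b, ‖h (x + τ) - h x‖ₑ ^ 2) (𝓝 0) (𝓝 0) := by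
  have hf : MemLp ((Icc (a - 1) (b + 1)).indicator h) 2 volume :=
    (memLp_indicator_iff_restrict measurableSet_Icc).2 (hh _ isCompact_Icc)
  set f := (Icc (a - 1) (b + 1)).indicator h with hfdef
  have hcont : Continuous fun τ : ℝ => DomAddAct.mk τ +ᵥ hf.toLp f := by
    have : Fact ((2 : ℝ≥0∞) ≠ ⊤) := ⟨by norm_num⟩
    exact DomAddAct.continuous_mk.vadd continuous_const
  have h0 : Tendsto (fun τ : ℝ => edist (DomAddAct.mk τ +ᵥ hf.toLp f) (hf.toLp f)) (𝓝 0) (𝓝 0) := by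
    have h1 := ((hcont.edist (continuous_const (y := hf.toLp f))).tendsto 0)
    have h2 : edist (DomAddAct.mk (0 : ℝ) +ᵥ hf.toLp f) (hf.toLp f) = 0 := by
      rw [DomAddAct.mk_zero, zero_vadd, edist_self]
    rwa [h2] at h1
  have h3 : ∀ τ : ℝ, edist (DomAddAct.mk τ +ᵥ hf.toLp f) (hf.toLp f) ^ 2
      = ∫⁻ x, ‖f (τ + x) - f x‖ₑ ^ 2 := by
    intro τ
    rw [DomAddAct.mk_vadd_toLp, Lp.edist_toLp_toLp]
    have := eLpNorm_nnreal_pow_eq_lintegral (μ := (volume : Measure ℝ))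
      (f := (fun x => f (τ +ᵥ x)) - f) (p := 2) two_ne_zero
    simpa using this
  have h4 : Tendsto (fun τ : ℝ => ∫⁻ x, ‖f (τ + x) - f x‖ₑ ^ 2) (𝓝 0) (𝓝 0) := by
    simp_rw [← h3]
    have h5 := ((ENNReal.continuous_pow 2).tendsto 0).comp h0
    rwa [zero_pow two_ne_zero] at h5
  refine tendsto_of_tendsto_of_tendsto_of_le_of_le' tendsto_const_nhds h4
    (Eventually.of_forall fun _ => zero_le) ?_
  filter_upwards [Ioo_mem_nhds (show (-1 : ℝ) < 0 by norm_num) one_pos] with τ hτ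
  refine (setLIntegral_mono' measurableSet_Ioo fun x hx => ?_).trans (setLIntegral_le_lintegral _ _)
  rw [hfdef, indicator_of_mem, indicator_of_mem, add_comm]
  · exact ⟨by linarith [hx.1], by linarith [hx.2]⟩
  · exact ⟨by linarith [hx.1, hτ.1], by linarith [hx.2, hτ.2]⟩

theorem lintegral_thin {a b : ℝ} {k : ℝ → ℝ≥0∞} (hk : AEMeasurable k (volume.restrict (Ioo a b)))
    {ε : ℝ} (hε : 0 < ε) :
    (ENNReal.ofReal ε)⁻¹ * ∫⁻ p in Ioo a b ×ˢ Ioo (-ε) 0, k p.1 = ∫⁻ x in Ioo a b, k x := by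
  rw [Measure.volume_eq_prod, ← Measure.prod_restrict]
  have h1 := lintegral_prod_mul (ν := volume.restrict (Ioo (-ε) 0)) hk
    (aemeasurable_const (b := (1 : ℝ≥0∞)))
  simp only [mul_one, lintegral_const, Measure.restrict_apply_univ, Real.volume_Ioo, one_mul,
    sub_neg_eq_add, zero_add] at h1
  rw [h1, mul_comm, mul_assoc, ENNReal.mul_inv_cancel (by simpa using hε) ENNReal.ofReal_ne_top,
    mul_one]

theorem enorm_sq_add_le (x y : ℂ) : ‖x + y‖ₑ ^ 2 ≤ 2 * (‖x‖ₑ ^ 2 + ‖y‖ₑ ^ 2) := by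
  have h1 : ‖x + y‖ ^ 2 ≤ 2 * (‖x‖ ^ 2 + ‖y‖ ^ 2) := by
    nlinarith [norm_add_le x y, norm_nonneg (x + y), sq_nonneg (‖x‖ - ‖y‖)]
  rw [← ofReal_norm_sq, ← ofReal_norm_sq, ← ofReal_norm_sq, ← ENNReal.ofReal_add (by positivity)
    (by positivity), ← ENNReal.ofReal_ofNat 2, ← ENNReal.ofReal_mul (by norm_num)]
  exact ENNReal.ofReal_le_ofReal h1

/-- The average of |q - q'|² over a strip of any thickness is its integral over the interval, and
the triangle inequality bounds it by two quantities tending to zero. -/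
theorem ae_eq_of_thin_limit {a b : ℝ} {v : ℝ × ℝ → ℂ} {q q' : ℝ → ℂ} (hv : AEStronglyMeasurable v)
    (hq : AEStronglyMeasurable q) (hq' : AEStronglyMeasurable q')
    (h : Tendsto (fun ε : ℝ => (ENNReal.ofReal ε)⁻¹ *
      ∫⁻ p in Ioo a b ×ˢ Ioo (-ε) 0, ‖v p - q p.1‖ₑ ^ 2) (𝓝[>] 0) (𝓝 0))
    (h' : Tendsto (fun ε : ℝ => (ENNReal.ofReal ε)⁻¹ *
      ∫⁻ p in Ioo a b ×ˢ Ioo (-ε) 0, ‖v p - q' p.1‖ₑ ^ 2) (𝓝[>] 0) (𝓝 0)) :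
    ∀ᵐ x ∂volume.restrict (Ioo a b), q x = q' x := by
  have hm : AEMeasurable (fun x => ‖q x - q' x‖ₑ ^ 2) (volume.restrict (Ioo a b)) :=
    ((hq.sub hq').restrict.enorm).pow_const 2
  have hqm : AEStronglyMeasurable (fun p : ℝ × ℝ => q p.1) volume := by
    rw [Measure.volume_eq_prod]
    exact hq.comp_fst
  have hle : ∀ᶠ ε : ℝ in 𝓝[>] 0, ∫⁻ x in Ioo a b, ‖q x - q' x‖ₑ ^ 2 ≤
      2 * ((ENNReal.ofReal ε)⁻¹ * (∫⁻ p in Ioo a b ×ˢ Ioo (-ε) 0, ‖v p - q p.1‖ₑ ^ 2)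
        + (ENNReal.ofReal ε)⁻¹ * ∫⁻ p in Ioo a b ×ˢ Ioo (-ε) 0, ‖v p - q' p.1‖ₑ ^ 2) := by
    filter_upwards [self_mem_nhdsWithin] with ε hε
    have hvm : AEMeasurable (fun p => ‖v p - q p.1‖ₑ ^ 2)
        (volume.restrict (Ioo a b ×ˢ Ioo (-ε) 0)) := ((hv.sub hqm).restrict.enorm).pow_const 2
    rw [← lintegral_thin hm hε, ← mul_add, mul_left_comm, ← lintegral_add_left' hvm,
      ← lintegral_const_mul' 2 _ (by norm_num)]
    refine mul_le_mul_right (lintegral_mono fun p => ?_) _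
    have e : q p.1 - q' p.1 = -(v p - q p.1) + (v p - q' p.1) := by ring
    simp only
    rw [e]
    have := enorm_sq_add_le (-(v p - q p.1)) (v p - q' p.1)
    rwa [enorm_neg] at this
  have hlim := ENNReal.Tendsto.const_mul (h.add h') (Or.inr (show (2 : ℝ≥0∞) ≠ ⊤ by norm_num))
  rw [add_zero, mul_zero] at hlim
  have h0 := le_antisymm (ge_of_tendsto hlim hle) zero_le
  rw [lintegral_eq_zero_iff' hm] at h0
  filter_upwards [h0] with x hx
  simpa [sub_eq_zero] using hx

theorem lintegral_thin_le {a b ε : ℝ} (f : ℝ × ℝ → ℝ≥0∞) {C : ℝ≥0∞}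
    (h : ∀ y ∈ Ioo (-ε) 0, ∫⁻ x in Ioo a b, f (x, y) ≤ C) (hε : 0 < ε) :
    (ENNReal.ofReal ε)⁻¹ * ∫⁻ p in Ioo a b ×ˢ Ioo (-ε) 0, f p ≤ C := by
  rw [Measure.volume_eq_prod, ← Measure.prod_restrict, ← lintegral_prod_swap]
  have h1 : ∫⁻ y in Ioo (-ε) 0, ∫⁻ x in Ioo a b, f (x, y) ≤ ENNReal.ofReal ε * C := by
    refine (setLIntegral_mono' measurableSet_Ioo h).trans ?_
    simp [mul_comm]
  refine (mul_le_mul_right ((lintegral_prod_le _).trans h1) _).trans ?_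
  rw [← mul_assoc, ENNReal.inv_mul_cancel (by simpa using hε) ENNReal.ofReal_ne_top, one_mul]

variable {Ω : Channel} {lam : Ioo (0 : ℝ) 1}

/-- The `x₂`-derivative of the solution with profile `h`. -/
def normalDeriv (Ω : Channel) (lam : Ioo (0 : ℝ) 1) (h : ℝ → ℂ) (x : ℝ × ℝ) : ℂ :=
  ((slope lam : ℝ) : ℂ)⁻¹ *
    (strip (Ω.bounce lam)).indicator (fun p => h p.1 + h p.2) ((charEquiv lam).symm x)

/-- At height x₂ just below the boundary the normal derivative is (h(x₁ + x₂/c) + h(x₁ - x₂/c))/c,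
and both translates tend to h in L². -/
theorem tendsto_normalDeriv (hsub : Ω.Subcritical lam) {h : ℝ → ℂ} (hh : L2Loc1 h) (a b : ℝ) :
    Tendsto (fun ε : ℝ => (ENNReal.ofReal ε)⁻¹ * ∫⁻ p in Ioo a b ×ˢ Ioo (-ε) 0,
      ‖normalDeriv Ω lam h p - 2 / ((slope lam : ℝ) : ℂ) * h p.1‖ₑ ^ 2) (𝓝[>] 0) (𝓝 0) := by
  obtain ⟨d, hd, hG⟩ := Ω.exists_depth
  have hc := slope_pos lam
  have hcC : ((slope lam : ℝ) : ℂ) ≠ 0 := by exact_mod_cast hc.ne'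
  set κ : ℝ≥0∞ := ‖((slope lam : ℝ) : ℂ)⁻¹‖ₑ ^ 2 * 4 with hκ
  have hκt : κ ≠ ⊤ := ENNReal.mul_ne_top (ENNReal.pow_ne_top enorm_ne_top) (by norm_num)
  have hm : AEStronglyMeasurable h := hh.locallyIntegrable.aestronglyMeasurable
  have hmτ : ∀ τ, AEStronglyMeasurable fun x => h (x + τ) := fun τ =>
    hm.comp_quasiMeasurePreserving (measurePreserving_add_right volume τ).quasiMeasurePreserving
  have ht := tendsto_lintegral_translate hh a b
  refine ENNReal.tendsto_nhds_zero.2 fun η hη => ?_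
  have hη' : 0 < η / κ := ENNReal.div_pos hη.ne' hκt
  have hev := (ENNReal.tendsto_nhds_zero.1 ht) _ hη'
  obtain ⟨δ, hδ, hball⟩ := Metric.eventually_nhds_iff.1 hev
  -- The condition ε < d keeps the thin strip inside Ω, and ε < cδ keeps the translations y/c
  -- smaller than δ.
  filter_upwards [self_mem_nhdsWithin, mem_nhdsWithin_of_mem_nhds (Iio_mem_nhds hd),
    mem_nhdsWithin_of_mem_nhds (Iio_mem_nhds (mul_pos hc hδ))] with ε hε hεd hεδ
  refine lintegral_thin_le _ (fun y hy => ?_) hε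
  have hyδ : |y / slope lam| < δ := by
    rw [abs_div, abs_of_pos hc, div_lt_iff₀ hc, abs_of_neg hy.2]
    have := mem_Iio.1 hεδ
    nlinarith [hy.1]
  have h1 := hball (y := y / slope lam) (by rwa [Real.dist_eq, sub_zero])
  have h2 := hball (y := -(y / slope lam)) (by rwa [Real.dist_eq, sub_zero, abs_neg])
  have hpt : ∀ x, ‖normalDeriv Ω lam h (x, y) - 2 / ((slope lam : ℝ) : ℂ) * h x‖ₑ ^ 2
      ≤ ‖((slope lam : ℝ) : ℂ)⁻¹‖ₑ ^ 2 * (2 * (‖h (x + y / slope lam) - h x‖ₑ ^ 2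
        + ‖h (x + -(y / slope lam)) - h x‖ₑ ^ 2)) := by
    intro x
    have hmem : (charEquiv lam).symm (x, y) ∈ strip (Ω.bounce lam) :=
      (mem_dom_iff hsub _).1 ⟨by
        have := hG x
        have := mem_Iio.1 hεd
        have := hy.1
        simp only
        linarith, hy.2⟩
    have e : normalDeriv Ω lam h (x, y) - 2 / ((slope lam : ℝ) : ℂ) * h x
        = ((slope lam : ℝ) : ℂ)⁻¹ * ((h (x + y / slope lam) - h x)
          + (h (x + -(y / slope lam)) - h x)) := by
      rw [normalDeriv, indicator_of_mem hmem, charEquiv_symm_apply]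
      simp only [sub_eq_add_neg]
      field_simp
      ring
    rw [e, enorm_mul, mul_pow]
    exact mul_le_mul_right (enorm_sq_add_le _ _) _
  have hmy : AEMeasurable (fun x => ‖h (x + y / slope lam) - h x‖ₑ ^ 2) (volume.restrict (Ioo a b)) :=
    (((hmτ _).sub hm).restrict.enorm).pow_const 2
  calc ∫⁻ x in Ioo a b, ‖normalDeriv Ω lam h (x, y) - 2 / ((slope lam : ℝ) : ℂ) * h x‖ₑ ^ 2
      ≤ ∫⁻ x in Ioo a b, ‖((slope lam : ℝ) : ℂ)⁻¹‖ₑ ^ 2 * (2 * (‖h (x + y / slope lam) - h x‖ₑ ^ 2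
        + ‖h (x + -(y / slope lam)) - h x‖ₑ ^ 2)) := lintegral_mono hpt
    _ = ‖((slope lam : ℝ) : ℂ)⁻¹‖ₑ ^ 2 * (2 * ((∫⁻ x in Ioo a b, ‖h (x + y / slope lam) - h x‖ₑ ^ 2)
        + ∫⁻ x in Ioo a b, ‖h (x + -(y / slope lam)) - h x‖ₑ ^ 2)) := by
      rw [lintegral_const_mul' _ _ (ENNReal.pow_ne_top enorm_ne_top),
        lintegral_const_mul' _ _ (by norm_num), lintegral_add_left' hmy]
    _ ≤ ‖((slope lam : ℝ) : ℂ)⁻¹‖ₑ ^ 2 * (2 * (η / κ + η / κ)) := by gcongr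
    _ = κ * (η / κ) := by rw [hκ]; ring
    _ ≤ η := ENNReal.mul_div_le

/-- Weak derivatives and thin-strip limits are both unique almost everywhere, so the boundary value
2h/c is the only possible Neumann datum. -/
theorem hasNeumann_iff (hsub : Ω.Subcritical lam) {h : ℝ → ℂ} (hh : L2Loc1 h) {u : ℝ × ℝ → ℂ}
    (hu : HasWeakDeriv (0, 1) u (normalDeriv Ω lam h)) (a : ℝ) (g : L2 lam) :
    HasNeumann u a g ↔ ∀ᵐ x : ℝ ∂volume.restrict (Ioo a (a + period lam)),
      g (x : Torus lam) = 2 / ((slope lam : ℝ) : ℂ) * h x := by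
  have hg : AEStronglyMeasurable fun x : ℝ => g (x : Torus lam) :=
    (Lp.aestronglyMeasurable g).comp_quasiMeasurePreserving quasiMeasurePreserving_coe
  have hm : AEStronglyMeasurable h := hh.locallyIntegrable.aestronglyMeasurable
  have ht := tendsto_normalDeriv hsub hh a (a + period lam)
  constructor
  · rintro ⟨v, hv, hlim⟩
    refine ae_eq_of_thin_limit (v := normalDeriv Ω lam h)
      hu.1.locallyIntegrable.aestronglyMeasurable hg (hm.const_mul _) (hlim.congr fun ε => ?_) ht
    congr 1
    refine lintegral_congr_ae (ae_restrict_of_ae ?_)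
    filter_upwards [hv.unique hu] with p hp
    rw [hp]
  · intro hae
    refine ⟨_, hu, ht.congr fun ε => ?_⟩
    congr 1
    rw [Measure.volume_eq_prod, ← Measure.prod_restrict]
    refine lintegral_congr_ae ?_
    filter_upwards [Measure.quasiMeasurePreserving_fst.ae hae] with p hp
    rw [hp]

theorem IsCharSol.hasWeakDeriv_normalDeriv (hsub : Ω.Subcritical lam) {u VS VT : ℝ × ℝ → ℂ}
    {h : ℝ → ℂ} (hu : IsCharSol (Ω.bounce lam) (u ∘ charEquiv lam) VS VT)
    (hS : VS =ᵐ[volume] (strip (Ω.bounce lam)).indicator fun p => h p.1)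
    (hT : VT =ᵐ[volume] (strip (Ω.bounce lam)).indicator fun p => -h p.2) :
    HasWeakDeriv (0, 1) u (normalDeriv Ω lam h) := by
  refine (hu.inH1LocDot hsub).2.2.congr (ae_eq_refl u) ?_
  filter_upwards [(quasiMeasurePreserving_equiv (charEquiv lam).symm).ae hS,
    (quasiMeasurePreserving_equiv (charEquiv lam).symm).ae hT] with x h1 h2
  rw [h1, h2, normalDeriv]
  congr 1
  by_cases hx : (charEquiv lam).symm x ∈ strip (Ω.bounce lam)
  · simp only [indicator_of_mem hx, sub_neg_eq_add]
  · simp only [indicator_of_notMem hx, sub_zero]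

end Neumann

/-! ### Transport of profiles along the billiard flow -/

section Transport

theorem ae_iterate_relation {b : ℝ → ℝ} (hb : IsDiffeo b) {h : ℝ → ℂ}
    (hrel : ∀ᵐ s, h s = ((deriv b s : ℝ) : ℂ) * h (b s)) (n : ℕ) :
    ∀ᵐ s, h s = ((deriv b^[n] s : ℝ) : ℂ) * h (b^[n] s) := by
  induction n with
  | zero => exact ae_of_all _ fun s => by simp
  | succ n ih =>
    filter_upwards [ih, (hb.iterate n).ae_comp hrel] with s h1 h2
    have h3 : deriv b^[n + 1] s = deriv b (b^[n] s) * deriv b^[n] s := by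
      rw [← hb.deriv_comp (hb.iterate n) s, Function.iterate_succ']
      rfl
    rw [h1, h2, h3, Function.iterate_succ_apply']
    push_cast
    ring

/-- The step is iterated over ℤ and the countably many exceptional null sets are discarded together;
then one period determines all. -/
theorem ae_of_periodic_step {lam : Ioo (0 : ℝ) 1} {P : ℝ → Prop}
    (hstep : ∀ᵐ y, P y ↔ P (y + period lam)) (a : ℝ)
    (h : ∀ᵐ y ∂volume.restrict (Ioc a (a + period lam)), P y) : ∀ᵐ y, P y := by
  have htr : ∀ (τ : ℝ) {Q : ℝ → Prop}, (∀ᵐ y, Q y) → ∀ᵐ y, Q (y + τ) := fun τ Q hQ =>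
    (measurePreserving_add_right volume τ).quasiMeasurePreserving.ae hQ
  have h1 : ∀ n : ℤ, ∀ᵐ y, P y ↔ P (y + n * period lam) := by
    intro n
    induction n using Int.induction_on with
    | zero => exact ae_of_all _ fun y => by simp
    | succ n ih =>
      filter_upwards [ih, htr (n * period lam) hstep] with y h2 h3
      rw [h2]
      push_cast
      rw [add_mul, one_mul, ← add_assoc]
      exact h3
    | pred n ih =>
      filter_upwards [ih, htr (-n * period lam - period lam) hstep] with y h2 h3
      rw [h2]
      push_cast
      rw [sub_mul, one_mul, h3]
      ring_nf
  have h2 : ∀ᵐ y ∂volume.restrict (Ioc a (a + period lam)), ∀ n : ℤ, P (y + n * period lam) := by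
    filter_upwards [h, ae_restrict_of_ae (ae_all_iff.2 h1)] with y h3 h4 n
    exact (h4 n).1 h3
  have h3 := (ae_torus_iff (lam := lam) a (P := fun t => ∀ x : ℝ, (x : Torus lam) = t → P x)).2 (by
    filter_upwards [h2] with y hy x hx
    have h4 : ((x - y : ℝ) : Torus lam) = 0 := by rw [AddCircle.coe_sub, hx, sub_self]
    obtain ⟨n, hn⟩ := AddCircle.coe_eq_zero_iff (period lam) |>.1 h4
    have h5 := hy n
    rw [zsmul_eq_mul] at hn
    rwa [hn, add_sub_cancel] at h5)
  filter_upwards [ae_torus_iff_real.1 h3] with y hy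
  exact hy y rfl

variable {Ω : Channel} {lam : Ioo (0 : ℝ) 1}

/-- In the coordinate y with s = X(y) the bounce is the translation by a period and X is the
identity on 𝓙_L. Equality of the profiles therefore spreads from one period to the line. -/
theorem ae_eq_of_profile (hsub : Ω.Subcritical lam) (J : FundamentalIntervals Ω lam) {h h' : ℝ → ℂ}
    (hrel : ∀ᵐ s, h s = ((deriv (Ω.bounce lam) s : ℝ) : ℂ) * h (Ω.bounce lam s))
    (hrel' : ∀ᵐ s, h' s = ((deriv (Ω.bounce lam) s : ℝ) : ℂ) * h' (Ω.bounce lam s))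
    (he : ∀ᵐ x ∂volume.restrict (Ioo J.aL (J.aL + period lam)), h x = h' x) : ∀ᵐ s, h s = h' s := by
  have hX := Channel.unroll_isDiffeo hsub
  have hb := Channel.bounce_isDiffeo hsub
  have hstep : ∀ᵐ s, h s = h' s ↔ h (Ω.bounce lam s) = h' (Ω.bounce lam s) := by
    filter_upwards [hrel, hrel'] with s h1 h2
    have h3 : ((deriv (Ω.bounce lam) s : ℝ) : ℂ) ≠ 0 := by exact_mod_cast (hb.deriv_pos s).ne'
    rw [h1, h2, mul_right_inj' h3]
  have h1 : ∀ᵐ y, h (Ω.unroll lam y) = h' (Ω.unroll lam y) := by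
    refine ae_of_periodic_step (lam := lam) ?_ J.aL ?_
    · filter_upwards [hX.ae_comp hstep] with y hy
      rw [hy, Channel.unroll_add_period hsub]
    · rw [← restrict_Ioo_eq_restrict_Ioc]
      filter_upwards [he, ae_restrict_mem measurableSet_Ioo] with y hy hm
      have := J.aL_add_lt
      have := Real.pi_pos
      have := slope_pos lam
      have : 0 < Real.pi / slope lam := by positivity
      rw [Channel.unroll_of_lt hsub (by linarith [hm.2]), hy]
  filter_upwards [hX.inv.ae_comp h1] with s hs
  rwa [hX.apply_inv] at hs

variable {J : FundamentalIntervals Ω lam} {β : ℝ → ℝ}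

theorem FundamentalIntervals.mb_mem (hsub : Ω.Subcritical lam) {x : ℝ} :
    J.mb x ∈ Ioo J.aR (J.aR + period lam) ↔ x ∈ Ioo J.aL (J.aL + period lam) := by
  rw [← J.image]
  exact (J.mb_isDiffeo hsub).injective.mem_set_image

/-- The boundary data on the two fundamental intervals are related by the pullback. -/
theorem ae_eq_pullback_iff (hsub : Ω.Subcritical lam) (hβ : IsLift (period lam) β)
    (he : ∀ x ∈ Icc J.aL (J.aL + period lam), J.mb =ᶠ[𝓝 x] β) {h : ℝ → ℂ}
    (hrel : ∀ᵐ s, h s = ((deriv (Ω.bounce lam) s : ℝ) : ℂ) * h (Ω.bounce lam s)) {gL gR : Torus lam → ℂ}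
    {κ : ℂ} (hL : ∀ᵐ x : ℝ ∂volume.restrict (Ioo J.aL (J.aL + period lam)),
      gL (x : Torus lam) = κ * h x) :
    (∀ᵐ x : ℝ ∂volume.restrict (Ioo J.aR (J.aR + period lam)), gR (x : Torus lam) = κ * h x) ↔
      gL =ᵐ[AddCircle.haarAddCircle] pullback β gR := by
  have hm := J.mb_isDiffeo hsub
  have hit : ∀ᵐ s, h s = ((deriv J.mb s : ℝ) : ℂ) * h (J.mb s) :=
    ae_iterate_relation (Channel.bounce_isDiffeo hsub) hrel J.N
  have hpull : ∀ x ∈ Ioo J.aL (J.aL + period lam), pullback β gR (x : Torus lam)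
      = ((deriv J.mb x : ℝ) : ℂ) * gR ((J.mb x : ℝ) : Torus lam) := by
    intro x hx
    have h1 := he x (Ioo_subset_Icc_self hx)
    rw [pullback_coe hβ, h1.deriv_eq, h1.eq_of_nhds]
  -- The profile is invariant under the N-fold bounce, so the condition on gR at 𝐛(x) is the
  -- condition on its pullback at x multiplied by 𝐛'(x) ≠ 0.
  have hpt : ∀ᵐ x, x ∈ Ioo J.aL (J.aL + period lam) →
      (gR ((J.mb x : ℝ) : Torus lam) = κ * h (J.mb x) ↔ gL (x : Torus lam) = pullback β gR x) := by
    filter_upwards [hit, (ae_restrict_iff' measurableSet_Ioo).1 hL] with x h1 h2 hx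
    have h3 : ((deriv J.mb x : ℝ) : ℂ) ≠ 0 := by exact_mod_cast (hm.deriv_pos x).ne'
    rw [hpull x hx, h2 hx, h1, mul_left_comm, mul_right_inj' h3, eq_comm]
  unfold Filter.EventuallyEq
  rw [ae_torus_iff J.aL, ← restrict_Ioo_eq_restrict_Ioc, ae_restrict_iff' measurableSet_Ioo,
    ae_restrict_iff' measurableSet_Ioo]
  constructor
  · intro h1
    filter_upwards [hpt, hm.ae_comp h1] with x h2 h3 hx
    exact (h2 hx).1 (h3 ((FundamentalIntervals.mb_mem hsub).2 hx))
  · intro h1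
    filter_upwards [hm.inv.ae_comp hpt, hm.inv.ae_comp h1] with y h2 h3 hy
    rw [hm.apply_inv] at h2
    have hx : Function.invFun J.mb y ∈ Ioo J.aL (J.aL + period lam) := by
      rw [← FundamentalIntervals.mb_mem hsub, hm.apply_inv]
      exact hy
    exact (h2 hx).2 (h3 hx)

theorem l2Loc1_comp_coe (g : L2 lam) : L2Loc1 fun x : ℝ => g (x : Torus lam) := by
  have hm : AEStronglyMeasurable fun x : ℝ => g (x : Torus lam) :=
    (Lp.aestronglyMeasurable g).comp_quasiMeasurePreserving quasiMeasurePreserving_coe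
  have hp := period_pos (lam := lam)
  have hfin : ∫⁻ t, ‖g t‖ₑ ^ 2 ∂AddCircle.haarAddCircle < ⊤ := (memLp_two_iff.1 (Lp.memLp g)).2
  have h1 : ∀ a : ℝ, ∫⁻ x in Ioc a (a + period lam), ‖g (x : Torus lam)‖ₑ ^ 2 < ⊤ := by
    intro a
    rw [lintegral_torus a] at hfin
    by_contra htop
    rw [not_lt_top_iff.1 htop, ENNReal.mul_top (by simp)] at hfin
    exact lt_irrefl _ hfin
  have h2 : ∀ (a : ℝ) (n : ℕ), ∫⁻ x in Ioc a (a + n * period lam), ‖g (x : Torus lam)‖ₑ ^ 2 < ⊤ := by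
    intro a n
    induction n with
    | zero => simp
    | succ n ih =>
      have e : Ioc a (a + (n + 1 : ℕ) * period lam) ⊆ Ioc a (a + n * period lam) ∪
          Ioc (a + n * period lam) (a + n * period lam + period lam) := by
        rw [Ioc_union_Ioc_eq_Ioc (by linarith [mul_nonneg n.cast_nonneg hp.le]) (by linarith)]
        refine Ioc_subset_Ioc_right ?_
        push_cast
        linarith
      exact ((lintegral_mono_set e).trans (lintegral_union_le _ _ _)).trans_lt
        (ENNReal.add_lt_top.2 ⟨ih, h1 _⟩)
  intro K hK
  refine memLp_two_iff.2 ⟨hm.restrict, ?_⟩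
  obtain ⟨r, hr⟩ := hK.isBounded.subset_closedBall 0
  obtain ⟨n, hn⟩ := exists_nat_gt ((2 * r + 1) / period lam)
  rw [div_lt_iff₀ hp] at hn
  refine (lintegral_mono_set fun x hx => ?_).trans_lt (h2 (-r - 1) n)
  have := hr hx
  rw [Real.closedBall_eq_Icc] at this
  exact ⟨by linarith [this.1], by linarith [this.2]⟩

theorem L2Loc1.pull {H : ℝ → ℂ} (hH : L2Loc1 H) {f : ℝ → ℝ} (hf : IsDiffeo f) :
    L2Loc1 fun x => ((deriv f x : ℝ) : ℂ) * H (f x) := by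
  have hm : AEStronglyMeasurable fun x => ((deriv f x : ℝ) : ℂ) * H (f x) :=
    (Complex.continuous_ofReal.comp hf.continuous_deriv).aestronglyMeasurable.mul
      (hH.locallyIntegrable.aestronglyMeasurable.comp_quasiMeasurePreserving hf.quasiMeasurePreserving)
  intro K hK
  refine memLp_two_iff.2 ⟨hm.restrict, ?_⟩
  obtain ⟨C, hC⟩ := hK.exists_bound_of_continuousOn hf.continuous_deriv.continuousOn
  have h1 : ∫⁻ x in K, ENNReal.ofReal (deriv f x) * ‖H (f x)‖ₑ ^ 2 < ⊤ := by
    rw [← hf.lintegral_image hK.measurableSet fun y => ‖H y‖ₑ ^ 2]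
    exact (memLp_two_iff.1 (hH _ (hK.image hf.continuous))).2
  refine (setLIntegral_mono' hK.measurableSet fun x hx => ?_).trans_lt
    ((lintegral_const_mul' (ENNReal.ofReal C) _ ENNReal.ofReal_ne_top).trans_lt
      (ENNReal.mul_lt_top ENNReal.ofReal_lt_top h1))
  have h2 : ‖((deriv f x : ℝ) : ℂ)‖ₑ = ENNReal.ofReal (deriv f x) := by
    rw [← ofReal_norm, Complex.norm_real, Real.norm_of_nonneg (hf.deriv_pos x).le]
  rw [enorm_mul, mul_pow, h2, sq (ENNReal.ofReal _), mul_assoc]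
  gcongr
  exact (Real.le_norm_self _).trans (hC x hx)

/-- The profile with prescribed values on the left fundamental interval. -/
theorem exists_profile (hsub : Ω.Subcritical lam) (J : FundamentalIntervals Ω lam) (g : L2 lam)
    (hg : g ∈ L2zero lam) :
    ∃ h : ℝ → ℂ, L2Loc1 h ∧
      (∀ s, h s = ((deriv (Ω.bounce lam) s : ℝ) : ℂ) * h (Ω.bounce lam s)) ∧
      (∫ r in J.aL..Ω.bounce lam J.aL, h r = 0) ∧
      ∀ x ∈ Ioc J.aL (J.aL + period lam), h x = g (x : Torus lam) := by
  have hX := Channel.unroll_isDiffeo hsub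
  have hb := Channel.bounce_isDiffeo hsub
  have hpos : 0 < Real.pi / slope lam := div_pos Real.pi_pos (slope_pos lam)
  have haL := J.aL_add_lt
  have hp := period_pos (lam := lam)
  -- Y conjugates the bounce to the translation by a period and is the identity on 𝓙_L. Pulling the
  -- periodic form g back by Y thus gives a form that is invariant at every point and has the right
  -- values.
  set Y := Function.invFun (Ω.unroll lam) with hY
  have hYb : ∀ s, Y (Ω.bounce lam s) = Y s + period lam := fun s => by
    apply hX.injective
    rw [hY, hX.apply_inv, Channel.unroll_add_period hsub, hX.apply_inv]
  have hYlt : ∀ s, s < -Ω.R₀ - Real.pi / slope lam → Y s = s := fun s hs => by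
    apply hX.injective
    rw [hY, hX.apply_inv, Channel.unroll_of_lt hsub hs]
  have hval : ∀ x ∈ Ioc J.aL (J.aL + period lam),
      ((deriv Y x : ℝ) : ℂ) * g ((Y x : ℝ) : Torus lam) = g (x : Torus lam) := by
    intro x hx
    have hlt : x < -Ω.R₀ - Real.pi / slope lam := by linarith [hx.2]
    have h1 : Y =ᶠ[𝓝 x] id := by
      filter_upwards [Iio_mem_nhds hlt] with s hs
      exact hYlt s hs
    rw [h1.deriv_eq, hYlt x hlt]
    simp
  refine ⟨fun s => ((deriv Y s : ℝ) : ℂ) * g ((Y s : ℝ) : Torus lam),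
    (l2Loc1_comp_coe g).pull hX.inv, fun s => ?_, ?_, hval⟩
  · have h1 := hX.inv.deriv_comp hb s
    have h2 : (fun s => Function.invFun (Ω.unroll lam) (Ω.bounce lam s)) = fun s => Y s + period lam :=
      funext hYb
    rw [h2, deriv_add_const] at h1
    simp only
    rw [hYb, AddCircle.coe_add_period, h1]
    push_cast
    ring
  -- One bounce from aL is exactly one period, so the flux of the profile is a multiple of the mean
  -- of g.
  · have h1 : Ω.bounce lam J.aL = J.aL + period lam := Channel.bounce_of_lt hsub (by linarith)
    rw [h1, intervalIntegral.integral_of_le (by linarith), setIntegral_congr_fun measurableSet_Ioc hval]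
    have h2 : ∫ t, g t ∂(AddCircle.haarAddCircle : Measure (Torus lam)) = 0 := hg
    rw [integral_torus J.aL] at h2
    exact (mul_eq_zero.1 h2).resolve_left (by
      rw [inv_eq_zero]
      exact_mod_cast hp.ne')

end Transport

/-! ### Scattering solutions and their boundary data -/

section Solutions

variable {Ω : Channel} {lam : Ioo (0 : ℝ) 1}

theorem InH1LocDot.congr {u u' : ℝ × ℝ → ℂ} (hu : InH1LocDot Ω u) (h : u =ᵐ[volume] u') :
    InH1LocDot Ω u' where
  l2 := hu.l2.congr h
  d1 := hu.d1.imp fun _ hv => hv.congr h (ae_eq_refl _)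
  d2 := hu.d2.imp fun _ hv => hv.congr h (ae_eq_refl _)
  supp := by
    filter_upwards [hu.supp, h] with p h1 h2 h3
    rw [← h2, h1 h3]

theorem IsHomogeneous.congr {u u' : ℝ × ℝ → ℂ} (hu : IsHomogeneous Ω lam u) (h : u =ᵐ[volume] u') :
    IsHomogeneous Ω lam u' := by
  intro φ hφ hs
  rw [← hu φ hφ hs]
  refine integral_congr_ae ?_
  filter_upwards [h] with p hp
  rw [hp]

theorem HasNeumann.congr {u u' : ℝ × ℝ → ℂ} {a : ℝ} {g : L2 lam} (hu : HasNeumann u a g)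
    (h : u =ᵐ[volume] u') : HasNeumann u' a g :=
  hu.imp fun _ hv => ⟨hv.1.congr h (ae_eq_refl _), hv.2⟩

theorem IsScattering.congr {J : FundamentalIntervals Ω lam} {gi go : L2zero lam} {u u' : ℝ × ℝ → ℂ}
    (hu : IsScattering J gi go u) (h : u =ᵐ[volume] u') : IsScattering J gi go u' :=
  ⟨hu.mem.congr h, hu.eqn.congr h, hu.left.congr h, hu.right.congr h⟩

/-- A homogeneous solution is described by a profile. -/
theorem exists_profile_of_homogeneous (hsub : Ω.Subcritical lam) {u : ℝ × ℝ → ℂ}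
    (hu : InH1LocDot Ω u) (hP : IsHomogeneous Ω lam u) :
    ∃ (VS VT : ℝ × ℝ → ℂ) (h : ℝ → ℂ), IsCharSol (Ω.bounce lam) (u ∘ charEquiv lam) VS VT ∧ L2Loc1 h ∧
      (∀ᵐ s, h s = ((deriv (Ω.bounce lam) s : ℝ) : ℂ) * h (Ω.bounce lam s)) ∧
      (VT =ᵐ[volume] (strip (Ω.bounce lam)).indicator fun p => -h p.2) ∧
      HasWeakDeriv (0, 1) u (normalDeriv Ω lam h) := by
  obtain ⟨VS, VT, hS⟩ := exists_isCharSol hsub hu hP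
  obtain ⟨δ, hδ, hgap⟩ := Channel.exists_gap hsub
  obtain ⟨h, hh, hrel, h1, h2⟩ := IsCharSol.exists_profile (Channel.bounce_isDiffeo hsub) hδ hgap hS
  exact ⟨VS, VT, h, hS, hh, hrel, h2, hS.hasWeakDeriv_normalDeriv hsub h1 h2⟩

variable {J : FundamentalIntervals Ω lam} {β : ℝ → ℝ}

/-- Both Neumann data are 2h/c for one and the same invariant profile, read on 𝓙_L and on 𝓙_R. -/
theorem IsScattering.ae_eq_pullback (hsub : Ω.Subcritical lam) (hβ : IsLift (period lam) β)
    (he : ∀ x ∈ Icc J.aL (J.aL + period lam), J.mb =ᶠ[𝓝 x] β) {gi go : L2zero lam} {u : ℝ × ℝ → ℂ}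
    (hu : IsScattering J gi go u) :
    ((projPos lam gi + projNeg lam go : L2 lam) : Torus lam → ℂ) =ᵐ[AddCircle.haarAddCircle]
      pullback β ((projNeg lam gi + projPos lam go : L2 lam) : Torus lam → ℂ) := by
  obtain ⟨VS, VT, h, -, hh, hrel, -, hw⟩ := exists_profile_of_homogeneous hsub hu.mem hu.eqn
  exact (ae_eq_pullback_iff hsub hβ he hrel ((hasNeumann_iff hsub hh hw _ _).1 hu.left)).1
    ((hasNeumann_iff hsub hh hw _ _).1 hu.right)

/-- The left datum fixes the profile on 𝓙_L, hence everywhere. The profile fixes ∂ₜU, and this fixes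
U because it vanishes outside the strip. -/
theorem IsScattering.unique (hsub : Ω.Subcritical lam) {gi go : L2zero lam} {u u' : ℝ × ℝ → ℂ}
    (hu : IsScattering J gi go u) (hu' : IsScattering J gi go u') : u =ᵐ[volume] u' := by
  obtain ⟨VS, VT, h, hS, hh, hrel, hT, hw⟩ := exists_profile_of_homogeneous hsub hu.mem hu.eqn
  obtain ⟨VS', VT', h', hS', hh', hrel', hT', hw'⟩ :=
    exists_profile_of_homogeneous hsub hu'.mem hu'.eqn
  have hc : (2 : ℂ) / ((slope lam : ℝ) : ℂ) ≠ 0 :=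
    div_ne_zero two_ne_zero (by exact_mod_cast (slope_pos lam).ne')
  have heq : ∀ᵐ s, h s = h' s := by
    refine ae_eq_of_profile hsub J hrel hrel' ?_
    filter_upwards [(hasNeumann_iff hsub hh hw _ _).1 hu.left,
      (hasNeumann_iff hsub hh' hw' _ _).1 hu'.left] with x h1 h2
    exact mul_left_cancel₀ hc (h1.symm.trans h2)
  obtain ⟨δ, hδ, hgap⟩ := Channel.exists_gap hsub
  have hVT : VT =ᵐ[volume] VT' := by
    have hsnd : ∀ᵐ p : ℝ × ℝ, h p.2 = h' p.2 := by
      rw [Measure.volume_eq_prod]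
      exact Measure.quasiMeasurePreserving_snd.ae heq
    filter_upwards [hT, hT', hsnd] with p h1 h2 h3
    rw [h1, h2]
    by_cases hp : p ∈ strip (Ω.bounce lam)
    · rw [indicator_of_mem hp, indicator_of_mem hp, h3]
    · rw [indicator_of_notMem hp, indicator_of_notMem hp]
  have key := IsCharSol.ae_eq (Channel.bounce_isDiffeo hsub) hδ hgap hS hS' hVT
  have := (quasiMeasurePreserving_equiv (charEquiv lam).symm).ae key
  filter_upwards [this] with x hx
  simpa using hx

theorem exists_isScattering (hsub : Ω.Subcritical lam) (hβ : IsLift (period lam) β)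
    (he : ∀ x ∈ Icc J.aL (J.aL + period lam), J.mb =ᶠ[𝓝 x] β) {gi go : L2zero lam}
    (h0 : (projPos lam gi + projNeg lam go : L2 lam) ∈ L2zero lam)
    (hg : ((projPos lam gi + projNeg lam go : L2 lam) : Torus lam → ℂ) =ᵐ[AddCircle.haarAddCircle]
      pullback β ((projNeg lam gi + projPos lam go : L2 lam) : Torus lam → ℂ)) :
    ∃ u : (ℝ × ℝ) →ₘ[volume] ℂ, IsScattering J gi go u := by
  have hb := Channel.bounce_isDiffeo hsub
  obtain ⟨δ, hδ, hgap⟩ := Channel.exists_gap hsub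
  have hc : (2 : ℂ) / ((slope lam : ℝ) : ℂ) ≠ 0 :=
    div_ne_zero two_ne_zero (by exact_mod_cast (slope_pos lam).ne')
  set κ : ℂ := 2 / ((slope lam : ℝ) : ℂ) with hκ
  -- The Neumann datum of a profile h is κh with κ = 2/c, hence the factor κ⁻¹.
  obtain ⟨h, hh, hrel, hint, hval⟩ := exists_profile hsub J (κ⁻¹ • (projPos lam gi + projNeg lam go))
    ((L2zero lam).smul_mem _ h0)
  obtain ⟨U, hU⟩ := exists_isCharSol_of_profile hb (fun s => by linarith [hgap s]) hh hrel hint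
  have hUu : (U ∘ (charEquiv lam).symm) ∘ charEquiv lam = U := by
    funext p
    simp
  have hU' : IsCharSol (Ω.bounce lam) ((U ∘ (charEquiv lam).symm) ∘ charEquiv lam)
      ((strip (Ω.bounce lam)).indicator fun p => h p.1)
      ((strip (Ω.bounce lam)).indicator fun p => -h p.2) := by rwa [hUu]
  obtain ⟨h1, h2, -⟩ := hU'.inH1LocDot hsub
  have hw := hU'.hasWeakDeriv_normalDeriv hsub (ae_eq_refl _) (ae_eq_refl _)
  have hL : ∀ᵐ x : ℝ ∂volume.restrict (Ioo J.aL (J.aL + period lam)),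
      (projPos lam gi + projNeg lam go : L2 lam) (x : Torus lam) = κ * h x := by
    have hs := (Lp.coeFn_smul κ⁻¹ (projPos lam gi + projNeg lam go : L2 lam))
    filter_upwards [ae_restrict_of_ae (ae_torus_iff_real.1 hs), ae_restrict_mem measurableSet_Ioo]
      with x h3 h4
    rw [hval x (Ioo_subset_Ioc_self h4), h3, Pi.smul_apply, smul_eq_mul, mul_inv_cancel_left₀ hc]
  have hm : AEStronglyMeasurable (U ∘ (charEquiv lam).symm) volume :=
    h1.l2.locallyIntegrable.aestronglyMeasurable
  have hsc : IsScattering J gi go (U ∘ (charEquiv lam).symm) :=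
    ⟨h1, h2, (hasNeumann_iff hsub hh hw _ _).2 hL, (hasNeumann_iff hsub hh hw _ _).2
      ((ae_eq_pullback_iff hsub hβ he (ae_of_all _ hrel) hL).2 hg)⟩
  exact ⟨AEEqFun.mk _ hm, hsc.congr (AEEqFun.coeFn_mk _ hm).symm⟩

end Solutions

/-! ### Mean-zero functions and their Fourier coefficients -/

section Coefficients

variable {lam : Ioo (0 : ℝ) 1}

/-- The nonzero Fourier coefficients of a square-integrable function. -/
def seqOf (g : L2 lam) (k : NZ) : ℂ := fourierCoeff g k

theorem coeffNZ_formPairing (g : L2 lam) : coeffNZ (formPairing g) = seqOf g :=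
  funext fun k => coeff_formPairing g k

theorem fourierCoeff_zero (g : L2zero lam) : fourierCoeff (g : L2 lam) 0 = 0 :=
  (mem_L2zero_iff _).1 g.2

theorem L2zero_ext {f g : L2zero lam} (h : seqOf (f : L2 lam) = seqOf (g : L2 lam)) : f = g := by
  refine Subtype.ext (L2_ext fun k => ?_)
  by_cases hk : k = 0
  · rw [hk, fourierCoeff_zero, fourierCoeff_zero]
  · exact congrFun h ⟨k, hk⟩

theorem fourierCoeff_add_L2 (f g : L2 lam) (k : ℤ) :
    fourierCoeff (f + g : L2 lam) k = fourierCoeff f k + fourierCoeff g k := by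
  simp only [fourierCoeff_eq_inner, inner_add_right]

theorem fourierCoeff_smul_L2 (a : ℂ) (g : L2 lam) (k : ℤ) :
    fourierCoeff (a • g : L2 lam) k = a * fourierCoeff g k := by
  simp only [fourierCoeff_eq_inner, inner_smul_right]

theorem tsum_NZ {f : ℤ → ℝ≥0∞} (h : f 0 = 0) : ∑' k : NZ, f k = ∑' k, f k :=
  tsum_subtype_eq_of_support_subset (s := {k : ℤ | k ≠ 0}) fun k hk => by
    rintro rfl
    exact hk h

theorem wsq_seqOf (g : L2zero lam) : wsq 0 (seqOf (g : L2 lam)) = ENNReal.ofReal (‖g‖ ^ 2) := by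
  have h1 : wsq 0 (seqOf (g : L2 lam)) = ∑' k : NZ, ‖fourierCoeff (g : L2 lam) k‖ₑ ^ 2 := by
    simp [wsq, seqOf]
  rw [h1, tsum_NZ (f := fun k => ‖fourierCoeff (g : L2 lam) k‖ₑ ^ 2) (by simp [fourierCoeff_zero]),
    tsum_enorm_sq_fourierCoeff (Lp.memLp _)]
  have h2 := eLpNorm_nnreal_pow_eq_lintegral (μ := (AddCircle.haarAddCircle : Measure (Torus lam)))
      (f := ((g : L2 lam) : Torus lam → ℂ)) (p := 2) two_ne_zero
  have h3 : ‖g‖ₑ = eLpNorm ((g : L2 lam) : Torus lam → ℂ) 2 AddCircle.haarAddCircle := Lp.enorm_def _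
  rw [ENNReal.ofReal_pow (norm_nonneg _), ofReal_norm, h3]
  simpa using h2.symm

theorem wsq_mono {s t : ℝ} (h : s ≤ t) (a : NZ → ℂ) : wsq s a ≤ wsq t a := by
  refine ENNReal.tsum_le_tsum fun k => ?_
  gcongr
  exact one_le_freq k

/-- Square-integrable data lie in the space of order -1/2, where the scattering equation is uniquely
solvable. -/
theorem wsq_seqOf_lt (g : L2zero lam) : wsq (-1 / 2) (seqOf (g : L2 lam)) < ⊤ :=
  (wsq_mono (by norm_num) _).trans_lt ((wsq_seqOf g).trans_lt ENNReal.ofReal_lt_top)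

theorem exists_L2zero {a : NZ → ℂ} (ha : wsq 0 a < ⊤) : ∃ g : L2zero lam, seqOf (g : L2 lam) = a := by
  classical
  set b : ℤ → ℂ := fun k => if h : k ≠ 0 then a ⟨k, h⟩ else 0 with hb
  have hba : ∀ k : NZ, b k = a k := fun k => by simp [hb, k.2]
  have h1 : ∑' k, ‖b k‖ₑ ^ 2 < ⊤ := by
    rw [← tsum_NZ (f := fun k => ‖b k‖ₑ ^ 2) (by simp [hb])]
    simp_rw [hba]
    simpa [wsq] using ha
  have h2 : Memℓp b 2 := by
    refine memℓp_gen ?_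
    have h3 := ENNReal.summable_toReal h1.ne
    simpa using h3
  set g : L2 lam := fourierBasis.repr.symm ⟨b, h2⟩ with hg
  have h4 : ∀ k, fourierCoeff g k = b k := fun k => by
    rw [← fourierBasis_repr, hg, LinearIsometryEquiv.apply_symm_apply]
  exact ⟨⟨g, (mem_L2zero_iff _).2 (by simp [h4, hb])⟩, funext fun k => by simp [seqOf, h4, hba]⟩

theorem seqOf_projPos (g : L2 lam) : seqOf (projPos lam g) = cut posFreq (seqOf g) := by
  classical
  funext k
  rw [cut_apply]
  exact (fourierCoeff_starProjection (Ioi 0) g k).trans (if_congr Iff.rfl rfl rfl)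

theorem seqOf_projNeg (g : L2 lam) : seqOf (projNeg lam g) = cut negFreq (seqOf g) := by
  classical
  funext k
  rw [cut_apply]
  exact (fourierCoeff_starProjection (Iio 0) g k).trans (if_congr Iff.rfl rfl rfl)

theorem projPos_mem (g : L2 lam) : projPos lam g ∈ L2zero lam := by
  classical
  rw [mem_L2zero_iff, projPos, fourierCoeff_starProjection (Ioi 0)]
  simp

theorem projNeg_mem (g : L2 lam) : projNeg lam g ∈ L2zero lam := by
  classical
  rw [mem_L2zero_iff, projNeg, fourierCoeff_starProjection (Iio 0)]
  simp

variable {β : ℝ → ℝ}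

theorem fourierCoeff_pullback_eq (hβ : IsLift (period lam) β) (g : L2zero lam) :
    fourierCoeff (pullback β ((g : L2 lam) : Torus lam → ℂ)) 0 = 0 ∧
      ∀ k : NZ, fourierCoeff (pullback β ((g : L2 lam) : Torus lam → ℂ)) k
        = mulVec (pullNZ lam β) (seqOf (g : L2 lam)) k := by
  have h1 := hasSum_pullMatrix hβ (Lp.memLp (g : L2 lam))
  constructor
  · rw [← (h1 0).tsum_eq]
    refine (tsum_congr fun l => ?_).trans tsum_zero
    by_cases hl : l = 0
    · rw [hl, fourierCoeff_zero, mul_zero]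
    · rw [pullMatrix_zero hβ l hl, zero_mul]
  · intro k
    rw [← (h1 k).tsum_eq]
    symm
    exact tsum_subtype_eq_of_support_subset (s := {k : ℤ | k ≠ 0})
      (f := fun l => pullMatrix lam β k l * fourierCoeff (g : L2 lam) l) fun l hl => by
        rintro rfl
        exact hl (by simp only [fourierCoeff_zero, mul_zero])

theorem ae_eq_pullback_iff_seqOf (hβ : IsLift (period lam) β) (f g : L2zero lam) :
    ((f : L2 lam) : Torus lam → ℂ) =ᵐ[AddCircle.haarAddCircle] pullback β ((g : L2 lam) : Torus lam → ℂ)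
      ↔ seqOf (f : L2 lam) = mulVec (pullNZ lam β) (seqOf (g : L2 lam)) := by
  have hm := pullback_memLp hβ (Lp.memLp (g : L2 lam))
  obtain ⟨h0, h1⟩ := fourierCoeff_pullback_eq hβ g
  constructor
  · intro h
    funext k
    rw [← h1 k]
    exact congrFun (fourierCoeff_congr_ae h) k
  · intro h
    have : (f : L2 lam) = hm.toLp _ := L2_ext fun k => by
      rw [fourierCoeff_toLp']
      by_cases hk : k = 0
      · rw [hk, fourierCoeff_zero, h0]
      · rw [h1 ⟨k, hk⟩, ← h]
        rfl
    rw [this]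
    exact hm.coeFn_toLp

end Coefficients

/-! ### The scattering operator -/

section ScatteringOperator

variable {Ω : Channel} {lam : Ioo (0 : ℝ) 1} {J : FundamentalIntervals Ω lam} {β : ℝ → ℝ}
  {S R : NZ → NZ → ℂ}

theorem seqOf_add (f g : L2 lam) (k : NZ) : seqOf (f + g) k = seqOf f k + seqOf g k :=
  fourierCoeff_add_L2 f g k

theorem seqOf_smul (a : ℂ) (g : L2 lam) (k : NZ) : seqOf (a • g) k = a * seqOf g k :=
  fourierCoeff_smul_L2 a g k

/-- Solvability with given data is the pullback relation between the data on the two intervals. In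
Fourier coefficients this is the scattering equation, whose solution is given by S. -/
theorem exists_isScattering_iff (hsub : Ω.Subcritical lam) (hβ : IsLift (period lam) β)
    (he : ∀ x ∈ Icc J.aL (J.aL + period lam), J.mb =ᶠ[𝓝 x] β)
    (hS : IsScatteringMatrix (pullNZ lam β) (pullNZ lam (Function.invFun β)) S R) (gi go : L2zero lam) :
    (∃ u : (ℝ × ℝ) →ₘ[volume] ℂ, IsScattering J gi go u) ↔
      seqOf (go : L2 lam) = mulVec S (seqOf (gi : L2 lam)) := by
  have hL : (projPos lam gi + projNeg lam go : L2 lam) ∈ L2zero lam :=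
    (L2zero lam).add_mem (projPos_mem _) (projNeg_mem _)
  have hR : (projNeg lam gi + projPos lam go : L2 lam) ∈ L2zero lam :=
    (L2zero lam).add_mem (projNeg_mem _) (projPos_mem _)
  have key := ae_eq_pullback_iff_seqOf hβ ⟨_, hL⟩ ⟨_, hR⟩
  have hseqL : seqOf (projPos lam gi + projNeg lam go : L2 lam)
      = fun k => cut posFreq (seqOf (gi : L2 lam)) k + cut negFreq (seqOf (go : L2 lam)) k := by
    funext k
    rw [seqOf_add, seqOf_projPos, seqOf_projNeg]
  have hseqR : seqOf (projNeg lam gi + projPos lam go : L2 lam)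
      = fun k => cut negFreq (seqOf (gi : L2 lam)) k + cut posFreq (seqOf (go : L2 lam)) k := by
    funext k
    rw [seqOf_add, seqOf_projPos, seqOf_projNeg]
  simp only [hseqL, hseqR] at key
  rw [← hS.iff _ _ (wsq_seqOf_lt gi) (wsq_seqOf_lt go), ← funext_iff, ← key]
  exact ⟨fun ⟨u, hu⟩ => hu.ae_eq_pullback hsub hβ he, fun h => exists_isScattering hsub hβ he hL h⟩

theorem tempered_seqOf (g : L2zero lam) : Tempered (seqOf (g : L2 lam)) :=
  tempered_of_wsq (wsq_seqOf_lt g)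

/-- The weighted bound at s = 0 keeps square-summable sequences square-summable; the isometry at
order -1/2 alone would not show that the outgoing datum is in L². -/
theorem exists_scatteringOp {U W : NZ → NZ → ℂ} (h : SymplecticPair U W)
    (hS : IsScatteringMatrix U W S R) :
    ∃ A : L2zero lam →L[ℂ] L2zero lam, ∀ g,
      seqOf (A g : L2 lam) = mulVec S (seqOf (g : L2 lam)) := by
  obtain ⟨D, hD⟩ := hS.wsq_le h 0
  have hfin : ∀ g : L2zero lam, wsq 0 (seqOf (g : L2 lam)) < ⊤ := fun g =>
    (wsq_seqOf g).trans_lt ENNReal.ofReal_lt_top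
  have hex : ∀ g : L2zero lam, ∃ f : L2zero lam, seqOf (f : L2 lam) = mulVec S (seqOf (g : L2 lam)) :=
    fun g => exists_L2zero ((hD _ (hfin g)).trans_lt (ENNReal.mul_lt_top ENNReal.coe_lt_top (hfin g)))
  choose A hA using hex
  have hadd : ∀ f g, A (f + g) = A f + A g := fun f g => L2zero_ext <| by
    funext k
    rw [Submodule.coe_add, seqOf_add, hA, hA, hA]
    have e : ∀ l, S k l * seqOf ((f + g : L2zero lam) : L2 lam) l
        = S k l * seqOf (f : L2 lam) l + S k l * seqOf (g : L2 lam) l := fun l => by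
      rw [Submodule.coe_add, seqOf_add, mul_add]
    exact (tsum_congr e).trans
      ((hS.summable h (tempered_seqOf f) k).tsum_add (hS.summable h (tempered_seqOf g) k))
  have hsmul : ∀ (a : ℂ) g, A (a • g) = a • A g := fun a g => L2zero_ext <| by
    funext k
    rw [hA, Submodule.coe_smul, Submodule.coe_smul, seqOf_smul, hA]
    have e : ∀ l, S k l * seqOf (a • (g : L2 lam)) l = a * (S k l * seqOf (g : L2 lam) l) := fun l => by
      rw [seqOf_smul, mul_left_comm]
    exact (tsum_congr e).trans tsum_mul_left
  refine ⟨LinearMap.mkContinuous ⟨⟨A, hadd⟩, hsmul⟩ (√D) fun g => ?_, hA⟩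
  have h1 := hD _ (hfin g)
  rw [← hA, wsq_seqOf, wsq_seqOf, ← ENNReal.ofReal_coe_nnreal, ← ENNReal.ofReal_mul D.coe_nonneg,
    ENNReal.ofReal_le_ofReal_iff (by positivity)] at h1
  change ‖A g‖ ≤ √D * ‖g‖
  refine abs_le_of_sq_le_sq' ?_ (by positivity) |>.2
  rwa [mul_pow, Real.sq_sqrt D.coe_nonneg]

theorem seqOf_toL2_pullback (hβ : IsLift (period lam) β) (g : L2zero lam) :
    seqOf (toL2 lam (pullback β ((g : L2 lam) : Torus lam → ℂ)))
      = mulVec (pullNZ lam β) (seqOf (g : L2 lam)) := by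
  have hm := pullback_memLp hβ (Lp.memLp (g : L2 lam))
  funext k
  rw [toL2, dif_pos hm, seqOf, fourierCoeff_toLp', (fourierCoeff_pullback_eq hβ g).2]

/-- The structure of the scattering operator modulo a smoothing operator. -/
theorem exists_structure (hsub : Ω.Subcritical lam) (hβ : IsLift (period lam) β)
    (he : ∀ x ∈ Icc J.aL (J.aL + period lam), J.mb =ᶠ[𝓝 x] β)
    (hS : IsScatteringMatrix (pullNZ lam β) (pullNZ lam (Function.invFun β)) S R)
    {A : L2zero lam →L[ℂ] L2zero lam}
    (hA : ∀ g, seqOf (A g : L2 lam) = mulVec S (seqOf (g : L2 lam))) :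
    ∃ Q : Distr lam →ₗ[ℂ] TestFn lam, IsSmoothing Q ∧ ∀ g : L2zero lam,
      ((A g : L2 lam) : Torus lam → ℂ) =ᵐ[AddCircle.haarAddCircle] fun t =>
        projPos lam (toL2 lam (J.pullInv (projPos lam g))) t
          + projNeg lam (toL2 lam (J.pull (projNeg lam g))) t
          + (Q (toDistr (g : L2 lam)) : Torus lam → ℂ) t := by
  obtain ⟨Q, hQ, hcoef⟩ := exists_smoothing (lam := lam) hS.rapid
  refine ⟨Q, hQ, fun g => ?_⟩
  rw [J.pullInv_eq he hsub hβ, J.pull_eq he hβ]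
  have hm : MemLp (Q (toDistr (g : L2 lam)) : Torus lam → ℂ) 2 AddCircle.haarAddCircle :=
    continuousMap_memLp (TestFn.toC (Q (toDistr (g : L2 lam))))
  obtain ⟨hq0, hq⟩ := hcoef (toDistr (g : L2 lam))
  have hseq : coeffNZ ((toDistr (g : L2 lam) : Distr lam) : Module.Dual ℂ (TestFn lam))
      = seqOf (g : L2 lam) := coeffNZ_formPairing _
  set F₁ := projPos lam (toL2 lam (pullback (Function.invFun β) (projPos lam g))) with hF₁
  set F₂ := projNeg lam (toL2 lam (pullback β (projNeg lam g))) with hF₂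
  have h1 : seqOf F₁ = mulVec (mask posFreq (pullNZ lam (Function.invFun β))) (seqOf (g : L2 lam)) := by
    rw [hF₁, seqOf_projPos, mulVec_mask]
    exact congrArg (cut posFreq) ((seqOf_toL2_pullback hβ.inv ⟨_, projPos_mem (g : L2 lam)⟩).trans
      (congrArg (mulVec _) (seqOf_projPos (g : L2 lam))))
  have h2 : seqOf F₂ = mulVec (mask negFreq (pullNZ lam β)) (seqOf (g : L2 lam)) := by
    rw [hF₂, seqOf_projNeg, mulVec_mask]
    exact congrArg (cut negFreq) ((seqOf_toL2_pullback hβ ⟨_, projNeg_mem (g : L2 lam)⟩).trans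
      (congrArg (mulVec _) (seqOf_projNeg (g : L2 lam))))
  have key : (A g : L2 lam) = F₁ + F₂ + hm.toLp _ := by
    refine L2_ext fun k => ?_
    rw [fourierCoeff_add_L2, fourierCoeff_add_L2, fourierCoeff_toLp']
    by_cases hk : k = 0
    · rw [hk, fourierCoeff_zero, hq0, (mem_L2zero_iff _).1 (projPos_mem _),
        (mem_L2zero_iff _).1 (projNeg_mem _)]
      simp
    · have h3 := congrFun (hA g) ⟨k, hk⟩
      rw [hS.mulVec_eq (symplecticPair_pullNZ hβ) (tempered_seqOf g), ← h1, ← h2, ← hseq, ← hq] at h3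
      exact h3
  rw [key]
  filter_upwards [Lp.coeFn_add (F₁ + F₂) (hm.toLp _), Lp.coeFn_add F₁ F₂, hm.coeFn_toLp] with t h3 h4 h5
  rw [h3, Pi.add_apply, h4, Pi.add_apply, h5]

end ScatteringOperator

end ChannelScattering

end

/-! ### The scattering theorem. -/

theorem theorem1p1 (Ω : Channel) (lam : Set.Ioo (0 : ℝ) 1)
    (hsub : Ω.Subcritical lam) (J : FundamentalIntervals Ω lam) :
    -- existence and uniqueness of the outgoing datum and of the solution
    (∀ gi : L2zero lam,
      ∃! p : L2zero lam × ((ℝ × ℝ) →ₘ[volume] ℂ),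
        IsScattering J gi p.1 p.2) ∧
    -- the pullbacks by the multi-bounce map and its inverse act on `L²`
    (∀ v : L2 lam,
      MemLp (J.pull v) 2 AddCircle.haarAddCircle ∧
      MemLp (J.pullInv v) 2 AddCircle.haarAddCircle) ∧
    -- the scattering matrix
    ∃ S : L2zero lam →L[ℂ] L2zero lam,
      (∀ gi, ∃ u : (ℝ × ℝ) →ₘ[volume] ℂ, IsScattering J gi (S gi) u) ∧
      -- its structure modulo a smoothing operator
      (∃ R : Distr lam →ₗ[ℂ] TestFn lam,
        IsSmoothing R ∧
        ∀ g : L2zero lam,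
          ((S g : L2 lam) : Torus lam → ℂ)
            =ᵐ[AddCircle.haarAddCircle] fun t =>
              projPos lam (toL2 lam
                (J.pullInv (projPos lam g))) t
              + projNeg lam (toL2 lam
                (J.pull (projNeg lam g))) t
              + (R (toDistr (g : L2 lam)) :
                  Torus lam → ℂ) t) ∧
      -- its extension to distributional one-forms, bounded on every Sobolev space and unitary
      ∃ S' : DistrZero lam →ₗ[ℂ] DistrZero lam,
        (∀ g, S' (toDistrZero g) = toDistrZero (S g)) ∧
        (∀ s : ℝ, ∃ C : NNReal, ∀ u : DistrZero lam,
          sobolevSq s u < ⊤ →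
            sobolevSq s (S' u) ≤ C * sobolevSq s u) ∧
        (∀ u : DistrZero lam, halfSq u < ⊤ →
          halfSq (S' u) = halfSq u) ∧
        (∀ w : DistrZero lam, halfSq w < ⊤ →
          ∃ u : DistrZero lam,
            halfSq u < ⊤ ∧ S' u = w) := by
  obtain ⟨β, hβ, he⟩ := J.exists_lift hsub
  have hsym := symplecticPair_pullNZ hβ
  obtain ⟨T, R, hT⟩ := hsym.exists_isScatteringMatrix
  obtain ⟨S, hS⟩ := exists_scatteringOp (lam := lam) hsym hT
  have hiff := exists_isScattering_iff hsub hβ he hT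
  have hsol : ∀ gi, ∃ u : (ℝ × ℝ) →ₘ[volume] ℂ, IsScattering J gi (S gi) u :=
    fun gi => (hiff gi (S gi)).2 (hS gi)
  refine ⟨fun gi => ?_, fun v => ⟨?_, ?_⟩, S, hsol, exists_structure hsub hβ he hT hS, ?_⟩
  · obtain ⟨u, hu⟩ := hsol gi
    refine ⟨(S gi, u), hu, fun q hq => ?_⟩
    -- The outgoing datum is identified first, through its Fourier coefficients. Only then do the
    -- two solutions share all their data, as the uniqueness of u requires.
    have h1 : q.1 = S gi := L2zero_ext (((hiff gi q.1).1 ⟨q.2, hq⟩).trans (hS gi).symm)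
    refine Prod.ext h1 (AEEqFun.ext ?_)
    have hq' : IsScattering J gi q.1 q.2 := hq
    rw [h1] at hq'
    exact hq'.unique hsub hu
  · rw [J.pull_eq he hβ]
    exact pullback_memLp hβ (Lp.memLp v)
  · rw [J.pullInv_eq he hsub hβ]
    exact pullback_memLp hβ.inv (Lp.memLp v)
  -- Every distribution lies in some Sobolev space and the matrix is bounded on each of them, so it
  -- acts on all distributions of mean zero.
  · have htemp : ∀ a, Tempered a → Tempered (mulVec T a) := fun a ha => by
      obtain ⟨s, hs⟩ := ha.exists_wsq
      obtain ⟨D, hD⟩ := hT.wsq_le hsym s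
      exact tempered_of_wsq ((hD a hs).trans_lt (ENNReal.mul_lt_top ENNReal.coe_lt_top hs))
    obtain ⟨S', hS'⟩ := exists_distr_op (lam := lam) (fun a ha k => hT.summable hsym ha k) htemp
    have hc : ENNReal.ofReal ((slope lam ^ 2)⁻¹) ≠ 0 := by
      have := slope_pos lam
      simp only [ne_eq, ENNReal.ofReal_eq_zero, not_le]
      positivity
    have hhalf : ∀ u : DistrZero lam, halfSq u < ⊤ ↔
        wsq (-1 / 2) (coeffNZ (u : Module.Dual ℂ (TestFn lam))) < ⊤ := fun u => by
      rw [halfSq_eq, ENNReal.mul_lt_top_iff]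
      simp only [hc, ENNReal.ofReal_lt_top, true_and, false_or]
      exact ⟨fun h => h.elim id fun h => by simp [h], Or.inl⟩
    refine ⟨S', fun g => DistrZero.ext_coeff ?_, fun s => ?_, fun u hu => ?_, fun w hw => ?_⟩
    · rw [hS']
      exact (congrArg _ (coeffNZ_formPairing _)).trans
        ((hS g).symm.trans (coeffNZ_formPairing _).symm)
    · obtain ⟨D, hD⟩ := hT.wsq_le hsym s
      refine ⟨D, fun u hu => ?_⟩
      rw [sobolevSq_eq] at hu
      rw [sobolevSq_eq, sobolevSq_eq, hS']
      exact hD _ hu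
    · rw [halfSq_eq, halfSq_eq, hS', hT.norm _ ((hhalf u).1 hu)]
    · obtain ⟨a, ha, haw⟩ := hT.surj _ ((hhalf w).1 hw)
      obtain ⟨u, hu⟩ := exists_distr (lam := lam) (tempered_of_wsq ha)
      refine ⟨u, (hhalf u).2 (by rwa [hu]), DistrZero.ext_coeff ?_⟩
      rw [hS', hu, haw]
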